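/- Let $\mathbb F$ be $\mathbb R$ or $\mathbb C$, let $n\ge 1$, $m\ge 3$, and put $k=\lceil m/2\rceil$, $l=\lfloor m/2\rfloor$. A *Waring decomposition* of length $R$ of a symmetric tensor $T\in S^m(\mathbb F^n)$ is an expression $T=\sum_{a=1}^R \alpha_a x_a^{\otimes m}$ with $\alpha_a\in\mathbb F$, $x_a\in\mathbb F^n$; the *Waring rank* of $T$ is the least such length, and a decomposition of that length is the *unique Waring rank decomposition* if every other one of that length has the same summands $\alpha_a x_a^{\otimes m}$ up to order. A property holds for a *generic symmetric tensor of Waring rank $R$* if there is a Zariski open dense subset $\mathcal A$ of $\mathcal Y^{R}$, $\mathcal Y=\{\alpha x^{\otimes m}:\alpha\in\mathbb F,\ x\in\mathbb F^n\}$, such that it holds for all $T=\sum_a\alpha_a x_a^{\otimes m}$ with $(\alpha_1x_1^{\otimes m},\dots,\alpha_Rx_R^{\otimes m})\in\mathcal A$. *Algorithm 1 (for varieties cut out by quadrics).* Input: a basis of a subspace $U\subseteq V=\mathbb F^N$ and quadratic forms, with span $I_2\subseteq S^2(V^*)$, cutting out a conic variety $X\subseteq V$. (1) Compute a basis $P_1,\dots,P_s$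 of $S^2(U)\cap I_2^{\perp}\subseteq S^2(V)$. If $s=0$, output "$U\cap X=\{0\}$". (2) If $s>\dim U$, output "Fail". Otherwise choose $f,g\in\mathbb F^s$ at random, and apply simultaneous diagonalization to $\sum_i e_i\otimes P_i\in\mathbb F^s\otimes V\otimes V$: with the symmetric matrices $A=\sum_i f_iP_i$ and $B=\sum_i g_iP_i$, the matrix $AB^{+}$ ($^+$ is the Moore–Penrose inverse) must have $r=\operatorname{rank}(AB^+)$ distinct nonzero eigenvalues $\mu_a$, and the nonzero eigenvalues of $(A^{+}B)^{\mathsf T}$ must be the $\mu_a^{-1}$; let $v_a$, $w_a$ be corresponding eigenvectors of the two matrices, let $u_a\in\mathbb F^s$ be the contractions of the tensor with functionals dual to the $v_a\otimes w_a$, and require that $u_a\notin\operatorname{span}(u_b)$ for $a\ne b$. If $\{u_a\otimes v_a\otimes w_a\}$ is a decomposition of the tensor $\sum_i e_i\otimes P_i$ of the form $\{z_a\otimes y_a\otimes y_a : a\le s\}$ with $z_1,\dots,z_s$ linearly independent and $y_1,\dots,y_s$ linearly independent, output "the only elements of $U\cap X$ are $y_1,\dots,y_s$ (up to scale)". In all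 other cases output "Fail". For a symmetric $T\in S^m(\mathbb F^n)\subseteq S^k(\mathbb F^n)\otimes S^l(\mathbb F^n)$, Algorithm 1 is run on a basis of $U=T\big(S^l(\mathbb F^n)^*\big)\subseteq V=S^k(\mathbb F^n)$ (in the coordinates given by the entries with non-decreasing multi-index) and a basis of the quadratic forms vanishing on $X=\{\alpha x^{\otimes k}\}\subseteq V$. From its answer one reads off a decomposition $T=\sum_a\alpha_ax_a^{\otimes m}$ in which the $x_a^{\otimes k}$ are, up to scale, exactly the listed vectors (none, if the answer is "$U\cap X=\{0\}$"), if there is one, and otherwise "Fail". Running time is counted on random access machines with unit-cost arithmetic, conjugation and zero tests on elements of $\mathbb F$ and unit-cost $+,-,\times,\le$ on natural numbers used for control, with the entries of $T$ and random elements of $\mathbb F$ (the coordinates of $f$ and $g$) as input, and with an oracle that diagonalizes diagonalizable matrices over $\mathbb F$ (a call on a $j\times j$ matrix costs $j^2+1$ steps). "Almost surely" means for all $(f,g)$ outside a set of Lebesgue measure zero. **Statement.** There are a single program and a constant $C$ such that the following holds. 1. For all $n\ge1$, $m\ge3$, every symmetric $T\in S^m(\mathbb F^n)$, all random inputs and every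 valid oracle, the program halts after at most $(n+1)^{Cm}$ steps and at most $C$ oracle calls (so in time $n^{O(m)}$ for $n\ge2$); its output is the one that is read off, as above, from an answer of Algorithm 1; and if the output is not "Fail", then it is the unique Waring rank decomposition of $T$. 2. Let $R\ge 0$ be an integer with $$R\le\min\left\{\binom{n+l-1}{l},\ \frac{\binom{n+k-1}{k}+1}{2}-\frac{\binom{n+2k-1}{2k}}{\binom{n+k-1}{k}}\right\}.$$ Then for a generic symmetric tensor $T=\sum_{a=1}^R\alpha_ax_a^{\otimes m}\in S^m(\mathbb F^n)$ of Waring rank $R$: this is the unique Waring rank decomposition of $T$; for all choices of the bases involved, Algorithm 1 almost surely answers that the only elements of $U\cap X$ are $x_1^{\otimes k},\dots,x_R^{\otimes k}$ up to scale and order ("$U\cap X=\{0\}$" if $R=0$); and, for every valid oracle, the program almost surely outputs this decomposition (up to the order of the summands and the choice of $(\alpha_a,x_a)$ for a given summand). 3. For $m=4$ and $n\ge1$, the right-hand side of the bound equals $\tfrac{n(n-1)}{6}$. -/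

import Mathlib

namespace Waring

/-! ## Symmetric tensors and Waring decompositions -/

section Tensors

variable {F : Type*} [Field F]

/-- The coordinate space of `(F^n)^{⊗ m}`. -/
abbrev Tensor (F : Type*) (n m : ℕ) : Type _ := (Fin m → Fin n) → F

/-- Membership in `S^m(F^n)`, the space of symmetric tensors in `(F^n)^{⊗ m}`. -/
def IsSymmetric {n m : ℕ} (T : Tensor F n m) : Prop :=
  ∀ (σ : Equiv.Perm (Fin m)) (i : Fin m → Fin n), T (i ∘ σ) = T i

/-- The symmetric product tensor `x^{⊗ m}`. -/
def tensorPow {n : ℕ} (x : Fin n → F) (m : ℕ) : Tensor F n m := fun i => ∏ j, x (i j)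

/-- The set `{α x^{⊗ m}}` of symmetric product tensors in `S^m(F^n)`. -/
def symProducts (F : Type*) [Field F] (n m : ℕ) : Set (Tensor F n m) :=
  {t | ∃ (α : F) (x : Fin n → F), t = α • tensorPow x m}

/-- The `R`-tuples of symmetric product tensors. They live in the coordinate space indexed by
`Fin R × (Fin m → Fin n)`. -/
def symProductTuples (F : Type*) [Field F] (n m R : ℕ) :
    Set (Fin R × (Fin m → Fin n) → F) :=
  {y | ∀ a, (fun i => y (a, i)) ∈ symProducts F n m}

/-- `T = t_1 + ⋯ + t_r` with symmetric product tensors `t_a`. -/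
def IsWaringDecomposition {n m r : ℕ} (T : Tensor F n m) (t : Fin r → Tensor F n m) : Prop :=
  (∀ a, t a ∈ symProducts F n m) ∧ ∑ a, t a = T

/-- `t_1 + ⋯ + t_r` is a Waring decomposition of `T` of the least possible length (so that the
Waring rank of `T` is `r`), and every other one of that length is a permutation of it. -/
def IsUniqueWaringRankDecomposition {n m r : ℕ} (T : Tensor F n m)
    (t : Fin r → Tensor F n m) : Prop :=
  IsWaringDecomposition T t ∧
  (∀ (r' : ℕ) (t' : Fin r' → Tensor F n m), IsWaringDecomposition T t' → r ≤ r') ∧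
  (∀ t' : Fin r → Tensor F n m, IsWaringDecomposition T t' →
    ∃ σ : Equiv.Perm (Fin r), t' = t ∘ σ)

/-- An explicit expression `∑ a, coeff a • (vec a)^{⊗ m}`. -/
structure Expression (F : Type*) (n : ℕ) where
  length : ℕ
  coeff : Fin length → F
  vec : Fin length → Fin n → F

/-- The `a`-th summand of an expression. -/
def Expression.term {n : ℕ} (D : Expression F n) (m : ℕ) (a : Fin D.length) : Tensor F n m :=
  D.coeff a • tensorPow (D.vec a) m

/-- `A` is a Zariski open dense subset of `Y` (in the induced Zariski topology on `Y`): inside `Y`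
it is the complement of the common zeros of a set of polynomials, and every polynomial that
vanishes on `A` vanishes on `Y`. -/
def IsZariskiOpenDense {σ : Type*} (Y A : Set (σ → F)) : Prop :=
  A ⊆ Y ∧
  (∃ S : Set (MvPolynomial σ F), A = {y ∈ Y | ∃ p ∈ S, MvPolynomial.eval y p ≠ 0}) ∧
  ∀ p : MvPolynomial σ F,
    (∀ y ∈ A, MvPolynomial.eval y p = 0) → ∀ y ∈ Y, MvPolynomial.eval y p = 0

end Tensors

/-! ## Simultaneous diagonalization and the intersection algorithm

Tensors in `F^s ⊗ F^ι ⊗ F^κ` are families `T : Fin s → Matrix ι κ F` of slices, and contracting the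
first factor with a functional `f` gives the matrix `∑ i, f i • T i`. -/

section Algorithm

variable {F : Type*} [RCLike F] {ι κ : Type*} [Fintype ι] [Fintype κ]

/-- `B` is the Moore-Penrose pseudoinverse of `A`. -/
def IsPseudoinverse (A : Matrix ι κ F) (B : Matrix κ ι F) : Prop :=
  A * B * A = A ∧ B * A * B = B ∧ (A * B).IsHermitian ∧ (B * A).IsHermitian

/-- The contraction `T(f)`. -/
def contract {s : ℕ} (T : Fin s → Matrix ι κ F) (f : Fin s → F) : Matrix ι κ F :=
  ∑ i, f i • T i

/-- The simultaneous diagonalization algorithm, on input `T` and with the functionals `f`, `g`, can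
output `{u a ⊗ v a ⊗ w a}`. With `r` the rank of `T(f) T(g)⁺`, this matrix has `r` distinct nonzero
eigenvalues `μ a`, with eigenvectors `v a`; the nonzero eigenvalues of `T(f)⁺ T(g)` are the
`(μ a)⁻¹`, with eigenvectors `w a` (as a map on `F^κ`, this is the transpose of the matrix product);
`u a` is the contraction of `T` with functionals `h a` dual to the `v a ⊗ w a`; and no
`u a` lies in the span of another `u b`. -/
def SimDiagOutputs {s r : ℕ} (T : Fin s → Matrix ι κ F) (f g : Fin s → F)
    (u : Fin r → Fin s → F) (v : Fin r → ι → F) (w : Fin r → κ → F) : Prop :=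
  ∃ (Tf' Tg' : Matrix κ ι F) (μ : Fin r → F) (h : Fin r → Matrix ι κ F),
    IsPseudoinverse (contract T f) Tf' ∧ IsPseudoinverse (contract T g) Tg' ∧
    (contract T f * Tg').rank = r ∧
    Function.Injective μ ∧ (∀ a, μ a ≠ 0) ∧
    (∀ a, v a ≠ 0 ∧ (contract T f * Tg').mulVec (v a) = μ a • v a) ∧
    (∀ (ν : F) (y : κ → F), ν ≠ 0 → y ≠ 0 →
      (Tf' * contract T g).transpose.mulVec y = ν • y → ∃ a, ν = (μ a)⁻¹) ∧
    (∀ a, w a ≠ 0 ∧ (Tf' * contract T g).transpose.mulVec (w a) = (μ a)⁻¹ • w a) ∧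
    (∀ a b, ∑ i, ∑ j, h a i j * (v b i * w b j) = if a = b then 1 else 0) ∧
    (∀ a l, u a l = ∑ i, ∑ j, h a i j * T l i j) ∧
    (∀ a b, a ≠ b → u a ∉ Submodule.span F {u b})

/-- `S²(U) ∩ I₂^⊥`, inside the symmetric matrices `S²(F^ι)`, where `I₂` is spanned by the
quadratic forms with symmetric matrices `q i`. A symmetric matrix lies in `S²(U)` when its columns
lie in `U`. -/
def liftedIntersection {p : ℕ} (U : Submodule F (ι → F)) (q : Fin p → Matrix ι ι F) :
    Submodule F (Matrix ι ι F) where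
  carrier := {P | P.IsSymm ∧ (∀ j, (fun i => P i j) ∈ U) ∧
    ∀ l, ∑ i, ∑ j, q l i j * P i j = 0}
  zero_mem' := ⟨Matrix.isSymm_zero, fun _ => U.zero_mem, fun _ => by simp⟩
  add_mem' := by
    rintro A B ⟨hA, hA', hA''⟩ ⟨hB, hB', hB''⟩
    refine ⟨hA.add hB, fun j => U.add_mem (hA' j) (hB' j), fun l => ?_⟩
    have h := congrArg₂ (· + ·) (hA'' l) (hB'' l)
    simpa [mul_add, Finset.sum_add_distrib] using h
  smul_mem' := by
    rintro c A ⟨hA, hA', hA''⟩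
    refine ⟨hA.smul c, fun j => U.smul_mem c (hA' j), fun l => ?_⟩
    have h := congrArg (c * ·) (hA'' l)
    simpa [Finset.mul_sum, mul_left_comm] using h

/-- The possible outputs of the intersection algorithm: "`U` trivially intersects `X`", "the only
elements of `U ∩ X` are `v_1, …, v_s` (up to scale)", and "Fail". -/
inductive Answer (F : Type*) (ι : Type*) where
  | trivial : Answer F ι
  | only (s : ℕ) (v : Fin s → ι → F) : Answer F ι
  | fail : Answer F ι

/-- Step 2: run on `∑ i, e_i ⊗ P_i`, simultaneous diagonalization outputs a decomposition of this
tensor of the form `{z a ⊗ v a ⊗ v a}`, with `z` and `v` linearly independent. -/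
def StepTwoSucceeds {s : ℕ} (P : Fin s → Matrix ι ι F) (f g : Fin s → F)
    (v : Fin s → ι → F) : Prop :=
  ∃ (u : Fin s → Fin s → F) (v' w : Fin s → ι → F) (z : Fin s → Fin s → F),
    SimDiagOutputs P f g u v' w ∧
    (∀ a l i j, u a l * (v' a i * w a j) = z a l * (v a i * v a j)) ∧
    (∀ l i j, P l i j = ∑ a, z a l * (v a i * v a j)) ∧
    LinearIndependent F z ∧ LinearIndependent F v

/-- The intersection algorithm for varieties cut out by quadrics (degree `d = 2`). On input a basis
`u` of a subspace `U ⊆ F^ι` and quadratic forms `q` cutting out a conic variety `X ⊆ F^ι`, having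
computed the basis `P` of `S²(U) ∩ I₂^⊥` and chosen the functionals `f`, `g`, the algorithm gives
the answer `ans`. -/
def IntersectionAlgorithm {R p s : ℕ} (u : Fin R → ι → F) (q : Fin p → Matrix ι ι F)
    (P : Fin s → Matrix ι ι F) (f g : Fin s → F) (ans : Answer F ι) : Prop :=
  LinearIndependent F P ∧
  Submodule.span F (Set.range P) = liftedIntersection (Submodule.span F (Set.range u)) q ∧
  match ans with
  | .trivial => s = 0
  | .only s' v => 0 < s ∧ s ≤ R ∧ ∃ h : s' = s, StepTwoSucceeds P f g (fun a => v (a.cast h.symm))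
  | .fail => 0 < s ∧ (s ≤ R → ¬ ∃ v, StepTwoSucceeds P f g v)

/-- The answer says that, up to scale, the elements of `U ∩ X` are exactly the given vectors
(only zero, if there are none). -/
def Answer.Lists {R : ℕ} (ans : Answer F ι) (y : Fin R → ι → F) : Prop :=
  match ans with
  | .trivial => R = 0
  | .only s v => ∃ e : Fin s ≃ Fin R, ∀ a, ∃ c : F, c ≠ 0 ∧ v a = c • y (e a)
  | .fail => False

/-- The component `I(X)₂` of the ideal of `X`: the quadratic forms vanishing on `X`. -/
def quadricsOn (X : Set (ι → F)) : Submodule F (Matrix ι ι F) where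
  carrier := {q | q.IsSymm ∧ ∀ y ∈ X, ∑ i, ∑ j, q i j * (y i * y j) = 0}
  zero_mem' := ⟨Matrix.isSymm_zero, fun _ _ => by simp⟩
  add_mem' := by
    rintro A B ⟨hA, hA'⟩ ⟨hB, hB'⟩
    refine ⟨hA.add hB, fun y hy => ?_⟩
    have h := congrArg₂ (· + ·) (hA' y hy) (hB' y hy)
    simpa [add_mul, Finset.sum_add_distrib] using h
  smul_mem' := by
    rintro c A ⟨hA, hA'⟩
    refine ⟨hA.smul c, fun y hy => ?_⟩
    have h := congrArg (c * ·) (hA' y hy)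
    simpa [Finset.mul_sum, mul_assoc] using h

end Algorithm

/-! ## The intersection algorithm applied to a symmetric tensor -/

section Flattening

variable {F : Type*} [RCLike F]

/-- The non-decreasing `k`-tuples in `Fin n`. They index the coordinates on `S^k(F^n)`. -/
abbrev MonoIdx (n k : ℕ) : Type := {i : Fin k → Fin n // Monotone i}

/-- The coordinates of a symmetric tensor; a linear isomorphism from `S^k(F^n)` onto
`F^(MonoIdx n k)`. -/
def symCoords {n k : ℕ} (t : Tensor F n k) : MonoIdx n k → F := fun i => t i.1

/-- The symmetric product tensors in `S^k(F^n)`, in coordinates. -/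
def veroneseCone (F : Type*) [RCLike F] (n k : ℕ) : Set (MonoIdx n k → F) :=
  symCoords '' symProducts F n k

/-- For a symmetric `T`, viewed in `V ⊗ W` with `V = S^⌈m/2⌉(F^n)` and `W = S^⌊m/2⌋(F^n)`, the
subspace `T(W*)` of `V`. -/
def image {n m : ℕ} (T : Tensor F n m) : Submodule F (MonoIdx n ((m + 1) / 2) → F) :=
  Submodule.span F (Set.range fun j : Fin (m / 2) → Fin n =>
    symCoords fun i : Fin ((m + 1) / 2) → Fin n =>
      T (Fin.append i j ∘ Fin.cast (by omega : m = (m + 1) / 2 + m / 2)))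

/-- `u` is a basis of `T(W*)`, and `q` is a basis of the quadratic forms that vanish on
(and cut out) the symmetric product tensors in `S^⌈m/2⌉(F^n)`. -/
def IsAlgorithmInput {n m R p : ℕ} (T : Tensor F n m)
    (u : Fin R → MonoIdx n ((m + 1) / 2) → F)
    (q : Fin p → Matrix (MonoIdx n ((m + 1) / 2)) (MonoIdx n ((m + 1) / 2)) F) : Prop :=
  (LinearIndependent F u ∧ Submodule.span F (Set.range u) = image T) ∧
  (LinearIndependent F q ∧
    Submodule.span F (Set.range q) = quadricsOn (veroneseCone F n ((m + 1) / 2)))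

/-- `∑ a, α_a x_a^{⊗ m}` is a decomposition of `T` in which, up to scale, the `x_a^{⊗ ⌈m/2⌉}` are
the vectors listed by the answer of the intersection algorithm. -/
def ReadsOff {n m : ℕ} (T : Tensor F n m) (ans : Answer F (MonoIdx n ((m + 1) / 2)))
    (D : Expression F n) : Prop :=
  ans.Lists (fun a => symCoords (tensorPow (D.vec a) ((m + 1) / 2))) ∧ ∑ a, D.term m a = T

/-- The bound on the rank. -/
noncomputable def rankBound (n m : ℕ) : ℝ :=
  min ((n + m / 2 - 1).choose (m / 2) : ℝ)
    (((n + (m + 1) / 2 - 1).choose ((m + 1) / 2) + 1 : ℝ) / 2 -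
      ((n + 2 * ((m + 1) / 2) - 1).choose (2 * ((m + 1) / 2)) : ℝ) /
        ((n + (m + 1) / 2 - 1).choose ((m + 1) / 2) : ℝ))

end Flattening

/-! ## The model of computation

Random access programs over the field `F` with unit cost arithmetic, tests for zero, complex
conjugation (on `ℝ` the identity) and calls to a diagonalization oracle. There is a memory of
natural numbers for control and addressing, and there are countably many arrays of field
elements. Programs are finite and contain no field constants except `0` and `1`; one program serves
all input sizes. All loops are bounded, so every program halts. -/

section Machine

/-- Natural number expressions; `load e` is the content of the natural number memory at `e`. -/
inductive IdxExpr where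
  | const (c : ℕ)
  | load (e : IdxExpr)
  | add (e e' : IdxExpr)
  | sub (e e' : IdxExpr)
  | mul (e e' : IdxExpr)

/-- The value of an expression. Subtraction is truncated. -/
def IdxExpr.eval (reg : ℕ → ℕ) : IdxExpr → ℕ
  | const c => c
  | load e => reg (e.eval reg)
  | add e e' => e.eval reg + e'.eval reg
  | sub e e' => e.eval reg - e'.eval reg
  | mul e e' => e.eval reg * e'.eval reg

/-- The cell with address `idx` of the array number `arr`. -/
structure Cell where
  arr : ℕ
  idx : IdxExpr

/-- The binary field operations. -/
inductive FieldOp where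
  | add | sub | mul | div

/-- The value of a field operation (`x / 0 = 0`). -/
def FieldOp.eval {F : Type*} [Field F] : FieldOp → F → F → F
  | add, x, y => x + y
  | sub, x, y => x - y
  | mul, x, y => x * y
  | div, x, y => x / y

/-- Programs. -/
inductive Program where
  | skip
  | seq (c c' : Program)
  /-- Write `e` to the natural number memory at `dst`. -/
  | setReg (dst e : IdxExpr)
  | ifLe (e e' : IdxExpr) (c c' : Program)
  /-- Execute `c` with register `i` set to `0, 1, …, e - 1` in turn; `e` is evaluated once. -/
  | loop (i : ℕ) (e : IdxExpr) (c : Program)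
  | setZero (dst : Cell)
  | setOne (dst : Cell)
  | op (o : FieldOp) (dst x y : Cell)
  | conj (dst x : Cell)
  | ifZero (x : Cell) (c c' : Program)
  /-- Diagonalize the `k × k` matrix that stands row by row in the array `src`; write the matrix of
  eigenvectors to the array `vecs` and the eigenvalues to the array `vals`. -/
  | diagonalize (k : IdxExpr) (src vecs vals : ℕ)

/-- The memory, and the number of steps and of oracle calls made so far. -/
structure State (F : Type*) where
  reg : ℕ → ℕ
  mem : ℕ → ℕ → F
  steps : ℕ
  calls : ℕ

variable {F : Type*} [RCLike F]

/-- The content of a cell. -/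
def State.get (s : State F) (x : Cell) : F := s.mem x.arr (x.idx.eval s.reg)

/-- Count one or more steps. -/
def State.tick (s : State F) (c : ℕ) : State F := { s with steps := s.steps + c }

/-- Write to the natural number memory. -/
def State.setReg (s : State F) (i v : ℕ) : State F := { s with reg := Function.update s.reg i v }

/-- Write to a cell. -/
def State.set (s : State F) (x : Cell) (v : F) : State F :=
  let a := Function.update (s.mem x.arr) (x.idx.eval s.reg) v
  { s with mem := Function.update s.mem x.arr a }

/-- A diagonalization oracle, which returns a matrix of eigenvectors and the eigenvalues. -/
abbrev Oracle (F : Type*) : Type _ :=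
  (k : ℕ) → Matrix (Fin k) (Fin k) F → Matrix (Fin k) (Fin k) F × (Fin k → F)

/-- The oracle diagonalizes every matrix that is diagonalizable over `F`. On other matrices its
answer is arbitrary. -/
def Oracle.IsValid (O : Oracle F) : Prop :=
  ∀ (k : ℕ) (M : Matrix (Fin k) (Fin k) F),
    (∃ (Q : Matrix (Fin k) (Fin k) F) (d : Fin k → F),
      IsUnit Q.det ∧ M * Q = Q * Matrix.diagonal d) →
    IsUnit (O k M).1.det ∧ M * (O k M).1 = (O k M).1 * Matrix.diagonal (O k M).2

/-- The effect of an oracle call on the memory. -/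
def State.diagonalize (O : Oracle F) (s : State F) (k src vecs vals : ℕ) : State F :=
  let res := O k (Matrix.of fun i j : Fin k => s.mem src (i * k + j))
  let mem₁ := Function.update s.mem vecs fun x =>
    if h : x < k * k then
      res.1 (finProdFinEquiv.symm ⟨x, h⟩).1 (finProdFinEquiv.symm ⟨x, h⟩).2
    else s.mem vecs x
  let mem₂ := Function.update mem₁ vals fun x =>
    if h : x < k then res.2 ⟨x, h⟩ else mem₁ vals x
  { s with mem := mem₂, calls := s.calls + 1 }

open Classical in
/-- The execution of a program. Every command, every test and every iteration of a loop costs one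
step, and an oracle call on a `k × k` matrix costs `k² + 1` steps. -/
noncomputable def Program.run (O : Oracle F) : Program → State F → State F
  | skip, s => s
  | seq c c', s => c'.run O (c.run O s)
  | setReg dst e, s => (s.setReg (dst.eval s.reg) (e.eval s.reg)).tick 1
  | ifLe e e' c c', s =>
      if e.eval s.reg ≤ e'.eval s.reg then c.run O (s.tick 1) else c'.run O (s.tick 1)
  | loop i e c, s =>
      (List.range (e.eval s.reg)).foldl (fun s' j => c.run O ((s'.setReg i j).tick 1)) (s.tick 1)
  | setZero dst, s => (s.set dst 0).tick 1
  | setOne dst, s => (s.set dst 1).tick 1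
  | op o dst x y, s => (s.set dst (o.eval (s.get x) (s.get y))).tick 1
  | conj dst x, s => (s.set dst (starRingEnd F (s.get x))).tick 1
  | ifZero x c c', s => if s.get x = 0 then c.run O (s.tick 1) else c'.run O (s.tick 1)
  | diagonalize k src vecs vals, s =>
      (s.diagonalize O (k.eval s.reg) src vecs vals).tick (k.eval s.reg * k.eval s.reg + 1)

/-- The initial state: `n` and `m` in registers 0 and 1; the `n ^ m` entries of `T`, with the
multi-index `i` at address `∑ j, i j * n ^ j`, in array 0; the random coordinates of the functionals
`f` and `g` in arrays 1 and 2. -/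
def initialState {n m : ℕ} (T : Tensor F n m) (f g : ℕ → F) : State F where
  reg i := if i = 0 then n else if i = 1 then m else 0
  mem a x :=
    if a = 0 then (if h : x < n ^ m then T (finFunctionFinEquiv.symm ⟨x, h⟩) else 0)
    else if a = 1 then f x else if a = 2 then g x else 0
  steps := 0
  calls := 0

/-- The output: "Fail" if register 0 holds `0`; otherwise a decomposition whose length is in
register 1, whose coefficients are in array 0 and whose vectors are, one after the other, in
array 1. -/
def State.output (s : State F) (n : ℕ) : Option (Expression F n) :=
  if s.reg 0 = 0 then none
  else some { length := s.reg 1, coeff := fun a => s.mem 0 a,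
              vec := fun a j => s.mem 1 (a * n + j) }

/-- A finite sequence of random numbers, as the content of an array. -/
def tape {R : ℕ} (f : Fin R → F) : ℕ → F := fun x => if h : x < R then f ⟨x, h⟩ else 0

end Machine

end Waring

set_option linter.unusedSectionVars false
set_option linter.unusedSimpArgs false

/-! Put k = ⌈m/2⌉, l = ⌊m/2⌋ and U = the image of the flattening of T. By duality the orthogonal
complement of the quadrics vanishing on the cone {α x^{⊗k}} is the span of the squares of the
vectors x^{⊗k}, and this is a copy of S^{2k}(F^n) inside S²(S^k(F^n)) (`map_matOf_symTensors`,
`mem_verSquares_of_forall`). So the algorithm computes L = S²(U) ∩ S^{2k}, and a point of U on the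
cone gives a square in L. If L is spanned by squares of independent vectors y_a of U, then the
square of a vector of U lies in L only if that vector is a multiple of some y_a. Hence the y_a are
the only candidates for points of U on the cone.

Certification. Step 2 succeeds exactly when the slices are combinations of squares of independent
vectors and f, g give nonzero, pairwise distinct ratios (`stepTwoSucceeds_iff`); no pseudoinverse is
needed after that. If the listed vectors are the x_a^{⊗k} of a decomposition of T, then dim U is its
length and is a lower bound for the length of every decomposition. In a second decomposition of that
length all points must lie in U, so they agree up to scale with the x_a, and independence of the
x_a^{⊗m} fixes the coefficients (`isUniqueWaringRankDecomposition_of_isolated`).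

Genericity. The first term of the bound makes the x_a^{⊗l} independent, so that U is spanned by the
x_a^{⊗k}. Then L is spanned by their squares as soon as the mixed products x_a^{⊗k} x_b^{⊗k}, a < b,
are independent modulo S^{2k} (`liftedIntersection_eq_span`). For N = dim S^k general points these
classes form a matroid on the edges of the complete graph that is invariant under permutations of
the points. If the edges inside a set of R points were dependent, a circuit there could be moved by
permutations, and the edges meeting only R - 2 points would span everything. That gives dimension at
most (R - 2)N, whereas the dimension is at least N(N+1)/2 - dim S^{2k} ≥ RN by the second term of
the bound (`linearIndepOn_pairClass_of_bound`). Independence at one point gives a polynomial open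
condition, and it is dense because the tuples of product tensors are parametrized by an affine
space. The exceptional f, g form a null set by linear independence and Fubini (`ae_separating`).

The program. Kernels are obtained by diagonalizing Gram matrices K^*K, which are Hermitian and
therefore diagonalizable. A basis of L is the kernel of linear conditions on tensors of order 2k.
With A and B the two random combinations, a solution of W(B^*B) = tA with t ≠ 0 gives X = WB^*,
which is t A B⁺. The vectors x_a are read off from the eigenvectors of X at nonzero eigenvalues.
Since the oracle is arbitrary on matrices that are not diagonalizable, the eigenvector equations for
the powers x_a^{⊗k}, the distinctness of the eigenvalues and their number are tested afterwards.
These tests are sufficient (`simDiagonalizedBy_of_eigen`, `TensorRunFacts.sound`), and they are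
passed whenever a run can be read off (`TensorRunFacts.complete`). The cost is bounded by a power of
the largest loop bound, with an exponent that depends only on the program text (`run_steps`). -/

namespace Waring

/-! ### Symmetric tensors and their coordinates -/

section TensorBasics

/-- The multiset of values of a non-decreasing tuple. -/
def monoMultiset {n k : ℕ} (i : MonoIdx n k) : Multiset (Fin n) := Finset.univ.val.map i.1

theorem monoMultiset_eq_ofFn {n k : ℕ} (i : MonoIdx n k) :
    monoMultiset i = (List.ofFn i.1 : Multiset (Fin n)) := by
  rw [monoMultiset, Fin.univ_def, List.ofFn_eq_map]; rfl

theorem monoMultiset_injective {n k : ℕ} :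
    Function.Injective (monoMultiset : MonoIdx n k → Multiset (Fin n)) := by
  intro i j h
  rw [monoMultiset_eq_ofFn, monoMultiset_eq_ofFn, Multiset.coe_eq_coe] at h
  have h1 : (List.ofFn i.1).SortedLE := i.2.sortedLE_ofFn
  have h2 : (List.ofFn j.1).SortedLE := j.2.sortedLE_ofFn
  exact Subtype.ext (List.ofFn_injective (h.eq_of_sortedLE h1 h2))

/-- Sorting identifies non-decreasing tuples with multisets of size k. -/
theorem card_monoIdx (n k : ℕ) : Fintype.card (MonoIdx n k) = (n + k - 1).choose k := by
  classical
  rw [← Nat.multichoose_eq]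
  have h := Sym.card_sym_eq_multichoose (Fin n) k
  rw [Fintype.card_fin] at h
  rw [← h]
  refine Fintype.card_of_bijective
    (f := fun i : MonoIdx n k => (⟨monoMultiset i, by simp [monoMultiset]⟩ : Sym (Fin n) k)) ⟨?_, ?_⟩
  · intro i j hij
    exact monoMultiset_injective (congrArg Subtype.val hij)
  · rintro ⟨s, hs⟩
    have hl : (s.sort (· ≤ ·)).length = k := by simp [hs]
    have hm : Monotone fun a : Fin k => (s.sort (· ≤ ·)).get (a.cast hl.symm) := by
      intro a b hab
      exact (s.pairwise_sort (· ≤ ·)).sortedLE.monotone_get (by simpa using hab)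
    refine ⟨⟨_, hm⟩, Subtype.ext ?_⟩
    simp only
    rw [monoMultiset_eq_ofFn]
    conv_rhs => rw [← Multiset.sort_eq s (· ≤ ·)]
    congr 1
    subst hl
    exact List.ofFn_get _

variable {F : Type*} [Field F]

theorem tensorPow_smul {n : ℕ} (c : F) (x : Fin n → F) (m : ℕ) :
    tensorPow (c • x) m = c ^ m • tensorPow x m := by
  ext i; simp [tensorPow, Finset.prod_mul_distrib]

theorem tensorPow_isSymmetric {n : ℕ} (x : Fin n → F) (m : ℕ) : IsSymmetric (tensorPow x m) := by
  intro σ i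
  exact Equiv.prod_comp σ (fun j => x (i j))

theorem tensorPow_append {n : ℕ} (x : Fin n → F) (k l : ℕ) (i : Fin k → Fin n) (j : Fin l → Fin n) :
    tensorPow x (k + l) (Fin.append i j) = tensorPow x k i * tensorPow x l j := by
  simp [tensorPow, Fin.prod_univ_add]

theorem tensorPow_cast {n : ℕ} (x : Fin n → F) {m m' : ℕ} (h : m = m') (i : Fin m' → Fin n) :
    tensorPow x m (i ∘ Fin.cast h) = tensorPow x m' i := by
  subst h; rfl

theorem tensorPow_ne_zero {n : ℕ} {x : Fin n → F} (hx : x ≠ 0) (m : ℕ) :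
    ∃ i, tensorPow x m i ≠ 0 := by
  obtain ⟨j, hj⟩ := Function.ne_iff.1 hx
  exact ⟨fun _ => j, by simpa [tensorPow] using fun h => absurd h hj⟩

theorem IsSymmetric.add {n m : ℕ} {S T : Tensor F n m} (hS : IsSymmetric S) (hT : IsSymmetric T) :
    IsSymmetric (S + T) := fun σ i => by simp [hS σ i, hT σ i]

theorem IsSymmetric.smul {n m : ℕ} {T : Tensor F n m} (c : F) (hT : IsSymmetric T) :
    IsSymmetric (c • T) := fun σ i => by simp [hT σ i]

/-- The space of symmetric tensors. -/
def symTensors (F : Type*) [Field F] (n m : ℕ) : Submodule F (Tensor F n m) where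
  carrier := {T | IsSymmetric T}
  zero_mem' := fun _ _ => rfl
  add_mem' := IsSymmetric.add
  smul_mem' := fun c _ h => h.smul c

theorem mem_symTensors {n m : ℕ} {T : Tensor F n m} : T ∈ symTensors F n m ↔ IsSymmetric T :=
  Iff.rfl

/-- The rearrangement of a tuple in non-decreasing order. -/
def sortIdx {n k : ℕ} (i : Fin k → Fin n) : MonoIdx n k :=
  ⟨i ∘ Tuple.sort i, Tuple.monotone_sort i⟩

end TensorBasics

theorem symCoords_apply_sortIdx {F : Type*} {n k : ℕ} {T : Tensor F n k} (hT : IsSymmetric T)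
    (i : Fin k → Fin n) : symCoords T (sortIdx i) = T i := hT _ _

/-! ### Powers of vectors and the orthogonal complement of the quadrics -/

section Coords

variable {F : Type*} [RCLike F]

theorem symCoords_injOn {n k : ℕ} {S T : Tensor F n k} (hS : IsSymmetric S) (hT : IsSymmetric T)
    (h : symCoords S = symCoords T) : S = T := by
  ext i
  rw [← symCoords_apply_sortIdx hS, ← symCoords_apply_sortIdx hT, h]

/-- `symCoords` as a linear map. -/
def symCoordsₗ (F : Type*) [RCLike F] (n k : ℕ) : Tensor F n k →ₗ[F] (MonoIdx n k → F) where
  toFun := symCoords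
  map_add' _ _ := rfl
  map_smul' _ _ := rfl

@[simp] theorem symCoordsₗ_apply {n k : ℕ} (T : Tensor F n k) :
    symCoordsₗ F n k T = symCoords T := rfl

theorem exists_dot_of_notMem {ι : Type*} [Fintype ι] {W : Submodule F (ι → F)} {v : ι → F}
    (hv : v ∉ W) : ∃ c : ι → F, (∀ w ∈ W, ∑ i, c i * w i = 0) ∧ ∑ i, c i * v i ≠ 0 := by
  classical
  obtain ⟨f, hf, hW⟩ := Submodule.exists_le_ker_of_notMem hv
  refine ⟨fun i => f fun j => if i = j then 1 else 0, fun w hw => ?_, ?_⟩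
  · have := hW hw
    rw [LinearMap.mem_ker, LinearMap.pi_apply_eq_sum_univ] at this
    simpa [mul_comm] using this
  · rw [LinearMap.pi_apply_eq_sum_univ] at hf
    simpa [mul_comm] using hf

theorem exists_matrix_dot_of_notMem {ι κ : Type*} [Fintype ι] [Fintype κ]
    {W : Submodule F (Matrix ι κ F)} {v : Matrix ι κ F}
    (hv : v ∉ W) : ∃ c : Matrix ι κ F, (∀ w ∈ W, ∑ i, ∑ j, c i j * w i j = 0) ∧
      ∑ i, ∑ j, c i j * v i j ≠ 0 := by
  classical
  obtain ⟨f, hf, hW⟩ := Submodule.exists_le_ker_of_notMem hv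
  have key : ∀ w : Matrix ι κ F, f w = ∑ i, ∑ j, f (Matrix.single i j 1) * w i j := by
    intro w
    conv_lhs => rw [Matrix.matrix_eq_sum_single w]
    rw [map_sum]
    refine Finset.sum_congr rfl fun i _ => ?_
    rw [map_sum]
    refine Finset.sum_congr rfl fun j _ => ?_
    have : Matrix.single i j (w i j) = w i j • Matrix.single i j (1 : F) := by
      simp
    rw [this, map_smul, smul_eq_mul, mul_comm]
  refine ⟨fun i j => f (Matrix.single i j 1), fun w hw => ?_, ?_⟩
  · rw [← key]; exact hW hw
  · rw [← key]; exact hf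

/-- A functional that kills all powers is a homogeneous polynomial with no nonzero value. Distinct
non-decreasing tuples are distinct monomials, so over an infinite field all its coefficients vanish.
-/
theorem span_symCoords_tensorPow (n k : ℕ) :
    Submodule.span F (Set.range fun x : Fin n → F => symCoords (tensorPow x k)) = ⊤ := by
  classical
  by_contra hne
  obtain ⟨v, hv⟩ : ∃ v, v ∉ Submodule.span F
      (Set.range fun x : Fin n → F => symCoords (tensorPow x k)) := by
    by_contra h; push Not at h; exact hne (Submodule.eq_top_iff'.2 h)
  obtain ⟨c, hc, hcv⟩ := exists_dot_of_notMem hv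
  let p : MvPolynomial (Fin n) F :=
    ∑ i, MvPolynomial.monomial (Multiset.toFinsupp (monoMultiset i)) (c i)
  have hp : p = 0 := by
    refine MvPolynomial.funext fun x => ?_
    have h := hc _ (Submodule.subset_span ⟨x, rfl⟩)
    simp only [p, map_sum, MvPolynomial.eval_monomial, map_zero]
    rw [← h]
    refine Finset.sum_congr rfl fun i _ => ?_
    congr 1
    change _ = (Finset.univ.val.map fun j => x (i.1 j)).prod
    have : (Finset.univ.val.map fun j => x (i.1 j)) = (monoMultiset i).map x := by
      rw [monoMultiset, Multiset.map_map]; rfl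
    rw [this, Finset.prod_multiset_map_count, Finsupp.prod, Multiset.toFinsupp_support]
    simp
  have hc0 : ∀ i, c i = 0 := by
    intro i
    have h := congrArg (MvPolynomial.coeff (Multiset.toFinsupp (monoMultiset i))) hp
    simp only [p, MvPolynomial.coeff_sum, MvPolynomial.coeff_monomial, MvPolynomial.coeff_zero] at h
    rw [Finset.sum_eq_single i] at h
    · simpa using h
    · intro j _ hji
      rw [if_neg]
      intro h'
      exact hji (monoMultiset_injective (Multiset.toFinsupp.injective h'))
    · simp
  exact hcv (by simp [hc0])

theorem span_tensorPow (n k : ℕ) :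
    Submodule.span F (Set.range fun x : Fin n → F => tensorPow x k) = symTensors F n k := by
  have hle : Submodule.span F (Set.range fun x : Fin n → F => tensorPow x k) ≤ symTensors F n k := by
    rw [Submodule.span_le]; rintro _ ⟨x, rfl⟩; exact tensorPow_isSymmetric x k
  refine le_antisymm hle fun T hT => ?_
  have h : symCoords T ∈ Submodule.map (symCoordsₗ F n k)
      (Submodule.span F (Set.range fun x : Fin n → F => tensorPow x k)) := by
    rw [Submodule.map_span, ← Set.range_comp]
    have := span_symCoords_tensorPow (F := F) n k
    simp only [Function.comp_def, symCoordsₗ_apply, this, Submodule.mem_top]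
  obtain ⟨S, hS, hST⟩ := h
  rwa [← symCoords_injOn (hle hS) hT hST]

/-- The matrix, in coordinates, of a tensor of order `2k`. -/
def matOf {n k : ℕ} (S : Tensor F n (k + k)) : Matrix (MonoIdx n k) (MonoIdx n k) F :=
  fun p q => S (Fin.append p.1 q.1)

/-- `matOf` as a linear map. -/
def matOfₗ (F : Type*) [RCLike F] (n k : ℕ) :
    Tensor F n (k + k) →ₗ[F] Matrix (MonoIdx n k) (MonoIdx n k) F where
  toFun := matOf
  map_add' _ _ := rfl
  map_smul' _ _ := rfl

/-- The coordinates of `x^{⊗ k}`. -/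
abbrev ver {n : ℕ} (k : ℕ) (x : Fin n → F) : MonoIdx n k → F := symCoords (tensorPow x k)

theorem matOf_tensorPow {n : ℕ} (k : ℕ) (x : Fin n → F) :
    matOf (tensorPow x (k + k)) = Matrix.vecMulVec (ver k x) (ver k x) := by
  ext p q; simp [matOf, tensorPow_append, Matrix.vecMulVec, symCoords]

/-- The orthogonal complement of the quadrics: the span of the squares of `x^{⊗ k}`. -/
def verSquares (F : Type*) [RCLike F] (n k : ℕ) :
    Submodule F (Matrix (MonoIdx n k) (MonoIdx n k) F) :=
  Submodule.span F (Set.range fun x : Fin n → F => Matrix.vecMulVec (ver k x) (ver k x))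

/-- Both sides are spanned by the images of the powers x^{⊗2k}. This is what turns S^{2k} into the
complement of the quadrics. -/
theorem map_matOf_symTensors (n k : ℕ) :
    (symTensors F n (k + k)).map (matOfₗ F n k) = verSquares F n k := by
  rw [← span_tensorPow, Submodule.map_span, ← Set.range_comp, verSquares]
  congr 2
  ext x : 1
  exact matOf_tensorPow k x

/-- Sorting each half separately is one permutation of all 2k positions. Hence the sorted
coordinates lose nothing on symmetric tensors. -/
theorem apply_append_sortIdx {n k : ℕ} {S : Tensor F n (k + k)} (hS : IsSymmetric S) (p q : Fin k → Fin n) :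
    S (Fin.append (sortIdx p).1 (sortIdx q).1) = S (Fin.append p q) := by
  have : Fin.append (sortIdx p).1 (sortIdx q).1 = Fin.append p q ∘
      (finSumFinEquiv.symm.trans ((Equiv.sumCongr (Tuple.sort p) (Tuple.sort q)).trans
        finSumFinEquiv)) := by
    ext i : 1
    refine Fin.addCases (fun i => ?_) (fun i => ?_) i
    · simp only [sortIdx, Fin.append_left, Function.comp_apply, Equiv.trans_apply,
        finSumFinEquiv_symm_apply_castAdd, Equiv.sumCongr_apply, Sum.map_inl,
        finSumFinEquiv_apply_left]
    · simp only [sortIdx, Fin.append_right, Function.comp_apply, Equiv.trans_apply,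
        finSumFinEquiv_symm_apply_natAdd, Equiv.sumCongr_apply, Sum.map_inr,
        finSumFinEquiv_apply_right]
  rw [this, hS]

theorem append_comp_sum {α : Type*} {k l : ℕ} (i : Fin (k + l) → α) :
    Fin.append (i ∘ Fin.castAdd l) (i ∘ Fin.natAdd k) = i := by
  ext a : 1
  refine Fin.addCases (fun a => ?_) (fun a => ?_) a <;> simp

theorem matOf_injOn {n k : ℕ} {S T : Tensor F n (k + k)} (hS : IsSymmetric S) (hT : IsSymmetric T)
    (h : matOf S = matOf T) : S = T := by
  ext i
  rw [← append_comp_sum i, ← apply_append_sortIdx hS, ← apply_append_sortIdx hT]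
  exact congrFun (congrFun h _) _

/-- Only this inequality enters the rank bound: it limits how many relations the quotient by
`verSquares` can create among symmetric products. -/
theorem finrank_verSquares_le (n k : ℕ) :
    Module.finrank F (verSquares F n k) ≤ Fintype.card (MonoIdx n (k + k)) := by
  rw [← map_matOf_symTensors]
  refine (Submodule.finrank_map_le _ _).trans ?_
  have : Function.Injective ((symCoordsₗ F n (k + k)).comp (symTensors F n (k + k)).subtype) := by
    intro S T h
    exact Subtype.ext (symCoords_injOn S.2 T.2 h)
  have := LinearMap.finrank_le_finrank_of_injective this
  simpa using this

theorem verSquares_isSymm {n k : ℕ} {P : Matrix (MonoIdx n k) (MonoIdx n k) F}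
    (hP : P ∈ verSquares F n k) : P.IsSymm := by
  induction hP using Submodule.span_induction with
  | mem x h => obtain ⟨x, rfl⟩ := h; ext i j; simp [Matrix.vecMulVec, mul_comm]
  | zero => exact Matrix.isSymm_zero
  | add x y _ _ hx hy => exact hx.add hy
  | smul a x _ hx => exact hx.smul a

theorem quadric_dot_verSquares {n k : ℕ} {q P : Matrix (MonoIdx n k) (MonoIdx n k) F}
    (hq : q ∈ quadricsOn (veroneseCone F n k)) (hP : P ∈ verSquares F n k) :
    ∑ i, ∑ j, q i j * P i j = 0 := by
  induction hP using Submodule.span_induction with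
  | mem x h =>
    obtain ⟨x, rfl⟩ := h
    exact hq.2 (ver k x) ⟨_, ⟨1, x, rfl⟩, by simp⟩
  | zero => simp
  | add x y _ _ hx hy => simp [mul_add, Finset.sum_add_distrib, hx, hy]
  | smul a x _ hx => 
    simp only [Matrix.smul_apply, smul_eq_mul, mul_left_comm _ a, ← Finset.mul_sum, hx, mul_zero]

/-- Biduality for symmetric matrices. A functional c separating P from the squares need not be
symmetric, but c + cᵀ is; it doubles the value of c on symmetric matrices, so it is a quadric
vanishing on the cone that does not vanish on P. -/
theorem mem_verSquares_of_forall {n k : ℕ} {P : Matrix (MonoIdx n k) (MonoIdx n k) F}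
    (hs : P.IsSymm) (h : ∀ q ∈ quadricsOn (veroneseCone F n k), ∑ i, ∑ j, q i j * P i j = 0) :
    P ∈ verSquares F n k := by
  by_contra hP
  obtain ⟨c, hc, hcP⟩ := exists_matrix_dot_of_notMem hP
  have key : ∀ M : Matrix (MonoIdx n k) (MonoIdx n k) F, M.IsSymm →
      ∑ i, ∑ j, (c + c.transpose) i j * M i j = 2 * ∑ i, ∑ j, c i j * M i j := by
    intro M hM
    simp only [Matrix.add_apply, Matrix.transpose_apply, add_mul, Finset.sum_add_distrib, two_mul]
    congr 1
    rw [Finset.sum_comm]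
    refine Finset.sum_congr rfl fun i _ => Finset.sum_congr rfl fun j _ => ?_
    rw [hM.apply]
  have hq : c + c.transpose ∈ quadricsOn (veroneseCone F n k) := by
    refine ⟨Matrix.isSymm_add_transpose_self c, ?_⟩
    rintro _ ⟨_, ⟨α, x, rfl⟩, rfl⟩
    have h1 := hc _ (Submodule.subset_span ⟨x, rfl⟩)
    have h2 := key (Matrix.vecMulVec (ver k x) (ver k x)) (by
      ext i j; simp [Matrix.vecMulVec, mul_comm])
    rw [h1, mul_zero] at h2
    have : ∀ i j, (c + c.transpose) i j * (symCoords (α • tensorPow x k) i *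
        symCoords (α • tensorPow x k) j) = α * α * ((c + c.transpose) i j *
        Matrix.vecMulVec (ver k x) (ver k x) i j) := by
      intro i j; simp only [Matrix.vecMulVec_apply, symCoords, Pi.smul_apply, smul_eq_mul]; ring
    simp_rw [this, ← Finset.mul_sum, h2, mul_zero]
  have := h _ hq
  rw [key P hs] at this
  exact hcP (by simpa using this)

/-- Replaces the given basis of quadrics by an intrinsic condition, so that nothing later depends on
that basis. Symmetry of P is contained in the second condition. -/
theorem mem_liftedIntersection_iff {n k p : ℕ} {U : Submodule F (MonoIdx n k → F)}
    {q : Fin p → Matrix (MonoIdx n k) (MonoIdx n k) F}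
    (hq : Submodule.span F (Set.range q) = quadricsOn (veroneseCone F n k))
    {P : Matrix (MonoIdx n k) (MonoIdx n k) F} :
    P ∈ liftedIntersection U q ↔ (∀ j, (fun i => P i j) ∈ U) ∧ P ∈ verSquares F n k := by
  constructor
  · rintro ⟨h1, h2, h3⟩
    refine ⟨h2, mem_verSquares_of_forall h1 fun q' hq' => ?_⟩
    rw [← hq] at hq'
    induction hq' using Submodule.span_induction with
    | mem x h => obtain ⟨l, rfl⟩ := h; exact h3 l
    | zero => simp
    | add x y _ _ hx hy => simp [add_mul, Finset.sum_add_distrib, hx, hy]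
    | smul a x _ hx => simp [mul_assoc, ← Finset.mul_sum, hx]
  · rintro ⟨h1, h2⟩
    refine ⟨verSquares_isSymm h2, h1, fun l => quadric_dot_verSquares ?_ h2⟩
    rw [← hq]; exact Submodule.subset_span ⟨l, rfl⟩

end Coords

end Waring

namespace Waring

/-! ### Simultaneous diagonalization without pseudoinverses -/

section SimDiag

open Matrix

variable {F : Type*} [RCLike F] {ι : Type*} [Fintype ι]

/-- The matrix with the given columns. -/
abbrev colMatrix {s : ℕ} (v : Fin s → ι → F) : Matrix ι (Fin s) F := Matrix.of fun i a => v a i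

theorem mulVec_injective_of_linearIndependent {s : ℕ} {v : Fin s → ι → F}
    (hv : LinearIndependent F v) {c : Fin s → F} (hc : colMatrix v *ᵥ c = 0) : c = 0 := by
  rw [Fintype.linearIndependent_iff] at hv
  ext a
  refine hv c ?_ a
  ext i
  have := congrFun hc i
  simpa [mulVec, dotProduct, mul_comm] using this

open scoped ComplexOrder in
-- The left inverse is (Y^*Y)⁻¹Y^*. Any left inverse would do for duality, but with this one YY' is
-- the orthogonal projection on the span of the vectors, hence Hermitian, as the Moore–Penrose
-- conditions demand.
theorem exists_pinv_colMatrix {s : ℕ} {v : Fin s → ι → F} (hv : LinearIndependent F v) :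
    ∃ Y' : Matrix (Fin s) ι F, Y' * colMatrix v = 1 ∧ (colMatrix v * Y').IsHermitian := by
  set Y := colMatrix v
  have hu : IsUnit (Yᴴ * Y) := by
    rw [← mulVec_injective_iff_isUnit, ← coe_mulVecLin]
    rw [← LinearMap.ker_eq_bot, ker_mulVecLin_conjTranspose_mul_self, LinearMap.ker_eq_bot']
    intro c hc
    exact mulVec_injective_of_linearIndependent hv hc
  have hu' : IsUnit (Yᴴ * Y).det := (isUnit_iff_isUnit_det _).1 hu
  have hH : (Yᴴ * Y).IsHermitian := isHermitian_conjTranspose_mul_self Y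
  refine ⟨(Yᴴ * Y)⁻¹ * Yᴴ, ?_, ?_⟩
  · rw [Matrix.mul_assoc, nonsing_inv_mul _ hu']
  · rw [IsHermitian, conjTranspose_mul, conjTranspose_mul, conjTranspose_conjTranspose,
      hH.inv.eq, Matrix.mul_assoc]

/-- The slices factor through Yᵀ and not Y^*. The two products are therefore YY' and its transpose,
and both are Hermitian. -/
theorem isPseudoinverse_diagonalized {s : ℕ} {Y : Matrix ι (Fin s) F} {Y' : Matrix (Fin s) ι F}
    (h1 : Y' * Y = 1) (h2 : (Y * Y').IsHermitian) {d : Fin s → F} (hd : ∀ a, d a ≠ 0) :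
    IsPseudoinverse (Y * diagonal d * Yᵀ) (Y'ᵀ * diagonal (fun a => (d a)⁻¹) * Y') := by
  have e1 : Yᵀ * Y'ᵀ = 1 := by rw [← transpose_mul, h1, transpose_one]
  have e2 : diagonal d * diagonal (fun a => (d a)⁻¹) = 1 := by
    rw [diagonal_mul_diagonal, ← diagonal_one]; congr 1; ext a; simp [hd a]
  have e3 : diagonal (fun a => (d a)⁻¹) * diagonal d = 1 := by
    rw [diagonal_mul_diagonal, ← diagonal_one]; congr 1; ext a; simp [hd a]
  have hAB : (Y * diagonal d * Yᵀ) * (Y'ᵀ * diagonal (fun a => (d a)⁻¹) * Y') = Y * Y' := by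
    calc _ = Y * (diagonal d * ((Yᵀ * Y'ᵀ) * diagonal (fun a => (d a)⁻¹))) * Y' := by
          simp only [Matrix.mul_assoc]
      _ = _ := by rw [e1, Matrix.one_mul, e2, Matrix.mul_one]
  have hBA : (Y'ᵀ * diagonal (fun a => (d a)⁻¹) * Y') * (Y * diagonal d * Yᵀ) = (Y * Y')ᵀ := by
    calc _ = Y'ᵀ * (diagonal (fun a => (d a)⁻¹) * ((Y' * Y) * diagonal d)) * Yᵀ := by
          simp only [Matrix.mul_assoc]
      _ = _ := by rw [h1, Matrix.one_mul, e3, Matrix.mul_one, transpose_mul]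
  refine ⟨?_, ?_, ?_, ?_⟩
  · rw [hAB]
    calc _ = Y * (Y' * Y) * diagonal d * Yᵀ := by simp only [Matrix.mul_assoc]
      _ = _ := by rw [h1, Matrix.mul_one]
  · rw [hBA, transpose_mul]
    calc _ = Y'ᵀ * (Yᵀ * Y'ᵀ) * diagonal (fun a => (d a)⁻¹) * Y' := by
          simp only [Matrix.mul_assoc]
      _ = _ := by rw [e1, Matrix.mul_one]
  · rw [hAB]; exact h2
  · rw [hBA]; exact h2.transpose

/-- Cancel Y and Yᵀ on both sides of ABA = A with the left inverse. No other Moore–Penrose condition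
is used, so the identity applies to whichever pseudoinverse the algorithm was given. -/
theorem sandwich_of_generalizedInverse {s : ℕ} {Y : Matrix ι (Fin s) F} {Y' : Matrix (Fin s) ι F}
    (h1 : Y' * Y = 1) {d : Fin s → F} (hd : ∀ a, d a ≠ 0) {B : Matrix ι ι F}
    (hB : (Y * diagonal d * Yᵀ) * B * (Y * diagonal d * Yᵀ) = Y * diagonal d * Yᵀ) :
    Yᵀ * B * Y = diagonal (fun a => (d a)⁻¹) := by
  have e1 : Yᵀ * Y'ᵀ = 1 := by rw [← transpose_mul, h1, transpose_one]
  have e2 : diagonal d * diagonal (fun a => (d a)⁻¹) = 1 := by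
    rw [diagonal_mul_diagonal, ← diagonal_one]; congr 1; ext a; simp [hd a]
  have e3 : diagonal (fun a => (d a)⁻¹) * diagonal d = 1 := by
    rw [diagonal_mul_diagonal, ← diagonal_one]; congr 1; ext a; simp [hd a]
  have h := congrArg (fun M => diagonal (fun a => (d a)⁻¹) * (Y' * M * Y'ᵀ) *
    diagonal (fun a => (d a)⁻¹)) hB
  have l : diagonal (fun a => (d a)⁻¹) * (Y' * ((Y * diagonal d * Yᵀ) * B *
      (Y * diagonal d * Yᵀ)) * Y'ᵀ) * diagonal (fun a => (d a)⁻¹) =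
      (diagonal (fun a => (d a)⁻¹) * ((Y' * Y) * diagonal d)) * (Yᵀ * B * Y) * (diagonal d *
        ((Yᵀ * Y'ᵀ) * diagonal (fun a => (d a)⁻¹))) := by
    simp only [Matrix.mul_assoc]
  have r : diagonal (fun a => (d a)⁻¹) * (Y' * (Y * diagonal d * Yᵀ) * Y'ᵀ) *
      diagonal (fun a => (d a)⁻¹) = (diagonal (fun a => (d a)⁻¹) * ((Y' * Y) * diagonal d)) *
      ((Yᵀ * Y'ᵀ) * diagonal (fun a => (d a)⁻¹)) := by
    simp only [Matrix.mul_assoc]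
  rw [l, r, h1, e1, Matrix.one_mul, Matrix.one_mul, e2, e3, Matrix.one_mul, Matrix.mul_one,
    Matrix.one_mul] at h
  exact h

/-- The slices `P l` are simultaneously diagonalized by the vectors `v a`, and the functionals
`f` and `g` separate the summands. -/
def SimDiagonalizedBy {s : ℕ} (P : Fin s → Matrix ι ι F) (f g : Fin s → F)
    (v : Fin s → ι → F) : Prop :=
  ∃ z : Fin s → Fin s → F, (∀ l i j, P l i j = ∑ a, z a l * (v a i * v a j)) ∧
    LinearIndependent F z ∧ LinearIndependent F v ∧
    (∀ a, ∑ l, f l * z a l ≠ 0) ∧ (∀ a, ∑ l, g l * z a l ≠ 0) ∧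
    Function.Injective fun a => (∑ l, f l * z a l) / (∑ l, g l * z a l)

theorem contract_eq_diagonalized {s : ℕ} {P : Fin s → Matrix ι ι F} {v : Fin s → ι → F}
    {z : Fin s → Fin s → F} (hP : ∀ l i j, P l i j = ∑ a, z a l * (v a i * v a j))
    (f : Fin s → F) :
    contract P f = colMatrix v * diagonal (fun a => ∑ l, f l * z a l) * (colMatrix v)ᵀ := by
  ext i j
  rw [Matrix.mul_apply]
  simp only [contract, Matrix.sum_apply, Matrix.smul_apply, smul_eq_mul, hP,
    mul_diagonal, transpose_apply, of_apply, Finset.mul_sum, Finset.sum_mul]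
  rw [Finset.sum_comm]
  refine Finset.sum_congr rfl fun a _ => Finset.sum_congr rfl fun l _ => ?_
  ring

theorem diagonal_ne_zero_of_rank {s : ℕ} {d : Fin s → F} (h : s ≤ (diagonal d).rank) (a : Fin s) :
    d a ≠ 0 := by
  classical
  rw [rank_diagonal] at h
  intro ha
  have : Fintype.card {i // d i ≠ 0} < Fintype.card (Fin s) :=
    Fintype.card_subtype_lt (x := a) (by simpa using ha)
  simp only [Fintype.card_fin] at this
  omega

theorem mulVec_colMatrix {s : ℕ} (M : Matrix ι ι F) (v : Fin s → ι → F) (a : Fin s) :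
    M *ᵥ v a = (M * colMatrix v).col a := by
  ext i; simp [mulVec, dotProduct, Matrix.mul_apply, Matrix.col]

/-- With contractions A = Y D_f Yᵀ and B = Y D_g Yᵀ, the matrix AB⁺ acts on the columns of Y by the
ratios, and (A⁺B)ᵀ by their inverses. The rows of the left inverse Y' supply the functionals dual to
the v_a ⊗ v_a, and contracting with them returns the z_a. -/
theorem SimDiagonalizedBy.stepTwoSucceeds {s : ℕ} {P : Fin s → Matrix ι ι F} {f g : Fin s → F}
    {v : Fin s → ι → F} (h : SimDiagonalizedBy P f g v) : StepTwoSucceeds P f g v := by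
  obtain ⟨z, hP, hz, hv, hf, hg, hinj⟩ := h
  obtain ⟨Y', h1, h2⟩ := exists_pinv_colMatrix hv
  have hA := contract_eq_diagonalized hP f
  have hB := contract_eq_diagonalized hP g
  set Y := colMatrix v with hY
  set df := fun a => ∑ l, f l * z a l with hdf
  set dg := fun a => ∑ l, g l * z a l with hdg
  have pA := isPseudoinverse_diagonalized h1 h2 hf
  have pB := isPseudoinverse_diagonalized h1 h2 hg
  have sB : Yᵀ * (_ : Matrix ι ι F) * Y = diagonal (fun a => (dg a)⁻¹) :=
    sandwich_of_generalizedInverse h1 hg pB.1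
  have sA : Yᵀ * (_ : Matrix ι ι F) * Y = diagonal (fun a => (df a)⁻¹) :=
    sandwich_of_generalizedInverse h1 hf pA.1
  rw [← hA] at pA
  rw [← hB] at pB
  set A' := Y'ᵀ * diagonal (fun a => (df a)⁻¹) * Y'
  set B' := Y'ᵀ * diagonal (fun a => (dg a)⁻¹) * Y'
  have hAY : contract P f * B' * Y = Y * diagonal (fun a => df a / dg a) := by
    calc contract P f * B' * Y = Y * diagonal df * (Yᵀ * B' * Y) := by
          rw [hA]; simp only [Matrix.mul_assoc]
      _ = _ := by
          rw [sB, Matrix.mul_assoc, diagonal_mul_diagonal]; simp only [div_eq_mul_inv]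
  have sA' : Yᵀ * A'ᵀ * Y = diagonal (fun a => (df a)⁻¹) := by
    have := congrArg Matrix.transpose sA
    rwa [transpose_mul, transpose_mul, transpose_transpose, diagonal_transpose,
      ← Matrix.mul_assoc] at this
  have hBt : (contract P g)ᵀ = contract P g := by
    rw [hB]; simp [transpose_mul, Matrix.mul_assoc]
  have hBY : (A' * contract P g)ᵀ * Y = Y * diagonal (fun a => (df a / dg a)⁻¹) := by
    calc (A' * contract P g)ᵀ * Y = Y * diagonal dg * (Yᵀ * A'ᵀ * Y) := by
          rw [transpose_mul, hBt, hB]; simp only [Matrix.mul_assoc]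
      _ = _ := by
          rw [sA', Matrix.mul_assoc, diagonal_mul_diagonal]; simp only [inv_div]; simp only [div_eq_mul_inv]
  have hmul : ∀ (d : Fin s → F) (a : Fin s), (Y * diagonal d).col a = d a • v a := by
    intro d a; ext i; simp [hY, Matrix.col, mul_comm]
  have hY'v : ∀ a b, ∑ i, Y' a i * v b i = if a = b then 1 else 0 := by
    intro a b
    have := congrFun (congrFun h1 a) b
    simpa [Matrix.mul_apply, hY, Matrix.one_apply] using this
  have hdual : ∀ a b, ∑ i, ∑ j, (Y' a i * Y' a j) * (v b i * v b j) = if a = b then 1 else 0 := by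
    intro a b
    have : ∑ i, ∑ j, (Y' a i * Y' a j) * (v b i * v b j) =
        (∑ i, Y' a i * v b i) * (∑ i, Y' a i * v b i) := by
      rw [Finset.sum_mul_sum]
      exact Finset.sum_congr rfl fun i _ => Finset.sum_congr rfl fun j _ => by ring
    rw [this, hY'v]; split_ifs <;> simp
  refine ⟨z, v, v, z, ⟨A', B', fun a => df a / dg a, fun a i j => Y' a i * Y' a j, pA, pB, ?_,
    hinj, fun a => div_ne_zero (hf a) (hg a), fun a => ⟨hv.ne_zero a, ?_⟩, ?_,
    fun a => ⟨hv.ne_zero a, ?_⟩, hdual, ?_, ?_⟩, fun _ _ _ _ => rfl, hP, hz, hv⟩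
  · apply le_antisymm
    · rw [hA, Matrix.mul_assoc, Matrix.mul_assoc]
      refine (rank_mul_le_left _ _).trans ((rank_le_card_width _).trans ?_)
      simp
    · have : Y' * (contract P f * B' * Y) = diagonal (fun a => df a / dg a) := by
        rw [hAY, ← Matrix.mul_assoc, h1, Matrix.one_mul]
      have hr : (diagonal (fun a => df a / dg a)).rank = s := by
        classical
        rw [rank_diagonal]
        have : ∀ i, df i / dg i ≠ 0 := fun i => div_ne_zero (hf i) (hg i)
        simp [this]
      calc s = (Y' * (contract P f * B' * Y)).rank := by rw [this, hr]
        _ ≤ (contract P f * B' * Y).rank := rank_mul_le_right _ _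
        _ ≤ _ := rank_mul_le_left _ _
  · rw [mulVec_colMatrix, hAY, hmul]
  · intro ν y hν hy hyν
    -- Since ν ≠ 0, the eigenvector lies in the range of (A⁺B)ᵀ = Y D_g Yᵀ (A⁺)ᵀ, hence in the
    -- column space of Y.
    obtain ⟨c, hc⟩ : ∃ c : Fin s → F, y = Y *ᵥ c := by
      refine ⟨ν⁻¹ • (diagonal dg * Yᵀ * A'ᵀ) *ᵥ y, ?_⟩
      rw [mulVec_smul, mulVec_mulVec]
      have : Y * (diagonal dg * Yᵀ * A'ᵀ) = (A' * contract P g)ᵀ := by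
        rw [transpose_mul A', hBt, hB]; simp only [Matrix.mul_assoc]
      rw [this, hyν, smul_smul, inv_mul_cancel₀ hν, one_smul]
    have hc0 : c ≠ 0 := by rintro rfl; exact hy (by simpa using hc)
    obtain ⟨a, ha⟩ := Function.ne_iff.1 hc0
    refine ⟨a, ?_⟩
    rw [hc, mulVec_mulVec, hBY, ← mulVec_mulVec, ← mulVec_smul, ← sub_eq_zero, ← mulVec_sub] at hyν
    have := congrFun (mulVec_injective_of_linearIndependent hv hyν) a
    simp only [Pi.sub_apply, mulVec_diagonal, Pi.smul_apply, smul_eq_mul, Pi.zero_apply,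
      ← sub_mul, mul_eq_zero] at this
    rcases this with h | h
    · exact (sub_eq_zero.1 h).symm
    · exact absurd h ha
  · rw [mulVec_colMatrix, hBY, hmul]
  · intro a l
    simp only [hP, Finset.mul_sum]
    have : ∀ i, ∑ j, ∑ b, (Y' a i * Y' a j) * (z b l * (v b i * v b j)) =
        ∑ b, z b l * ∑ j, (Y' a i * Y' a j) * (v b i * v b j) := by
      intro i
      rw [Finset.sum_comm]
      simp only [Finset.mul_sum]
      exact Finset.sum_congr rfl fun i _ => Finset.sum_congr rfl fun j _ => by ring
    simp only [this]
    rw [Finset.sum_comm]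
    simp only [← Finset.mul_sum, hdual]
    simp
  · intro a b hab hmem
    have := hz.notMem_span_image (s := {b}) (x := a) (by simpa using hab)
    rw [Set.image_singleton] at this
    exact this hmem

/-- The rank condition makes all diagonal entries of D_f and D_g nonzero. The equality of rank one
tensors makes each reported eigenvector proportional to v_a, which identifies μ_a with the ratio at
a; the ratios are then distinct because the μ_a are. -/
theorem StepTwoSucceeds.simDiagonalizedBy {s : ℕ} {P : Fin s → Matrix ι ι F} {f g : Fin s → F}
    {v : Fin s → ι → F} (h : StepTwoSucceeds P f g v) : SimDiagonalizedBy P f g v := by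
  obtain ⟨u, v', w, z, ⟨A', B', μ, -, pA, pB, hr, hμ, hμ0, hv', -, -, -, -, -⟩, huz, hP, hz, hv⟩ := h
  obtain ⟨Y', h1, h2⟩ := exists_pinv_colMatrix hv
  have hA := contract_eq_diagonalized hP f
  have hB := contract_eq_diagonalized hP g
  set Y := colMatrix v with hY
  set df := fun a => ∑ l, f l * z a l with hdf
  set dg := fun a => ∑ l, g l * z a l with hdg
  have hf : ∀ a, df a ≠ 0 := by
    refine diagonal_ne_zero_of_rank ?_
    calc s = (contract P f * B').rank := hr.symm
      _ ≤ (Y * diagonal df).rank := by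
        rw [hA, Matrix.mul_assoc _ _ B']; exact rank_mul_le_left _ _
      _ ≤ _ := rank_mul_le_right _ _
  -- The rank of the pseudoinverse is compared with that of B through B⁺ = B⁺BB⁺.
  have hg : ∀ a, dg a ≠ 0 := by
    refine diagonal_ne_zero_of_rank ?_
    calc s = (contract P f * B').rank := hr.symm
      _ ≤ B'.rank := rank_mul_le_right _ _
      _ = (B' * contract P g * B').rank := by rw [pB.2.1]
      _ ≤ (B' * contract P g).rank := rank_mul_le_left _ _
      _ ≤ (contract P g).rank := rank_mul_le_right _ _
      _ ≤ (Y * diagonal dg).rank := by rw [hB]; exact rank_mul_le_left _ _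
      _ ≤ _ := rank_mul_le_right _ _
  have pB1 := pB.1
  rw [hB] at pB1
  have sB : Yᵀ * B' * Y = diagonal (fun a => (dg a)⁻¹) :=
    sandwich_of_generalizedInverse h1 hg pB1
  have hAY : contract P f * B' * Y = Y * diagonal (fun a => df a / dg a) := by
    calc contract P f * B' * Y = Y * diagonal df * (Yᵀ * B' * Y) := by
          rw [hA]; simp only [Matrix.mul_assoc]
      _ = _ := by
          rw [sB, Matrix.mul_assoc, diagonal_mul_diagonal]; simp only [div_eq_mul_inv]
  have hmul : ∀ (d : Fin s → F) (a : Fin s), (Y * diagonal d).col a = d a • v a := by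
    intro d a; ext i; simp [hY, Matrix.col, mul_comm]
  have hμd : ∀ a, μ a = df a / dg a := by
    intro a
    obtain ⟨l, hl⟩ := Function.ne_iff.1 (hz.ne_zero a)
    obtain ⟨j, hj⟩ := Function.ne_iff.1 (hv.ne_zero a)
    have hl : z a l ≠ 0 := hl
    have hj : v a j ≠ 0 := hj
    -- At the entry (l, j, j) the tensor z_a ⊗ v_a ⊗ v_a is nonzero, so none of the factors on the
    -- other side vanishes there.
    have hne : u a l * w a j ≠ 0 := by
      intro h0
      have h3 := huz a l j j
      have : u a l * (v' a j * w a j) = 0 := by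
        rw [mul_left_comm, h0, mul_zero]
      rw [this] at h3
      exact mul_ne_zero hl (mul_ne_zero hj hj) h3.symm
    have hprop : v' a = (z a l * v a j / (u a l * w a j)) • v a := by
      ext i
      have h3 := huz a l i j
      rw [Pi.smul_apply, smul_eq_mul, div_mul_eq_mul_div, eq_div_iff hne]
      linear_combination h3
    set c := z a l * v a j / (u a l * w a j) with hc
    have hc0 : c ≠ 0 := div_ne_zero (mul_ne_zero hl hj) hne
    have h4 := (hv' a).2
    rw [hprop, mulVec_smul, mulVec_colMatrix, hAY, hmul] at h4
    have h5 := congrFun h4 j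
    simp only [Pi.smul_apply, smul_eq_mul] at h5
    have : c * v a j * (μ a - df a / dg a) = 0 := by linear_combination -h5
    rcases mul_eq_zero.1 this with h | h
    · exact absurd h (mul_ne_zero hc0 hj)
    · exact sub_eq_zero.1 h
  refine ⟨z, hP, hz, hv, hf, hg, ?_⟩
  have : (fun a => df a / dg a) = μ := by ext a; exact (hμd a).symm
  change Function.Injective (fun a => df a / dg a)
  rw [this]; exact hμ

/-- From here on, success of the second step is a statement about one decomposition of the slices
and the separation by f and g. -/
theorem stepTwoSucceeds_iff {s : ℕ} {P : Fin s → Matrix ι ι F} {f g : Fin s → F}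
    {v : Fin s → ι → F} : StepTwoSucceeds P f g v ↔ SimDiagonalizedBy P f g v :=
  ⟨StepTwoSucceeds.simDiagonalizedBy, SimDiagonalizedBy.stepTwoSucceeds⟩

end SimDiag

end Waring

namespace Waring

/-! ### Squares in the span of squares of independent vectors -/

section RankOne

open Matrix

variable {F : Type*} [RCLike F] {ι : Type*} [Fintype ι]

/-- The squares of linearly independent vectors, and their mixed products, are independent. -/
theorem coeff_eq_zero_of_sum_mul_eq_zero {s : ℕ} {v : Fin s → ι → F} (hv : LinearIndependent F v)
    {C : Fin s → Fin s → F} (h : ∀ i j, ∑ a, ∑ b, C a b * (v a i * v b j) = 0) (a b : Fin s) :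
    C a b = 0 := by
  obtain ⟨Y', h1, -⟩ := exists_pinv_colMatrix hv
  have h2 : colMatrix v * Matrix.of C * (colMatrix v)ᵀ = 0 := by
    ext i j
    rw [Matrix.zero_apply, ← h i j, Matrix.mul_apply]
    simp only [Matrix.mul_apply, transpose_apply, of_apply, Finset.sum_mul]
    rw [Finset.sum_comm]
    exact Finset.sum_congr rfl fun _ _ => Finset.sum_congr rfl fun _ _ => by ring
  have h3 : (Y' * colMatrix v) * Matrix.of C * (Y' * colMatrix v)ᵀ = 0 := by
    have := congrArg (fun M => Y' * M * Y'ᵀ) h2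
    simpa [transpose_mul, Matrix.mul_assoc] using this
  rw [h1, Matrix.one_mul, transpose_one, Matrix.mul_one] at h3
  exact congrFun (congrFun h3 a) b

theorem linearIndependent_vecMulVec {s : ℕ} {v : Fin s → ι → F} (hv : LinearIndependent F v) :
    LinearIndependent F fun a => vecMulVec (v a) (v a) := by
  rw [Fintype.linearIndependent_iff]
  intro c hc a
  have := coeff_eq_zero_of_sum_mul_eq_zero hv (C := fun a b => if a = b then c a else 0) ?_ a a
  · simpa using this
  · intro i j
    have := congrFun (congrFun hc i) j
    simpa [Matrix.sum_apply, vecMulVec_apply] using this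

/-- A rank one matrix in the span of squares of linearly independent vectors is one of them. -/
theorem eq_smul_of_vecMulVec_mem_span {s : ℕ} {v : Fin s → ι → F} (hv : LinearIndependent F v)
    {w : ι → F} (hw : w ∈ Submodule.span F (Set.range v)) (hw0 : w ≠ 0)
    (h : vecMulVec w w ∈ Submodule.span F (Set.range fun a => vecMulVec (v a) (v a))) :
    ∃ a, ∃ c : F, c ≠ 0 ∧ w = c • v a := by
  obtain ⟨b, rfl⟩ := (Submodule.mem_span_range_iff_exists_fun F).1 hw
  obtain ⟨c, hc⟩ := (Submodule.mem_span_range_iff_exists_fun F).1 h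
  have key : ∀ a a', b a * b a' - (if a = a' then c a else 0) = 0 := by
    refine coeff_eq_zero_of_sum_mul_eq_zero hv
      (C := fun a a' => b a * b a' - (if a = a' then c a else 0)) fun i j => ?_
    have := congrFun (congrFun hc i) j
    simp only [Matrix.sum_apply, Matrix.smul_apply, vecMulVec_apply, Finset.sum_apply,
      Pi.smul_apply, smul_eq_mul, Finset.sum_mul_sum] at this
    simp only [sub_mul, Finset.sum_sub_distrib, ite_mul, zero_mul, Finset.sum_ite_eq,
      Finset.mem_univ, if_true, this]
    rw [sub_eq_zero]
    exact Finset.sum_congr rfl fun _ _ => Finset.sum_congr rfl fun _ _ => by ring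
  obtain ⟨a, ha⟩ : ∃ a, b a ≠ 0 := by
    by_contra hb; push Not at hb; exact hw0 (by simp [hb])
  refine ⟨a, b a, ha, ?_⟩
  refine Finset.sum_eq_single a (fun a' _ h' => ?_) (by simp)
  have := key a a'
  rw [if_neg (Ne.symm h'), sub_zero, mul_eq_zero] at this
  rw [this.resolve_left ha, zero_smul]

/-- The slices lie in a span of s matrices and are themselves s independent matrices. -/
theorem SimDiagonalizedBy.span_eq {s : ℕ} {P : Fin s → Matrix ι ι F} {f g : Fin s → F}
    {v : Fin s → ι → F} (h : SimDiagonalizedBy P f g v) (hP : LinearIndependent F P) :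
    Submodule.span F (Set.range P) =
      Submodule.span F (Set.range fun a => vecMulVec (v a) (v a)) := by
  obtain ⟨z, hz, -, -, -⟩ := h
  have hle : Submodule.span F (Set.range P) ≤
      Submodule.span F (Set.range fun a => vecMulVec (v a) (v a)) := by
    rw [Submodule.span_le]
    rintro _ ⟨l, rfl⟩
    refine (Submodule.mem_span_range_iff_exists_fun F).2 ⟨fun a => z a l, ?_⟩
    ext i j
    simp [Matrix.sum_apply, vecMulVec_apply, hz]
  refine Submodule.eq_of_le_of_finrank_le hle ?_
  rw [finrank_span_eq_card hP]
  exact finrank_range_le_card _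

/-- Rescaling v_a by c_a multiplies z_a by c_a². Both contractions acquire the same factor, so the
ratios do not change. -/
theorem SimDiagonalizedBy.of_smul {s : ℕ} {P : Fin s → Matrix ι ι F} {f g : Fin s → F}
    {v w : Fin s → ι → F} (h : SimDiagonalizedBy P f g v) {c : Fin s → F} (hc : ∀ a, c a ≠ 0)
    (hw : ∀ a, v a = c a • w a) : SimDiagonalizedBy P f g w := by
  obtain ⟨z, hP, hz, hv, hf, hg, hi⟩ := h
  have hc2 : ∀ a, c a * c a ≠ 0 := fun a => mul_ne_zero (hc a) (hc a)
  have hs : ∀ (f : Fin s → F) a, ∑ l, f l * (c a * c a) • z a l =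
      (c a * c a) * ∑ l, f l * z a l := by
    intro f a; rw [Finset.mul_sum]; exact Finset.sum_congr rfl fun l _ => by
      rw [smul_eq_mul]; ring
  refine ⟨fun a => (c a * c a) • z a, fun l i j => ?_, ?_, ?_, fun a => ?_, fun a => ?_, ?_⟩
  · rw [hP]
    refine Finset.sum_congr rfl fun a _ => ?_
    simp only [hw, Pi.smul_apply, smul_eq_mul]; ring
  · exact hz.units_smul (fun a => Units.mk0 _ (hc2 a))
  · have := hv.units_smul (fun a => (Units.mk0 _ (hc a))⁻¹)
    convert this using 1
    ext a i
    simp [hw, Units.smul_def, hc a]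
  · simp only [Pi.smul_apply]; rw [hs]; exact mul_ne_zero (hc2 a) (hf a)
  · simp only [Pi.smul_apply]; rw [hs]; exact mul_ne_zero (hc2 a) (hg a)
  · convert hi using 2 with a
    simp only [Pi.smul_apply]; rw [hs, hs, mul_div_mul_left _ _ (hc2 a)]

end RankOne

/-! ### Uniqueness of the Waring rank decomposition -/

section Uniqueness

open Matrix

variable {F : Type*} [RCLike F]

theorem half_add_half (m : ℕ) : (m + 1) / 2 + m / 2 = m := by omega

theorem tensorPow_flatten {n m : ℕ} (x : Fin n → F) (i : Fin ((m + 1) / 2) → Fin n)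
    (j : Fin (m / 2) → Fin n) :
    tensorPow x m (Fin.append i j ∘ Fin.cast (by omega : m = (m + 1) / 2 + m / 2)) =
      tensorPow x ((m + 1) / 2) i * tensorPow x (m / 2) j := by
  rw [← tensorPow_append]
  exact tensorPow_cast x (by omega) _

theorem linearIndependent_ver_iff {n k r : ℕ} {x : Fin r → Fin n → F} :
    LinearIndependent F (fun a => ver k (x a)) ↔
      LinearIndependent F (fun a => tensorPow (x a) k) := by
  constructor
  · intro h
    exact LinearIndependent.of_comp (symCoordsₗ F n k) h
  · intro h
    rw [Fintype.linearIndependent_iff] at h ⊢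
    intro c hc
    apply h c
    have hs : ∑ a, c a • tensorPow (x a) k ∈ symTensors F n k :=
      Submodule.sum_mem _ fun a _ => Submodule.smul_mem _ _ (tensorPow_isSymmetric _ _)
    refine symCoords_injOn hs (symTensors F n k).zero_mem ?_
    have : symCoordsₗ F n k (∑ a, c a • tensorPow (x a) k) = 0 := by
      rw [map_sum]; simpa using hc
    exact this

/-- To isolate the coefficient of a given a, restrict a relation to the slice at a multi-index p of
length j where x_a^{⊗j} does not vanish. This gives a relation among k-th powers with coefficients
c_b x_b^{⊗j}(p). -/
theorem linearIndependent_tensorPow_add {n k r : ℕ} {x : Fin r → Fin n → F}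
    (h : LinearIndependent F (fun a => tensorPow (x a) k)) (hx : ∀ a, x a ≠ 0) (j : ℕ) :
    LinearIndependent F (fun a => tensorPow (x a) (k + j)) := by
  rw [Fintype.linearIndependent_iff] at h ⊢
  intro c hc a
  obtain ⟨p, hp⟩ := tensorPow_ne_zero (hx a) j
  have := h (fun a => c a * tensorPow (x a) j p) (by
    ext i
    have := congrFun hc (Fin.append i p)
    simp only [Finset.sum_apply, Pi.smul_apply, smul_eq_mul, tensorPow_append,
      Pi.zero_apply] at this ⊢
    rw [← this]
    exact Finset.sum_congr rfl fun _ _ => by ring) a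
  exact (mul_eq_zero.1 this).resolve_right hp

theorem ver_smul {n k : ℕ} (c : F) (x : Fin n → F) : ver k (c • x) = c ^ k • ver k x := by
  rw [ver, tensorPow_smul]; rfl

theorem ver_zero {n k : ℕ} (hk : k ≠ 0) : ver k (0 : Fin n → F) = 0 := by
  ext i
  simp [ver, symCoords, tensorPow, hk]

/-- Fix all indices but one at a coordinate where x is nonzero; the remaining fibre of the k-th
power is a multiple of the vector itself. -/
theorem eq_smul_of_ver_eq_smul {n k : ℕ} (hk : k ≠ 0) {x y : Fin n → F} (hx : x ≠ 0) {c : F}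
    (h : ver k x = c • ver k y) : ∃ d : F, d ≠ 0 ∧ x = d • y := by
  have h' : tensorPow x k = c • tensorPow y k :=
    symCoords_injOn (tensorPow_isSymmetric x k) ((tensorPow_isSymmetric y k).smul c) h
  obtain ⟨k, rfl⟩ := Nat.exists_eq_succ_of_ne_zero hk
  obtain ⟨j, hj⟩ := Function.ne_iff.1 hx
  have hj : x j ≠ 0 := hj
  have key : ∀ i, x j ^ k * x i = c * (y j ^ k * y i) := by
    intro i
    have := congrFun h' (Fin.snoc (fun _ => j) i)
    simpa [tensorPow, Fin.prod_univ_castSucc] using this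
  have hx' : x = (c * y j ^ k / x j ^ k) • y := by
    ext i
    rw [Pi.smul_apply, smul_eq_mul, div_mul_eq_mul_div, eq_div_iff (pow_ne_zero _ hj)]
    linear_combination key i
  refine ⟨_, ?_, hx'⟩
  intro h0
  rw [h0, zero_smul] at hx'
  exact hx hx'

theorem image_sum_le {n m r : ℕ} (α : Fin r → F) (x : Fin r → Fin n → F) :
    image (∑ a, α a • tensorPow (x a) m) ≤
      Submodule.span F (Set.range fun a => ver ((m + 1) / 2) (x a)) := by
  rw [image, Submodule.span_le]
  rintro _ ⟨j, rfl⟩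
  refine (Submodule.mem_span_range_iff_exists_fun F).2
    ⟨fun a => α a * tensorPow (x a) (m / 2) j, ?_⟩
  ext i
  simp only [Finset.sum_apply, Pi.smul_apply, smul_eq_mul, symCoords, tensorPow_flatten]
  exact Finset.sum_congr rfl fun _ _ => by ring

/-- The image of the flattening has dimension s and lies in the span of the x'_a^{⊗k} of any
decomposition; this is the lower bound on the length. At length s that span equals the image, so
each x'_a^{⊗k} is a nonzero point of it on the cone and must be proportional to some x_b^{⊗k}. -/
theorem isUniqueWaringRankDecomposition_of_isolated {n m s : ℕ} (hm : 1 ≤ m) {T : Tensor F n m}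
    {α : Fin s → F} {x : Fin s → Fin n → F} (hT : ∑ a, α a • tensorPow (x a) m = T)
    (hx : LinearIndependent F fun a => ver ((m + 1) / 2) (x a))
    (hU : ∀ a, ver ((m + 1) / 2) (x a) ∈ image T)
    (hiso : ∀ y : Fin n → F, ver ((m + 1) / 2) y ∈ image T → ver ((m + 1) / 2) y ≠ 0 →
      ∃ a, ∃ c : F, ver ((m + 1) / 2) y = c • ver ((m + 1) / 2) (x a)) :
    IsUniqueWaringRankDecomposition T fun a => α a • tensorPow (x a) m := by
  have hk : (m + 1) / 2 ≠ 0 := by omega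
  have hUeq : image T = Submodule.span F (Set.range fun a => ver ((m + 1) / 2) (x a)) := by
    refine le_antisymm (hT ▸ image_sum_le α x) ?_
    rw [Submodule.span_le]; rintro _ ⟨a, rfl⟩; exact hU a
  have hdim : Module.finrank F (image T) = s := by
    rw [hUeq, finrank_span_eq_card hx, Fintype.card_fin]
  have hx0 : ∀ a, x a ≠ 0 := fun a h => hx.ne_zero a (by simp only [h]; exact ver_zero hk)
  have hxm : LinearIndependent F fun a => tensorPow (x a) m := by
    have := linearIndependent_tensorPow_add (linearIndependent_ver_iff.1 hx) hx0 (m / 2)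
    rwa [half_add_half] at this
  refine ⟨⟨fun a => ⟨α a, x a, rfl⟩, hT⟩, ?_, ?_⟩
  · rintro r' t' ⟨ht', hsum⟩
    choose α' x' hα' using ht'
    have hT' : ∑ a, α' a • tensorPow (x' a) m = T := by
      rw [← hsum]; exact Finset.sum_congr rfl fun a _ => (hα' a).symm
    calc s = Module.finrank F (image T) := hdim.symm
      _ ≤ _ := Submodule.finrank_mono (hT' ▸ image_sum_le α' x')
      _ ≤ _ := finrank_range_le_card _
      _ = r' := Fintype.card_fin _
  · rintro t' ⟨ht', hsum⟩
    choose α' x' hα' using ht'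
    have hT' : ∑ a, α' a • tensorPow (x' a) m = T := by
      rw [← hsum]; exact Finset.sum_congr rfl fun a _ => (hα' a).symm
    have hle : image T ≤ Submodule.span F (Set.range fun a => ver ((m + 1) / 2) (x' a)) :=
      hT' ▸ image_sum_le α' x'
    have hcard : Module.finrank F
        (Submodule.span F (Set.range fun a => ver ((m + 1) / 2) (x' a))) = s := by
      refine le_antisymm ((finrank_range_le_card _).trans_eq (Fintype.card_fin _)) ?_
      exact hdim.symm.le.trans (Submodule.finrank_mono hle)
    have hx' : LinearIndependent F fun a => ver ((m + 1) / 2) (x' a) := by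
      rw [linearIndependent_iff_card_eq_finrank_span, Fintype.card_fin]
      exact hcard.symm
    have heq : image T = Submodule.span F (Set.range fun a => ver ((m + 1) / 2) (x' a)) :=
      Submodule.eq_of_le_of_finrank_le hle (by rw [hcard, hdim])
    have hex : ∀ a, ∃ b, ∃ d : F, d ≠ 0 ∧ x' a = d • x b := by
      intro a
      obtain ⟨b, c, hc⟩ := hiso (x' a) (by rw [heq]; exact Submodule.subset_span ⟨a, rfl⟩)
        (hx'.ne_zero a)
      obtain ⟨d, hd⟩ := eq_smul_of_ver_eq_smul hk
        (fun h => hx'.ne_zero a (by simp only [h]; exact ver_zero hk)) hc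
      exact ⟨b, d, hd⟩
    choose σ d hd hσ using hex
    -- Two x'_a attached to the same x_b would have proportional k-th powers, against independence.
    have hinj : Function.Injective σ := by
      intro a a' haa
      by_contra hne
      have := hx'.notMem_span_image (s := {a'}) (x := a) (by simpa using hne)
      rw [Set.image_singleton] at this
      apply this
      refine Submodule.mem_span_singleton.2 ⟨d a ^ ((m + 1) / 2) / d a' ^ ((m + 1) / 2), ?_⟩
      rw [hσ a, hσ a', ver_smul, ver_smul, haa, smul_smul,
        div_mul_cancel₀ _ (pow_ne_zero _ (hd a'))]
    let e : Equiv.Perm (Fin s) := Equiv.ofBijective σ (Finite.injective_iff_bijective.1 hinj)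
    refine ⟨e, ?_⟩
    have hterm : ∀ a, t' a = (α' a * d a ^ m) • tensorPow (x (e a)) m := by
      intro a
      rw [hα', hσ, tensorPow_smul, smul_smul]; rfl
    -- Both decompositions are now combinations of the same independent powers x_b^{⊗m}, so their
    -- coefficients agree.
    have hcoef : ∀ b, (α' (e.symm b) * d (e.symm b) ^ m) - α b = 0 := by
      rw [Fintype.linearIndependent_iff] at hxm
      apply hxm
      simp only [sub_smul, Finset.sum_sub_distrib]
      rw [hT, sub_eq_zero, ← hsum, ← Equiv.sum_comp e]
      refine Finset.sum_congr rfl fun a _ => ?_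
      rw [hterm]; simp
    ext a : 1
    rw [hterm]
    have := hcoef (e a)
    rw [Equiv.symm_apply_apply, sub_eq_zero] at this
    rw [this]; rfl

/-- If the lifted intersection is spanned by squares of independent vectors of `U`, then these
are, up to scale, the only points of `U` on the cone. -/
theorem isolated_of_liftedIntersection {n k p s : ℕ} {U : Submodule F (MonoIdx n k → F)}
    {q : Fin p → Matrix (MonoIdx n k) (MonoIdx n k) F}
    (hq : Submodule.span F (Set.range q) = quadricsOn (veroneseCone F n k))
    {v : Fin s → MonoIdx n k → F} (hv : LinearIndependent F v)
    (hU : U = Submodule.span F (Set.range v))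
    (hl : liftedIntersection U q ≤ Submodule.span F (Set.range fun a => vecMulVec (v a) (v a)))
    {y : Fin n → F} (hy : ver k y ∈ U) (hy0 : ver k y ≠ 0) :
    ∃ a, ∃ c : F, c ≠ 0 ∧ ver k y = c • v a := by
  refine eq_smul_of_vecMulVec_mem_span hv (hU ▸ hy) hy0 (hl ?_)
  rw [mem_liftedIntersection_iff hq]
  refine ⟨fun j => ?_, Submodule.subset_span ⟨y, rfl⟩⟩
  have : (fun i => vecMulVec (ver k y) (ver k y) i j) = ver k y j • ver k y := by
    ext i; simp [vecMulVec_apply, mul_comm]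
  rw [this]; exact U.smul_mem _ hy

/-- Each column of the square of v is a multiple of v, and one of these multiples is nonzero. -/
theorem mem_of_vecMulVec_mem_liftedIntersection {ι : Type*} [Fintype ι] {p : ℕ}
    {U : Submodule F (ι → F)} {q : Fin p → Matrix ι ι F} {v : ι → F} (hv : v ≠ 0)
    (h : vecMulVec v v ∈ liftedIntersection U q) : v ∈ U := by
  obtain ⟨j, hj⟩ := Function.ne_iff.1 hv
  have h1 := h.2.1 j
  have : (fun i => vecMulVec v v i j) = v j • v := by
    ext i; simp [vecMulVec_apply, mul_comm]
  rw [this] at h1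
  exact (Submodule.smul_mem_iff _ hj).1 h1

/-- A decomposition that is read off from a successful run is the unique one of minimal length. -/
theorem SimDiagonalizedBy.isUniqueWaringRankDecomposition {n m p s : ℕ} (hm : 1 ≤ m)
    {T : Tensor F n m} {α : Fin s → F} {x : Fin s → Fin n → F}
    (hT : ∑ a, α a • tensorPow (x a) m = T)
    {q : Fin p → Matrix (MonoIdx n ((m + 1) / 2)) (MonoIdx n ((m + 1) / 2)) F}
    (hq : Submodule.span F (Set.range q) = quadricsOn (veroneseCone F n ((m + 1) / 2)))
    {P : Fin s → Matrix (MonoIdx n ((m + 1) / 2)) (MonoIdx n ((m + 1) / 2)) F}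
    (hP : LinearIndependent F P)
    (hPspan : Submodule.span F (Set.range P) = liftedIntersection (image T) q)
    {f g : Fin s → F} (h : SimDiagonalizedBy P f g fun a => ver ((m + 1) / 2) (x a)) :
    IsUniqueWaringRankDecomposition T fun a => α a • tensorPow (x a) m := by
  have hspan := h.span_eq hP
  rw [hPspan] at hspan
  obtain ⟨z, -, -, hv, -⟩ := h
  have hU : ∀ a, ver ((m + 1) / 2) (x a) ∈ image T := fun a =>
    mem_of_vecMulVec_mem_liftedIntersection (hv.ne_zero a) (hspan.ge (Submodule.subset_span ⟨a, rfl⟩))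
  have hUeq : image T = Submodule.span F (Set.range fun a => ver ((m + 1) / 2) (x a)) := by
    refine le_antisymm (hT ▸ image_sum_le α x) ?_
    rw [Submodule.span_le]; rintro _ ⟨a, rfl⟩; exact hU a
  refine isUniqueWaringRankDecomposition_of_isolated hm hT hv hU fun y hy hy0 => ?_
  obtain ⟨a, c, -, hc⟩ := isolated_of_liftedIntersection hq hv hUeq hspan.le hy hy0
  exact ⟨a, c, hc⟩

/-- Two simultaneous diagonalizations list the same vectors. -/
theorem exists_equiv_of_span_vecMulVec_eq {ι : Type*} [Fintype ι] {s R : ℕ} {v : Fin s → ι → F}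
    {y : Fin R → ι → F} (hv : LinearIndependent F v) (hy : LinearIndependent F y)
    (hvy : ∀ a, v a ∈ Submodule.span F (Set.range y))
    (h : Submodule.span F (Set.range fun a => vecMulVec (v a) (v a)) =
      Submodule.span F (Set.range fun a => vecMulVec (y a) (y a))) :
    ∃ e : Fin s ≃ Fin R, ∀ a, ∃ c : F, c ≠ 0 ∧ v a = c • y (e a) := by
  have hsR : s = R := by
    have := congrArg (fun W : Submodule F (Matrix ι ι F) => Module.finrank F W) h
    simpa [finrank_span_eq_card (linearIndependent_vecMulVec hv),
      finrank_span_eq_card (linearIndependent_vecMulVec hy)] using this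
  subst hsR
  have := fun a => eq_smul_of_vecMulVec_mem_span hy (hvy a) (hv.ne_zero a)
    (h.le (Submodule.subset_span ⟨a, rfl⟩))
  choose σ c hc hσ using this
  have hinj : Function.Injective σ := by
    intro a a' haa
    by_contra hne
    have := hv.notMem_span_image (s := {a'}) (x := a) (by simpa using hne)
    rw [Set.image_singleton] at this
    apply this
    refine Submodule.mem_span_singleton.2 ⟨c a / c a', ?_⟩
    rw [hσ a, hσ a', haa, smul_smul, div_mul_cancel₀ _ (hc a')]
  exact ⟨Equiv.ofBijective σ (Finite.injective_iff_bijective.1 hinj), fun a => ⟨c a, hc a, hσ a⟩⟩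

end Uniqueness

end Waring

namespace Waring

/-! ### Independence as a polynomial open condition -/

section PolyFun

variable {F : Type*} [RCLike F] {σ : Type*}

/-- Functions given by a polynomial. -/
def IsPolyFun (f : (σ → F) → F) : Prop :=
  ∃ p : MvPolynomial σ F, ∀ x, MvPolynomial.eval x p = f x

theorem IsPolyFun.const (c : F) : IsPolyFun fun _ : σ → F => c :=
  ⟨MvPolynomial.C c, fun _ => by simp⟩

theorem IsPolyFun.proj (i : σ) : IsPolyFun fun x : σ → F => x i :=
  ⟨MvPolynomial.X i, fun _ => by simp⟩

theorem IsPolyFun.add {f g : (σ → F) → F} (hf : IsPolyFun f) (hg : IsPolyFun g) :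
    IsPolyFun fun x => f x + g x := by
  obtain ⟨p, hp⟩ := hf; obtain ⟨q, hq⟩ := hg
  exact ⟨p + q, fun x => by simp [hp, hq]⟩

theorem IsPolyFun.mul {f g : (σ → F) → F} (hf : IsPolyFun f) (hg : IsPolyFun g) :
    IsPolyFun fun x => f x * g x := by
  obtain ⟨p, hp⟩ := hf; obtain ⟨q, hq⟩ := hg
  exact ⟨p * q, fun x => by simp [hp, hq]⟩

theorem IsPolyFun.sum {τ : Type*} (s : Finset τ) {f : τ → (σ → F) → F}
    (hf : ∀ t ∈ s, IsPolyFun (f t)) : IsPolyFun fun x => ∑ t ∈ s, f t x := by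
  choose! p hp using hf
  exact ⟨∑ t ∈ s, p t, fun x => by rw [map_sum]; exact Finset.sum_congr rfl fun t ht => hp t ht x⟩

theorem IsPolyFun.prod {τ : Type*} (s : Finset τ) {f : τ → (σ → F) → F}
    (hf : ∀ t ∈ s, IsPolyFun (f t)) : IsPolyFun fun x => ∏ t ∈ s, f t x := by
  choose! p hp using hf
  exact ⟨∏ t ∈ s, p t, fun x => by rw [map_prod]; exact Finset.prod_congr rfl fun t ht => hp t ht x⟩

theorem IsPolyFun.linear_pi {ι : Type*} [Fintype ι] (l : (ι → F) →ₗ[F] F)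
    {f : (σ → F) → ι → F} (hf : ∀ i, IsPolyFun fun x => f x i) : IsPolyFun fun x => l (f x) := by
  classical
  have key : (fun x => l (f x)) =
      fun x => ∑ i, f x i * l fun j => if i = j then 1 else 0 :=
    funext fun x => LinearMap.pi_apply_eq_sum_univ l (f x)
  rw [key]
  exact IsPolyFun.sum _ fun i _ => (hf i).mul (IsPolyFun.const _)

theorem IsPolyFun.linear_matrix {ι κ : Type*} [Fintype ι] [Fintype κ] (l : Matrix ι κ F →ₗ[F] F)
    {f : (σ → F) → Matrix ι κ F} (hf : ∀ i j, IsPolyFun fun x => f x i j) :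
    IsPolyFun fun x => l (f x) := by
  classical
  have key : ∀ w : Matrix ι κ F, l w = ∑ i, ∑ j, w i j * l (Matrix.single i j 1) := by
    intro w
    conv_lhs => rw [Matrix.matrix_eq_sum_single w]
    rw [map_sum]
    refine Finset.sum_congr rfl fun i _ => ?_
    rw [map_sum]
    refine Finset.sum_congr rfl fun j _ => ?_
    have : Matrix.single i j (w i j) = w i j • Matrix.single i j (1 : F) := by simp
    rw [this, map_smul, smul_eq_mul]
  rw [show (fun x => l (f x)) = _ from funext fun x => key (f x)]
  exact IsPolyFun.sum _ fun i _ => IsPolyFun.sum _ fun j _ => (hf i j).mul (IsPolyFun.const _)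

/-- Linear independence of a family that depends polynomially on parameters is an open
condition. -/
theorem exists_poly_linearIndependent {τ V : Type*} [Fintype τ] [AddCommGroup V] [Module F V]
    {w : (σ → F) → τ → V} (hw : ∀ (l : V →ₗ[F] F) (t : τ), IsPolyFun fun x => l (w x t))
    {x₀ : σ → F} (h : LinearIndependent F (w x₀)) :
    ∃ q : MvPolynomial σ F, MvPolynomial.eval x₀ q ≠ 0 ∧
      ∀ x, MvPolynomial.eval x q ≠ 0 → LinearIndependent F (w x) := by
  classical
  -- A left inverse supplies functionals dual to the family at x₀. The polynomial is the determinant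
  -- of these fixed functionals evaluated on the family; it is 1 at x₀.
  obtain ⟨L, hL⟩ := (Finsupp.linearCombination F (w x₀)).exists_leftInverse_of_injective
    (LinearMap.ker_eq_bot.2 h)
  let l : τ → V →ₗ[F] F := fun t => (Finsupp.lapply t).comp L
  have hl : ∀ t t', l t (w x₀ t') = if t = t' then 1 else 0 := by
    intro t t'
    have := LinearMap.congr_fun hL (Finsupp.single t' 1)
    simp only [LinearMap.comp_apply, Finsupp.linearCombination_single, one_smul,
      LinearMap.id_apply] at this
    simp only [l, LinearMap.comp_apply, Finsupp.lapply_apply, this, Finsupp.single_apply, eq_comm]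
  choose p hp using fun t t' => hw (l t) t'
  have heval : ∀ x, MvPolynomial.eval x (Matrix.det (Matrix.of p)) =
      (Matrix.of fun t t' => l t (w x t')).det := by
    intro x
    rw [RingHom.map_det]
    congr 1
    ext t t'
    simp [hp]
  refine ⟨Matrix.det (Matrix.of p), ?_, fun x hx => ?_⟩
  · rw [heval]
    have : (Matrix.of fun t t' => l t (w x₀ t')) = (1 : Matrix τ τ F) := by
      ext t t'; simp [hl, Matrix.one_apply]
    rw [this]; simp
  · rw [heval] at hx
    rw [Fintype.linearIndependent_iff]
    intro c hc
    have : (Matrix.of fun t t' => l t (w x t')).mulVec c = 0 := by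
      ext t
      have := congrArg (l t) hc
      simpa [Matrix.mulVec, dotProduct, mul_comm] using this
    exact fun t => congrFun (Matrix.eq_zero_of_mulVec_eq_zero hx this) t

theorem exists_eval_ne_zero {p : MvPolynomial σ F} (hp : p ≠ 0) :
    ∃ x, MvPolynomial.eval x p ≠ 0 := by
  by_contra h; push Not at h
  exact hp (MvPolynomial.funext fun x => by simp [h])

theorem ne_zero_of_eval_ne_zero {p : MvPolynomial σ F} {x : σ → F}
    (h : MvPolynomial.eval x p ≠ 0) : p ≠ 0 := by
  rintro rfl; simp at h

end PolyFun

/-! ### Mixed products modulo S^{2k}: the matroid argument -/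

section PairProducts

open Matrix

variable {F : Type*} [RCLike F]

/-- The symmetric product of two vectors. -/
def symProd {ι : Type*} (u v : ι → F) : Matrix ι ι F := vecMulVec u v + vecMulVec v u

theorem symProd_comm {ι : Type*} (u v : ι → F) : symProd u v = symProd v u := add_comm _ _

/-- The symmetric products of a family of vectors, indexed by unordered pairs. -/
def symProds {ι : Type*} {r : ℕ} (v : Fin r → ι → F) : Sym2 (Fin r) → Matrix ι ι F :=
  Sym2.lift ⟨fun a b => symProd (v a) (v b), fun _ _ => symProd_comm _ _⟩

@[simp] theorem symProds_mk {ι : Type*} {r : ℕ} (v : Fin r → ι → F) (a b : Fin r) :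
    symProds v s(a, b) = symProd (v a) (v b) := rfl

/-- Evaluate on products of dual functionals. For an unordered pair the value at the pair itself is
1, or 2 when its members coincide, so characteristic zero matters; at other pairs it is 0. -/
theorem linearIndependent_symProds {ι : Type*} [Fintype ι] {r : ℕ} {v : Fin r → ι → F}
    (hv : LinearIndependent F v) : LinearIndependent F (symProds v) := by
  classical
  obtain ⟨Y', h1, -⟩ := exists_pinv_colMatrix hv
  have hY' : ∀ a b, ∑ i, Y' a i * v b i = if a = b then 1 else 0 := by
    intro a b
    have := congrFun (congrFun h1 a) b
    simpa [Matrix.mul_apply, Matrix.one_apply] using this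
  have hφ : ∀ a b c d, ∑ i, ∑ j, Y' a i * Y' b j * symProd (v c) (v d) i j =
      (if a = c then 1 else 0) * (if b = d then 1 else 0) +
        (if a = d then 1 else 0) * (if b = c then 1 else 0) := by
    intro a b c d
    simp only [← hY', Finset.sum_mul_sum, ← Finset.sum_add_distrib]
    refine Finset.sum_congr rfl fun i _ => Finset.sum_congr rfl fun j _ => ?_
    simp only [symProd, Matrix.add_apply, vecMulVec_apply]; ring
  rw [Fintype.linearIndependent_iff]
  intro c hc s
  induction s using Sym2.ind with
  | _ a b =>
  have h : ∑ s, c s * ∑ i, ∑ j, Y' a i * Y' b j * symProds v s i j = 0 := by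
    have : ∑ i, ∑ j, Y' a i * Y' b j * (∑ s, c s • symProds v s) i j = 0 := by simp [hc]
    rw [← this]
    simp only [Matrix.sum_apply, Matrix.smul_apply, smul_eq_mul, Finset.mul_sum]
    rw [Finset.sum_comm]
    refine Finset.sum_congr rfl fun i _ => ?_
    rw [Finset.sum_comm]
    exact Finset.sum_congr rfl fun i _ => Finset.sum_congr rfl fun j _ => by ring
  rw [Finset.sum_eq_single s(a, b)] at h
  · rw [symProds_mk, hφ] at h
    rcases mul_eq_zero.1 h with h | h
    · exact h
    · exfalso
      simp only [if_true, mul_one] at h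
      split_ifs at h <;> norm_num at h
  · intro s _ hs
    induction s using Sym2.ind with
    | _ p q =>
    rw [symProds_mk, hφ]
    have h1 : ¬ (a = p ∧ b = q) := by rintro ⟨rfl, rfl⟩; exact hs rfl
    have h2 : ¬ (a = q ∧ b = p) := by rintro ⟨rfl, rfl⟩; exact hs Sym2.eq_swap
    rcases not_and_or.1 h1 with h1 | h1 <;> rcases not_and_or.1 h2 with h2 | h2 <;> simp [h1, h2]
  · simp

variable {n k : ℕ}

/-- The symmetric products of the `x_a^{⊗ k}`, as functionals on the quadrics. -/
def pairClass {r : ℕ} (v : Fin r → MonoIdx n k → F) (s : Sym2 (Fin r)) :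
    Matrix (MonoIdx n k) (MonoIdx n k) F ⧸ verSquares F n k :=
  (verSquares F n k).mkQ (symProds v s)

theorem isPolyFun_pairClass {σ : Type*} {r : ℕ} {v : (σ → F) → Fin r → MonoIdx n k → F}
    (hv : ∀ a i, IsPolyFun fun x => v x a i)
    (l : (Matrix (MonoIdx n k) (MonoIdx n k) F ⧸ verSquares F n k) →ₗ[F] F) (s : Sym2 (Fin r)) :
    IsPolyFun fun x => l (pairClass (v x) s) := by
  induction s using Sym2.ind with
  | _ a b =>
  refine IsPolyFun.linear_matrix (l.comp (verSquares F n k).mkQ)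
    (f := fun x => symProd (v x a) (v x b)) fun i j => ?_
  simp only [symProd, Matrix.add_apply, vecMulVec_apply]
  exact ((hv a i).mul (hv b j)).add ((hv b i).mul (hv a j))

theorem isPolyFun_ver {r : ℕ} (a : Fin r) (i : MonoIdx n k) :
    IsPolyFun fun x : Fin r × Fin n → F => ver k (fun j => x (a, j)) i := by
  change IsPolyFun fun x : Fin r × Fin n → F => ∏ j, x (a, i.1 j)
  exact IsPolyFun.prod _ fun j _ => IsPolyFun.proj (a, i.1 j)

theorem pairClass_comp {r r' : ℕ} (v : Fin r → MonoIdx n k → F) (f : Fin r' → Fin r) :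
    pairClass (v ∘ f) = pairClass v ∘ Sym2.map f := by
  ext s
  induction s using Sym2.ind with
  | _ a b => rfl

/-- Points at which every set of pair classes that is independent somewhere is independent. -/
theorem exists_universal_point {n k N : ℕ} (hN : Fintype.card (MonoIdx n k) = N) :
    ∃ x : Fin N → Fin n → F,
    LinearIndependent F (fun a => ver k (x a)) ∧
    ∀ (S : Finset (Sym2 (Fin N)))
      (y : Fin N → Fin n → F),
      LinearIndepOn F (pairClass fun a => ver k (y a)) (S : Set (Sym2 (Fin _))) →
      LinearIndepOn F (pairClass fun a => ver k (x a)) (S : Set (Sym2 (Fin _))) := by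
  classical
  obtain ⟨f, hf, -, hfi⟩ := Submodule.exists_fun_fin_finrank_span_eq F
    (Set.range fun x : Fin n → F => ver k x)
  have hr : Module.finrank F (Submodule.span F (Set.range fun x : Fin n → F => ver k x)) = N := by
    rw [span_symCoords_tensorPow]; simp [hN]
  choose x₁ hx₁ using hf
  have hx₁' : LinearIndependent F fun a : Fin N => ver k (x₁ (a.cast hr.symm)) := by
    have := hfi.comp _ (Fin.cast_injective hr.symm)
    have he : (fun a : Fin N => ver k (x₁ (a.cast hr.symm))) = f ∘ Fin.cast hr.symm :=
      funext fun a => hx₁ _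
    rw [he]; exact this
  obtain ⟨q₀, hq₀, hq₀'⟩ := exists_poly_linearIndependent
    (w := fun (x : Fin N × Fin n → F) (a : Fin N) => ver k fun j => x (a, j))
    (fun l a => IsPolyFun.linear_pi l fun i => isPolyFun_ver a i)
    (x₀ := fun y => x₁ (y.1.cast hr.symm) y.2) hx₁'
  -- There are finitely many sets S. Those that are independent for some choice of points contribute
  -- a nonzero polynomial and the others the constant 1; a point outside the zero set of the product
  -- serves for all of them at once.
  have hS : ∀ S : Finset (Sym2 (Fin N)), ∃ q : MvPolynomial (Fin N × Fin n) F, q ≠ 0 ∧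
      ∀ y : Fin N → Fin n → F,
        LinearIndepOn F (pairClass fun a => ver k (y a)) (S : Set (Sym2 (Fin N))) →
        ∀ x : Fin N × Fin n → F, MvPolynomial.eval x q ≠ 0 →
          LinearIndepOn F (pairClass fun a => ver k fun j => x (a, j)) (S : Set (Sym2 (Fin N))) := by
    intro S
    by_cases h : ∃ y : Fin N → Fin n → F,
        LinearIndepOn F (pairClass fun a => ver k (y a)) (S : Set (Sym2 (Fin N)))
    · obtain ⟨y, hy⟩ := h
      obtain ⟨q, hq, hq'⟩ := exists_poly_linearIndependent
        (w := fun (x : Fin N × Fin n → F) (s : (S : Set (Sym2 (Fin N)))) =>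
          pairClass (fun a => ver k fun j => x (a, j)) s.1)
        (fun l s => isPolyFun_pairClass (fun a i => isPolyFun_ver a i) l s.1)
        (x₀ := fun z => y z.1 z.2) hy
      exact ⟨q, ne_zero_of_eval_ne_zero hq, fun _ _ => hq'⟩
    · exact ⟨1, one_ne_zero, fun y hy => absurd ⟨y, hy⟩ h⟩
  choose q hq hq' using hS
  obtain ⟨x, hx⟩ := exists_eval_ne_zero (p := q₀ * ∏ S, q S)
    (mul_ne_zero (ne_zero_of_eval_ne_zero hq₀) (Finset.prod_ne_zero_iff.2 fun S _ => hq S))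
  rw [map_mul, map_prod] at hx
  exact ⟨fun a j => x (a, j), hq₀' x (left_ne_zero_of_mul hx), fun S y hy =>
    hq' S y hy x (Finset.prod_ne_zero_iff.1 (right_ne_zero_of_mul hx) S (Finset.mem_univ S))⟩

/-- The symmetric products of independent vectors span a space of dimension r(r+1)/2, and passing to
the quotient loses at most dim S^{2k}. -/
theorem le_finrank_span_pairClass {r : ℕ} {v : Fin r → MonoIdx n k → F}
    (hv : LinearIndependent F v) :
    (r + 1).choose 2 ≤ Module.finrank F (Submodule.span F (Set.range (pairClass v))) +
      Fintype.card (MonoIdx n (k + k)) := by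
  classical
  have h1 : Module.finrank F (Submodule.span F (Set.range (symProds v))) = (r + 1).choose 2 := by
    rw [finrank_span_eq_card (linearIndependent_symProds hv), Sym2.card, Fintype.card_fin]
  set W := Submodule.span F (Set.range (symProds v)) with hW
  have h2 : Submodule.span F (Set.range (pairClass v)) = W.map (verSquares F n k).mkQ := by
    rw [hW, Submodule.map_span, ← Set.range_comp]; rfl
  have h3 := LinearMap.finrank_range_add_finrank_ker ((verSquares F n k).mkQ.domRestrict W)
  rw [LinearMap.range_domRestrict, ← h2, h1] at h3
  rw [← h3]
  refine Nat.add_le_add_left ?_ _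
  refine le_trans ?_ (finrank_verSquares_le (F := F) n k)
  let φ : LinearMap.ker ((verSquares F n k).mkQ.domRestrict W) →ₗ[F] verSquares F n k :=
    LinearMap.codRestrict _ (W.subtype.comp (Submodule.subtype _)) fun c => by
      have := c.2
      rw [LinearMap.mem_ker, LinearMap.domRestrict_apply, Submodule.mkQ_apply,
        Submodule.Quotient.mk_eq_zero] at this
      exact this
  refine LinearMap.finrank_le_finrank_of_injective (f := φ) ?_
  intro c d hcd
  have := congrArg Subtype.val hcd
  exact Subtype.ext (Subtype.ext this)

theorem pairClass_diag {r : ℕ} {x : Fin r → Fin n → F} (a : Fin r) :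
    pairClass (fun a => ver k (x a)) s(a, a) = 0 := by
  rw [pairClass, symProds_mk, Submodule.mkQ_apply, Submodule.Quotient.mk_eq_zero, symProd]
  exact Submodule.add_mem _ (Submodule.subset_span ⟨x a, rfl⟩) (Submodule.subset_span ⟨x a, rfl⟩)

/-- A composite of two transpositions: the first brings c to a, the second brings the image of d to
b. Only points outside Z are exchanged. -/
theorem exists_perm_move {α : Type*} [DecidableEq α] {c d a b : α} (hcd : c ≠ d) (hab : a ≠ b)
    {Z : Set α} (hc : c ∉ Z) (hd : d ∉ Z) (ha : a ∉ Z) (hb : b ∉ Z) :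
    ∃ σ : Equiv.Perm α, σ c = a ∧ σ d = b ∧ ∀ z ∈ Z, σ z = z := by
  have hd' : Equiv.swap c a d ∉ Z := by
    rcases eq_or_ne d a with rfl | h
    · rwa [Equiv.swap_apply_right]
    · rwa [Equiv.swap_apply_of_ne_of_ne hcd.symm h]
  have hne : a ≠ Equiv.swap c a d := by
    intro h
    have := congrArg (Equiv.swap c a) h
    rw [Equiv.swap_apply_right, Equiv.swap_apply_self] at this
    exact hcd this
  refine ⟨Equiv.swap (Equiv.swap c a d) b * Equiv.swap c a, ?_, ?_, fun z hz => ?_⟩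
  · rw [Equiv.Perm.mul_apply, Equiv.swap_apply_left, Equiv.swap_apply_of_ne_of_ne hne hab]
  · rw [Equiv.Perm.mul_apply, Equiv.swap_apply_left]
  · have h : ∀ y, y ∉ Z → z ≠ y := fun y hy h => hy (h ▸ hz)
    rw [Equiv.Perm.mul_apply, Equiv.swap_apply_of_ne_of_ne (h c hc) (h a ha),
      Equiv.swap_apply_of_ne_of_ne (h _ hd') (h b hb)]

/-- If every element could be added to every independent subset without losing independence,
induction would make the whole of K independent. -/
theorem exists_circuit {ι V : Type*} [DecidableEq ι] [AddCommGroup V] [Module F V] (v : ι → V)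
    {K : Finset ι} (hK : ¬ LinearIndepOn F v (K : Set ι)) :
    ∃ (S : Finset ι) (e : ι), S ⊆ K ∧ e ∈ K ∧ e ∉ S ∧ LinearIndepOn F v (S : Set ι) ∧
      ¬ LinearIndepOn F v (insert e (S : Set ι)) := by
  by_contra hcon
  push Not at hcon
  apply hK
  have : ∀ S : Finset ι, S ⊆ K → LinearIndepOn F v (S : Set ι) := by
    intro S
    induction S using Finset.induction with
    | empty => intro _; simp
    | insert e S he ih =>
      intro h
      rw [Finset.insert_subset_iff] at h
      rw [Finset.coe_insert]
      exact hcon S e h.2 h.1 he (ih h.2)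
  exact this K subset_rfl

theorem finrank_span_range_le_of_forall_mem {ι V : Type*} [AddCommGroup V] [Module F V]
    [FiniteDimensional F V] {E : ι → V} {t : Finset ι}
    (h : ∀ s, E s ∈ Submodule.span F (E '' (t : Set ι))) :
    Module.finrank F (Submodule.span F (Set.range E)) ≤ t.card := by
  classical
  have hle : Submodule.span F (Set.range E) ≤
      Submodule.span F ((t.image E : Finset V) : Set V) := by
    rw [Submodule.span_le, Finset.coe_image]; rintro _ ⟨s, rfl⟩; exact h s
  exact (Submodule.finrank_mono hle).trans
    ((finrank_span_finset_le_card _).trans Finset.card_image_le)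

/-- Suppose the edges inside A are dependent, and take an independent set S of them and an edge cd
with S ∪ {cd} dependent. With Z = A \ {c, d}, every edge of S meets Z. Permutations that fix Z move
cd to any edge ab outside Z, so all classes lie in the span of the edges meeting Z. That bounds the
dimension by |Z| N = (|A| - 2)N, less than the |A| N forced by the hypothesis and
`le_finrank_span_pairClass`. -/
theorem linearIndepOn_pairClass_of_bound {N : ℕ} {x : Fin N → Fin n → F}
    (hx : LinearIndependent F fun a => ver k (x a))
    (hgen : ∀ (S : Finset (Sym2 (Fin N)))
      (y : Fin N → Fin n → F),
      LinearIndepOn F (pairClass fun a => ver k (y a)) (S : Set (Sym2 (Fin _))) →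
      LinearIndepOn F (pairClass fun a => ver k (x a)) (S : Set (Sym2 (Fin _))))
    (A : Finset (Fin N))
    (hA : A.card * N + Fintype.card (MonoIdx n (k + k)) ≤
      (N + 1).choose 2) :
    LinearIndepOn F (pairClass fun a => ver k (x a)) {s | ¬ s.IsDiag ∧ ∀ a ∈ s, a ∈ A} := by
  classical
  set E := pairClass fun a => ver k (x a) with hE
  by_contra hcon
  have hK : {s : Sym2 (Fin N) | ¬ s.IsDiag ∧ ∀ a ∈ s, a ∈ A} =
      ((Finset.univ.filter fun s : Sym2 (Fin N) => ¬ s.IsDiag ∧ ∀ a ∈ s, a ∈ A : Finset _) :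
        Set (Sym2 (Fin N))) := by ext; simp
  rw [hK] at hcon
  obtain ⟨S, e, hSK, heK, heS, hS, hSe⟩ := exists_circuit E hcon
  induction e using Sym2.ind with
  | _ c d =>
  simp only [Finset.mem_filter, Finset.mem_univ, true_and, Sym2.mk_isDiag_iff, Sym2.mem_iff,
    forall_eq_or_imp, forall_eq] at heK
  obtain ⟨hcd, hcA, hdA⟩ := heK
  set Z := (A.erase c).erase d with hZ
  have hZcard : Z.card + 2 = A.card := by
    have h1 := Finset.card_erase_add_one hcA
    have h2 := Finset.card_erase_add_one (s := A.erase c) (a := d)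
      (Finset.mem_erase.2 ⟨Ne.symm hcd, hdA⟩)
    rw [← hZ] at h2
    omega
  -- the pairs that meet `Z`
  let touch : Finset (Sym2 (Fin N)) := (Z ×ˢ Finset.univ).image fun p => s(p.1, p.2)
  have htouch : ∀ s : Sym2 (Fin N), (∃ z ∈ Z, z ∈ s) → s ∈ touch := by
    rintro s ⟨z, hz, hzs⟩
    obtain ⟨w, rfl⟩ := hzs
    exact Finset.mem_image.2 ⟨(z, w), by simp [hz], rfl⟩
  have hspan : ∀ s, E s ∈ Submodule.span F (E '' (touch : Set (Sym2 (Fin N)))) := by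
    intro s
    by_cases hs : ∃ z ∈ Z, z ∈ s
    · exact Submodule.subset_span ⟨s, htouch s hs, rfl⟩
    induction s using Sym2.ind with
    | _ a b =>
    push Not at hs
    have haZ : a ∉ (Z : Set (Fin N)) := fun h => hs a h (Sym2.mem_mk_left a b)
    have hbZ : b ∉ (Z : Set (Fin N)) := fun h => hs b h (Sym2.mem_mk_right a b)
    by_cases hab : a = b
    · subst hab; rw [hE, pairClass_diag]; exact Submodule.zero_mem _
    obtain ⟨σ, hσc, hσd, hσZ⟩ := exists_perm_move hcd hab (Z := (Z : Set (Fin N)))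
      (by simp [hZ]) (by simp [hZ]) haZ hbZ
    have hinj : Function.Injective (Sym2.map σ) := Sym2.map.injective σ.injective
    -- transport along a permutation
    have htrans : ∀ (τ : Equiv.Perm (Fin N)) (S : Finset (Sym2 (Fin N))),
        LinearIndepOn F E (S : Set (Sym2 (Fin N))) →
        LinearIndepOn F E (Sym2.map τ '' (S : Set (Sym2 (Fin N)))) := by
      intro τ S hS
      rw [← Finset.coe_image]
      -- Relabelling the points turns the moved set at x ∘ τ⁻¹ into the original set at x.
      -- Universality of x then carries its independence back to x.
      apply hgen _ (x ∘ τ.symm)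
      rw [Finset.coe_image]
      apply LinearIndepOn.image_of_comp
      have : pairClass (fun a => ver k ((x ∘ τ.symm) a)) ∘ Sym2.map τ = E := by
        rw [← pairClass_comp]
        congr 1
        ext a : 1
        simp
      rwa [this]
    have h1 : LinearIndepOn F E (Sym2.map σ '' (S : Set (Sym2 (Fin N)))) := htrans σ S hS
    have h2 : ¬ LinearIndepOn F E (insert s(a, b) (Sym2.map σ '' (S : Set (Sym2 (Fin N))))) := by
      intro h
      apply hSe
      have h3 : insert s(a, b) (Sym2.map σ '' (S : Set (Sym2 (Fin N)))) =
          ((insert s(c, d) S).image (Sym2.map σ) : Finset (Sym2 (Fin N))) := by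
        rw [Finset.coe_image, Finset.coe_insert, Set.image_insert_eq, Sym2.map_mk]
        simp [hσc, hσd]
      rw [h3] at h
      have h4 := htrans σ.symm _ h
      rw [Finset.coe_image, Set.image_image] at h4
      have h5 : ∀ s, Sym2.map σ.symm (Sym2.map σ s) = s := by
        intro s; rw [Sym2.map_map]; simp
      simpa [h5] using h4
    have h3 : E s(a, b) ∈ Submodule.span F (E '' (Sym2.map σ '' (S : Set (Sym2 (Fin N))))) := by
      by_contra hn
      exact h2 ((h1.notMem_span_iff).1 hn).1
    refine Submodule.span_mono (Set.image_mono ?_) h3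
    rintro _ ⟨t, ht, rfl⟩
    have htK := hSK ht
    apply htouch
    induction t using Sym2.ind with
    | _ p q =>
    simp only [Finset.mem_filter, Finset.mem_univ, true_and, Sym2.mk_isDiag_iff, Sym2.mem_iff,
      forall_eq_or_imp, forall_eq] at htK
    obtain ⟨hpq, hpA, hqA⟩ := htK
    have hmem : ∀ y ∈ A, y ≠ c → y ≠ d → y ∈ Z := fun y hy h1 h2 => by simp [hZ, hy, h1, h2]
    -- The only non-diagonal pair inside A that avoids Z is {c, d}, and it does not belong to S.
    have hor : p ∈ Z ∨ q ∈ Z := by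
      by_contra hh
      push Not at hh
      have hp : p = c ∨ p = d := by by_contra h; push Not at h; exact hh.1 (hmem p hpA h.1 h.2)
      have hq : q = c ∨ q = d := by by_contra h; push Not at h; exact hh.2 (hmem q hqA h.1 h.2)
      have : s(p, q) = s(c, d) := by
        rcases hp with rfl | rfl <;> rcases hq with rfl | rfl
        · exact absurd rfl hpq
        · rfl
        · exact Sym2.eq_swap
        · exact absurd rfl hpq
      exact heS (this ▸ ht)
    rcases hor with h | h
    · exact ⟨p, h, by rw [Sym2.map_mk]; simp [hσZ p h]⟩
    · exact ⟨q, h, by rw [Sym2.map_mk]; simp [hσZ q h]⟩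
  have h1 : Module.finrank F (Submodule.span F (Set.range E)) ≤ Z.card * N := by
    refine (finrank_span_range_le_of_forall_mem hspan).trans (Finset.card_image_le.trans ?_)
    simp
  have h2 : (N + 1).choose 2 ≤ Module.finrank F (Submodule.span F (Set.range E)) +
      Fintype.card (MonoIdx n (k + k)) := le_finrank_span_pairClass hx
  have hNpos : 0 < N := Fin.pos c
  -- Since |A| = |Z| + 2 and N > 0, this comparison is absurd.
  have h3 : A.card * N + Fintype.card (MonoIdx n (k + k)) ≤
      Z.card * N + Fintype.card (MonoIdx n (k + k)) := hA.trans (h2.trans (by omega))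
  rw [← hZcard] at h3
  nlinarith

end PairProducts

end Waring

namespace Waring

/-! ### Arithmetic of the rank bound -/

section RankBound

theorem rankBound_four {n : ℕ} (hn : 1 ≤ n) : rankBound n 4 = (n : ℝ) * (n - 1) / 6 := by
  have h2 : ((n + 1).choose 2 : ℝ) = (n + 1) * n / 2 := by
    rw [Nat.cast_choose_two]; push_cast; ring
  have h4 : ((n + 3).choose 4 : ℝ) = (n + 3) * (n + 2) * (n + 1) * n / 24 := by
    have h := Nat.descFactorial_eq_factorial_mul_choose (n + 3) 4
    have h' : (n + 3).descFactorial 4 = n * ((n + 1) * ((n + 2) * (n + 3))) := by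
      simp [Nat.descFactorial_succ]
    rw [h'] at h
    have h'' := congrArg (Nat.cast : ℕ → ℝ) h
    push_cast [Nat.factorial] at h''
    linarith
  have hn' : (1 : ℝ) ≤ n := by exact_mod_cast hn
  have hpos : (0 : ℝ) < (n + 1) * n := by positivity
  have e : ((n + 1 : ℝ) * n / 2 + 1) / 2 - ((n + 3) * (n + 2) * (n + 1) * n / 24) /
      ((n + 1) * n / 2) = (n : ℝ) * (n - 1) / 6 := by
    field_simp; ring
  simp only [rankBound, show (4 + 1) / 2 = 2 from rfl,
    show 2 * 2 = 4 from rfl, show n + 2 - 1 = n + 1 from rfl, show n + 4 - 1 = n + 3 from rfl]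
  rw [h2, h4, e, min_eq_right]
  nlinarith

variable {n m R : ℕ}

theorem card_monoIdx_pos (hn : 1 ≤ n) (k : ℕ) : 0 < Fintype.card (MonoIdx n k) := by
  rw [card_monoIdx]; exact Nat.choose_pos (by omega)

theorem le_card_of_le_rankBound (hR : (R : ℝ) ≤ rankBound n m) :
    R ≤ Fintype.card (MonoIdx n (m / 2)) := by
  rw [card_monoIdx]
  exact_mod_cast hR.trans (min_le_left _ _)

/-- Multiplying the second term of the bound by N = dim S^k clears denominators: RN + dim S^{2k} ≤
N(N+1)/2. -/
theorem mul_card_add_card_le_of_le_rankBound (hn : 1 ≤ n) (hR : (R : ℝ) ≤ rankBound n m) :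
    R * Fintype.card (MonoIdx n ((m + 1) / 2)) +
      Fintype.card (MonoIdx n ((m + 1) / 2 + (m + 1) / 2)) ≤
      (Fintype.card (MonoIdx n ((m + 1) / 2)) + 1).choose 2 := by
  have hN := card_monoIdx_pos hn ((m + 1) / 2)
  rw [card_monoIdx] at hN
  rw [card_monoIdx, card_monoIdx, ← two_mul]
  have h := hR.trans (min_le_right _ _)
  set N := (n + (m + 1) / 2 - 1).choose ((m + 1) / 2)
  set D := (n + 2 * ((m + 1) / 2) - 1).choose (2 * ((m + 1) / 2))
  have hN' : (0 : ℝ) < N := by exact_mod_cast hN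
  have : (R * N + D : ℝ) ≤ (N + 1).choose 2 := by
    rw [Nat.cast_choose_two]
    push_cast
    have h2 := mul_le_mul_of_nonneg_right h hN'.le
    rw [sub_mul, div_mul_cancel₀ _ hN'.ne'] at h2
    linarith
  exact_mod_cast this

/-- If R exceeded N, then RN ≥ (N+1)N would already be too large. It is needed in order to choose R
of the N universal points. -/
theorem le_of_mul_add_le_choose {R N D : ℕ} (hN : 0 < N) (h : R * N + D ≤ (N + 1).choose 2) :
    R ≤ N := by
  by_contra hR
  push Not at hR
  rw [Nat.choose_two_right] at h
  have h1 : (N + 1) * N ≤ R * N := Nat.mul_le_mul_right _ hR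
  have h2 : (N + 1) * (N + 1 - 1) / 2 < (N + 1) * N := by
    rw [Nat.add_sub_cancel]
    exact Nat.div_lt_self (by positivity) (by norm_num)
  omega

end RankBound

/-! ### Generic tuples of symmetric product tensors -/

section Generic

variable {F : Type*} [RCLike F] {n m R : ℕ}

/-- Take the first R of the universal points; the edges among them are the edges inside a set of R
vertices. -/
theorem exists_points_pairClass (k : ℕ) (hn : 1 ≤ n)
    (hR : R * Fintype.card (MonoIdx n k) + Fintype.card (MonoIdx n (k + k)) ≤
      (Fintype.card (MonoIdx n k) + 1).choose 2) :
    ∃ x : Fin R → Fin n → F, LinearIndependent F (fun a => ver k (x a)) ∧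
      LinearIndepOn F (pairClass fun a => ver k (x a)) {s | ¬ s.IsDiag} := by
  classical
  obtain ⟨x, hx, hgen⟩ := exists_universal_point (F := F) (n := n) (k := k) rfl
  have hRN := le_of_mul_add_le_choose (card_monoIdx_pos hn k) hR
  let f : Fin R → Fin (Fintype.card (MonoIdx n k)) := Fin.castLE hRN
  have hf : Function.Injective f := Fin.castLE_injective hRN
  have h := linearIndepOn_pairClass_of_bound hx hgen (Finset.univ.image f)
    (by rw [Finset.card_image_of_injective _ hf, Finset.card_univ, Fintype.card_fin]; exact hR)
  refine ⟨x ∘ f, hx.comp f hf, ?_⟩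
  have h2 := pairClass_comp (fun a => ver k (x a)) f
  change LinearIndepOn F (pairClass ((fun a => ver k (x a)) ∘ f)) _
  rw [h2]
  refine LinearIndepOn.comp_of_image (h.mono ?_) (Sym2.map.injective hf).injOn
  rintro _ ⟨s, hs, rfl⟩
  induction s using Sym2.ind with
  | _ a b =>
  simp only [Set.mem_ofPred_eq, Sym2.mk_isDiag_iff] at hs
  simp only [Set.mem_ofPred_eq, Sym2.map_mk, Sym2.mk_isDiag_iff, hf.eq_iff, hs,
    not_false_eq_true, Sym2.mem_iff, forall_eq_or_imp, forall_eq, true_and]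
  simp

theorem exists_points_tensorPow (l : ℕ) (hR : R ≤ Fintype.card (MonoIdx n l)) :
    ∃ x : Fin R → Fin n → F, LinearIndependent F (fun a => tensorPow (x a) l) := by
  obtain ⟨x, hx, -⟩ := exists_universal_point (F := F) (n := n) (k := l) rfl
  exact ⟨x ∘ Fin.castLE hR,
    linearIndependent_ver_iff.1 (hx.comp _ (Fin.castLE_injective hR))⟩

/-- The coordinates of the tuple `(α_a x_a^{⊗ m})_a`. -/
def tupleOf (m : ℕ) (α : Fin R → F) (x : Fin R → Fin n → F) : Fin R × (Fin m → Fin n) → F :=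
  fun y => (α y.1 • tensorPow (x y.1) m) y.2

theorem mem_symProductTuples_iff {t : Fin R × (Fin m → Fin n) → F} :
    t ∈ symProductTuples F n m R ↔ ∃ α x, t = tupleOf m α x := by
  constructor
  · intro h
    choose α x hx using h
    exact ⟨α, x, by ext ⟨a, i⟩; exact congrFun (hx a) i⟩
  · rintro ⟨α, x, rfl⟩ a
    exact ⟨α a, x a, rfl⟩

/-- The parametrization of tuples of symmetric product tensors. -/
noncomputable def tuplePullback (F : Type*) [RCLike F] (n m R : ℕ) :
    MvPolynomial (Fin R × (Fin m → Fin n)) F →ₐ[F] MvPolynomial (Fin R ⊕ Fin R × Fin n) F :=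
  MvPolynomial.aeval fun y => MvPolynomial.X (Sum.inl y.1) *
    ∏ j, MvPolynomial.X (Sum.inr (y.1, y.2 j))

theorem eval_tuplePullback (α : Fin R → F) (x : Fin R → Fin n → F)
    (p : MvPolynomial (Fin R × (Fin m → Fin n)) F) :
    MvPolynomial.eval (Sum.elim α fun y => x y.1 y.2) (tuplePullback F n m R p) =
      MvPolynomial.eval (tupleOf m α x) p := by
  induction p using MvPolynomial.induction_on with
  | C a => simp [tuplePullback]
  | add p q hp hq => simp [hp, hq]
  | mul_X p i hp =>
    rw [map_mul, map_mul, hp, map_mul]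
    congr 1
    simp [tuplePullback, tupleOf, tensorPow]

/-- The tuples of symmetric product tensors form an irreducible variety. -/
theorem isZariskiOpenDense_of_eval_ne_zero {q : MvPolynomial (Fin R × (Fin m → Fin n)) F}
    {t : Fin R × (Fin m → Fin n) → F} (ht : t ∈ symProductTuples F n m R)
    (hq : MvPolynomial.eval t q ≠ 0) :
    IsZariskiOpenDense (symProductTuples F n m R)
      {y ∈ symProductTuples F n m R | MvPolynomial.eval y q ≠ 0} := by
  refine ⟨Set.sep_subset _ _, ⟨{q}, by simp⟩, fun p hp y hy => ?_⟩
  obtain ⟨α, x, rfl⟩ := mem_symProductTuples_iff.1 hy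
  obtain ⟨α₀, x₀, rfl⟩ := mem_symProductTuples_iff.1 ht
  have hq0 : tuplePullback F n m R q ≠ 0 :=
    ne_zero_of_eval_ne_zero (x := Sum.elim α₀ fun y => x₀ y.1 y.2) (by rwa [eval_tuplePullback])
  -- On the parameter space, p vanishes wherever q does not. The product of the pullbacks is
  -- therefore zero in a polynomial ring, which is an integral domain.
  have h0 : tuplePullback F n m R p * tuplePullback F n m R q = 0 := by
    refine MvPolynomial.funext fun z => ?_
    obtain ⟨β, w, rfl⟩ : ∃ (β : Fin R → F) (w : Fin R → Fin n → F),
        z = Sum.elim β fun y => w y.1 y.2 :=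
      ⟨fun a => z (Sum.inl a), fun a j => z (Sum.inr (a, j)), by ext (a | a) <;> rfl⟩
    rw [map_mul, eval_tuplePullback, eval_tuplePullback, map_zero, mul_eq_zero]
    by_cases h : MvPolynomial.eval (tupleOf m β w) q = 0
    · exact Or.inr h
    · exact Or.inl (hp _ ⟨mem_symProductTuples_iff.2 ⟨_, _, rfl⟩, h⟩)
  have := (mul_eq_zero.1 h0).resolve_right hq0
  rw [← eval_tuplePullback, this, map_zero]

/-- Irreducibility again: the locus where p is nonzero is dense, so q cannot vanish on all of it. -/
theorem exists_eval_mul_ne_zero {p q : MvPolynomial (Fin R × (Fin m → Fin n)) F}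
    {t t' : Fin R × (Fin m → Fin n) → F} (ht : t ∈ symProductTuples F n m R)
    (hp : MvPolynomial.eval t p ≠ 0) (ht' : t' ∈ symProductTuples F n m R)
    (hq : MvPolynomial.eval t' q ≠ 0) :
    ∃ t ∈ symProductTuples F n m R, MvPolynomial.eval t (p * q) ≠ 0 := by
  by_contra h
  push Not at h
  refine hq ((isZariskiOpenDense_of_eval_ne_zero ht hp).2.2 q ?_ t' ht')
  rintro y ⟨hy, hy'⟩
  have := h y hy
  rw [map_mul] at this
  exact (mul_eq_zero.1 this).resolve_left hy'

/-- Index of an entry of a flattening. -/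
def flatIdx {n m : ℕ} (i : Fin ((m + 1) / 2) → Fin n) (j : Fin (m / 2) → Fin n) : Fin m → Fin n :=
  Fin.append i j ∘ Fin.cast (by omega : m = (m + 1) / 2 + m / 2)

theorem tupleOf_flatIdx (α : Fin R → F) (x : Fin R → Fin n → F) (a : Fin R)
    (i : Fin ((m + 1) / 2) → Fin n) (j : Fin (m / 2) → Fin n) :
    tupleOf m α x (a, flatIdx i j) =
      α a * (tensorPow (x a) ((m + 1) / 2) i * tensorPow (x a) (m / 2) j) := by
  simp only [tupleOf, flatIdx, Pi.smul_apply, smul_eq_mul, tensorPow_flatten]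

/-- The open condition that ensures success. -/
theorem exists_generic_set (hn : 1 ≤ n) (hm : 2 ≤ m) (hR : (R : ℝ) ≤ rankBound n m) :
    ∃ A : Set (Fin R × (Fin m → Fin n) → F), IsZariskiOpenDense (symProductTuples F n m R) A ∧
      ∀ (α : Fin R → F) (x : Fin R → Fin n → F), tupleOf m α x ∈ A →
        (∀ a, α a ≠ 0) ∧ (∀ a, x a ≠ 0) ∧
        LinearIndependent F (fun a => tensorPow (x a) (m / 2)) ∧
        LinearIndepOn F (pairClass fun a => ver ((m + 1) / 2) (x a)) {s | ¬ s.IsDiag} := by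
  classical
  set k := (m + 1) / 2 with hk
  set l := m / 2 with hl
  have hk0 : k ≠ 0 := by omega
  have hl0 : l ≠ 0 := by omega
  obtain ⟨x₁, hx₁⟩ := exists_points_tensorPow (F := F) l (le_card_of_le_rankBound hR)
  obtain ⟨x₂, hx₂, hx₂'⟩ := exists_points_pairClass (F := F) k hn
    (mul_card_add_card_le_of_le_rankBound hn hR)
  have hz : ∀ j, j ≠ 0 → tensorPow (0 : Fin n → F) j = 0 := by
    intro j hj; ext i; simp [tensorPow, hj]
  have hx₁0 : ∀ a, x₁ a ≠ 0 := fun a h => hx₁.ne_zero a (by simp only [h]; exact hz l hl0)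
  have hx₂0 : ∀ a, x₂ a ≠ 0 := fun a h => hx₂.ne_zero a (by simp only [h]; exact ver_zero hk0)
  -- The open conditions must be polynomials in the entries of the tensors, not in α and x. A row of
  -- the flattening of α x^{⊗m} is a multiple of x^{⊗l} and a column is a multiple of x^{⊗k}; the
  -- row and column are chosen so that the multiple is nonzero at the witnesses x₁ and x₂.
  choose i₁ hi₁ using fun a => tensorPow_ne_zero (hx₁0 a) k
  choose j₂ hj₂ using fun a => tensorPow_ne_zero (hx₂0 a) l
  -- rows and columns of the flattenings of the summands
  let W : (Fin R × (Fin m → Fin n) → F) → Fin R → (Fin l → Fin n) → F :=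
    fun t a j => t (a, flatIdx (i₁ a) j)
  let Y : (Fin R × (Fin m → Fin n) → F) → Fin R → MonoIdx n k → F :=
    fun t a i => t (a, flatIdx i.1 (j₂ a))
  have hW : ∀ α x a, W (tupleOf m α x) a =
      (α a * tensorPow (x a) k (i₁ a)) • tensorPow (x a) l := by
    intro α x a; ext j
    simp only [W, tupleOf_flatIdx, Pi.smul_apply, smul_eq_mul]; ring
  have hY : ∀ α x a, Y (tupleOf m α x) a =
      (α a * tensorPow (x a) l (j₂ a)) • ver k (x a) := by
    intro α x a; ext j
    simp only [Y, tupleOf_flatIdx, Pi.smul_apply, smul_eq_mul, ver, symCoords]; ring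
  have hEY : ∀ α x a b, pairClass (Y (tupleOf m α x)) s(a, b) =
      ((α a * tensorPow (x a) l (j₂ a)) * (α b * tensorPow (x b) l (j₂ b))) •
        pairClass (fun a => ver k (x a)) s(a, b) := by
    intro α x a b
    simp only [pairClass, symProds_mk, hY, ← map_smul]
    congr 1
    ext i j
    simp only [symProd, Matrix.add_apply, Matrix.vecMulVec_apply, Pi.smul_apply, smul_eq_mul,
      Matrix.smul_apply]
    ring
  obtain ⟨q₁, hq₁, hq₁'⟩ := exists_poly_linearIndependent (w := W)
    (fun f a => IsPolyFun.linear_pi f fun j => IsPolyFun.proj _)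
    (x₀ := tupleOf m 1 x₁) (by
      have : W (tupleOf m 1 x₁) = fun a =>
          (Units.mk0 _ (hi₁ a)) • tensorPow (x₁ a) l := by
        ext a : 1; rw [hW]; simp [Units.smul_def]
      rw [this]
      exact hx₁.units_smul fun a => Units.mk0 _ (hi₁ a))
  have hYt : LinearIndepOn F (pairClass (Y (tupleOf m 1 x₂))) {s : Sym2 (Fin R) | ¬ s.IsDiag} := by
    have hex : ∀ s : Sym2 (Fin R), ∃ c : Fˣ, pairClass (Y (tupleOf m 1 x₂)) s =
        c • pairClass (fun a => ver k (x₂ a)) s := by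
      intro s
      induction s using Sym2.ind with
      | _ a b =>
      exact ⟨Units.mk0 _ (mul_ne_zero (hj₂ a) (hj₂ b)), by rw [hEY]; simp [Units.smul_def]⟩
    choose c hc using hex
    have h := LinearIndependent.units_smul hx₂' (fun s => c s.1)
    have he : (fun s : {s : Sym2 (Fin R) | ¬ s.IsDiag} => pairClass (Y (tupleOf m 1 x₂)) s.1) =
        (fun s : {s : Sym2 (Fin R) | ¬ s.IsDiag} => c s.1) •
          (fun s : {s : Sym2 (Fin R) | ¬ s.IsDiag} =>
            pairClass (fun a => ver k (x₂ a)) s.1) := by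
      ext s : 1; exact hc s.1
    rw [LinearIndepOn, he]; exact h
  obtain ⟨q₂, hq₂, hq₂'⟩ := exists_poly_linearIndependent
    (w := fun t (s : {s : Sym2 (Fin R) | ¬ s.IsDiag}) => pairClass (Y t) s.1)
    (fun f s => isPolyFun_pairClass (fun a i => IsPolyFun.proj _) f s.1)
    (x₀ := tupleOf m 1 x₂) hYt
  obtain ⟨t, ht, hqt⟩ := exists_eval_mul_ne_zero (mem_symProductTuples_iff.2 ⟨_, _, rfl⟩) hq₁
    (mem_symProductTuples_iff.2 ⟨_, _, rfl⟩) hq₂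
  refine ⟨_, isZariskiOpenDense_of_eval_ne_zero ht hqt, fun α x hx => ?_⟩
  have h := hx.2
  rw [map_mul] at h
  have h1 := hq₁' _ (left_ne_zero_of_mul h)
  have h2 := hq₂' _ (right_ne_zero_of_mul h)
  -- Independence of the chosen rows makes each of them nonzero. This already gives α_a ≠ 0 and x_a
  -- ≠ 0, without separate open conditions.
  have hne := fun a => h1.ne_zero a
  simp only [hW] at hne
  have hc : ∀ a, α a * tensorPow (x a) k (i₁ a) ≠ 0 := fun a h => hne a (by rw [h, zero_smul])
  have hα : ∀ a, α a ≠ 0 := fun a => left_ne_zero_of_mul (hc a)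
  have hx0 : ∀ a, x a ≠ 0 := by
    intro a h
    apply hne a
    rw [h, hz l hl0, smul_zero]
  refine ⟨hα, hx0, ?_, ?_⟩
  · have := h1.units_smul (fun a => (Units.mk0 _ (hc a))⁻¹)
    have he : (fun a => tensorPow (x a) l) =
        (fun a => (Units.mk0 _ (hc a))⁻¹) • W (tupleOf m α x) := by
      ext a : 1
      rw [Pi.smul_apply', hW, Units.smul_def, Units.val_inv_eq_inv_val, Units.val_mk0, smul_smul,
        inv_mul_cancel₀ (hc a), one_smul]
    rw [he]; exact this
  · have hex : ∀ s : {s : Sym2 (Fin R) | ¬ s.IsDiag}, ∃ c : Fˣ,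
        pairClass (fun a => ver k (x a)) s.1 = c • pairClass (Y (tupleOf m α x)) s.1 := by
      intro s
      have hs := h2.ne_zero s
      obtain ⟨s, hs'⟩ := s
      induction s using Sym2.ind with
      | _ a b =>
      simp only [hEY] at hs ⊢
      have : (α a * tensorPow (x a) l (j₂ a)) * (α b * tensorPow (x b) l (j₂ b)) ≠ 0 :=
        fun h => hs (by rw [h, zero_smul])
      exact ⟨(Units.mk0 _ this)⁻¹, by
        rw [Units.smul_def, Units.val_inv_eq_inv_val, Units.val_mk0, smul_smul,
          inv_mul_cancel₀ this, one_smul]⟩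
    choose c hc using hex
    have h := LinearIndependent.units_smul h2 c
    have he : (fun s : {s : Sym2 (Fin R) | ¬ s.IsDiag} =>
        pairClass (fun a => ver k (x a)) s.1) = c •
          (fun s : {s : Sym2 (Fin R) | ¬ s.IsDiag} => pairClass (Y (tupleOf m α x)) s.1) := by
      ext s : 1; exact hc s
    rw [LinearIndepOn, he]; exact h

end Generic

end Waring

namespace Waring

/-! ### The lifted intersection for generic tensors -/

section GenericConsequences

open Matrix

variable {F : Type*} [RCLike F] {n m R : ℕ}

theorem linearIndependent_tensorPow_of_le {k l : ℕ} {x : Fin R → Fin n → F}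
    (h : LinearIndependent F (fun a => tensorPow (x a) l)) (hx : ∀ a, x a ≠ 0) (hlk : l ≤ k) :
    LinearIndependent F (fun a => tensorPow (x a) k) := by
  obtain ⟨j, rfl⟩ := Nat.exists_eq_add_of_le hlk
  exact linearIndependent_tensorPow_add h hx j

/-- Functionals dual to the independent x_a^{⊗l} contract T to α_a x_a^{⊗k}. -/
theorem image_eq_span_ver {α : Fin R → F} {x : Fin R → Fin n → F} (hα : ∀ a, α a ≠ 0)
    (hx : LinearIndependent F (fun a => tensorPow (x a) (m / 2))) :
    image (∑ a, α a • tensorPow (x a) m) =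
      Submodule.span F (Set.range fun a => ver ((m + 1) / 2) (x a)) := by
  refine le_antisymm (image_sum_le α x) ?_
  rw [Submodule.span_le]
  rintro _ ⟨a, rfl⟩
  obtain ⟨Y', h1, -⟩ := exists_pinv_colMatrix hx
  have hY' : ∀ b, ∑ j, Y' a j * tensorPow (x b) (m / 2) j = if a = b then 1 else 0 := by
    intro b
    have := congrFun (congrFun h1 a) b
    simpa [Matrix.mul_apply, Matrix.one_apply] using this
  have : ver ((m + 1) / 2) (x a) = (α a)⁻¹ • ∑ j, Y' a j •
      symCoords fun i : Fin ((m + 1) / 2) → Fin n => (∑ a, α a • tensorPow (x a) m)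
        (Fin.append i j ∘ Fin.cast (by omega : m = (m + 1) / 2 + m / 2)) := by
    ext i
    simp only [Pi.smul_apply, Finset.sum_apply, smul_eq_mul, symCoords, tensorPow_flatten]
    have : ∀ j, Y' a j * ∑ b, α b * (tensorPow (x b) ((m + 1) / 2) i.1 *
        tensorPow (x b) (m / 2) j) = ∑ b, (α b * tensorPow (x b) ((m + 1) / 2) i.1) *
          (Y' a j * tensorPow (x b) (m / 2) j) := by
      intro j; rw [Finset.mul_sum]; exact Finset.sum_congr rfl fun _ _ => by ring
    simp only [this]
    rw [Finset.sum_comm]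
    simp only [← Finset.mul_sum, hY']
    simp only [mul_ite, mul_one, mul_zero, Finset.sum_ite_eq, Finset.mem_univ, if_true]
    rw [inv_mul_cancel_left₀ (hα a)]
  change ver ((m + 1) / 2) (x a) ∈ image _
  rw [this]
  exact Submodule.smul_mem _ _ (Submodule.sum_mem _ fun j _ =>
    Submodule.smul_mem _ _ (Submodule.subset_span ⟨j, rfl⟩))

/-- A symmetric P with columns in U has the form Y C Yᵀ with C symmetric. Modulo S^{2k} the squares
vanish and the off-diagonal entries of C become coefficients of independent classes, so C is
diagonal. -/
theorem liftedIntersection_eq_span {k p : ℕ} {x : Fin R → Fin n → F}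
    (hx : LinearIndependent F fun a => ver k (x a))
    (hE : LinearIndepOn F (pairClass fun a => ver k (x a)) {s | ¬ s.IsDiag})
    {q : Fin p → Matrix (MonoIdx n k) (MonoIdx n k) F}
    (hq : Submodule.span F (Set.range q) = quadricsOn (veroneseCone F n k)) :
    liftedIntersection (Submodule.span F (Set.range fun a => ver k (x a))) q =
      Submodule.span F (Set.range fun a => vecMulVec (ver k (x a)) (ver k (x a))) := by
  classical
  apply le_antisymm
  · intro P hP
    rw [mem_liftedIntersection_iff hq] at hP
    obtain ⟨hU, hZ⟩ := hP
    have hsymm := verSquares_isSymm hZ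
    obtain ⟨Y', h1, -⟩ := exists_pinv_colMatrix hx
    set Y := colMatrix fun a => ver k (x a) with hY
    -- YY' is the identity on the span of the columns of Y, which contains the columns of P.
    have hYP : Y * Y' * P = P := by
      ext i j
      obtain ⟨c, hc⟩ := (Submodule.mem_span_range_iff_exists_fun F).1 (hU j)
      have h2 : P.col j = Y *ᵥ c := by
        ext i
        have := congrFun hc i
        simp only [Finset.sum_apply, Pi.smul_apply, smul_eq_mul] at this
        simp only [Matrix.col_apply, ← this, mulVec, dotProduct, hY, of_apply, mul_comm]
      have h3 : (Y * Y' * P).col j = (Y * Y') *ᵥ P.col j := by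
        ext i; simp [Matrix.mul_apply, mulVec, dotProduct]
      have h4 : (Y * Y' * P).col j = P.col j := by
        rw [h3, h2, mulVec_mulVec, Matrix.mul_assoc, h1, Matrix.mul_one]
      exact congrFun h4 i
    set C := Y' * P * Y'ᵀ with hC
    have hPC : P = Y * C * Yᵀ := by
      have h2 : P * (Y * Y')ᵀ = P := by
        have := congrArg Matrix.transpose hYP
        rwa [transpose_mul, hsymm.eq] at this
      calc P = (Y * Y' * P) * (Y * Y')ᵀ := by rw [hYP, h2]
        _ = _ := by rw [hC, transpose_mul]; simp only [Matrix.mul_assoc]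
    have hCs : ∀ a b, C a b = C b a := by
      have : Cᵀ = C := by
        rw [hC]; simp only [transpose_mul, transpose_transpose, hsymm.eq, Matrix.mul_assoc]
      intro a b
      exact (congrFun (congrFun this b) a)
    have hPsum : P = ∑ a, ∑ b, C a b • vecMulVec (ver k (x a)) (ver k (x b)) := by
      conv_lhs => rw [hPC]
      ext i j
      rw [Matrix.mul_apply]
      simp only [Matrix.mul_apply, transpose_apply, hY, of_apply, Finset.sum_mul,
        Matrix.sum_apply, Matrix.smul_apply, smul_eq_mul, vecMulVec_apply]
      rw [Finset.sum_comm]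
      exact Finset.sum_congr rfl fun _ _ => Finset.sum_congr rfl fun _ _ => by ring
    -- the coefficients as a function of unordered pairs
    let c : Sym2 (Fin R) → F := Sym2.lift ⟨fun a b => C a b, hCs⟩
    -- Doubling P allows symmetric products to be summed over ordered pairs without treating the
    -- diagonal separately.
    have h2P : P + P = ∑ y : Fin R × Fin R,
        (fun s => c s • symProds (fun a => ver k (x a)) s) s(y.1, y.2) := by
      rw [Fintype.sum_prod_type]
      simp only [symProds_mk, symProd, smul_add, Finset.sum_add_distrib]
      have e1 : ∀ a b, c s(a, b) = C a b := fun _ _ => rfl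
      simp only [e1]
      congr 1
      rw [Finset.sum_comm, hPsum]
      exact Finset.sum_congr rfl fun a _ => Finset.sum_congr rfl fun b _ => by rw [hCs]
    -- Grouping the ordered pairs by their unordered pair puts the size of each fibre into the
    -- coefficient. Only that this size is nonzero is used below.
    have hzero : ∑ s ∈ Finset.univ.filter (fun s : Sym2 (Fin R) => ¬ s.IsDiag),
        (((Finset.univ.filter fun y : Fin R × Fin R => s(y.1, y.2) = s).card : F) * c s) •
          pairClass (fun a => ver k (x a)) s = 0 := by
      have h3 : (verSquares F n k).mkQ (P + P) = 0 := by
        rw [Submodule.mkQ_apply, Submodule.Quotient.mk_eq_zero]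
        exact Submodule.add_mem _ hZ hZ
      rw [h2P, ← Finset.sum_fiberwise Finset.univ (fun y : Fin R × Fin R => s(y.1, y.2)),
        map_sum] at h3
      rw [Finset.sum_filter]
      refine Eq.trans ?_ h3
      refine Finset.sum_congr rfl fun s _ => ?_
      have : ∑ y : Fin R × Fin R with s(y.1, y.2) = s,
          (fun s => c s • symProds (fun a => ver k (x a)) s) s(y.1, y.2) =
          ∑ y : Fin R × Fin R with s(y.1, y.2) = s,
            c s • symProds (fun a => ver k (x a)) s := by
        refine Finset.sum_congr rfl fun y hy => ?_
        rw [(Finset.mem_filter.1 hy).2]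
      rw [this, Finset.sum_const, ← Nat.cast_smul_eq_nsmul F, smul_smul, map_smul]
      split_ifs with hs
      · induction s using Sym2.ind with
        | _ a b =>
        rw [Sym2.mk_isDiag_iff] at hs
        subst hs
        have := pairClass_diag (F := F) (k := k) (x := x) a
        rw [pairClass] at this
        rw [this, smul_zero]
      · rfl
    have hE' : LinearIndepOn F (pairClass fun a => ver k (x a))
        ((Finset.univ.filter fun s : Sym2 (Fin R) => ¬ s.IsDiag : Finset _) :
          Set (Sym2 (Fin R))) := by
      convert hE using 1
      ext; simp
    rw [linearIndepOn_finset_iff] at hE'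
    have hC0 : ∀ a b, a ≠ b → C a b = 0 := by
      intro a b hab
      have := hE' _ hzero s(a, b) (by simpa using hab)
      refine (mul_eq_zero.1 this).resolve_left ?_
      exact Nat.cast_ne_zero.2 (Finset.card_ne_zero.2 ⟨(a, b), by simp⟩)
    rw [hPsum]
    refine Submodule.sum_mem _ fun a _ => ?_
    rw [Finset.sum_eq_single a (fun b _ hb => by rw [hC0 a b (Ne.symm hb), zero_smul]) (by simp)]
    exact Submodule.smul_mem _ _ (Submodule.subset_span ⟨a, rfl⟩)
  · rw [Submodule.span_le]
    rintro _ ⟨a, rfl⟩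
    rw [SetLike.mem_coe, mem_liftedIntersection_iff hq]
    refine ⟨fun j => ?_, Submodule.subset_span ⟨x a, rfl⟩⟩
    have : (fun i => vecMulVec (ver k (x a)) (ver k (x a)) i j) =
        ver k (x a) j • ver k (x a) := by
      ext i; simp [vecMulVec_apply, mul_comm]
    rw [this]
    exact Submodule.smul_mem _ _ (Submodule.subset_span ⟨a, rfl⟩)

/-- Coefficients of a basis of the span of the squares. -/
theorem exists_coeff_of_span_eq {ι : Type*} [Fintype ι] {s : ℕ} {P : Fin s → Matrix ι ι F}
    {v : Fin s → ι → F} (hP : LinearIndependent F P)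
    (h : Submodule.span F (Set.range P) =
      Submodule.span F (Set.range fun a => vecMulVec (v a) (v a))) :
    ∃ z : Fin s → Fin s → F, (∀ l i j, P l i j = ∑ a, z a l * (v a i * v a j)) ∧
      LinearIndependent F z := by
  have h1 : ∀ l, ∃ c : Fin s → F, ∑ a, c a • vecMulVec (v a) (v a) = P l := fun l =>
    (Submodule.mem_span_range_iff_exists_fun F).1 (h.le (Submodule.subset_span ⟨l, rfl⟩))
  choose c hc using h1
  refine ⟨fun a l => c l a, fun l i j => ?_, ?_⟩
  · rw [← hc]; simp [Matrix.sum_apply, vecMulVec_apply]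
  · have hrow : LinearIndependent F (Matrix.of c).row := by
      rw [Fintype.linearIndependent_iff] at hP ⊢
      intro d hd
      apply hP d
      simp only [← hc, Finset.smul_sum, smul_smul]
      rw [Finset.sum_comm]
      simp only [← Finset.sum_smul]
      refine Finset.sum_eq_zero fun a _ => ?_
      have := congrFun hd a
      simp only [Finset.sum_apply, Pi.smul_apply, smul_eq_mul, Pi.zero_apply, Matrix.row_apply,
        of_apply] at this
      rw [this, zero_smul]
    rw [linearIndependent_rows_iff_isUnit] at hrow
    have := (linearIndependent_cols_iff_isUnit (A := Matrix.of c)).2 hrow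
    exact this

end GenericConsequences

/-! ### Almost sure success of simultaneous diagonalization -/

section AlmostEverywhere

open MeasureTheory

variable {F : Type*} [RCLike F] [MeasurableSpace F] [BorelSpace F]

/-- The kernel is a proper real subspace and therefore null. Only real linearity is assumed, so the
real and the complex case are treated together. -/
theorem ae_functional_ne_zero {E : Type*} [NormedAddCommGroup E] [NormedSpace ℝ E]
    [MeasurableSpace E] [BorelSpace E] [FiniteDimensional ℝ E] (μ : Measure E)
    [μ.IsAddHaarMeasure] (φ : E →ₗ[ℝ] F) (hφ : φ ≠ 0) : ∀ᵐ x ∂μ, φ x ≠ 0 := by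
  have : μ (LinearMap.ker φ) = 0 := by
    apply Measure.addHaar_submodule
    rwa [Ne, LinearMap.ker_eq_top]
  rw [ae_iff]
  have h : {x | ¬ φ x ≠ 0} = LinearMap.ker φ := by ext; simp
  rw [h, this]

/-- The functional `f ↦ ∑ l, f l * z l`, as a real linear map. -/
noncomputable def dotReal {s : ℕ} (z : Fin s → F) : (Fin s → F) →ₗ[ℝ] F where
  toFun f := ∑ l, f l * z l
  map_add' f g := by simp [add_mul, Finset.sum_add_distrib]
  map_smul' c f := by simp [Finset.smul_sum]

theorem dotReal_ne_zero {s : ℕ} {z : Fin s → F} (hz : z ≠ 0) : dotReal z ≠ 0 := by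
  obtain ⟨l, hl⟩ := Function.ne_iff.1 hz
  intro h
  apply hl
  have := LinearMap.congr_fun h (Pi.single l 1)
  simpa [dotReal, Pi.single_apply] using this

/-- Nonvanishing is a linear condition in f or in g alone. Distinctness of the ratios is bilinear
after clearing denominators, and is handled by fixing f and integrating over g. -/
theorem ae_separating {s : ℕ} {z : Fin s → Fin s → F} (hz : LinearIndependent F z) :
    ∀ᵐ fg : (Fin s → F) × (Fin s → F) ∂Measure.addHaar,
      (∀ a, ∑ l, fg.1 l * z a l ≠ 0) ∧ (∀ a, ∑ l, fg.2 l * z a l ≠ 0) ∧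
      Function.Injective fun a => (∑ l, fg.1 l * z a l) / (∑ l, fg.2 l * z a l) := by
  have h1 : ∀ᵐ fg : (Fin s → F) × (Fin s → F) ∂Measure.addHaar,
      ∀ a, ∑ l, fg.1 l * z a l ≠ 0 := by
    rw [ae_all_iff]
    intro a
    let ψ : (Fin s → F) × (Fin s → F) →ₗ[ℝ] F := (dotReal (z a)).comp (LinearMap.fst ℝ _ _)
    refine ae_functional_ne_zero _ ψ fun h => ?_
    apply dotReal_ne_zero (hz.ne_zero a)
    exact LinearMap.ext fun f => LinearMap.congr_fun h (f, 0)
  have h2 : ∀ᵐ fg : (Fin s → F) × (Fin s → F) ∂Measure.addHaar,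
      ∀ a, ∑ l, fg.2 l * z a l ≠ 0 := by
    rw [ae_all_iff]
    intro a
    let ψ : (Fin s → F) × (Fin s → F) →ₗ[ℝ] F := (dotReal (z a)).comp (LinearMap.snd ℝ _ _)
    refine ae_functional_ne_zero _ ψ fun h => ?_
    apply dotReal_ne_zero (hz.ne_zero a)
    exact LinearMap.ext fun f => LinearMap.congr_fun h (0, f)
  have h3 : ∀ᵐ fg : (Fin s → F) × (Fin s → F) ∂Measure.addHaar, ∀ a b, a ≠ b →
      (∑ l, fg.1 l * z a l) * (∑ l, fg.2 l * z b l) ≠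
        (∑ l, fg.1 l * z b l) * (∑ l, fg.2 l * z a l) := by
    rw [ae_all_iff]; intro a
    rw [ae_all_iff]; intro b
    by_cases hab : a = b
    · exact ae_of_all _ fun _ h => absurd hab h
    have hac : (Measure.addHaar : Measure ((Fin s → F) × (Fin s → F))) ≪
        (Measure.addHaar : Measure (Fin s → F)).prod (Measure.addHaar : Measure (Fin s → F)) :=
      Measure.absolutelyContinuous_isAddHaarMeasure _ _
    suffices h : ∀ᵐ fg ∂((Measure.addHaar : Measure (Fin s → F)).prod
        (Measure.addHaar : Measure (Fin s → F))),
        (∑ l, fg.1 l * z a l) * (∑ l, fg.2 l * z b l) ≠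
          (∑ l, fg.1 l * z b l) * (∑ l, fg.2 l * z a l) by
      filter_upwards [hac.ae_le h] with fg h _ using h
    rw [ae_iff]
    simp only [not_not]
    refine Measure.measure_prod_null_of_ae_null (IsClosed.measurableSet ?_) ?_
    · exact isClosed_eq (by fun_prop) (by fun_prop)
    · have hf := ae_functional_ne_zero (Measure.addHaar : Measure (Fin s → F)) (dotReal (z a))
        (dotReal_ne_zero (hz.ne_zero a))
      filter_upwards [hf] with f hf
      have hf' : (∑ l, f l * z a l) ≠ 0 := hf
      -- For fixed f, equality of the two cross products says that g is orthogonal to w. This vector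
      -- is nonzero because z_a, z_b are independent and the coefficient of z_b is nonzero for
      -- almost every f.
      set w : Fin s → F := (∑ l, f l * z a l) • z b - (∑ l, f l * z b l) • z a with hw
      have hw0 : w ≠ 0 := by
        intro h0
        have hmem := hz.notMem_span_image (s := {a}) (x := b) (by simpa using Ne.symm hab)
        rw [Set.image_singleton] at hmem
        refine hmem (Submodule.mem_span_singleton.2
          ⟨(∑ l, f l * z b l) / (∑ l, f l * z a l), ?_⟩)
        rw [hw, sub_eq_zero] at h0
        rw [div_eq_inv_mul, mul_smul, ← h0, smul_smul, inv_mul_cancel₀ hf', one_smul]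
      have hg := ae_functional_ne_zero (Measure.addHaar : Measure (Fin s → F)) (dotReal w)
        (dotReal_ne_zero hw0)
      rw [ae_iff] at hg
      refine measure_mono_null ?_ hg
      intro g hg
      have hg : (∑ l, f l * z a l) * (∑ l, g l * z b l) =
        (∑ l, f l * z b l) * (∑ l, g l * z a l) := hg
      have : ∑ l, g l * w l = 0 := by
        rw [← sub_eq_zero.2 hg, Finset.mul_sum, Finset.mul_sum, ← Finset.sum_sub_distrib]
        refine Finset.sum_congr rfl fun l _ => ?_
        simp only [hw, Pi.sub_apply, Pi.smul_apply, smul_eq_mul]; ring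
      exact not_not.2 this
  filter_upwards [h1, h2, h3] with fg h1 h2 h3
  refine ⟨h1, h2, fun a b hab => ?_⟩
  by_contra hne
  simp only at hab
  rw [div_eq_div_iff (h2 a) (h2 b)] at hab
  exact h3 a b hne hab

/-- For a basis of the span of squares of independent vectors, almost all pairs of functionals
separate the summands. -/
theorem ae_simDiagonalizedBy {ι : Type*} [Fintype ι] {s : ℕ} {P : Fin s → Matrix ι ι F}
    {v : Fin s → ι → F} (hP : LinearIndependent F P) (hv : LinearIndependent F v)
    (h : Submodule.span F (Set.range P) =
      Submodule.span F (Set.range fun a => Matrix.vecMulVec (v a) (v a))) :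
    ∀ᵐ fg : (Fin s → F) × (Fin s → F) ∂Measure.addHaar, SimDiagonalizedBy P fg.1 fg.2 v := by
  obtain ⟨z, hz, hzi⟩ := exists_coeff_of_span_eq hP h
  filter_upwards [ae_separating hzi] with fg ⟨h1, h2, h3⟩
  exact ⟨z, hz, hzi, hv, h1, h2, h3⟩

/-- Almost surely, the intersection algorithm lists the points. -/
theorem ae_intersectionAlgorithm_lists {ι : Type*} [Fintype ι] {R R' p s : ℕ} {y : Fin R → ι → F}
    (hy : LinearIndependent F y) {u : Fin R' → ι → F} {q : Fin p → Matrix ι ι F}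
    (hu : LinearIndependent F u)
    (huy : Submodule.span F (Set.range u) = Submodule.span F (Set.range y))
    (hl : liftedIntersection (Submodule.span F (Set.range u)) q =
      Submodule.span F (Set.range fun a => Matrix.vecMulVec (y a) (y a)))
    (P : Fin s → Matrix ι ι F) :
    ∀ᵐ fg : (Fin s → F) × (Fin s → F) ∂Measure.addHaar,
      ∀ ans, IntersectionAlgorithm u q P fg.1 fg.2 ans → ans.Lists y := by
  by_cases hP : LinearIndependent F P ∧
      Submodule.span F (Set.range P) = liftedIntersection (Submodule.span F (Set.range u)) q
  swap
  · exact ae_of_all _ fun fg ans h => absurd ⟨h.1, h.2.1⟩ hP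
  obtain ⟨hPi, hPs⟩ := hP
  rw [hl] at hPs
  -- Both P and the squares of y are bases of the lifted intersection.
  have hsR : s = R := by
    have := congrArg (fun W : Submodule F (Matrix ι ι F) => Module.finrank F W) hPs
    simpa [finrank_span_eq_card hPi, finrank_span_eq_card (linearIndependent_vecMulVec hy)]
      using this
  subst hsR
  have hRR : R' = s := by
    have := congrArg (fun W : Submodule F (ι → F) => Module.finrank F W) huy
    simpa [finrank_span_eq_card hu, finrank_span_eq_card hy] using this
  filter_upwards [ae_simDiagonalizedBy hPi hy hPs] with fg hfg ans hans
  obtain ⟨-, -, hans⟩ := hans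
  match ans, hans with
  | .trivial, hans => exact hans
  | .only s' v, hans =>
    obtain ⟨hs0, -, rfl, hv⟩ := hans
    rw [stepTwoSucceeds_iff] at hv
    have hv : SimDiagonalizedBy P fg.1 fg.2 v := hv
    have hspan := (hv.span_eq hPi).symm.trans hPs
    obtain ⟨z, -, -, hvi, -⟩ := hv
    refine exists_equiv_of_span_vecMulVec_eq hvi hy (fun a => ?_) hspan
    rw [← huy]
    refine mem_of_vecMulVec_mem_liftedIntersection (q := q) (hvi.ne_zero a) ?_
    rw [hl, ← hspan]; exact Submodule.subset_span ⟨a, rfl⟩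
  -- Failure is excluded by the vectors y themselves: they pass the second step, and the test s ≤
  -- dim U holds with equality.
  | .fail, hans =>
    exact absurd ⟨y, hfg.stepTwoSucceeds⟩ (hans.2 hRR.ge)

end AlmostEverywhere

end Waring

namespace Waring

/-! ### Static analysis of programs -/

section Syntax'

instance : Add IdxExpr := ⟨.add⟩
instance : Sub IdxExpr := ⟨.sub⟩
instance : Mul IdxExpr := ⟨.mul⟩
instance (c : ℕ) : OfNat IdxExpr c := ⟨.const c⟩

/-- The content of a register. -/
abbrev rg (i : ℕ) : IdxExpr := .load (.const i)

@[simp] theorem IdxExpr.eval_add (reg : ℕ → ℕ) (e e' : IdxExpr) :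
    (e + e').eval reg = e.eval reg + e'.eval reg := rfl
@[simp] theorem IdxExpr.eval_sub (reg : ℕ → ℕ) (e e' : IdxExpr) :
    (e - e').eval reg = e.eval reg - e'.eval reg := rfl
@[simp] theorem IdxExpr.eval_mul (reg : ℕ → ℕ) (e e' : IdxExpr) :
    (e * e').eval reg = e.eval reg * e'.eval reg := rfl
@[simp] theorem IdxExpr.eval_zero (reg : ℕ → ℕ) : (0 : IdxExpr).eval reg = 0 := rfl
@[simp] theorem IdxExpr.eval_one (reg : ℕ → ℕ) : (1 : IdxExpr).eval reg = 1 := rfl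
@[simp] theorem IdxExpr.eval_two (reg : ℕ → ℕ) : (2 : IdxExpr).eval reg = 2 := rfl
@[simp] theorem IdxExpr.eval_const (reg : ℕ → ℕ) (c : ℕ) :
    (IdxExpr.const c).eval reg = c := rfl
@[simp] theorem IdxExpr.eval_rg (reg : ℕ → ℕ) (i : ℕ) : (rg i).eval reg = reg i := rfl

/-- The expression reads only registers outside `bad`. -/
def IdxExpr.avoids (bad : ℕ → Bool) : IdxExpr → Bool
  | const _ => true
  | load (const c) => !bad c
  | load _ => false
  | add e e' => e.avoids bad && e'.avoids bad
  | sub e e' => e.avoids bad && e'.avoids bad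
  | mul e e' => e.avoids bad && e'.avoids bad

theorem IdxExpr.eval_congr {bad : ℕ → Bool} {reg reg' : ℕ → ℕ}
    (h : ∀ r, bad r = false → reg r = reg' r) :
    ∀ e : IdxExpr, e.avoids bad = true → e.eval reg = e.eval reg'
  | const _, _ => rfl
  | load (const c), he => h c (by simpa [avoids] using he)
  | add e e', he => by
    simp only [avoids, Bool.and_eq_true] at he
    simp only [eval, eval_congr h e he.1, eval_congr h e' he.2]
  | sub e e', he => by
    simp only [avoids, Bool.and_eq_true] at he
    simp only [eval, eval_congr h e he.1, eval_congr h e' he.2]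
  | mul e e', he => by
    simp only [avoids, Bool.and_eq_true] at he
    simp only [eval, eval_congr h e he.1, eval_congr h e' he.2]

namespace Program

/-- The registers that a program may change. -/
def modReg : Program → ℕ → Bool
  | skip, _ => false
  | seq c c', r => c.modReg r || c'.modReg r
  | setReg (.const i) _, r => i == r
  | setReg _ _, _ => true
  | ifLe _ _ c c', r => c.modReg r || c'.modReg r
  | loop i _ c, r => i == r || c.modReg r
  | setZero _, _ => false
  | setOne _, _ => false
  | op _ _ _ _, _ => false
  | conj _ _, _ => false
  | ifZero _ c c', r => c.modReg r || c'.modReg r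
  | diagonalize _ _ _ _, _ => false

/-- The arrays that a program may change. -/
def modArr : Program → ℕ → Bool
  | skip, _ => false
  | seq c c', r => c.modArr r || c'.modArr r
  | setReg _ _, _ => false
  | ifLe _ _ c c', r => c.modArr r || c'.modArr r
  | loop _ _ c, r => c.modArr r
  | setZero d, r => d.arr == r
  | setOne d, r => d.arr == r
  | op _ d _ _, r => d.arr == r
  | conj d _, r => d.arr == r
  | ifZero _ c c', r => c.modArr r || c'.modArr r
  | diagonalize _ _ v w, r => v == r || w == r

/-- The program neither reads nor writes the arrays in `B`. -/
def ignores (B : ℕ → Bool) : Program → Bool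
  | skip => true
  | seq c c' => c.ignores B && c'.ignores B
  | setReg _ _ => true
  | ifLe _ _ c c' => c.ignores B && c'.ignores B
  | loop _ _ c => c.ignores B
  | setZero d => !B d.arr
  | setOne d => !B d.arr
  | op _ d x y => !B d.arr && (!B x.arr && !B y.arr)
  | conj d x => !B d.arr && !B x.arr
  | ifZero x c c' => !B x.arr && (c.ignores B && c'.ignores B)
  | diagonalize _ s v w => !B s && (!B v && !B w)

/-- The bounds of loops and the sizes of diagonalized matrices depend only on registers
outside `bad`. -/
def boundsAvoid (bad : ℕ → Bool) : Program → Bool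
  | seq c c' => c.boundsAvoid bad && c'.boundsAvoid bad
  | ifLe _ _ c c' => c.boundsAvoid bad && c'.boundsAvoid bad
  | loop _ e c => e.avoids bad && c.boundsAvoid bad
  | ifZero _ c c' => c.boundsAvoid bad && c'.boundsAvoid bad
  | diagonalize k _ _ _ => k.avoids bad
  | _ => true

/-- The bounds of loops and the sizes of diagonalized matrices are at most `b`. -/
def boundsLe (b : ℕ) (reg : ℕ → ℕ) : Program → Prop
  | seq c c' => c.boundsLe b reg ∧ c'.boundsLe b reg
  | ifLe _ _ c c' => c.boundsLe b reg ∧ c'.boundsLe b reg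
  | loop _ e c => e.eval reg ≤ b ∧ c.boundsLe b reg
  | ifZero _ c c' => c.boundsLe b reg ∧ c'.boundsLe b reg
  | diagonalize k _ _ _ => k.eval reg ≤ b
  | _ => True

/-- The degree of a bound on the number of steps. -/
def weight : Program → ℕ
  | seq c c' => c.weight + c'.weight + 1
  | ifLe _ _ c c' => c.weight + c'.weight + 1
  | loop _ _ c => c.weight + 3
  | ifZero _ c c' => c.weight + c'.weight + 1
  | diagonalize _ _ _ _ => 3
  | _ => 0

/-- The number of calls to the oracle in the program text. -/
def callCount : Program → ℕ
  | seq c c' => c.callCount + c'.callCount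
  | ifLe _ _ c c' => c.callCount + c'.callCount
  | loop _ _ c => c.callCount
  | ifZero _ c c' => c.callCount + c'.callCount
  | diagonalize _ _ _ _ => 1
  | _ => 0

/-- No oracle calls inside of loops. -/
def noLoopCalls : Program → Bool
  | seq c c' => c.noLoopCalls && c'.noLoopCalls
  | ifLe _ _ c c' => c.noLoopCalls && c'.noLoopCalls
  | loop _ _ c => c.callCount == 0 && c.noLoopCalls
  | ifZero _ c c' => c.noLoopCalls && c'.noLoopCalls
  | _ => true

end Program

end Syntax'

/-! ### Frame properties, cost and loop rules -/

section Semantics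

variable {F : Type*} [RCLike F]

theorem foldl_range_induction {α : Type*} (P : ℕ → α → Prop) {f : α → ℕ → α} {a : α} {n : ℕ}
    (h0 : P 0 a) (hs : ∀ j < n, ∀ a, P j a → P (j + 1) (f a j)) :
    P n ((List.range n).foldl f a) := by
  induction n with
  | zero => exact h0
  | succ n ih =>
    rw [List.range_succ, List.foldl_append]
    exact hs n (Nat.lt_succ_self n) _ (ih fun j hj => hs j (hj.trans (Nat.lt_succ_self n)))

@[simp] theorem State.reg_tick (s : State F) (c : ℕ) : (s.tick c).reg = s.reg := rfl
@[simp] theorem State.mem_tick (s : State F) (c : ℕ) : (s.tick c).mem = s.mem := rfl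
@[simp] theorem State.get_tick (s : State F) (c : ℕ) (x : Cell) : (s.tick c).get x = s.get x := rfl
@[simp] theorem State.reg_setReg (s : State F) (i v : ℕ) :
    (s.setReg i v).reg = Function.update s.reg i v := rfl
@[simp] theorem State.mem_setReg (s : State F) (i v : ℕ) : (s.setReg i v).mem = s.mem := rfl
@[simp] theorem State.reg_set (s : State F) (x : Cell) (v : F) : (s.set x v).reg = s.reg := rfl
theorem State.mem_set (s : State F) (x : Cell) (v : F) :
    (s.set x v).mem = Function.update s.mem x.arr
      (Function.update (s.mem x.arr) (x.idx.eval s.reg) v) := rfl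

theorem State.mem_set_same (s : State F) (x : Cell) (v : F) :
    (s.set x v).mem x.arr = Function.update (s.mem x.arr) (x.idx.eval s.reg) v := by
  rw [State.mem_set, Function.update_self]

theorem State.mem_set_ne (s : State F) (x : Cell) (v : F) {a : ℕ} (h : a ≠ x.arr) :
    (s.set x v).mem a = s.mem a := by
  rw [State.mem_set, Function.update_of_ne h]

/-- Frame rule for registers: a computed address counts as possibly changing every register, so the
syntactic test is conservative. -/
theorem run_reg (O : Oracle F) (r : ℕ) : ∀ (c : Program) (s : State F), c.modReg r = false →
    (c.run O s).reg r = s.reg r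
  | .skip, _, _ => rfl
  | .seq c c', s, h => by
    simp only [Program.modReg, Bool.or_eq_false_iff] at h
    rw [Program.run, run_reg O r c' _ h.2, run_reg O r c s h.1]
  | .setReg dst e, s, h => by
    cases dst with
    | const i =>
      simp only [Program.modReg, beq_eq_false_iff_ne] at h
      simp [Program.run, Function.update_of_ne (Ne.symm h)]
    | _ => simp [Program.modReg] at h
  | .ifLe e e' c c', s, h => by
    simp only [Program.modReg, Bool.or_eq_false_iff] at h
    rw [Program.run]
    split_ifs
    · rw [run_reg O r c _ h.1]; rfl
    · rw [run_reg O r c' _ h.2]; rfl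
  | .loop i e c, s, h => by
    simp only [Program.modReg, Bool.or_eq_false_iff, beq_eq_false_iff_ne] at h
    rw [Program.run]
    refine foldl_range_induction (fun _ (s' : State F) => s'.reg r = s.reg r) rfl fun j _ s' hs' => ?_
    rw [run_reg O r c _ h.2]
    simp [Function.update_of_ne (Ne.symm h.1), hs']
  | .setZero _, _, _ => rfl
  | .setOne _, _, _ => rfl
  | .op _ _ _ _, _, _ => rfl
  | .conj _ _, _, _ => rfl
  | .ifZero x c c', s, h => by
    simp only [Program.modReg, Bool.or_eq_false_iff] at h
    rw [Program.run]
    split_ifs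
    · rw [run_reg O r c _ h.1]; rfl
    · rw [run_reg O r c' _ h.2]; rfl
  | .diagonalize _ _ _ _, _, _ => rfl

theorem State.mem_diagonalize_ne (O : Oracle F) (s : State F) (k src v w : ℕ) {a : ℕ}
    (hv : a ≠ v) (hw : a ≠ w) : (s.diagonalize O k src v w).mem a = s.mem a := by
  simp only [State.diagonalize]
  rw [Function.update_of_ne hw, Function.update_of_ne hv]

theorem run_mem (O : Oracle F) (a : ℕ) : ∀ (c : Program) (s : State F), c.modArr a = false →
    (c.run O s).mem a = s.mem a
  | .skip, _, _ => rfl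
  | .seq c c', s, h => by
    simp only [Program.modArr, Bool.or_eq_false_iff] at h
    rw [Program.run, run_mem O a c' _ h.2, run_mem O a c s h.1]
  | .setReg _ _, _, _ => rfl
  | .ifLe e e' c c', s, h => by
    simp only [Program.modArr, Bool.or_eq_false_iff] at h
    rw [Program.run]
    split_ifs
    · rw [run_mem O a c _ h.1]; rfl
    · rw [run_mem O a c' _ h.2]; rfl
  | .loop i e c, s, h => by
    simp only [Program.modArr] at h
    rw [Program.run]
    refine foldl_range_induction (fun _ (s' : State F) => s'.mem a = s.mem a) rfl fun j _ s' hs' => ?_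
    rw [run_mem O a c _ h]
    simp [hs']
  | .setZero d, s, h => by
    simp only [Program.modArr, beq_eq_false_iff_ne] at h
    exact State.mem_set_ne _ _ _ (Ne.symm h)
  | .setOne d, s, h => by
    simp only [Program.modArr, beq_eq_false_iff_ne] at h
    exact State.mem_set_ne _ _ _ (Ne.symm h)
  | .op _ _ _ _, _, h => by
    simp only [Program.modArr, beq_eq_false_iff_ne] at h
    exact State.mem_set_ne _ _ _ (Ne.symm h)
  | .conj _ _, _, h => by
    simp only [Program.modArr, beq_eq_false_iff_ne] at h
    exact State.mem_set_ne _ _ _ (Ne.symm h)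
  | .ifZero x c c', s, h => by
    simp only [Program.modArr, Bool.or_eq_false_iff] at h
    rw [Program.run]
    split_ifs
    · rw [run_mem O a c _ h.1]; rfl
    · rw [run_mem O a c' _ h.2]; rfl
  | .diagonalize _ _ _ _, _, h => by
    simp only [Program.modArr, Bool.or_eq_false_iff, beq_eq_false_iff_ne] at h
    exact State.mem_diagonalize_ne _ _ _ _ _ _ (Ne.symm h.1) (Ne.symm h.2)

/-- Without oracle calls inside loops, the number of calls in the program text bounds the number of
calls made. -/
theorem run_calls (O : Oracle F) : ∀ (c : Program) (s : State F), c.noLoopCalls = true →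
    (c.run O s).calls ≤ s.calls + c.callCount
  | .skip, _, _ => le_rfl
  | .seq c c', s, h => by
    simp only [Program.noLoopCalls, Bool.and_eq_true] at h
    have h1 := run_calls O c s h.1
    have h2 := run_calls O c' (c.run O s) h.2
    rw [Program.run, Program.callCount]; omega
  | .setReg _ _, _, _ => le_rfl
  | .ifLe e e' c c', s, h => by
    simp only [Program.noLoopCalls, Bool.and_eq_true] at h
    have h1 := run_calls O c (s.tick 1) h.1
    have h2 := run_calls O c' (s.tick 1) h.2
    have h3 : (s.tick 1).calls = s.calls := rfl
    rw [Program.run, Program.callCount]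
    split_ifs <;> omega
  | .loop i e c, s, h => by
    simp only [Program.noLoopCalls, Bool.and_eq_true, beq_iff_eq] at h
    rw [Program.run, Program.callCount, h.1]
    refine foldl_range_induction (fun _ (s' : State F) => s'.calls ≤ s.calls + 0) le_rfl fun j _ s' hs' => ?_
    have h1 := run_calls O c ((s'.setReg i j).tick 1) h.2
    have h3 : ((s'.setReg i j).tick 1).calls = s'.calls := rfl
    omega
  | .setZero _, _, _ => le_rfl
  | .setOne _, _, _ => le_rfl
  | .op _ _ _ _, _, _ => le_rfl
  | .conj _ _, _, _ => le_rfl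
  | .ifZero x c c', s, h => by
    simp only [Program.noLoopCalls, Bool.and_eq_true] at h
    have h1 := run_calls O c (s.tick 1) h.1
    have h2 := run_calls O c' (s.tick 1) h.2
    have h3 : (s.tick 1).calls = s.calls := rfl
    rw [Program.run, Program.callCount]
    split_ifs <;> omega
  | .diagonalize _ _ _ _, _, _ => le_rfl

/-- Every loop bound refers only to registers that the program never writes, so it has the same
value at each evaluation and is at most b. Each constructor then raises the exponent by a constant.
For a loop of at most b iterations around a body of cost P ≥ 1, the total 1 + b(1 + P) is at most
b³P since b ≥ 2. -/
theorem run_steps (O : Oracle F) {b : ℕ} (hb : 2 ≤ b) {bad : ℕ → Bool} {ρ : ℕ → ℕ} :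
    ∀ (c : Program) (s : State F), (∀ r, c.modReg r = true → bad r = true) →
    c.boundsAvoid bad = true → (∀ r, bad r = false → s.reg r = ρ r) → c.boundsLe b ρ →
    (c.run O s).steps ≤ s.steps + b ^ c.weight
  | .skip, _, _, _, _, _ => Nat.le_add_right _ _
  | .seq c c', s, h1, h2, h3, h4 => by
    simp only [Program.boundsAvoid, Bool.and_eq_true] at h2
    simp only [Program.modReg, Bool.or_eq_true] at h1
    have e1 := run_steps O hb c s (fun r hr => h1 r (Or.inl hr)) h2.1 h3 h4.1
    have e2 := run_steps O hb c' (c.run O s) (fun r hr => h1 r (Or.inr hr)) h2.2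
      (fun r hr => by
        rw [run_reg O r c s, h3 r hr]
        by_contra hc
        rw [h1 r (Or.inl (by simpa using hc))] at hr
        exact absurd hr (by simp)) h4.2
    rw [Program.run, Program.weight]
    have p1 : b ^ c.weight ≤ b ^ (c.weight + c'.weight) := Nat.pow_le_pow_right (by omega) (by omega)
    have p2 : b ^ c'.weight ≤ b ^ (c.weight + c'.weight) :=
      Nat.pow_le_pow_right (by omega) (by omega)
    rw [pow_succ]
    have p3 := Nat.mul_le_mul_left (b ^ (c.weight + c'.weight)) hb
    omega
  | .setReg _ _, s, _, _, _, _ => le_rfl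
  | .ifLe e e' c c', s, h1, h2, h3, h4 => by
    simp only [Program.boundsAvoid, Bool.and_eq_true] at h2
    simp only [Program.modReg, Bool.or_eq_true] at h1
    have e1 := run_steps O hb c (s.tick 1) (fun r hr => h1 r (Or.inl hr)) h2.1 h3 h4.1
    have e2 := run_steps O hb c' (s.tick 1) (fun r hr => h1 r (Or.inr hr)) h2.2 h3 h4.2
    have ht : (s.tick 1).steps = s.steps + 1 := rfl
    have p1 : b ^ c.weight ≤ b ^ (c.weight + c'.weight) := Nat.pow_le_pow_right (by omega) (by omega)
    have p2 : b ^ c'.weight ≤ b ^ (c.weight + c'.weight) :=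
      Nat.pow_le_pow_right (by omega) (by omega)
    have p3 : 1 ≤ b ^ (c.weight + c'.weight) := Nat.one_le_pow _ _ (by omega)
    have p4 := Nat.mul_le_mul_left (b ^ (c.weight + c'.weight)) hb
    have p5 : 1 ≤ b ^ c.weight := Nat.one_le_pow _ _ (by omega)
    have p6 : 1 ≤ b ^ c'.weight := Nat.one_le_pow _ _ (by omega)
    rw [Program.run, Program.weight, pow_succ]
    split_ifs <;> omega
  | .loop i e c, s, h1, h2, h3, h4 => by
    simp only [Program.boundsAvoid, Bool.and_eq_true] at h2
    simp only [Program.modReg, Bool.or_eq_true, beq_iff_eq] at h1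
    have he : e.eval s.reg ≤ b := by
      rw [IdxExpr.eval_congr h3 e h2.1]; exact h4.1
    rw [Program.run]
    have key : ∀ N : ℕ, (fun s' : State F => (∀ r, bad r = false → s'.reg r = ρ r) ∧
        s'.steps ≤ s.steps + 1 + N * (1 + b ^ c.weight)) ((List.range N).foldl
          (fun s' j => c.run O ((s'.setReg i j).tick 1)) (s.tick 1)) := by
      intro N
      refine foldl_range_induction (fun j (s' : State F) => (∀ r, bad r = false → s'.reg r = ρ r) ∧
        s'.steps ≤ s.steps + 1 + j * (1 + b ^ c.weight)) ⟨h3, ?_⟩ fun j _ s' hs' => ?_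
      · simp [State.tick]
      · have hr : ∀ r, bad r = false → ((s'.setReg i j).tick 1).reg r = ρ r := by
          intro r hr
          have : r ≠ i := by
            rintro rfl
            rw [h1 r (Or.inl rfl)] at hr
            exact absurd hr (by simp)
          simp [Function.update_of_ne this, hs'.1 r hr]
        refine ⟨fun r hr' => ?_, ?_⟩
        · rw [run_reg, hr r hr']
          by_contra hc
          rw [h1 r (Or.inr (by simpa using hc))] at hr'
          exact absurd hr' (by simp)
        · have e1 := run_steps O hb c ((s'.setReg i j).tick 1) (fun r hr => h1 r (Or.inr hr))
            h2.2 hr h4.2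
          have ht : ((s'.setReg i j).tick 1).steps = s'.steps + 1 := rfl
          have := hs'.2
          rw [add_mul]
          omega
    refine (key _).2.trans ?_
    rw [Program.weight, pow_add]
    have p3 : 1 ≤ b ^ c.weight := Nat.one_le_pow _ _ (by omega)
    set P := b ^ c.weight
    have q1 : e.eval s.reg * (1 + P) ≤ b * (2 * P) := Nat.mul_le_mul he (by omega)
    have q2 : b * (2 * P) + P ≤ P * b ^ 3 := by
      have : b ^ 3 = b * b * b := by ring
      have h5 : 2 * b + 1 ≤ b ^ 3 := by rw [this]; nlinarith
      calc b * (2 * P) + P = P * (2 * b + 1) := by ring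
        _ ≤ _ := Nat.mul_le_mul_left _ h5
    omega
  | .setZero _, _, _, _, _, _ => le_rfl
  | .setOne _, _, _, _, _, _ => le_rfl
  | .op _ _ _ _, _, _, _, _, _ => le_rfl
  | .conj _ _, _, _, _, _, _ => le_rfl
  | .ifZero x c c', s, h1, h2, h3, h4 => by
    simp only [Program.boundsAvoid, Bool.and_eq_true] at h2
    simp only [Program.modReg, Bool.or_eq_true] at h1
    have e1 := run_steps O hb c (s.tick 1) (fun r hr => h1 r (Or.inl hr)) h2.1 h3 h4.1
    have e2 := run_steps O hb c' (s.tick 1) (fun r hr => h1 r (Or.inr hr)) h2.2 h3 h4.2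
    have ht : (s.tick 1).steps = s.steps + 1 := rfl
    have p1 : b ^ c.weight ≤ b ^ (c.weight + c'.weight) := Nat.pow_le_pow_right (by omega) (by omega)
    have p2 : b ^ c'.weight ≤ b ^ (c.weight + c'.weight) :=
      Nat.pow_le_pow_right (by omega) (by omega)
    have p3 : 1 ≤ b ^ (c.weight + c'.weight) := Nat.one_le_pow _ _ (by omega)
    have p4 := Nat.mul_le_mul_left (b ^ (c.weight + c'.weight)) hb
    have p5 : 1 ≤ b ^ c.weight := Nat.one_le_pow _ _ (by omega)
    have p6 : 1 ≤ b ^ c'.weight := Nat.one_le_pow _ _ (by omega)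
    rw [Program.run, Program.weight, pow_succ]
    split_ifs <;> omega
  | .diagonalize k src v w, s, h1, h2, h3, h4 => by
    have he : k.eval s.reg ≤ b := by
      rw [IdxExpr.eval_congr h3 k h2]; exact h4
    have e1 : (Program.run O (.diagonalize k src v w) s).steps =
      s.steps + (k.eval s.reg * k.eval s.reg + 1) := rfl
    rw [e1, Program.weight]
    have : k.eval s.reg * k.eval s.reg ≤ b * b := Nat.mul_le_mul he he
    have h3 : b ^ 3 = b * (b * b) := by ring
    rw [h3]
    nlinarith

/-- The state with some arrays replaced. -/
def State.withArrays (B : ℕ → Bool) (h : ℕ → ℕ → F) (s : State F) : State F :=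
  { s with mem := fun a => if B a then h a else s.mem a }

theorem withArrays_set (B : ℕ → Bool) (h : ℕ → ℕ → F) (s : State F) (x : Cell) (v : F)
    (hx : B x.arr = false) : (s.withArrays B h).set x v = (s.set x v).withArrays B h := by
  simp only [State.set, State.withArrays]
  congr 1
  ext a : 1
  by_cases ha : a = x.arr
  · subst ha; simp [hx]
  · simp [Function.update_of_ne ha]

theorem withArrays_get (B : ℕ → Bool) (h : ℕ → ℕ → F) (s : State F) (x : Cell)
    (hx : B x.arr = false) : (s.withArrays B h).get x = s.get x := by
  simp [State.get, State.withArrays, hx]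

/-- Noninterference: ignored arrays are neither read nor written, so replacing their contents
commutes with execution. It will show that the basis of L does not depend on the random numbers. -/
theorem run_withArrays (O : Oracle F) (B : ℕ → Bool) (h : ℕ → ℕ → F) :
    ∀ (c : Program) (s : State F), c.ignores B = true →
    c.run O (s.withArrays B h) = (c.run O s).withArrays B h
  | .skip, _, _ => rfl
  | .seq c c', s, hc => by
    simp only [Program.ignores, Bool.and_eq_true] at hc
    rw [Program.run, Program.run, run_withArrays O B h c s hc.1, run_withArrays O B h c' _ hc.2]
  | .setReg _ _, _, _ => rfl
  | .ifLe e e' c c', s, hc => by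
    simp only [Program.ignores, Bool.and_eq_true] at hc
    have h1 := run_withArrays O B h c (s.tick 1) hc.1
    have h2 := run_withArrays O B h c' (s.tick 1) hc.2
    have hr : (s.withArrays B h).reg = s.reg := rfl
    rw [Program.run, Program.run, hr]
    split_ifs
    · exact h1
    · exact h2
  | .loop i e c, s, hc => by
    simp only [Program.ignores] at hc
    have hr : (s.withArrays B h).reg = s.reg := rfl
    rw [Program.run, Program.run, hr]
    have key : ∀ (l : List ℕ) (s : State F),
        l.foldl (fun s' j => c.run O ((s'.setReg i j).tick 1)) (s.withArrays B h) =
          (l.foldl (fun s' j => c.run O ((s'.setReg i j).tick 1)) s).withArrays B h := by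
      intro l
      induction l with
      | nil => intro s; rfl
      | cons j l ih =>
        intro s
        have h1 := run_withArrays O B h c ((s.setReg i j).tick 1) hc
        rw [List.foldl_cons, List.foldl_cons, ← ih]
        exact congrArg (fun t => l.foldl (fun s' j => c.run O ((s'.setReg i j).tick 1)) t) h1
    exact key _ (s.tick 1)
  | .setZero d, s, hc => by
    simp only [Program.ignores, Bool.not_eq_true'] at hc
    rw [Program.run, Program.run, withArrays_set B h s d 0 hc]; rfl
  | .setOne d, s, hc => by
    simp only [Program.ignores, Bool.not_eq_true'] at hc
    rw [Program.run, Program.run, withArrays_set B h s d 1 hc]; rfl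
  | .op o d x y, s, hc => by
    simp only [Program.ignores, Bool.not_eq_true', Bool.and_eq_true] at hc
    rw [Program.run, Program.run, withArrays_get B h s x hc.2.1, withArrays_get B h s y hc.2.2,
      withArrays_set B h s d _ hc.1]; rfl
  | .conj d x, s, hc => by
    simp only [Program.ignores, Bool.not_eq_true', Bool.and_eq_true] at hc
    rw [Program.run, Program.run, withArrays_get B h s x hc.2, withArrays_set B h s d _ hc.1]; rfl
  | .ifZero x c c', s, hc => by
    simp only [Program.ignores, Bool.not_eq_true', Bool.and_eq_true] at hc
    have h1 := run_withArrays O B h c (s.tick 1) hc.2.1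
    have h2 := run_withArrays O B h c' (s.tick 1) hc.2.2
    rw [Program.run, Program.run, withArrays_get B h s x hc.1]
    split_ifs
    · exact h1
    · exact h2
  | .diagonalize k src v w, s, hc => by
    simp only [Program.ignores, Bool.not_eq_true', Bool.and_eq_true] at hc
    obtain ⟨h1, h2, h3⟩ := hc
    rw [Program.run, Program.run]
    simp only [State.diagonalize, State.withArrays, State.tick, h1]
    congr 1
    ext a : 1
    by_cases haw : a = w
    · subst haw
      by_cases hav : a = v
      · subst hav; simp [h3]; rfl
      · simp [h3, Function.update_of_ne hav]; rfl
    · by_cases hav : a = v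
      · subst hav; simp [h2, Function.update_of_ne haw]; rfl
      · simp [Function.update_of_ne hav, Function.update_of_ne haw]

/-- Induction over the iterations of a loop, for assertions that do not mention the counter. -/
theorem loop_induction (O : Oracle F) {i : ℕ} {e : IdxExpr} {c : Program} {s : State F}
    (P : ℕ → (ℕ → ℕ) → (ℕ → ℕ → F) → Prop)
    (hP : ∀ j reg mem v, P j reg mem → P j (Function.update reg i v) mem)
    (h0 : P 0 s.reg s.mem)
    (hs : ∀ j < e.eval s.reg, ∀ s' : State F,
      (∀ r, r ≠ i → c.modReg r = false → s'.reg r = s.reg r) → s'.reg i = j →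
      (∀ a, c.modArr a = false → s'.mem a = s.mem a) → P j s'.reg s'.mem →
      P (j + 1) (c.run O s').reg (c.run O s').mem) :
    P (e.eval s.reg) (Program.run O (.loop i e c) s).reg (Program.run O (.loop i e c) s).mem := by
  rw [Program.run]
  refine (foldl_range_induction (a := s.tick 1)
    (f := fun s' j => c.run O ((s'.setReg i j).tick 1)) (n := e.eval s.reg)
    (fun j (s' : State F) => (∀ r, r ≠ i → c.modReg r = false →
    s'.reg r = s.reg r) ∧ (∀ a, c.modArr a = false → s'.mem a = s.mem a) ∧
    P j s'.reg s'.mem) ⟨fun _ _ _ => rfl, fun _ _ => rfl, h0⟩ fun j hj s' hs' => ?_).2.2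
  have h1 : ∀ r, r ≠ i → c.modReg r = false → ((s'.setReg i j).tick 1).reg r = s.reg r := by
    intro r hr hc
    rw [State.reg_tick, State.reg_setReg, Function.update_of_ne hr, hs'.1 r hr hc]
  refine ⟨fun r hr hc => ?_, fun a hc => ?_, ?_⟩
  · rw [run_reg O r c _ hc, h1 r hr hc]
  · rw [run_mem O a c _ hc]; exact hs'.2.1 a hc
  · refine hs j hj _ h1 ?_ (fun a hc => hs'.2.1 a hc) (hP j _ _ j hs'.2.2)
    simp

/-- A loop whose body adds something to an array. -/
theorem loop_add (O : Oracle F) {i : ℕ} {e : IdxExpr} {c : Program} {s : State F} {dst : ℕ}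
    (Δ : ℕ → ℕ → F)
    (hs : ∀ j < e.eval s.reg, ∀ s' : State F,
      (∀ r, r ≠ i → c.modReg r = false → s'.reg r = s.reg r) → s'.reg i = j →
      (∀ a, c.modArr a = false → s'.mem a = s.mem a) →
      (c.run O s').mem dst = s'.mem dst + Δ j) :
    (Program.run O (.loop i e c) s).mem dst =
      s.mem dst + ∑ j ∈ Finset.range (e.eval s.reg), Δ j := by
  refine loop_induction O (fun N _ mem => mem dst = s.mem dst + ∑ j ∈ Finset.range N, Δ j)
    (fun _ _ _ _ h => h) (by simp) fun j hj s' h1 h2 h3 h4 => ?_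
  rw [hs j hj s' h1 h2 h3, h4, Finset.sum_range_succ, add_assoc]

/-- A loop whose body raises a flag. -/
theorem loop_flag (O : Oracle F) {i : ℕ} {e : IdxExpr} {c : Program} {s : State F} {b : ℕ}
    (hb : b ≠ i) (Q : ℕ → Prop)
    (hs : ∀ j < e.eval s.reg, ∀ s' : State F,
      (∀ r, r ≠ i → c.modReg r = false → s'.reg r = s.reg r) → s'.reg i = j →
      (∀ a, c.modArr a = false → s'.mem a = s.mem a) →
      ((c.run O s').reg b ≠ 0 ↔ s'.reg b ≠ 0 ∨ Q j)) :
    (Program.run O (.loop i e c) s).reg b ≠ 0 ↔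
      s.reg b ≠ 0 ∨ ∃ j < e.eval s.reg, Q j := by
  refine loop_induction O (fun N reg _ => reg b ≠ 0 ↔ s.reg b ≠ 0 ∨ ∃ j < N, Q j)
    (fun _ _ _ _ h => by rwa [Function.update_of_ne hb]) (by simp) fun j hj s' h1 h2 h3 h4 => ?_
  rw [hs j hj s' h1 h2 h3, h4, or_assoc]
  refine or_congr Iff.rfl ⟨?_, ?_⟩
  · rintro (⟨j', hj', hQ⟩ | hQ)
    · exact ⟨j', by omega, hQ⟩
    · exact ⟨j, by omega, hQ⟩
  · rintro ⟨j', hj', hQ⟩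
    rcases Nat.lt_succ_iff_lt_or_eq.1 hj' with h | rfl
    · exact Or.inl ⟨j', h, hQ⟩
    · exact Or.inr hQ

theorem run_seq (O : Oracle F) (c c' : Program) (s : State F) :
    Program.run O (.seq c c') s = c'.run O (c.run O s) := rfl

end Semantics

end Waring

namespace Waring

/-! ### Nested accumulating loops -/

section Loops

variable {F : Type*} [RCLike F]

theorem loop_add' (O : Oracle F) {i : ℕ} {e : IdxExpr} {c : Program} {s : State F} {dst N : ℕ}
    (hN : e.eval s.reg = N) (Δ : ℕ → ℕ → F)
    (hs : ∀ j < N, ∀ s' : State F,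
      (∀ r, r ≠ i → c.modReg r = false → s'.reg r = s.reg r) → s'.reg i = j →
      (∀ a, c.modArr a = false → s'.mem a = s.mem a) →
      (c.run O s').mem dst = s'.mem dst + Δ j) :
    (Program.run O (.loop i e c) s).mem dst = s.mem dst + ∑ j ∈ Finset.range N, Δ j := by
  subst hN
  exact loop_add O Δ hs

theorem loop2_add (O : Oracle F) {i j : ℕ} (hij : i ≠ j) {e e' : IdxExpr} {c : Program}
    (hi : c.modReg i = false) {s : State F} {dst N N' : ℕ} (hN : e.eval s.reg = N)
    (hN' : ∀ reg' : ℕ → ℕ, (∀ r, r ≠ i → r ≠ j → c.modReg r = false → reg' r = s.reg r) →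
      e'.eval reg' = N')
    (Δ : ℕ → ℕ → ℕ → F)
    (hs : ∀ a < N, ∀ b < N', ∀ s' : State F,
      (∀ r, r ≠ i → r ≠ j → c.modReg r = false → s'.reg r = s.reg r) → s'.reg i = a →
      s'.reg j = b → (∀ x, c.modArr x = false → s'.mem x = s.mem x) →
      (c.run O s').mem dst = s'.mem dst + Δ a b) :
    (Program.run O (.loop i e (.loop j e' c)) s).mem dst =
      s.mem dst + ∑ a ∈ Finset.range N, ∑ b ∈ Finset.range N', Δ a b := by
  refine loop_add' O hN (fun a => ∑ b ∈ Finset.range N', Δ a b) fun a ha s1 r1 e1 m1 => ?_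
  have r1' : ∀ r, r ≠ i → r ≠ j → c.modReg r = false → s1.reg r = s.reg r := fun r h1 h2 h3 =>
    r1 r h1 (by simp [Program.modReg, h3, Ne.symm h2])
  refine loop_add' O (hN' _ r1') (Δ a) fun b hb s2 r2 e2 m2 => ?_
  refine hs a ha b hb s2 (fun r h1 h2 h3 => ?_) ?_ e2 (fun x hx => ?_)
  · rw [r2 r h2 h3, r1' r h1 h2 h3]
  · rw [r2 i hij hi, e1]
  · rw [m2 x hx, m1 x hx]

theorem loop3_add (O : Oracle F) {i j l : ℕ} (hij : i ≠ j) (hil : i ≠ l) (hjl : j ≠ l)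
    {e e' e'' : IdxExpr} {c : Program}
    (hi : c.modReg i = false) (hj : c.modReg j = false) {s : State F} {dst N N' N'' : ℕ}
    (hN : e.eval s.reg = N)
    (hN' : ∀ reg' : ℕ → ℕ,
      (∀ r, r ≠ i → r ≠ j → r ≠ l → c.modReg r = false → reg' r = s.reg r) → e'.eval reg' = N')
    (hN'' : ∀ reg' : ℕ → ℕ,
      (∀ r, r ≠ i → r ≠ j → r ≠ l → c.modReg r = false → reg' r = s.reg r) → e''.eval reg' = N'')
    (Δ : ℕ → ℕ → ℕ → ℕ → F)
    (hs : ∀ a < N, ∀ b < N', ∀ d < N'', ∀ s' : State F,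
      (∀ r, r ≠ i → r ≠ j → r ≠ l → c.modReg r = false → s'.reg r = s.reg r) → s'.reg i = a →
      s'.reg j = b → s'.reg l = d → (∀ x, c.modArr x = false → s'.mem x = s.mem x) →
      (c.run O s').mem dst = s'.mem dst + Δ a b d) :
    (Program.run O (.loop i e (.loop j e' (.loop l e'' c))) s).mem dst =
      s.mem dst + ∑ a ∈ Finset.range N, ∑ b ∈ Finset.range N', ∑ d ∈ Finset.range N'', Δ a b d := by
  have hm : ∀ r, r ≠ l → c.modReg r = false → (Program.loop l e'' c).modReg r = false :=
    fun r h1 h2 => by simp [Program.modReg, h2, Ne.symm h1]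
  have hml : ∀ r, (Program.loop l e'' c).modReg r = false → r ≠ l ∧ c.modReg r = false := by
    intro r h
    simp only [Program.modReg, Bool.or_eq_false_iff, beq_eq_false_iff_ne] at h
    exact ⟨h.1.symm, h.2⟩
  refine loop2_add O hij (hm i hil hi) hN
    (fun reg' h => hN' reg' fun r h1 h2 h3 h4 => h r h1 h2 (hm r h3 h4))
    (fun a b => ∑ d ∈ Finset.range N'', Δ a b d) fun a ha b hb s1 r1 e1 e2 m1 => ?_
  have r1' : ∀ r, r ≠ i → r ≠ j → r ≠ l → c.modReg r = false → s1.reg r = s.reg r :=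
    fun r h1 h2 h3 h4 => r1 r h1 h2 (hm r h3 h4)
  refine loop_add' O (hN'' _ r1') (Δ a b) fun d hd s2 r2 e3 m2 => ?_
  refine hs a ha b hb d hd s2 (fun r h1 h2 h3 h4 => ?_) ?_ ?_ e3 (fun x hx => ?_)
  · rw [r2 r h3 h4, r1' r h1 h2 h3 h4]
  · rw [r2 i hil hi, e1]
  · rw [r2 j hjl hj, e2]
  · rw [m2 x hx, m1 x hx]

end Loops

/-! ### Elementary array operations -/

section Primitives

/-- `dst += x * y` -/
def addMul (d : ℕ) (e : IdxExpr) (x y : Cell) : Program :=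
  .seq (.op .mul ⟨40, 0⟩ x y) (.op .add ⟨d, e⟩ ⟨d, e⟩ ⟨40, 0⟩)

/-- `dst -= x * y` -/
def subMul (d : ℕ) (e : IdxExpr) (x y : Cell) : Program :=
  .seq (.op .mul ⟨40, 0⟩ x y) (.op .sub ⟨d, e⟩ ⟨d, e⟩ ⟨40, 0⟩)

/-- `dst += conj x * y` -/
def addConjMul (d : ℕ) (e : IdxExpr) (x y : Cell) : Program :=
  .seq (.conj ⟨40, 0⟩ x) (.seq (.op .mul ⟨40, 0⟩ ⟨40, 0⟩ y) (.op .add ⟨d, e⟩ ⟨d, e⟩ ⟨40, 0⟩))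

/-- `dst += x` -/
def addCopy (d : ℕ) (e : IdxExpr) (x : Cell) : Program := .op .add ⟨d, e⟩ ⟨d, e⟩ x

/-- `dst -= x` -/
def subCopy (d : ℕ) (e : IdxExpr) (x : Cell) : Program := .op .sub ⟨d, e⟩ ⟨d, e⟩ x

/-- `dst += 1` -/
def addOne (d : ℕ) (e : IdxExpr) : Program :=
  .seq (.setOne ⟨40, 0⟩) (.op .add ⟨d, e⟩ ⟨d, e⟩ ⟨40, 0⟩)

/-- `dst -= 1` -/
def subOne (d : ℕ) (e : IdxExpr) : Program :=
  .seq (.setOne ⟨40, 0⟩) (.op .sub ⟨d, e⟩ ⟨d, e⟩ ⟨40, 0⟩)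

variable {F : Type*} [RCLike F]

/-- Written as addition of a one-point function, an accumulation step fits the loop rules, and the
content of an array after a loop is a finite sum. -/
theorem update_add_eq (h : ℕ → F) (a : ℕ) (v : F) :
    Function.update h a (h a + v) = h + Pi.single a v := by
  ext x
  by_cases hx : x = a
  · subst hx; simp
  · simp [hx]

theorem update_sub_eq (h : ℕ → F) (a : ℕ) (v : F) :
    Function.update h a (h a - v) = h + -Pi.single a v := by
  ext x
  by_cases hx : x = a
  · subst hx; simp [sub_eq_add_neg]
  · simp [hx]

variable (O : Oracle F) (s : State F)

theorem addCopy_mem (d : ℕ) (e : IdxExpr) (x : Cell) :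
    ((addCopy d e x).run O s).mem d = s.mem d + Pi.single (e.eval s.reg) (s.get x) := by
  simp only [addCopy, Program.run, State.mem_tick, FieldOp.eval]
  rw [State.mem_set_same s ⟨d, e⟩, ← update_add_eq]; rfl

theorem subCopy_mem (d : ℕ) (e : IdxExpr) (x : Cell) :
    ((subCopy d e x).run O s).mem d = s.mem d + -Pi.single (e.eval s.reg) (s.get x) := by
  simp only [subCopy, Program.run, State.mem_tick, FieldOp.eval]
  rw [State.mem_set_same s ⟨d, e⟩, ← update_sub_eq]; rfl

theorem mem_set_tmp (x : Cell) (v : F) (r : IdxExpr) :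
    (s.set ⟨x.arr, r⟩ v).get ⟨x.arr, r⟩ = v := by
  simp [State.get, State.mem_set]

theorem addMul_mem {d : ℕ} (hd : d ≠ 40) (e : IdxExpr) (x y : Cell) :
    ((addMul d e x y).run O s).mem d =
      s.mem d + Pi.single (e.eval s.reg) (s.get x * s.get y) := by
  rw [addMul, run_seq]
  refine (addCopy_mem O _ d e _).trans ?_
  simp only [Program.run, State.mem_tick, State.reg_tick, State.reg_set, State.get_tick,
    FieldOp.eval, mem_set_tmp s ⟨40, 0⟩]
  rw [State.mem_set_ne _ _ _ hd]

theorem subMul_mem {d : ℕ} (hd : d ≠ 40) (e : IdxExpr) (x y : Cell) :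
    ((subMul d e x y).run O s).mem d =
      s.mem d + -Pi.single (e.eval s.reg) (s.get x * s.get y) := by
  rw [subMul, run_seq]
  refine (subCopy_mem O _ d e _).trans ?_
  simp only [Program.run, State.mem_tick, State.reg_tick, State.reg_set, State.get_tick,
    FieldOp.eval, mem_set_tmp s ⟨40, 0⟩]
  rw [State.mem_set_ne _ _ _ hd]

theorem addOne_mem {d : ℕ} (hd : d ≠ 40) (e : IdxExpr) :
    ((addOne d e).run O s).mem d = s.mem d + Pi.single (e.eval s.reg) 1 := by
  rw [addOne, run_seq]
  refine (addCopy_mem O _ d e _).trans ?_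
  simp only [Program.run, State.mem_tick, State.reg_tick, State.reg_set, State.get_tick,
    mem_set_tmp s ⟨40, 0⟩]
  rw [State.mem_set_ne _ _ _ hd]

theorem subOne_mem {d : ℕ} (hd : d ≠ 40) (e : IdxExpr) :
    ((subOne d e).run O s).mem d = s.mem d + -Pi.single (e.eval s.reg) 1 := by
  rw [subOne, run_seq]
  refine (subCopy_mem O _ d e _).trans ?_
  simp only [Program.run, State.mem_tick, State.reg_tick, State.reg_set, State.get_tick,
    mem_set_tmp s ⟨40, 0⟩]
  rw [State.mem_set_ne _ _ _ hd]

/-- The conjugate is stored in the scratch cell before the second factor is read, so that factor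
must lie in another array. -/
theorem addConjMul_mem {d : ℕ} (hd : d ≠ 40) (e : IdxExpr) (x y : Cell) (hy : y.arr ≠ 40) :
    ((addConjMul d e x y).run O s).mem d =
      s.mem d + Pi.single (e.eval s.reg) (starRingEnd F (s.get x) * s.get y) := by
  rw [addConjMul, run_seq]
  refine (addMul_mem O _ hd e _ _).trans ?_
  have h : (Program.run O (.conj ⟨40, 0⟩ x) s).get y = s.get y := by
    simp only [State.get]
    rw [run_mem O y.arr _ _ (by simpa [Program.modArr] using hy.symm)]
    rfl
  rw [h]
  simp only [Program.run, State.mem_tick, State.reg_tick, State.reg_set, State.get_tick,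
    mem_set_tmp s ⟨40, 0⟩]
  rw [State.mem_set_ne _ _ _ hd]

theorem run_ifZero (x : Cell) (c c' : Program) :
    Program.run O (.ifZero x c c') s =
      if s.get x = 0 then c.run O (s.tick 1) else c'.run O (s.tick 1) := by
  rw [Program.run]

theorem run_ifLe (e e' : IdxExpr) (c c' : Program) :
    Program.run O (.ifLe e e' c c') s =
      if e.eval s.reg ≤ e'.eval s.reg then c.run O (s.tick 1) else c'.run O (s.tick 1) := rfl

theorem run_setReg (i : ℕ) (e : IdxExpr) :
    (Program.run O (.setReg (.const i) e) s).reg = Function.update s.reg i (e.eval s.reg) := rfl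

theorem run_setReg_mem (i e : IdxExpr) :
    (Program.run O (.setReg i e) s).mem = s.mem := rfl

end Primitives

/-! ### Matrices stored in arrays, kernels from Gram matrices -/

section Arrays

variable {F : Type*} [RCLike F]

theorem rowMajor_inj {V i j i' j' : ℕ} (hj : j < V) (hj' : j' < V)
    (h : i * V + j = i' * V + j') : i = i' ∧ j = j' := by
  have h1 : (i * V + j) / V = i := by
    rw [add_comm, Nat.add_mul_div_right _ _ (by omega), Nat.div_eq_of_lt hj, zero_add]
  have h2 : (i' * V + j') / V = i' := by
    rw [add_comm, Nat.add_mul_div_right _ _ (by omega), Nat.div_eq_of_lt hj', zero_add]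
  have : i = i' := by rw [← h1, ← h2, h]
  subst this
  exact ⟨rfl, by omega⟩

theorem sum_ite_rowMajor {U V i j : ℕ} (hi : i < U) (hj : j < V) {M : Type*} [AddCommMonoid M]
    (G : ℕ → ℕ → M) :
    ∑ a ∈ Finset.range U, ∑ b ∈ Finset.range V, (if i * V + j = a * V + b then G a b else 0) =
      G i j := by
  rw [Finset.sum_eq_single i, Finset.sum_eq_single j, if_pos rfl]
  · exact fun b hb hne => if_neg fun h => hne (rowMajor_inj hj (Finset.mem_range.1 hb) h).2.symm
  · exact fun h => absurd (Finset.mem_range.2 hj) h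
  · exact fun a _ hne => Finset.sum_eq_zero fun b hb =>
      if_neg fun h => hne (rowMajor_inj hj (Finset.mem_range.1 hb) h).1.symm
  · exact fun h => absurd (Finset.mem_range.2 hi) h

theorem sum_single_rowMajor {U V i j : ℕ} (hi : i < U) (hj : j < V) (G : ℕ → ℕ → F) :
    (∑ a ∈ Finset.range U, ∑ b ∈ Finset.range V, Pi.single (a * V + b) (G a b) : ℕ → F)
      (i * V + j) = G i j := by
  rw [← sum_ite_rowMajor hi hj G]
  simp only [Finset.sum_apply, Pi.single_apply]

theorem sum_pi_single {ι : Type*} (S : Finset ι) (a : ℕ) (g : ι → F) :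
    ∑ i ∈ S, (Pi.single a (g i) : ℕ → F) = Pi.single a (∑ i ∈ S, g i) := by
  ext x
  by_cases hx : x = a
  · subst hx; simp
  · simp [hx]

/-- A row of an array, as a functional. -/
def rowDot (V r : ℕ) (x : ℕ → F) : (ℕ → F) →ₗ[F] F where
  toFun h := ∑ v ∈ Finset.range V, h (r * V + v) * x v
  map_add' g h := by simp [add_mul, Finset.sum_add_distrib]
  map_smul' c h := by simp [Finset.mul_sum, mul_assoc]

/-- Rows are evaluated as functionals on the whole array. A matrix assembled entry by entry is then
read row by row by linearity. -/
theorem rowDot_single {V v' : ℕ} (hv : v' < V) (r r' : ℕ) (x : ℕ → F) (g : F) :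
    rowDot V r x (Pi.single (r' * V + v') g) = if r = r' then g * x v' else 0 := by
  simp only [rowDot, LinearMap.coe_mk, AddHom.coe_mk, Pi.single_apply]
  split_ifs with h
  · subst h
    rw [Finset.sum_eq_single v']
    · simp
    · intro v hv1 hne
      rw [if_neg (fun h => hne (by omega)), zero_mul]
    · exact fun h => absurd (Finset.mem_range.2 hv) h
  · refine Finset.sum_eq_zero fun v hv1 => ?_
    rw [if_neg (fun h' => h (rowMajor_inj (Finset.mem_range.1 hv1) hv h').1), zero_mul]

/-- The matrix that stands row by row in an array. -/
def arrMat (h : ℕ → F) (a b : ℕ) : Matrix (Fin a) (Fin b) F := Matrix.of fun i j => h (i * b + j)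

theorem arrMat_apply (h : ℕ → F) (a b : ℕ) (i : Fin a) (j : Fin b) :
    arrMat h a b i j = h (i * b + j) := rfl

theorem arrMat_mulVec (h : ℕ → F) (a b : ℕ) (x : ℕ → F) (i : Fin a) :
    (arrMat h a b).mulVec (fun j => x j) i = rowDot b i x h := by
  simp only [Matrix.mulVec, dotProduct, arrMat_apply, rowDot, LinearMap.coe_mk, AddHom.coe_mk]
  rw [Finset.sum_range]

theorem mem_diagonalize (O : Oracle F) (s : State F) (k src v w : ℕ) (hvw : v ≠ w) :
    arrMat ((s.diagonalize O k src v w).mem v) k k = (O k (arrMat (s.mem src) k k)).1 ∧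
    (fun j : Fin k => (s.diagonalize O k src v w).mem w j) = (O k (arrMat (s.mem src) k k)).2 := by
  constructor
  · ext i j
    simp only [State.diagonalize, arrMat_apply]
    rw [Function.update_of_ne hvw, Function.update_self]
    have hlt : (i : ℕ) * k + j < k * k := by
      calc (i : ℕ) * k + j < i * k + k := by omega
        _ = (i + 1) * k := by ring
        _ ≤ k * k := Nat.mul_le_mul_right _ i.2
    rw [dif_pos hlt]
    have : finProdFinEquiv.symm ⟨(i : ℕ) * k + j, hlt⟩ = (i, j) := by
      rw [Equiv.symm_apply_eq]
      ext
      simp [finProdFinEquiv, add_comm, mul_comm]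
    rw [this]
    rfl
  · ext j
    simp only [State.diagonalize]
    rw [Function.update_self, dif_pos j.2]
    rfl

/-- The columns of `Q` at the zeros of `d` are a basis of the kernel of `K`. -/
def IsKernelBasis {m v : Type*} [Fintype m] [Fintype v] [DecidableEq v] (K : Matrix m v F)
    (Q : Matrix v v F) (d : v → F) : Prop :=
  IsUnit Q.det ∧ (∀ j, d j = 0 → K.mulVec (fun i => Q i j) = 0) ∧
  ∀ x, K.mulVec x = 0 → ∃ c : v → F, (∀ j, d j ≠ 0 → c j = 0) ∧ x = Q.mulVec c

open Matrix ComplexOrder in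
-- K^*K and K have the same kernel. In the eigenbasis Q, a vector is in the kernel exactly when its
-- coordinates at nonzero eigenvalues vanish.
theorem isKernelBasis_of_gram {m v : Type*} [Fintype m] [Fintype v] [DecidableEq v]
    (K : Matrix m v F) (Q : Matrix v v F) (d : v → F) (hQ : IsUnit Q.det)
    (h : Kᴴ * K * Q = Q * Matrix.diagonal d) : IsKernelBasis K Q d := by
  refine ⟨hQ, fun j hj => ?_, fun x hx => ?_⟩
  · have h1 : (Kᴴ * K).mulVec (fun i => Q i j) = 0 := by
      ext i
      have := congrFun (congrFun h i) j
      rw [Matrix.mul_diagonal, hj, mul_zero] at this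
      exact this
    rwa [Matrix.conjTranspose_mul_self_mulVec_eq_zero] at h1
  · refine ⟨Q⁻¹.mulVec x, fun j hj => ?_, ?_⟩
    · have h1 : Q.mulVec ((Matrix.diagonal d).mulVec (Q⁻¹.mulVec x)) = 0 := by
        rw [Matrix.mulVec_mulVec, ← h, Matrix.mulVec_mulVec, Matrix.mul_assoc,
          Matrix.mul_nonsing_inv _ hQ, Matrix.mul_one, ← Matrix.mulVec_mulVec, hx,
          Matrix.mulVec_zero]
      have h2 : (Matrix.diagonal d).mulVec (Q⁻¹.mulVec x) = 0 := by
        have := congrArg Q⁻¹.mulVec h1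
        rwa [Matrix.mulVec_mulVec, Matrix.nonsing_inv_mul _ hQ, Matrix.one_mulVec,
          Matrix.mulVec_zero] at this
      have h3 := congrFun h2 j
      rw [Matrix.mulVec_diagonal] at h3
      exact (mul_eq_zero.1 h3).resolve_left hj
    · rw [Matrix.mulVec_mulVec, Matrix.mul_nonsing_inv _ hQ, Matrix.one_mulVec]

/-- The registers that serve as loop counters. -/
def loopReg (r : ℕ) : Bool := r == 10 || r == 11 || r == 12 || r == 13

/-- Add the Gram matrix of the columns of an `E × V` matrix to an array. -/
def gram (E V : IdxExpr) (src dst : ℕ) : Program :=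
  .loop 10 V (.loop 11 V (.loop 12 E
    (addConjMul dst (rg 10 * V + rg 11) ⟨src, rg 12 * V + rg 10⟩ ⟨src, rg 12 * V + rg 11⟩)))

theorem gram_mem (O : Oracle F) {E V : IdxExpr} (hE : E.avoids loopReg = true)
    (hV : V.avoids loopReg = true) {src dst : ℕ} (h1 : dst ≠ 40) (h2 : src ≠ 40) (h3 : src ≠ dst)
    {s : State F} (h0 : s.mem dst = 0) :
    arrMat (((gram E V src dst).run O s).mem dst) (V.eval s.reg) (V.eval s.reg) =
      (arrMat (s.mem src) (E.eval s.reg) (V.eval s.reg)).conjTranspose *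
        arrMat (s.mem src) (E.eval s.reg) (V.eval s.reg) := by
  have hreg : ∀ e : IdxExpr, e.avoids loopReg = true → ∀ reg' : ℕ → ℕ,
      (∀ r, r ≠ 10 → r ≠ 11 → r ≠ 12 → reg' r = s.reg r) → e.eval reg' = e.eval s.reg := by
    intro e he reg' hr
    refine IdxExpr.eval_congr (fun r hb => ?_) e he
    simp only [loopReg, Bool.or_eq_false_iff, beq_eq_false_iff_ne] at hb
    exact hr r hb.1.1.1 hb.1.1.2 hb.1.2
  have key : ((gram E V src dst).run O s).mem dst = s.mem dst +
      ∑ i ∈ Finset.range (V.eval s.reg), ∑ j ∈ Finset.range (V.eval s.reg),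
        ∑ e ∈ Finset.range (E.eval s.reg), Pi.single (i * V.eval s.reg + j)
          (starRingEnd F (s.mem src (e * V.eval s.reg + i)) *
            s.mem src (e * V.eval s.reg + j)) := by
    refine loop3_add O (by decide) (by decide) (by decide) rfl rfl rfl
      (fun reg' h => hreg V hV reg' fun r a b c => h r a b c rfl)
      (fun reg' h => hreg E hE reg' fun r a b c => h r a b c rfl) _
      fun a ha b hb e he s' hr e1 e2 e3 hm => ?_
    rw [addConjMul_mem O s' h1 _ _ _ h2]
    have hs : s'.mem src = s.mem src :=
      hm src (by simp [Program.modArr, addConjMul, h2.symm, h3.symm])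
    have hv := hreg V hV s'.reg fun r a b c => hr r a b c rfl
    simp only [State.get, IdxExpr.eval_add, IdxExpr.eval_mul, IdxExpr.eval_rg, e1, e2, e3, hs, hv]
  ext i j
  rw [arrMat_apply, key, h0, zero_add]
  simp only [sum_pi_single]
  rw [sum_single_rowMajor i.2 j.2, Matrix.mul_apply, Finset.sum_range]
  rfl

/-- Through the spectral theorem this guarantees that every valid oracle answers correctly on Gram
matrices. -/
theorem exists_diagonalization_of_isHermitian {v : ℕ} {A : Matrix (Fin v) (Fin v) F}
    (hA : A.IsHermitian) :
    ∃ (Q : Matrix (Fin v) (Fin v) F) (d : Fin v → F), IsUnit Q.det ∧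
      A * Q = Q * Matrix.diagonal d := by
  have h := hA.spectral_theorem
  rw [Unitary.conjStarAlgAut_apply] at h
  have hU := Unitary.coe_star_mul_self hA.eigenvectorUnitary
  refine ⟨hA.eigenvectorUnitary, RCLike.ofReal ∘ hA.eigenvalues,
    Matrix.UnitaryGroup.det_isUnit hA.eigenvectorUnitary, ?_⟩
  have key : ∀ U D : Matrix (Fin v) (Fin v) F, A = U * D * star U → star U * U = 1 →
      A * U = U * D := fun U D h1 h2 => by rw [h1, Matrix.mul_assoc, h2, Matrix.mul_one]
  exact key _ _ h hU

/-- Compute a basis of the kernel of an `E × V` matrix. -/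
def ker (E V : IdxExpr) (src H Q D : ℕ) : Program :=
  .seq (gram E V src H) (.diagonalize V H Q D)

theorem ker_spec {O : Oracle F} (hO : O.IsValid) {E V : IdxExpr} (hE : E.avoids loopReg = true)
    (hV : V.avoids loopReg = true) {src H Q D : ℕ} (h1 : H ≠ 40) (h2 : src ≠ 40) (h3 : src ≠ H)
    (h4 : Q ≠ D) {s : State F} (h0 : s.mem H = 0) {e v : ℕ} (he : E.eval s.reg = e)
    (hv : V.eval s.reg = v) :
    IsKernelBasis (arrMat (s.mem src) e v) (arrMat (((ker E V src H Q D).run O s).mem Q) v v)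
      (fun j : Fin v => ((ker E V src H Q D).run O s).mem D j) := by
  subst he hv
  have hv' : V.eval ((gram E V src H).run O s).reg = V.eval s.reg := by
    refine IdxExpr.eval_congr (fun r hb => run_reg O r _ s ?_) V hV
    simp only [loopReg, Bool.or_eq_false_iff, beq_eq_false_iff_ne] at hb
    simp [gram, addConjMul, Program.modReg, Ne.symm hb.1.1.1, Ne.symm hb.1.1.2, Ne.symm hb.1.2]
  have hm := mem_diagonalize O ((gram E V src H).run O s) (V.eval s.reg) H Q D h4
  rw [gram_mem O hE hV h1 h2 h3 h0] at hm
  have hrun : ((ker E V src H Q D).run O s).mem =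
      (((gram E V src H).run O s).diagonalize O (V.eval s.reg) H Q D).mem := by
    rw [ker, run_seq, Program.run, hv']
    rfl
  set K := arrMat (s.mem src) (E.eval s.reg) (V.eval s.reg)
  have hH : (K.conjTranspose * K).IsHermitian := Matrix.isHermitian_conjTranspose_mul_self K
  have hval := hO _ (K.conjTranspose * K) (exists_diagonalization_of_isHermitian hH)
  rw [hrun, hm.1, hm.2]
  exact isKernelBasis_of_gram K _ _ hval.1 hval.2

/-- Find a zero of `D` at which a given row of `Q` does not vanish. -/
def pick (V : IdxExpr) (D Q : ℕ) (row : IdxExpr) (pr fr : ℕ) : Program :=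
  .loop 10 V (.ifZero ⟨D, rg 10⟩ (.ifZero ⟨Q, row * V + rg 10⟩ .skip
    (.seq (.setReg (.const pr) (rg 10)) (.setReg (.const fr) 1))) .skip)

/-- The flag stays zero exactly when the whole kernel has coordinate zero in the given row.
Otherwise the last suitable column is recorded. -/
theorem pick_spec (O : Oracle F) {V row : IdxExpr} {D Q pr fr v w : ℕ} {s : State F}
    (hpr : 13 < pr) (hfr : 13 < fr) (hne : pr ≠ fr)
    (hV : ∀ reg' : ℕ → ℕ, (∀ r < 10, reg' r = s.reg r) → V.eval reg' = v)
    (hrow : ∀ reg' : ℕ → ℕ, (∀ r < 10, reg' r = s.reg r) → row.eval reg' = w)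
    (h0 : s.reg fr = 0) :
    (((pick V D Q row pr fr).run O s).reg fr = 0 ∧
      ∀ j < v, s.mem D j = 0 → s.mem Q (w * v + j) = 0) ∨
    (1 ≤ ((pick V D Q row pr fr).run O s).reg fr ∧
      ((pick V D Q row pr fr).run O s).reg pr < v ∧
      s.mem D (((pick V D Q row pr fr).run O s).reg pr) = 0 ∧
      s.mem Q (w * v + ((pick V D Q row pr fr).run O s).reg pr) ≠ 0) := by
  have hv := hV s.reg fun _ _ => rfl
  have key := loop_induction O (i := 10) (e := V) (s := s)
    (c := .ifZero ⟨D, rg 10⟩ (.ifZero ⟨Q, row * V + rg 10⟩ .skip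
      (.seq (.setReg (.const pr) (rg 10)) (.setReg (.const fr) 1))) .skip)
    (fun N reg _ => (reg fr = 0 ∧ ∀ j < N, s.mem D j = 0 → s.mem Q (w * v + j) = 0) ∨
      (1 ≤ reg fr ∧ reg pr < v ∧ s.mem D (reg pr) = 0 ∧ s.mem Q (w * v + reg pr) ≠ 0))
    (fun j reg mem x h => by
      rwa [Function.update_of_ne (by omega), Function.update_of_ne (by omega)])
    (Or.inl ⟨h0, by simp⟩) fun j hj s' h1 h2 h3 h4 => ?_
  · rw [hv] at key; exact key
  · have hmem : s'.mem = s.mem := funext fun a => h3 a rfl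
    have hr : ∀ r < 10, s'.reg r = s.reg r := fun r hr => h1 r (by omega) (by
      simp [Program.modReg]; omega)
    have g1 : s'.get ⟨D, rg 10⟩ = s.mem D j := by simp [State.get, h2, hmem]
    have g2 : (s'.tick 1).get ⟨Q, row * V + rg 10⟩ = s.mem Q (w * v + j) := by
      simp [State.get, h2, hmem, hV _ hr, hrow _ hr]
    rw [run_ifZero, g1]
    split_ifs with c1
    · rw [run_ifZero, g2]
      split_ifs with c2
      · rcases h4 with h4 | h4
        · refine Or.inl ⟨h4.1, fun j' hj' => ?_⟩
          rcases Nat.lt_succ_iff_lt_or_eq.1 hj' with h | rfl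
          · exact h4.2 j' h
          · exact fun _ => c2
        · exact Or.inr h4
      · right
        rw [run_seq, run_setReg, run_setReg, Function.update_self, Function.update_of_ne hne,
          Function.update_self]
        simp only [State.reg_tick, IdxExpr.eval_rg, h2]
        exact ⟨le_rfl, hv ▸ hj, c1, c2⟩
    · rcases h4 with h4 | h4
      · refine Or.inl ⟨h4.1, fun j' hj' => ?_⟩
        rcases Nat.lt_succ_iff_lt_or_eq.1 hj' with h | rfl
        · exact h4.2 j' h
        · exact fun h => absurd h c1
      · exact Or.inr h4

end Arrays

end Waring

namespace Waring

/-! ### Initialization and the linear conditions that define L -/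

section Stages

variable {F : Type*} [RCLike F]

/-- Compute `⌈m/2⌉`, `n ^ (⌈m/2⌉ - 1)`, `n ^ ⌈m/2⌉` and `n ^ ⌊m/2⌋`. -/
def initProg : Program :=
  .seq (.loop 10 (rg 1) (.ifLe (2 * rg 2 + 1) (rg 1) (.setReg (.const 2) (rg 2 + 1)) .skip))
  (.seq (.setReg (.const 3) 1) (.seq (.setReg (.const 5) 1)
  (.seq (.loop 10 (rg 1) (.seq
      (.ifLe (rg 10 + 2) (rg 2) (.setReg (.const 3) (rg 3 * rg 0)) .skip)
      (.ifLe (rg 10 + 1 + rg 2) (rg 1) (.setReg (.const 5) (rg 5 * rg 0)) .skip)))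
    (.setReg (.const 4) (rg 3 * rg 0)))))

theorem initProg_reg (O : Oracle F) (s : State F) {n m : ℕ} (hm : 1 ≤ m) (h0 : s.reg 0 = n)
    (h1 : s.reg 1 = m) (h2 : s.reg 2 = 0) :
    (initProg.run O s).reg 0 = n ∧ (initProg.run O s).reg 1 = m ∧
    (initProg.run O s).reg 2 = (m + 1) / 2 ∧
    (initProg.run O s).reg 3 = n ^ ((m + 1) / 2 - 1) ∧
    (initProg.run O s).reg 4 = n ^ ((m + 1) / 2) ∧ (initProg.run O s).reg 5 = n ^ (m / 2) ∧
    ∀ r, 5 < r → r ≠ 10 → (initProg.run O s).reg r = s.reg r := by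
  have e0 : (initProg.run O s).reg 0 = n := by rw [run_reg O 0 _ s rfl, h0]
  have e1 : (initProg.run O s).reg 1 = m := by rw [run_reg O 1 _ s rfl, h1]
  refine ⟨e0, e1, ?_⟩
  simp only [initProg, run_seq]
  set s1 := Program.run O (.loop 10 (rg 1)
    (.ifLe (2 * rg 2 + 1) (rg 1) (.setReg (.const 2) (rg 2 + 1)) .skip)) s with hs1
  have k1 : s1.reg 2 = (m + 1) / 2 := by
    -- The register grows by one as long as twice its value is less than m, so it stops at ⌈m/2⌉; m
    -- iterations are more than enough.
    have := loop_induction O (i := 10) (e := rg 1) (s := s)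
      (c := .ifLe (2 * rg 2 + 1) (rg 1) (.setReg (.const 2) (rg 2 + 1)) .skip)
      (fun j reg _ => reg 2 = min j ((m + 1) / 2))
      (fun j reg mem x h => by simpa [Function.update_of_ne] using h) (by simp [h2])
      fun j hj s' r1 r2 r3 r4 => by
        have h1' : s'.reg 1 = m := by rw [r1 1 (by decide) rfl, h1]
        rw [run_ifLe]
        simp only [IdxExpr.eval_add, IdxExpr.eval_mul, IdxExpr.eval_rg, IdxExpr.eval_zero, IdxExpr.eval_one, IdxExpr.eval_two, h1', r4]
        split_ifs with hc
        · rw [run_setReg, Function.update_self]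
          simp only [State.reg_tick, IdxExpr.eval_add, IdxExpr.eval_rg, IdxExpr.eval_zero, IdxExpr.eval_one, IdxExpr.eval_two, r4]
          omega
        · simp only [Program.run, State.reg_tick, r4]
          omega
    simp only [IdxExpr.eval_rg, h1] at this
    rw [hs1, this]
    omega
  have k0 : s1.reg 0 = n := by rw [hs1, run_reg O 0 _ s rfl, h0]
  have k11 : s1.reg 1 = m := by rw [hs1, run_reg O 1 _ s rfl, h1]
  set s2 := Program.run O (.setReg (.const 3) 1) s1 with hs2
  set s3 := Program.run O (.setReg (.const 5) 1) s2 with hs3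
  have q : s3.reg = Function.update (Function.update s1.reg 3 1) 5 1 := rfl
  have q0 : s3.reg 0 = n := by rw [q]; simpa using k0
  have q1 : s3.reg 1 = m := by rw [q]; simpa using k11
  have q2 : s3.reg 2 = (m + 1) / 2 := by rw [q]; simpa using k1
  have q3 : s3.reg 3 = 1 := by rw [q]; simp
  have q5 : s3.reg 5 = 1 := by rw [q]; simp
  set s4 := Program.run O (.loop 10 (rg 1) (.seq
      (.ifLe (rg 10 + 2) (rg 2) (.setReg (.const 3) (rg 3 * rg 0)) .skip)
      (.ifLe (rg 10 + 1 + rg 2) (rg 1) (.setReg (.const 5) (rg 5 * rg 0)) .skip))) s3 with hs4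
  have key : s4.reg 3 = n ^ (min m ((m + 1) / 2 - 1)) ∧ s4.reg 5 = n ^ (min m (m / 2)) := by
    -- The two tests let exactly ⌈m/2⌉ - 1 and ⌊m/2⌋ of the m iterations multiply by n.
    have := loop_induction O (i := 10) (e := rg 1) (s := s3)
      (c := (.seq (.ifLe (rg 10 + 2) (rg 2) (.setReg (.const 3) (rg 3 * rg 0)) .skip)
        (.ifLe (rg 10 + 1 + rg 2) (rg 1) (.setReg (.const 5) (rg 5 * rg 0)) .skip)))
      (fun j reg _ => reg 3 = n ^ (min j ((m + 1) / 2 - 1)) ∧ reg 5 = n ^ (min j (m / 2)))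
      (fun j reg mem x h => by simpa [Function.update_of_ne] using h) (by simp [q3, q5])
      fun j hj s' r1 r2 r3 r4 => by
        have h0' : s'.reg 0 = n := by rw [r1 0 (by decide) rfl, q0]
        have h1' : s'.reg 1 = m := by rw [r1 1 (by decide) rfl, q1]
        have h2' : s'.reg 2 = (m + 1) / 2 := by rw [r1 2 (by decide) rfl, q2]
        simp only [run_seq, run_ifLe]
        simp only [IdxExpr.eval_add, IdxExpr.eval_rg, IdxExpr.eval_zero, IdxExpr.eval_one, IdxExpr.eval_two, r2, h2']
        have a1 : (if j + 2 ≤ (m + 1) / 2 then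
            Program.run O (.setReg (.const 3) (rg 3 * rg 0)) (s'.tick 1)
            else Program.run O .skip (s'.tick 1)).reg =
            Function.update s'.reg 3 (n ^ (min (j + 1) ((m + 1) / 2 - 1))) := by
          split_ifs with hc
          · rw [run_setReg]
            simp only [State.reg_tick, IdxExpr.eval_mul, IdxExpr.eval_rg, r4.1, h0']
            rw [← pow_succ]
            congr 2
            omega
          · simp only [Program.run, State.reg_tick]
            rw [show min (j + 1) ((m + 1) / 2 - 1) = min j ((m + 1) / 2 - 1) by omega, ← r4.1,
              Function.update_eq_self]
        generalize (if j + 2 ≤ (m + 1) / 2 then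
          Program.run O (.setReg (.const 3) (rg 3 * rg 0)) (s'.tick 1)
          else Program.run O .skip (s'.tick 1)) = s'' at a1 ⊢
        rw [a1]
        have t10 : (10 : ℕ) ≠ 3 := by decide
        simp only [Function.update_of_ne t10, r2]
        rw [Function.update_of_ne (by decide), Function.update_of_ne (by decide), h1', h2']
        split_ifs with hc
        · rw [run_setReg, State.reg_tick, a1]
          simp only [IdxExpr.eval_mul, IdxExpr.eval_rg]
          constructor
          · simp
          · rw [Function.update_self, Function.update_of_ne (by decide),
              Function.update_of_ne (by decide), r4.2, h0', ← pow_succ]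
            congr 1
            omega
        · simp only [Program.run, State.reg_tick]
          rw [a1]
          refine ⟨by simp, ?_⟩
          rw [Function.update_of_ne (by decide), r4.2]
          congr 1
          omega
    simp only [IdxExpr.eval_rg, q1] at this
    exact this
  have z0 : s4.reg 0 = n := by rw [hs4, run_reg O 0 _ s3 rfl, q0]
  have z2 : s4.reg 2 = (m + 1) / 2 := by rw [hs4, run_reg O 2 _ s3 rfl, q2]
  rw [run_setReg]
  refine ⟨by simpa using z2, ?_, ?_, ?_, fun r hr hr' => ?_⟩
  · rw [Function.update_of_ne (by decide), key.1]
    congr 1; omega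
  · rw [Function.update_self]
    simp only [IdxExpr.eval_mul, IdxExpr.eval_rg, key.1, z0]
    rw [← pow_succ]
    congr 1; omega
  · rw [Function.update_of_ne (by decide), key.2]
    congr 1; omega
  · have f1 : ∀ i, i ≤ 5 → (i == r) = false := fun i hi => by simp; omega
    have f2 : (10 == r) = false := by simpa using hr'.symm
    rw [Function.update_of_ne (by omega), hs4, run_reg O r _ s3, hs3, run_reg O r _ s2, hs2,
      run_reg O r _ s1, hs1, run_reg O r _ s] <;> simp [Program.modReg] <;> omega

/-- The linear conditions on `S^k ⊗ S^k`: the columns lie in the image of the flattening, and the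
tensor is invariant under rotation of its `2k` factors. -/
def fillSymRows : Program :=
  .seq (.loop 10 (rg 4) (.ifZero ⟨12, rg 10⟩ (.loop 11 (rg 4) (.loop 12 (rg 4)
    (addCopy 13 ((rg 10 * rg 4 + rg 11) * (rg 4 * rg 4) + (rg 12 + rg 4 * rg 11))
      ⟨11, rg 12 * rg 4 + rg 10⟩))) .skip))
  (.loop 10 (rg 0) (.loop 11 (rg 3 * rg 4) (.seq
    (addOne 13 ((rg 4 * rg 4 + (rg 10 * (rg 3 * rg 4) + rg 11)) * (rg 4 * rg 4) +
      (rg 10 + rg 0 * rg 11)))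
    (subOne 13 ((rg 4 * rg 4 + (rg 10 * (rg 3 * rg 4) + rg 11)) * (rg 4 * rg 4) +
      (rg 11 + rg 3 * rg 4 * rg 10))))))

open Classical in
theorem fillSymRows_mem (O : Oracle F) {s : State F} (h0 : s.mem 13 = 0) {n K N : ℕ}
    (hn : s.reg 0 = n) (hK : s.reg 3 = K) (hN : s.reg 4 = N) :
    (fillSymRows.run O s).mem 13 =
      (∑ c ∈ Finset.range N, if s.mem 12 c = 0 then ∑ j ∈ Finset.range N, ∑ p ∈ Finset.range N,
          Pi.single ((c * N + j) * (N * N) + (p + N * j)) (s.mem 11 (p * N + c)) else 0) +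
      ∑ i ∈ Finset.range n, ∑ y ∈ Finset.range (K * N),
        (Pi.single ((N * N + (i * (K * N) + y)) * (N * N) + (i + n * y)) 1 +
          -Pi.single ((N * N + (i * (K * N) + y)) * (N * N) + (y + K * N * i)) 1) := by
  rw [fillSymRows, run_seq]
  set c1 : Program := .loop 10 (rg 4) (.ifZero ⟨12, rg 10⟩ (.loop 11 (rg 4) (.loop 12 (rg 4)
    (addCopy 13 ((rg 10 * rg 4 + rg 11) * (rg 4 * rg 4) + (rg 12 + rg 4 * rg 11))
      ⟨11, rg 12 * rg 4 + rg 10⟩))) .skip) with hc1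
  have e1 : (c1.run O s).mem 13 = s.mem 13 +
      ∑ c ∈ Finset.range N, if s.mem 12 c = 0 then ∑ j ∈ Finset.range N, ∑ p ∈ Finset.range N,
          Pi.single ((c * N + j) * (N * N) + (p + N * j)) (s.mem 11 (p * N + c)) else 0 := by
    refine loop_add' O (e := rg 4) (s := s) hN _ fun c hc s' r1 e1 m1 => ?_
    have hN' : s'.reg 4 = N := by rw [r1 4 (by decide) rfl, hN]
    have g : s'.get ⟨12, rg 10⟩ = s.mem 12 c := by
      simp only [State.get, IdxExpr.eval_rg, e1, m1 12 rfl]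
    rw [run_ifZero, g]
    split_ifs with hz
    · refine loop2_add O (e := rg 4) (s := s'.tick 1) (by decide) rfl hN'
        (fun reg' h => by rw [IdxExpr.eval_rg, h 4 (by decide) (by decide) rfl]; exact hN') _
        fun a _ b _ s2 r2 e2 e3 m2 => ?_
      have hN2 : s2.reg 4 = N := by rw [r2 4 (by decide) (by decide) rfl]; exact hN'
      have h10 : s2.reg 10 = c := by rw [r2 10 (by decide) (by decide) rfl]; exact e1
      have hm : s2.mem 11 = s.mem 11 := by rw [m2 11 rfl]; exact m1 11 rfl
      rw [addCopy_mem]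
      simp only [State.get, IdxExpr.eval_add, IdxExpr.eval_mul, IdxExpr.eval_rg, hN2, h10, e2, e3,
        hm]
    · simp [Program.run]
  have e2 : s.mem 13 = (0 : ℕ → F) := h0
  rw [e2, zero_add] at e1
  rw [← e1]
  refine loop2_add O (by decide) rfl ?_ (fun reg' h => ?_) _ fun i _ y _ s' r1 f1 f2 m1 => ?_
  · rw [IdxExpr.eval_rg, run_reg O 0 _ s rfl, hn]
  · simp only [IdxExpr.eval_mul, IdxExpr.eval_rg]
    rw [h 3 (by decide) (by decide) rfl, h 4 (by decide) (by decide) rfl,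
      run_reg O 3 _ s rfl, run_reg O 4 _ s rfl, hK, hN]
  · have g0 : s'.reg 0 = n := by
      rw [r1 0 (by decide) (by decide) rfl, run_reg O 0 _ s rfl, hn]
    have g3 : s'.reg 3 = K := by
      rw [r1 3 (by decide) (by decide) rfl, run_reg O 3 _ s rfl, hK]
    have g4 : s'.reg 4 = N := by
      rw [r1 4 (by decide) (by decide) rfl, run_reg O 4 _ s rfl, hN]
    rw [run_seq, subOne_mem O _ (by decide), addOne_mem O _ (by decide)]
    rw [show ((addOne 13 ((rg 4 * rg 4 + (rg 10 * (rg 3 * rg 4) + rg 11)) * (rg 4 * rg 4) +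
      (rg 10 + rg 0 * rg 11))).run O s').reg = s'.reg from rfl]
    simp only [IdxExpr.eval_add, IdxExpr.eval_mul, IdxExpr.eval_rg, g0, g3, g4, f1, f2, add_assoc]

open Classical in
-- The first N² rows are numbered by a kernel vector c and a column j, and the rotation conditions
-- start at row N². Rows for which c does not belong to the kernel basis are zero and impose
-- nothing.
theorem fillSymRows_col (O : Oracle F) {s : State F} (h0 : s.mem 13 = 0) {n K N : ℕ}
    (hn : s.reg 0 = n) (hK : s.reg 3 = K) (hN : s.reg 4 = N) (hKn : K * n = N) (x : ℕ → F)
    {c j : ℕ} (hc : c < N) (hj : j < N) :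
    rowDot (N * N) (c * N + j) x ((fillSymRows.run O s).mem 13) =
      if s.mem 12 c = 0 then ∑ p ∈ Finset.range N, s.mem 11 (p * N + c) * x (p + N * j)
      else 0 := by
  have hlt : ∀ p < N, ∀ j < N, p + N * j < N * N := fun p hp j hj => by nlinarith
  rw [fillSymRows_mem O h0 hn hK hN, map_add, map_sum]
  have h2 : rowDot (N * N) (c * N + j) x (∑ i ∈ Finset.range n, ∑ y ∈ Finset.range (K * N),
        (Pi.single ((N * N + (i * (K * N) + y)) * (N * N) + (i + n * y)) 1 +
          -Pi.single ((N * N + (i * (K * N) + y)) * (N * N) + (y + K * N * i)) 1)) = 0 := by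
    rw [map_sum]
    refine Finset.sum_eq_zero fun i hi => ?_
    rw [map_sum]
    refine Finset.sum_eq_zero fun y hy => ?_
    rw [Finset.mem_range] at hi hy
    -- The column conditions occupy rows below N², so no rotation row interferes.
    have hcj : c * N + j ≠ N * N + (i * (K * N) + y) := by nlinarith
    have hNN : K * N * n = N * N := by rw [← hKn]; ring
    rw [map_add, map_neg, rowDot_single (by nlinarith), rowDot_single (by nlinarith), if_neg hcj,
      if_neg hcj]
    simp
  rw [h2, add_zero]
  have h1 : ∀ c' ∈ Finset.range N, rowDot (N * N) (c * N + j) x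
      (if s.mem 12 c' = 0 then ∑ j' ∈ Finset.range N, ∑ p ∈ Finset.range N,
        Pi.single ((c' * N + j') * (N * N) + (p + N * j')) (s.mem 11 (p * N + c')) else 0) =
      ∑ j' ∈ Finset.range N, if c * N + j = c' * N + j' then
        (if s.mem 12 c' = 0 then ∑ p ∈ Finset.range N, s.mem 11 (p * N + c') * x (p + N * j')
          else 0) else 0 := by
    intro c' _
    split_ifs with hz
    · rw [map_sum]
      refine Finset.sum_congr rfl fun j' hj' => ?_
      rw [map_sum]
      rw [Finset.sum_congr rfl fun p hp => rowDot_single (hlt p (Finset.mem_range.1 hp) j'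
        (Finset.mem_range.1 hj')) _ _ _ _]
      split_ifs <;> simp
    · simp
  rw [Finset.sum_congr rfl h1, sum_ite_rowMajor hc hj]

/-- The addresses i + n y and y + n^{2k-1} i place the index i first and last: the row compares an
entry with the one whose indices are rotated by one place. -/
theorem fillSymRows_rot (O : Oracle F) {s : State F} (h0 : s.mem 13 = 0) {n K N : ℕ}
    (hn : s.reg 0 = n) (hK : s.reg 3 = K) (hN : s.reg 4 = N) (hKn : K * n = N) (x : ℕ → F)
    {i y : ℕ} (hi : i < n) (hy : y < K * N) :
    rowDot (N * N) (N * N + (i * (K * N) + y)) x ((fillSymRows.run O s).mem 13) =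
      x (i + n * y) - x (y + K * N * i) := by
  classical
  have hlt : ∀ p < N, ∀ j < N, p + N * j < N * N := fun p hp j hj => by nlinarith
  have hNN : K * N * n = N * N := by rw [← hKn]; ring
  rw [fillSymRows_mem O h0 hn hK hN, map_add, map_sum]
  have h1 : ∀ c ∈ Finset.range N, rowDot (N * N) (N * N + (i * (K * N) + y)) x
      (if s.mem 12 c = 0 then ∑ j' ∈ Finset.range N, ∑ p ∈ Finset.range N,
        Pi.single ((c * N + j') * (N * N) + (p + N * j')) (s.mem 11 (p * N + c)) else 0) = 0 := by
    intro c hc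
    rw [Finset.mem_range] at hc
    split_ifs with hz
    · rw [map_sum]
      refine Finset.sum_eq_zero fun j' hj' => ?_
      rw [map_sum]
      refine Finset.sum_eq_zero fun p hp => ?_
      rw [Finset.mem_range] at hj' hp
      rw [rowDot_single (hlt p hp j' hj'), if_neg (by nlinarith)]
    · simp
  rw [Finset.sum_eq_zero h1, zero_add, map_sum]
  rw [← sum_ite_rowMajor hi hy (fun i y => x (i + n * y) - x (y + K * N * i))]
  refine Finset.sum_congr rfl fun i' hi' => ?_
  rw [map_sum]
  refine Finset.sum_congr rfl fun y' hy' => ?_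
  rw [Finset.mem_range] at hi' hy'
  rw [map_add, map_neg, rowDot_single (by nlinarith), rowDot_single (by nlinarith)]
  simp only [Nat.add_left_cancel_iff]
  split_ifs <;> simp [sub_eq_add_neg]

end Stages

end Waring

namespace Waring

/-! ### Random combinations and the ratio matrix -/

section Stages

variable {F : Type*} [RCLike F]

/-- The two random combinations of the basis vectors of the kernel. -/
def combine : Program :=
  .loop 10 (rg 4 * rg 4) (.ifZero ⟨16, rg 10⟩
    (.seq (.loop 11 (rg 4 * rg 4) (.seq
        (addMul 17 (rg 11) ⟨1, rg 20⟩ ⟨15, rg 11 * (rg 4 * rg 4) + rg 10⟩)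
        (addMul 18 (rg 11) ⟨2, rg 20⟩ ⟨15, rg 11 * (rg 4 * rg 4) + rg 10⟩)))
      (.setReg (.const 20) (rg 20 + 1))) .skip)

open Classical in
-- Register 20 counts the kernel columns met so far and addresses the random coordinates. The l-th
-- random number thus multiplies the l-th zero of the eigenvalue array in increasing order.
theorem combine_spec (O : Oracle F) {s : State F} {V : ℕ} (hV : s.reg 4 * s.reg 4 = V)
    (h20 : s.reg 20 = 0) (h17 : s.mem 17 = 0) (h18 : s.mem 18 = 0) :
    (combine.run O s).reg 20 = Nat.count (fun j => s.mem 16 j = 0) V ∧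
    (∀ v < V, (combine.run O s).mem 17 v =
      ∑ l ∈ Finset.range (Nat.count (fun j => s.mem 16 j = 0) V),
        s.mem 1 l * s.mem 15 (v * V + Nat.nth (fun j => s.mem 16 j = 0) l)) ∧
    ∀ v < V, (combine.run O s).mem 18 v =
      ∑ l ∈ Finset.range (Nat.count (fun j => s.mem 16 j = 0) V),
        s.mem 2 l * s.mem 15 (v * V + Nat.nth (fun j => s.mem 16 j = 0) l) := by
  set p : ℕ → Prop := fun j => s.mem 16 j = 0 with hp
  have key := loop_induction O (i := 10) (e := rg 4 * rg 4) (s := s)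
    (c := .ifZero ⟨16, rg 10⟩
      (.seq (.loop 11 (rg 4 * rg 4) (.seq
          (addMul 17 (rg 11) ⟨1, rg 20⟩ ⟨15, rg 11 * (rg 4 * rg 4) + rg 10⟩)
          (addMul 18 (rg 11) ⟨2, rg 20⟩ ⟨15, rg 11 * (rg 4 * rg 4) + rg 10⟩)))
        (.setReg (.const 20) (rg 20 + 1))) .skip)
    (fun j reg mem => reg 20 = Nat.count p j ∧
      (∀ v < V, mem 17 v = ∑ l ∈ Finset.range (Nat.count p j),
        s.mem 1 l * s.mem 15 (v * V + Nat.nth p l)) ∧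
      ∀ v < V, mem 18 v = ∑ l ∈ Finset.range (Nat.count p j),
        s.mem 2 l * s.mem 15 (v * V + Nat.nth p l))
    (fun j reg mem x h => by simpa [Function.update_of_ne] using h)
    (by simp [h20, h17, h18]) fun j hj s' r1 e1 m1 h => ?_
  · simp only [IdxExpr.eval_mul, IdxExpr.eval_rg, hV] at key
    exact key
  · have g : s'.get ⟨16, rg 10⟩ = s.mem 16 j := by
      simp only [State.get, IdxExpr.eval_rg, e1, m1 16 rfl]
    have g4 : s'.reg 4 = s.reg 4 := r1 4 (by decide) rfl
    rw [run_ifZero, g]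
    split_ifs with hz
    · have hcount : Nat.count p (j + 1) = Nat.count p j + 1 := by
        rw [Nat.count_succ, if_pos hz]
      -- The column just met is the next selected one.
      have hnth : Nat.nth p (Nat.count p j) = j := Nat.nth_count hz
      rw [run_seq]
      set c1 : Program := .loop 11 (rg 4 * rg 4) (.seq
          (addMul 17 (rg 11) ⟨1, rg 20⟩ ⟨15, rg 11 * (rg 4 * rg 4) + rg 10⟩)
          (addMul 18 (rg 11) ⟨2, rg 20⟩ ⟨15, rg 11 * (rg 4 * rg 4) + rg 10⟩)) with hc1
      have hN : (rg 4 * rg 4).eval (s'.tick 1).reg = V := by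
        simp only [IdxExpr.eval_mul, IdxExpr.eval_rg, State.reg_tick, g4, hV]
      have a17 : (c1.run O (s'.tick 1)).mem 17 = s'.mem 17 + ∑ v ∈ Finset.range V,
          Pi.single v (s.mem 1 (Nat.count p j) * s.mem 15 (v * V + j)) := by
        refine loop_add' O hN _ fun v hv s2 r2 e2 m2 => ?_
        have q4 : s2.reg 4 * s2.reg 4 = V := by
          rw [r2 4 (by decide) rfl, State.reg_tick, g4, hV]
        have q10 : s2.reg 10 = j := by rw [r2 10 (by decide) rfl, State.reg_tick, e1]
        have q20 : s2.reg 20 = Nat.count p j := by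
          rw [r2 20 (by decide) rfl, State.reg_tick, h.1]
        have m1' : s2.mem 1 = s.mem 1 := by rw [m2 1 rfl, State.mem_tick, m1 1 rfl]
        have m15 : s2.mem 15 = s.mem 15 := by rw [m2 15 rfl, State.mem_tick, m1 15 rfl]
        rw [run_seq, run_mem O 17 (addMul 18 _ _ _) _ rfl, addMul_mem O _ (by decide)]
        simp only [State.get, IdxExpr.eval_add, IdxExpr.eval_mul, IdxExpr.eval_rg, q4, q10, q20,
          e2, m1', m15]
      have a18 : (c1.run O (s'.tick 1)).mem 18 = s'.mem 18 + ∑ v ∈ Finset.range V,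
          Pi.single v (s.mem 2 (Nat.count p j) * s.mem 15 (v * V + j)) := by
        refine loop_add' O hN _ fun v hv s2 r2 e2 m2 => ?_
        have q4 : s2.reg 4 * s2.reg 4 = V := by
          rw [r2 4 (by decide) rfl, State.reg_tick, g4, hV]
        have q10 : s2.reg 10 = j := by rw [r2 10 (by decide) rfl, State.reg_tick, e1]
        have q20 : s2.reg 20 = Nat.count p j := by
          rw [r2 20 (by decide) rfl, State.reg_tick, h.1]
        have m2' : s2.mem 2 = s.mem 2 := by rw [m2 2 rfl, State.mem_tick, m1 2 rfl]
        have m15 : s2.mem 15 = s.mem 15 := by rw [m2 15 rfl, State.mem_tick, m1 15 rfl]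
        rw [run_seq, addMul_mem O _ (by decide)]
        have f1 : ∀ s3 : State F, ((addMul 17 (rg 11) ⟨1, rg 20⟩
          ⟨15, rg 11 * (rg 4 * rg 4) + rg 10⟩).run O s3).reg = s3.reg := fun _ => rfl
        simp only [State.get, IdxExpr.eval_add, IdxExpr.eval_mul, IdxExpr.eval_rg, f1, q4, q10,
          q20, e2]
        rw [run_mem O 18 (addMul 17 _ _ _) _ rfl, run_mem O 2 (addMul 17 _ _ _) _ rfl,
          run_mem O 15 (addMul 17 _ _ _) _ rfl, m2', m15]
      have hsingle : ∀ (G : ℕ → F) (v : ℕ), v < V →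
          (∑ v ∈ Finset.range V, Pi.single v (G v) : ℕ → F) v = G v := by
        intro G v hv
        simp [Finset.sum_apply, Pi.single_apply, hv]
      rw [run_setReg, run_setReg_mem, hcount]
      refine ⟨?_, fun v hv => ?_, fun v hv => ?_⟩
      · rw [Function.update_self]
        simp only [IdxExpr.eval_add, IdxExpr.eval_rg, IdxExpr.eval_zero, IdxExpr.eval_one, IdxExpr.eval_two]
        rw [run_reg O 20 c1 _ rfl, State.reg_tick, h.1]
      · rw [a17, Pi.add_apply, hsingle _ v hv, h.2.1 v hv, Finset.sum_range_succ, hnth]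
      · rw [a18, Pi.add_apply, hsingle _ v hv, h.2.2 v hv, Finset.sum_range_succ, hnth]
    · have hcount : Nat.count p (j + 1) = Nat.count p j := by
        rw [Nat.count_succ, if_neg hz, add_zero]
      rw [hcount]
      exact h

/-- The system `W (B^* B) = t A` for a matrix `W` and a number `t`. -/
def fillRatioRows : Program :=
  .loop 10 (rg 4) (.loop 11 (rg 4) (.seq
    (.loop 12 (rg 4) (addCopy 20
      ((rg 10 * rg 4 + rg 11) * (rg 4 * rg 4 + 1) + (rg 10 * rg 4 + rg 12))
      ⟨19, rg 12 * rg 4 + rg 11⟩))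
    (subCopy 20 ((rg 10 * rg 4 + rg 11) * (rg 4 * rg 4 + 1) + rg 4 * rg 4)
      ⟨17, rg 10 * rg 4 + rg 11⟩)))

/-- The unknown vector contains W row by row and then t at position N². Keeping t unknown makes the
system homogeneous, so that the kernel routine can solve it. -/
theorem fillRatioRows_row (O : Oracle F) {s : State F} (h0 : s.mem 20 = 0) {N : ℕ}
    (hN : s.reg 4 = N) (x : ℕ → F) {p j : ℕ} (hp : p < N) (hj : j < N) :
    rowDot (N * N + 1) (p * N + j) x ((fillRatioRows.run O s).mem 20) =
      ∑ q ∈ Finset.range N, s.mem 19 (q * N + j) * x (p * N + q) -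
        s.mem 17 (p * N + j) * x (N * N) := by
  have key : (fillRatioRows.run O s).mem 20 = s.mem 20 + ∑ p ∈ Finset.range N,
      ∑ j ∈ Finset.range N, (∑ q ∈ Finset.range N,
        Pi.single ((p * N + j) * (N * N + 1) + (p * N + q)) (s.mem 19 (q * N + j)) +
        -Pi.single ((p * N + j) * (N * N + 1) + N * N) (s.mem 17 (p * N + j))) := by
    refine loop2_add O (e := rg 4) (s := s) (by decide) rfl hN
      (fun reg' h => by rw [IdxExpr.eval_rg, h 4 (by decide) (by decide) rfl, hN]) _
      fun a _ b _ s' r1 e1 e2 m1 => ?_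
    have q4 : s'.reg 4 = N := by rw [r1 4 (by decide) (by decide) rfl, hN]
    rw [run_seq, subCopy_mem]
    rw [loop_add' O (e := rg 4) (N := N) q4 (fun q => Pi.single
      ((a * N + b) * (N * N + 1) + (a * N + q)) (s.mem 19 (q * N + b))) fun q _ s2 r2 f2 m2 => ?_]
    · set c1 : Program := .loop 12 (rg 4) (addCopy 20
        ((rg 10 * rg 4 + rg 11) * (rg 4 * rg 4 + 1) + (rg 10 * rg 4 + rg 12))
        ⟨19, rg 12 * rg 4 + rg 11⟩) with hc1
      have w4 : (c1.run O s').reg 4 = N := by rw [run_reg O 4 c1 _ rfl, q4]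
      have w10 : (c1.run O s').reg 10 = a := by rw [run_reg O 10 c1 _ rfl, e1]
      have w11 : (c1.run O s').reg 11 = b := by rw [run_reg O 11 c1 _ rfl, e2]
      have w17 : (c1.run O s').mem 17 = s.mem 17 := by rw [run_mem O 17 c1 _ rfl, m1 17 rfl]
      simp only [State.get, IdxExpr.eval_add, IdxExpr.eval_mul, IdxExpr.eval_rg,
        IdxExpr.eval_zero, IdxExpr.eval_one, IdxExpr.eval_two, w4, w10, w11, w17, add_assoc]
    · have w4 : s2.reg 4 = N := by rw [r2 4 (by decide) rfl, q4]
      have w10 : s2.reg 10 = a := by rw [r2 10 (by decide) rfl, e1]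
      have w11 : s2.reg 11 = b := by rw [r2 11 (by decide) rfl, e2]
      have w19 : s2.mem 19 = s.mem 19 := by rw [m2 19 rfl, m1 19 rfl]
      rw [addCopy_mem]
      simp only [State.get, IdxExpr.eval_add, IdxExpr.eval_mul, IdxExpr.eval_rg,
        IdxExpr.eval_zero, IdxExpr.eval_one, IdxExpr.eval_two, w4, w10, w11, w19, f2]
  rw [key, h0, zero_add, map_sum]
  rw [← sum_ite_rowMajor hp hj (fun p j => ∑ q ∈ Finset.range N,
    s.mem 19 (q * N + j) * x (p * N + q) - s.mem 17 (p * N + j) * x (N * N))]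
  refine Finset.sum_congr rfl fun p' hp' => ?_
  rw [map_sum]
  refine Finset.sum_congr rfl fun j' hj' => ?_
  rw [Finset.mem_range] at hp' hj'
  rw [map_add, map_neg, map_sum, rowDot_single (by omega)]
  rw [Finset.sum_congr rfl fun q hq => rowDot_single (by
    rw [Finset.mem_range] at hq; nlinarith) _ _ _ _]
  split_ifs <;> simp [sub_eq_add_neg]

/-- `X = W B^*`, with `W` in a column of array 22. -/
def fillRatio : Program :=
  .loop 10 (rg 4) (.loop 11 (rg 4) (.loop 12 (rg 4)
    (addConjMul 24 (rg 10 * rg 4 + rg 11) ⟨18, rg 11 * rg 4 + rg 12⟩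
      ⟨22, (rg 10 * rg 4 + rg 12) * (rg 4 * rg 4 + 1) + rg 21⟩)))

theorem fillRatio_mem (O : Oracle F) {s : State F} (h0 : s.mem 24 = 0) {N t : ℕ}
    (hN : s.reg 4 = N) (ht : s.reg 21 = t) {p q : ℕ} (hp : p < N) (hq : q < N) :
    (fillRatio.run O s).mem 24 (p * N + q) = ∑ e ∈ Finset.range N,
      starRingEnd F (s.mem 18 (q * N + e)) * s.mem 22 ((p * N + e) * (N * N + 1) + t) := by
  have key : (fillRatio.run O s).mem 24 = s.mem 24 + ∑ p ∈ Finset.range N,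
      ∑ q ∈ Finset.range N, ∑ e ∈ Finset.range N, Pi.single (p * N + q)
        (starRingEnd F (s.mem 18 (q * N + e)) *
          s.mem 22 ((p * N + e) * (N * N + 1) + t)) := by
    refine loop3_add O (e := rg 4) (s := s) (by decide) (by decide) (by decide) rfl rfl hN
      (fun reg' h => by rw [IdxExpr.eval_rg, h 4 (by decide) (by decide) (by decide) rfl, hN])
      (fun reg' h => by rw [IdxExpr.eval_rg, h 4 (by decide) (by decide) (by decide) rfl, hN]) _
      fun a _ b _ e _ s' r1 e1 e2 e3 m1 => ?_
    have q4 : s'.reg 4 = N := by rw [r1 4 (by decide) (by decide) (by decide) rfl, hN]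
    have q21 : s'.reg 21 = t := by rw [r1 21 (by decide) (by decide) (by decide) rfl, ht]
    rw [addConjMul_mem O _ (by decide) _ _ _ (by decide)]
    simp only [State.get, IdxExpr.eval_add, IdxExpr.eval_mul, IdxExpr.eval_rg,
      IdxExpr.eval_zero, IdxExpr.eval_one, IdxExpr.eval_two, q4, q21, e1, e2, e3, m1 18 rfl, m1 22 rfl]
  rw [key, h0, zero_add]
  simp only [sum_pi_single]
  rw [sum_single_rowMajor hp hq]

end Stages

end Waring

namespace Waring

/-! ### Reading vectors from eigenvectors and computing their powers -/

section Stages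

variable {F : Type*} [RCLike F]

/-- Find a fiber in the first direction of the eigenvector in column `rg 10` of array 25 that does
not vanish; register 25 gets its number plus one. -/
def findFiber : Program :=
  .loop 11 (rg 3) (.loop 12 (rg 0) (.ifZero ⟨25, (rg 11 + rg 3 * rg 12) * rg 4 + rg 10⟩ .skip
    (.setReg (.const 25) (rg 11 + 1))))

/-- The number of the fibre is stored increased by one, so that zero means that none was found. -/
theorem findFiber_spec (O : Oracle F) {s : State F} {n K N j : ℕ} (hn : s.reg 0 = n)
    (hK : s.reg 3 = K) (hN : s.reg 4 = N) (hj : s.reg 10 = j) (h25 : s.reg 25 = 0) :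
    ((findFiber.run O s).reg 25 = 0 ∧
      ∀ p < K, ∀ i < n, s.mem 25 ((p + K * i) * N + j) = 0) ∨
    (1 ≤ (findFiber.run O s).reg 25 ∧ (findFiber.run O s).reg 25 - 1 < K ∧ ∃ i < n,
      s.mem 25 (((findFiber.run O s).reg 25 - 1 + K * i) * N + j) ≠ 0) := by
  have key := loop_induction O (i := 11) (e := rg 3) (s := s)
    (c := .loop 12 (rg 0) (.ifZero ⟨25, (rg 11 + rg 3 * rg 12) * rg 4 + rg 10⟩ .skip
      (.setReg (.const 25) (rg 11 + 1))))
    (fun P reg _ => (reg 25 = 0 ∧ ∀ p < P, ∀ i < n, s.mem 25 ((p + K * i) * N + j) = 0) ∨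
      (1 ≤ reg 25 ∧ reg 25 - 1 < K ∧ ∃ i < n, s.mem 25 ((reg 25 - 1 + K * i) * N + j) ≠ 0))
    (fun _ reg mem x h => by simpa [Function.update_of_ne] using h)
    (Or.inl ⟨h25, by simp⟩) fun p hp s1 r1 e1 m1 h1 => ?_
  · simp only [IdxExpr.eval_rg, hK] at key
    exact key
  · have hp' : p < K := by simpa [hK] using hp
    have key2 := loop_induction O (i := 12) (e := rg 0) (s := s1)
      (c := .ifZero ⟨25, (rg 11 + rg 3 * rg 12) * rg 4 + rg 10⟩ .skip
        (.setReg (.const 25) (rg 11 + 1)))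
      (fun I reg _ => (reg 25 = 0 ∧ (∀ p' < p, ∀ i < n, s.mem 25 ((p' + K * i) * N + j) = 0) ∧
          ∀ i < I, s.mem 25 ((p + K * i) * N + j) = 0) ∨
        (1 ≤ reg 25 ∧ reg 25 - 1 < K ∧ ∃ i < n, s.mem 25 ((reg 25 - 1 + K * i) * N + j) ≠ 0))
      (fun _ reg mem x h => by simpa [Function.update_of_ne] using h)
      (h1.imp (fun h => ⟨h.1, h.2, by simp⟩) id) fun i hi s2 r2 e2 m2 h2 => ?_
    · simp only [IdxExpr.eval_rg] at key2
      rw [r1 0 (by decide) rfl, hn] at key2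
      refine key2.imp (fun h => ⟨h.1, fun p' hp' => ?_⟩) id
      rcases Nat.lt_succ_iff_lt_or_eq.1 hp' with hlt | rfl
      · exact h.2.1 p' hlt
      · exact h.2.2
    · have hi' : i < n := by
        rw [IdxExpr.eval_rg, r1 0 (by decide) rfl, hn] at hi
        exact hi
      have g : s2.get ⟨25, (rg 11 + rg 3 * rg 12) * rg 4 + rg 10⟩ =
          s.mem 25 ((p + K * i) * N + j) := by
        simp only [State.get, IdxExpr.eval_add, IdxExpr.eval_mul, IdxExpr.eval_rg, e2, m2 25 rfl,
          m1 25 rfl, r2 11 (by decide) rfl, e1, r2 3 (by decide) rfl, r1 3 (by decide) rfl, hK,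
          r2 4 (by decide) rfl, r1 4 (by decide) rfl, hN, r2 10 (by decide) rfl,
          r1 10 (by decide) rfl, hj]
      rw [run_ifZero, g]
      split_ifs with hz
      · refine h2.imp (fun h => ⟨h.1, h.2.1, fun i' hi' => ?_⟩) id
        rcases Nat.lt_succ_iff_lt_or_eq.1 hi' with hlt | rfl
        · exact h.2.2 i' hlt
        · exact hz
      · right
        rw [run_setReg, Function.update_self]
        simp only [State.reg_tick, IdxExpr.eval_add, IdxExpr.eval_rg, IdxExpr.eval_one,
          r2 11 (by decide) rfl, e1, Nat.add_sub_cancel]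
        exact ⟨by omega, hp', i, hi', hz⟩

/-- Read off the vectors from the eigenvectors at nonzero eigenvalues, and count these. Register 23
is set if some eigenvector vanishes. -/
def extractVecs : Program :=
  .loop 10 (rg 4) (.ifZero ⟨26, rg 10⟩ .skip
    (.seq (.setReg (.const 28) (rg 28 + 1)) (.seq (.setReg (.const 25) 0) (.seq findFiber
      (.seq (.ifLe 1 (rg 25) .skip (.setReg (.const 23) 1))
        (.loop 11 (rg 0) (addCopy 27 (rg 10 * rg 0 + rg 11)
          ⟨25, (rg 25 - 1 + rg 3 * rg 11) * rg 4 + rg 10⟩)))))))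

open Classical in
-- If a column is a nonzero multiple of x^{⊗k}, fixing the first k - 1 indices at a place where the
-- fibre is nonzero leaves a nonzero multiple of x. Columns at eigenvalue zero leave the zero
-- vector, which keeps the later sums over all N columns correct.
theorem extractVecs_spec (O : Oracle F) {s : State F} {n K N : ℕ} (hn : s.reg 0 = n)
    (hK : s.reg 3 = K) (hN : s.reg 4 = N) (h28 : s.reg 28 = 0) (h23 : s.reg 23 = 0)
    (h27 : s.mem 27 = 0) :
    (extractVecs.run O s).reg 28 = Nat.count (fun j => s.mem 26 j ≠ 0) N ∧
    ((extractVecs.run O s).reg 23 = 0 ↔ ∀ j < N, s.mem 26 j ≠ 0 →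
      ∃ p < K, ∃ i < n, s.mem 25 ((p + K * i) * N + j) ≠ 0) ∧
    ∃ piv : ℕ → ℕ, (∀ j < N, s.mem 26 j ≠ 0 →
        (∃ p < K, ∃ i < n, s.mem 25 ((p + K * i) * N + j) ≠ 0) →
        piv j < K ∧ ∃ i < n, s.mem 25 ((piv j + K * i) * N + j) ≠ 0) ∧
      ∀ j < N, ∀ i < n, (extractVecs.run O s).mem 27 (j * n + i) =
        if s.mem 26 j = 0 then 0 else s.mem 25 ((piv j + K * i) * N + j) := by
  have key := loop_induction O (i := 10) (e := rg 4) (s := s)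
    (c := .ifZero ⟨26, rg 10⟩ .skip
      (.seq (.setReg (.const 28) (rg 28 + 1)) (.seq (.setReg (.const 25) 0) (.seq findFiber
        (.seq (.ifLe 1 (rg 25) .skip (.setReg (.const 23) 1))
          (.loop 11 (rg 0) (addCopy 27 (rg 10 * rg 0 + rg 11)
            ⟨25, (rg 25 - 1 + rg 3 * rg 11) * rg 4 + rg 10⟩)))))))
    (fun J reg mem => reg 28 = Nat.count (fun j => s.mem 26 j ≠ 0) J ∧
      (reg 23 = 0 ↔ ∀ j < J, s.mem 26 j ≠ 0 →
        ∃ p < K, ∃ i < n, s.mem 25 ((p + K * i) * N + j) ≠ 0) ∧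
      ∃ piv : ℕ → ℕ, (∀ j < J, s.mem 26 j ≠ 0 →
          (∃ p < K, ∃ i < n, s.mem 25 ((p + K * i) * N + j) ≠ 0) →
          piv j < K ∧ ∃ i < n, s.mem 25 ((piv j + K * i) * N + j) ≠ 0) ∧
        mem 27 = ∑ j ∈ Finset.range J, ∑ i ∈ Finset.range n, Pi.single (j * n + i)
          (if s.mem 26 j = 0 then 0 else s.mem 25 ((piv j + K * i) * N + j)))
    (fun _ reg mem x h => by simpa [Function.update_of_ne] using h)
    ⟨by simp [h28], by simp [h23], fun _ => 0, by simp, by simp [h27]⟩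
    fun j hj s1 r1 e1 m1 h => ?_
  · simp only [IdxExpr.eval_rg, hN] at key
    obtain ⟨k1, k2, piv, k3, k4⟩ := key
    refine ⟨k1, k2, piv, k3, fun j hj i hi => ?_⟩
    rw [show (extractVecs.run O s).mem 27 = _ from k4, sum_single_rowMajor hj hi]
  · obtain ⟨k1, k2, piv, k3, k4⟩ := h
    have g : s1.get ⟨26, rg 10⟩ = s.mem 26 j := by
      simp only [State.get, IdxExpr.eval_rg, e1, m1 26 rfl]
    rw [run_ifZero, g]
    by_cases hz : s.mem 26 j = 0
    · rw [if_pos hz]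
      refine ⟨?_, ?_, piv, ?_, ?_⟩
      · rw [Nat.count_succ, if_neg (by simpa using hz), add_zero]; exact k1
      · refine Iff.trans k2 ⟨fun h j' hj' hne => ?_, fun h j' hj' => h j' (by omega)⟩
        rcases Nat.lt_succ_iff_lt_or_eq.1 hj' with hlt | rfl
        · exact h j' hlt hne
        · exact absurd hz hne
      · intro j' hj' hne
        rcases Nat.lt_succ_iff_lt_or_eq.1 hj' with hlt | rfl
        · exact k3 j' hlt hne
        · exact absurd hz hne
      · rw [Finset.sum_range_succ, ← k4]
        simp [hz, Program.run]
    · rw [if_neg hz]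
      simp only [run_seq]
      set s2 := Program.run O (.setReg (.const 25) 0)
        (Program.run O (.setReg (.const 28) (rg 28 + 1)) (s1.tick 1)) with hs2
      have q : s2.reg = Function.update (Function.update s1.reg 28 (s1.reg 28 + 1)) 25 0 := rfl
      have qm : s2.mem = s1.mem := rfl
      have f := findFiber_spec O (s := s2) (n := n) (K := K) (N := N) (j := j)
        (by rw [q]; simp [r1 0 (by decide) rfl, hn]) (by rw [q]; simp [r1 3 (by decide) rfl, hK])
        (by rw [q]; simp [r1 4 (by decide) rfl, hN]) (by rw [q]; simp [e1]) (by rw [q]; simp)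
      rw [qm, m1 25 rfl] at f
      set s3 := findFiber.run O s2 with hs3
      have z28 : s3.reg 28 = s1.reg 28 + 1 := by rw [hs3, run_reg O 28 _ _ rfl, q]; simp
      have z23 : s3.reg 23 = s1.reg 23 := by rw [hs3, run_reg O 23 _ _ rfl, q]; simp
      set s4 := Program.run O (.ifLe 1 (rg 25) .skip (.setReg (.const 23) 1)) s3 with hs4
      have y25 : s4.reg 25 = s3.reg 25 := by rw [hs4, run_reg O 25 _ _ rfl]
      have y0 : s4.reg 0 = n := by
        rw [hs4, run_reg O 0 _ _ rfl, hs3, run_reg O 0 _ _ rfl, q]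
        simp [r1 0 (by decide) rfl, hn]
      have y3 : s4.reg 3 = K := by
        rw [hs4, run_reg O 3 _ _ rfl, hs3, run_reg O 3 _ _ rfl, q]
        simp [r1 3 (by decide) rfl, hK]
      have y4 : s4.reg 4 = N := by
        rw [hs4, run_reg O 4 _ _ rfl, hs3, run_reg O 4 _ _ rfl, q]
        simp [r1 4 (by decide) rfl, hN]
      have y10 : s4.reg 10 = j := by
        rw [hs4, run_reg O 10 _ _ rfl, hs3, run_reg O 10 _ _ rfl, q]
        simp [e1]
      have ym : ∀ a, s4.mem a = s1.mem a := fun a => by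
        rw [hs4, run_mem O a _ _ rfl, hs3, run_mem O a _ _ rfl, qm]
      have y23 : s4.reg 23 = if 1 ≤ s3.reg 25 then s1.reg 23 else 1 := by
        rw [hs4, run_ifLe]
        by_cases h : 1 ≤ s3.reg 25
        · rw [if_pos (show IdxExpr.eval s3.reg 1 ≤ IdxExpr.eval s3.reg (rg 25) from h), if_pos h]
          exact z23
        · rw [if_neg (show ¬ IdxExpr.eval s3.reg 1 ≤ IdxExpr.eval s3.reg (rg 25) from h), if_neg h,
            run_setReg, Function.update_self]
          rfl
      set c5 : Program := .loop 11 (rg 0) (addCopy 27 (rg 10 * rg 0 + rg 11)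
            ⟨25, (rg 25 - 1 + rg 3 * rg 11) * rg 4 + rg 10⟩) with hc5
      have hadd : (c5.run O s4).mem 27 = s4.mem 27 + ∑ i ∈ Finset.range n,
          Pi.single (j * n + i) (s.mem 25 ((s3.reg 25 - 1 + K * i) * N + j)) := by
        refine loop_add' O (e := rg 0) y0 _ fun i _ s5 r5 e5 m5 => ?_
        rw [addCopy_mem]
        simp only [State.get, IdxExpr.eval_add, IdxExpr.eval_mul, IdxExpr.eval_rg,
          IdxExpr.eval_sub, IdxExpr.eval_one, e5, r5 10 (by decide) rfl, r5 0 (by decide) rfl,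
          r5 25 (by decide) rfl, r5 3 (by decide) rfl, r5 4 (by decide) rfl, y0, y3, y4, y10, y25,
          m5 25 rfl, ym 25, m1 25 rfl]
      -- If no fibre was found, the truncated subtraction gives the harmless pivot 0; the flag in
      -- register 23 records the failure.
      refine ⟨?_, ?_, Function.update piv j (s3.reg 25 - 1), ?_, ?_⟩
      · rw [run_reg O 28 c5 _ rfl, hs4, run_reg O 28 _ _ rfl, z28, k1, Nat.count_succ, if_pos hz]
      · rw [run_reg O 23 c5 _ rfl, y23]
        rcases f with f | f
        · rw [if_neg (by omega)]
          constructor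
          · intro h; exact absurd h one_ne_zero
          · intro h
            obtain ⟨p, hp, i, hi, hne⟩ := h j (Nat.lt_succ_self j) hz
            exact absurd (f.2 p hp i hi) hne
        · rw [if_pos f.1, k2]
          constructor
          · intro h j' hj' hne
            rcases Nat.lt_succ_iff_lt_or_eq.1 hj' with hlt | rfl
            · exact h j' hlt hne
            · exact ⟨_, f.2.1, f.2.2⟩
          · exact fun h j' hj' => h j' (by omega)
      · intro j' hj' hne hex
        rcases Nat.lt_succ_iff_lt_or_eq.1 hj' with hlt | rfl
        · rw [Function.update_of_ne (by omega)]
          exact k3 j' hlt hne hex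
        · rw [Function.update_self]
          rcases f with f | f
          · obtain ⟨p, hp, i, hi, hne⟩ := hex
            exact absurd (f.2 p hp i hi) hne
          · exact f.2
      · rw [hadd, ym, k4, Finset.sum_range_succ]
        congr 1
        · refine Finset.sum_congr rfl fun j' hj' => Finset.sum_congr rfl fun i _ => ?_
          rw [Finset.mem_range] at hj'
          rw [Function.update_of_ne (by omega)]
        · refine Finset.sum_congr rfl fun i _ => ?_
          rw [if_neg hz, Function.update_self]

/-- Compute an entry of a power of the vector with number `rg 10`. -/
def powEntry (K B : IdxExpr) : Program :=
  .seq (.setOne ⟨41, 0⟩) (.seq (.setReg (.const 26) (rg 11)) (.loop 12 K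
    (.seq (.setReg (.const 27) 0)
    (.seq (.loop 13 B (.ifLe (rg 13 * rg 0) (rg 26) (.setReg (.const 27) (rg 13)) .skip))
    (.seq (.op .mul ⟨41, 0⟩ ⟨41, 0⟩ ⟨27, rg 10 * rg 0 + (rg 26 - rg 27 * rg 0)⟩)
      (.setReg (.const 26) (rg 27)))))))

/-- Index expressions have no division, so the quotient is found as the largest j with jn ≤ cur. The
range is sufficient because cur / n ≤ cur < b. -/
theorem divSearch (O : Oracle F) {s : State F} {B : IdxExpr} {n b cur : ℕ} (hn : 1 ≤ n)
    (h0 : s.reg 0 = n) (hB : B.eval s.reg = b) (h26 : s.reg 26 = cur) (h27 : s.reg 27 = 0)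
    (hcur : cur < b) :
    (Program.run O (.loop 13 B (.ifLe (rg 13 * rg 0) (rg 26) (.setReg (.const 27) (rg 13)) .skip))
      s).reg 27 = cur / n := by
  have key := loop_induction O (i := 13) (e := B) (s := s)
    (c := .ifLe (rg 13 * rg 0) (rg 26) (.setReg (.const 27) (rg 13)) .skip)
    (fun J reg _ => reg 27 = min (J - 1) (cur / n))
    (fun _ reg mem x h => by simpa [Function.update_of_ne] using h)
    (by simp [h27]) fun j hj s1 r1 e1 m1 h => ?_
  · rw [hB] at key
    have : cur / n ≤ cur := Nat.div_le_self _ _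
    rw [key]
    omega
  · rw [run_ifLe]
    have hiff : (rg 13 * rg 0).eval s1.reg ≤ (rg 26).eval s1.reg ↔ j ≤ cur / n := by
      simp only [IdxExpr.eval_mul, IdxExpr.eval_rg, e1, r1 0 (by decide) rfl,
        r1 26 (by decide) rfl, h0, h26]
      rw [Nat.le_div_iff_mul_le hn]
    split_ifs with hle <;> rw [hiff] at hle
    · rw [run_setReg, Function.update_self]
      simp only [State.reg_tick, IdxExpr.eval_rg, e1]
      omega
    · simp only [Program.run, State.reg_tick, h]
      omega

/-- The address p is taken apart into its base n digits, and each digit selects one coordinate of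
the vector as a factor. -/
theorem powEntry_mem (O : Oracle F) {s : State F} {K B : IdxExpr} {n k b j p : ℕ} (hn : 1 ≤ n)
    (h0 : s.reg 0 = n) (hK : ∀ reg' : ℕ → ℕ, (∀ r < 10, reg' r = s.reg r) → K.eval reg' = k)
    (hB : ∀ reg' : ℕ → ℕ, (∀ r < 10, reg' r = s.reg r) → B.eval reg' = b)
    (h10 : s.reg 10 = j) (h11 : s.reg 11 = p) (hp : p < b) :
    ((powEntry K B).run O s).mem 41 0 =
      ∏ l ∈ Finset.range k, s.mem 27 (j * n + p / n ^ l % n) := by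
  rw [powEntry, run_seq, run_seq]
  set s0 := Program.run O (.setReg (.const 26) (rg 11)) (Program.run O (.setOne ⟨41, 0⟩) s)
    with hs0
  have q : s0.reg = Function.update s.reg 26 p := by
    rw [hs0, run_setReg]
    simp only [Program.run, State.reg_tick, State.reg_set, IdxExpr.eval_rg, h11]
  have q41 : s0.mem 41 0 = 1 := by
    rw [hs0, run_setReg_mem]
    simp [Program.run, State.mem_set]
  have q27 : s0.mem 27 = s.mem 27 := by
    rw [hs0, run_setReg_mem, run_mem O 27 _ _ rfl]
  have qr : ∀ r < 10, s0.reg r = s.reg r := fun r hr => by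
    rw [q, Function.update_of_ne (by omega)]
  have key := loop_induction O (i := 12) (e := K) (s := s0)
    (c := .seq (.setReg (.const 27) 0)
      (.seq (.loop 13 B (.ifLe (rg 13 * rg 0) (rg 26) (.setReg (.const 27) (rg 13)) .skip))
      (.seq (.op .mul ⟨41, 0⟩ ⟨41, 0⟩ ⟨27, rg 10 * rg 0 + (rg 26 - rg 27 * rg 0)⟩)
        (.setReg (.const 26) (rg 27)))))
    (fun J reg mem => reg 26 = p / n ^ J ∧
      mem 41 0 = ∏ l ∈ Finset.range J, s.mem 27 (j * n + p / n ^ l % n))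
    (fun _ reg mem x h => by simpa [Function.update_of_ne] using h)
    (by simp [q, q41]) fun l hl s1 r1 e1 m1 h => ?_
  · rw [hK s0.reg qr] at key
    exact key.2
  · simp only [run_seq]
    set s2 := Program.run O (.setReg (.const 27) 0) s1 with hs2
    have w : s2.reg = Function.update s1.reg 27 0 := rfl
    have w0 : ∀ r < 10, s2.reg r = s.reg r := fun r hr => by
      rw [w, Function.update_of_ne (by omega), r1 r (by omega) (by
        simp [Program.modReg]; omega), qr r hr]
    set c3 : Program := .loop 13 B (.ifLe (rg 13 * rg 0) (rg 26) (.setReg (.const 27) (rg 13))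
      .skip) with hc3
    have hcur : p / n ^ l < b := lt_of_le_of_lt (Nat.div_le_self _ _) hp
    have d := divSearch O (s := s2) (B := B) (n := n) (b := b) (cur := p / n ^ l) hn
      (by rw [w0 0 (by decide), h0]) (hB _ w0) (by rw [w, Function.update_of_ne (by decide), h.1])
      (by rw [w, Function.update_self]) hcur
    set s3 := c3.run O s2 with hs3
    have v0 : s3.reg 0 = n := by rw [hs3, run_reg O 0 c3 _ rfl, w0 0 (by decide), h0]
    have v10 : s3.reg 10 = j := by
      rw [hs3, run_reg O 10 c3 _ rfl, w, Function.update_of_ne (by decide),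
        r1 10 (by decide) rfl, q, Function.update_of_ne (by decide), h10]
    have v26 : s3.reg 26 = p / n ^ l := by
      rw [hs3, run_reg O 26 c3 _ rfl, w, Function.update_of_ne (by decide), h.1]
    have vm : ∀ a, s3.mem a = s1.mem a := fun a => by rw [hs3, run_mem O a c3 _ rfl]; rfl
    -- The digit is the remainder after subtracting n times the quotient found by the search.
    have hdig : p / n ^ l - p / n ^ l / n * n = p / n ^ l % n := by
      have := Nat.div_add_mod (p / n ^ l) n
      rw [mul_comm] at this
      omega
    have d' : s3.reg 27 = p / n ^ l / n := d
    rw [run_setReg, run_setReg_mem, Function.update_self]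
    simp only [Program.run, State.reg_tick, State.mem_tick, State.reg_set, IdxExpr.eval_rg, d']
    refine ⟨by rw [pow_succ, Nat.div_div_eq_div_mul], ?_⟩
    rw [State.mem_set_same s3 ⟨41, 0⟩, Finset.prod_range_succ, ← h.2]
    simp only [State.get, FieldOp.eval, IdxExpr.eval_add, IdxExpr.eval_sub, IdxExpr.eval_mul,
      IdxExpr.eval_rg, IdxExpr.eval_zero, v0, v10, v26, d', vm, hdig, Function.update_self]
    rw [m1 27 rfl, q27]

/-- Add the powers of all vectors to an array. -/
def fillPowers (K B : IdxExpr) (dst : ℕ) (addr : IdxExpr) : Program :=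
  .loop 10 (rg 4) (.loop 11 B (.seq (powEntry K B) (addCopy dst addr ⟨41, 0⟩)))

theorem fillPowers_mem (O : Oracle F) {s : State F} {K B addr : IdxExpr} {dst n N k b : ℕ}
    (hdst : dst ≠ 41) (hdst' : dst ≠ 27) (hn : 1 ≤ n) (h0 : s.reg 0 = n) (hN : s.reg 4 = N)
    (hK : ∀ reg' : ℕ → ℕ, (∀ r < 10, reg' r = s.reg r) → K.eval reg' = k)
    (hB : ∀ reg' : ℕ → ℕ, (∀ r < 10, reg' r = s.reg r) → B.eval reg' = b)
    (ad : ℕ → ℕ → ℕ) (had : ∀ reg' : ℕ → ℕ, (∀ r < 10, reg' r = s.reg r) →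
      addr.eval reg' = ad (reg' 10) (reg' 11)) :
    ((fillPowers K B dst addr).run O s).mem dst = s.mem dst +
      ∑ j ∈ Finset.range N, ∑ p ∈ Finset.range b, Pi.single (ad j p)
        (∏ l ∈ Finset.range k, s.mem 27 (j * n + p / n ^ l % n)) := by
  have low : ∀ r < 10, Program.modReg (.seq (powEntry K B) (addCopy dst addr ⟨41, 0⟩)) r = false :=
    fun r hr => by simp [Program.modReg, powEntry, addCopy]; omega
  refine loop2_add O (e := rg 4) (s := s) (by decide) rfl hN
    (fun reg' h => hB reg' fun r hr => h r (by omega) (by omega) (low r hr)) _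
    fun j _ p hp s' r1 e1 e2 m1 => ?_
  have lo : ∀ r < 10, s'.reg r = s.reg r := fun r hr => r1 r (by omega) (by omega) (low r hr)
  have f := powEntry_mem O (s := s') hn (by rw [lo 0 (by decide), h0])
    (fun reg' h => hK reg' fun r hr => by rw [h r hr, lo r hr])
    (fun reg' h => hB reg' fun r hr => by rw [h r hr, lo r hr]) e1 e2 hp
  have m27 : s'.mem 27 = s.mem 27 := m1 27 (by
    simp [Program.modArr, powEntry, addCopy, hdst'])
  rw [run_seq, addCopy_mem, run_mem O dst (powEntry K B) s' (by
    simp [Program.modArr, powEntry, hdst.symm])]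
  rw [had _ fun r hr => by
    rw [run_reg O r _ s' (by simp [Program.modReg, powEntry]; omega), lo r hr]]
  rw [run_reg O 10 (powEntry K B) s' rfl, run_reg O 11 (powEntry K B) s' rfl, e1, e2]
  have : ((powEntry K B).run O s').get ⟨41, 0⟩ = ((powEntry K B).run O s').mem 41 0 := rfl
  rw [this, f, m27]

end Stages

end Waring

namespace Waring

/-! ### Tests, coefficients and output -/

section Stages

variable {F : Type*} [RCLike F]

/-- The defects `X z - d z` of the eigenvector equations for the powers `z`. -/
def fillDefect : Program :=
  .seq (.loop 10 (rg 4) (.loop 11 (rg 4) (.loop 12 (rg 4)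
    (addMul 33 (rg 10 * rg 4 + rg 11) ⟨24, rg 11 * rg 4 + rg 12⟩ ⟨28, rg 10 * rg 4 + rg 12⟩))))
  (.loop 10 (rg 4) (.loop 11 (rg 4)
    (subMul 33 (rg 10 * rg 4 + rg 11) ⟨26, rg 10⟩ ⟨28, rg 10 * rg 4 + rg 11⟩)))

theorem fillDefect_mem (O : Oracle F) {s : State F} (h0 : s.mem 33 = 0) {N j p : ℕ}
    (hN : s.reg 4 = N) (hj : j < N) (hp : p < N) :
    (fillDefect.run O s).mem 33 (j * N + p) =
      ∑ q ∈ Finset.range N, s.mem 24 (p * N + q) * s.mem 28 (j * N + q) -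
        s.mem 26 j * s.mem 28 (j * N + p) := by
  rw [fillDefect, run_seq]
  set c1 : Program := .loop 10 (rg 4) (.loop 11 (rg 4) (.loop 12 (rg 4)
    (addMul 33 (rg 10 * rg 4 + rg 11) ⟨24, rg 11 * rg 4 + rg 12⟩ ⟨28, rg 10 * rg 4 + rg 12⟩)))
    with hc1
  have a1 : (c1.run O s).mem 33 = s.mem 33 + ∑ j ∈ Finset.range N, ∑ p ∈ Finset.range N,
      ∑ q ∈ Finset.range N, Pi.single (j * N + p)
        (s.mem 24 (p * N + q) * s.mem 28 (j * N + q)) := by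
    refine loop3_add O (e := rg 4) (s := s) (by decide) (by decide) (by decide) rfl rfl hN
      (fun reg' h => by rw [IdxExpr.eval_rg, h 4 (by decide) (by decide) (by decide) rfl, hN])
      (fun reg' h => by rw [IdxExpr.eval_rg, h 4 (by decide) (by decide) (by decide) rfl, hN]) _
      fun a _ b _ e _ s' r1 e1 e2 e3 m1 => ?_
    have q4 : s'.reg 4 = N := by rw [r1 4 (by decide) (by decide) (by decide) rfl, hN]
    rw [addMul_mem O _ (by decide)]
    simp only [State.get, IdxExpr.eval_add, IdxExpr.eval_mul, IdxExpr.eval_rg, q4, e1, e2, e3,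
      m1 24 rfl, m1 28 rfl]
  have a2 : (Program.run O (.loop 10 (rg 4) (.loop 11 (rg 4)
      (subMul 33 (rg 10 * rg 4 + rg 11) ⟨26, rg 10⟩ ⟨28, rg 10 * rg 4 + rg 11⟩)))
      (c1.run O s)).mem 33 = (c1.run O s).mem 33 + ∑ j ∈ Finset.range N, ∑ p ∈ Finset.range N,
        Pi.single (j * N + p) (-(s.mem 26 j * s.mem 28 (j * N + p))) := by
    have hN1 : (c1.run O s).reg 4 = N := by rw [run_reg O 4 c1 s rfl, hN]
    refine loop2_add O (e := rg 4) (by decide) rfl hN1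
      (fun reg' h => by rw [IdxExpr.eval_rg, h 4 (by decide) (by decide) rfl, hN1]) _
      fun a _ b _ s' r1 e1 e2 m1 => ?_
    have q4 : s'.reg 4 = N := by rw [r1 4 (by decide) (by decide) rfl, hN1]
    rw [subMul_mem O _ (by decide)]
    simp only [State.get, IdxExpr.eval_add, IdxExpr.eval_mul, IdxExpr.eval_rg, q4, e1, e2,
      m1 26 rfl, m1 28 rfl]
    rw [run_mem O 26 c1 s rfl, run_mem O 28 c1 s rfl, Pi.single_neg]
  rw [a2, a1, h0, zero_add]
  simp only [sum_pi_single]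
  rw [Pi.add_apply, sum_single_rowMajor hj hp, sum_single_rowMajor hj hp, sub_eq_add_neg]

/-- Set register 23 if a defect does not vanish or two nonzero eigenvalues agree. -/
def checkEigen : Program :=
  .loop 10 (rg 4) (.ifZero ⟨26, rg 10⟩ .skip (.seq
    (.loop 11 (rg 4) (.ifZero ⟨33, rg 10 * rg 4 + rg 11⟩ .skip (.setReg (.const 23) 1)))
    (.loop 11 (rg 4) (.ifLe (rg 10 + 1) (rg 11)
      (.seq (.op .sub ⟨40, 0⟩ ⟨26, rg 10⟩ ⟨26, rg 11⟩) (.ifZero ⟨40, 0⟩ (.setReg (.const 23) 1) .skip))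
      .skip))))

/-- Comparing only pairs j < j' suffices, since equality of eigenvalues is symmetric. -/
theorem checkEigen_spec (O : Oracle F) {s : State F} {N : ℕ} (hN : s.reg 4 = N) :
    (checkEigen.run O s).reg 23 ≠ 0 ↔ s.reg 23 ≠ 0 ∨ ∃ j < N, s.mem 26 j ≠ 0 ∧
      ((∃ p < N, s.mem 33 (j * N + p) ≠ 0) ∨ ∃ j' < N, j < j' ∧ s.mem 26 j = s.mem 26 j') := by
  have key := loop_flag O (i := 10) (e := rg 4) (s := s) (b := 23)
    (c := .ifZero ⟨26, rg 10⟩ .skip (.seq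
      (.loop 11 (rg 4) (.ifZero ⟨33, rg 10 * rg 4 + rg 11⟩ .skip (.setReg (.const 23) 1)))
      (.loop 11 (rg 4) (.ifLe (rg 10 + 1) (rg 11)
        (.seq (.op .sub ⟨40, 0⟩ ⟨26, rg 10⟩ ⟨26, rg 11⟩)
          (.ifZero ⟨40, 0⟩ (.setReg (.const 23) 1) .skip)) .skip))))
    (by decide) (fun j => s.mem 26 j ≠ 0 ∧
      ((∃ p < N, s.mem 33 (j * N + p) ≠ 0) ∨ ∃ j' < N, j < j' ∧ s.mem 26 j = s.mem 26 j'))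
    fun j hj s1 r1 e1 m1 => ?_
  · rw [IdxExpr.eval_rg, hN] at key
    exact key
  · have q4 : s1.reg 4 = N := by rw [r1 4 (by decide) rfl, hN]
    have g : s1.get ⟨26, rg 10⟩ = s.mem 26 j := by
      simp only [State.get, IdxExpr.eval_rg, e1, m1 26 rfl]
    rw [run_ifZero, g]
    by_cases hz : s.mem 26 j = 0
    · rw [if_pos hz]
      simp [hz, Program.run]
    · rw [if_neg hz, run_seq]
      have k1 := loop_flag O (i := 11) (e := rg 4) (s := s1.tick 1) (b := 23)
        (c := .ifZero ⟨33, rg 10 * rg 4 + rg 11⟩ .skip (.setReg (.const 23) 1))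
        (by decide) (fun p => s.mem 33 (j * N + p) ≠ 0) fun p hp s2 r2 e2 m2 => by
          have g2 : s2.get ⟨33, rg 10 * rg 4 + rg 11⟩ = s.mem 33 (j * N + p) := by
            simp only [State.get, IdxExpr.eval_rg, IdxExpr.eval_add, IdxExpr.eval_mul, e2,
              r2 10 (by decide) rfl, r2 4 (by decide) rfl, State.reg_tick, e1, q4, m2 33 rfl,
              State.mem_tick, m1 33 rfl]
          rw [run_ifZero, g2]
          by_cases h : s.mem 33 (j * N + p) = 0
          · simp [h, Program.run]
          · simp [h, Program.run]
      set c1 : Program := .loop 11 (rg 4) (.ifZero ⟨33, rg 10 * rg 4 + rg 11⟩ .skip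
        (.setReg (.const 23) 1)) with hc1
      have k2 := loop_flag O (i := 11) (e := rg 4) (s := c1.run O (s1.tick 1)) (b := 23)
        (c := .ifLe (rg 10 + 1) (rg 11) (.seq (.op .sub ⟨40, 0⟩ ⟨26, rg 10⟩ ⟨26, rg 11⟩)
          (.ifZero ⟨40, 0⟩ (.setReg (.const 23) 1) .skip)) .skip)
        (by decide) (fun j' => j < j' ∧ s.mem 26 j = s.mem 26 j') fun j' hj' s2 r2 e2 m2 => by
          have w10 : s2.reg 10 = j := by
            rw [r2 10 (by decide) rfl, run_reg O 10 c1 _ rfl]; exact e1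
          have w26 : s2.mem 26 = s.mem 26 := by
            rw [m2 26 rfl, run_mem O 26 c1 _ rfl]; exact m1 26 rfl
          rw [run_ifLe]
          by_cases hlt : j < j'
          · rw [if_pos (show (rg 10 + 1).eval s2.reg ≤ (rg 11).eval s2.reg by
              simp only [IdxExpr.eval_add, IdxExpr.eval_rg, IdxExpr.eval_one, w10, e2]; omega)]
            rw [run_seq, run_ifZero]
            have g3 : (Program.run O (.op .sub ⟨40, 0⟩ ⟨26, rg 10⟩ ⟨26, rg 11⟩)
                (s2.tick 1)).get ⟨40, 0⟩ = s.mem 26 j - s.mem 26 j' := by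
              simp only [Program.run, State.get_tick, mem_set_tmp _ ⟨40, 0⟩, FieldOp.eval]
              simp only [State.get, IdxExpr.eval_rg, w10, e2, w26]
            rw [g3]
            by_cases h : s.mem 26 j = s.mem 26 j'
            · rw [if_pos (sub_eq_zero.2 h)]
              simp [h, hlt, Program.run]
            · rw [if_neg fun e => h (sub_eq_zero.1 e)]
              simp [h, Program.run]
          · rw [if_neg (show ¬ (rg 10 + 1).eval s2.reg ≤ (rg 11).eval s2.reg by
              simp only [IdxExpr.eval_add, IdxExpr.eval_rg, IdxExpr.eval_one, w10, e2]; omega)]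
            simp [hlt, Program.run]
      rw [k2, k1]
      have w4 : (rg 4).eval (c1.run O (s1.tick 1)).reg = N := by
        rw [IdxExpr.eval_rg, run_reg O 4 c1 _ rfl]; exact q4
      have w4' : (rg 4).eval (s1.tick 1).reg = N := q4
      rw [w4, w4', State.reg_tick, or_assoc]
      simp [hz]

/-- Set register 23 if the number of eigenvectors is not the number of basis vectors. -/
def checkCount : Program :=
  .ifLe (rg 28) (rg 20) (.ifLe (rg 20) (rg 28) .skip (.setReg (.const 23) 1))
    (.setReg (.const 23) 1)

theorem checkCount_spec (O : Oracle F) (s : State F) :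
    (checkCount.run O s).reg 23 = 0 ↔ s.reg 23 = 0 ∧ s.reg 28 = s.reg 20 := by
  rw [checkCount, run_ifLe]
  split_ifs with h
  · rw [run_ifLe]
    split_ifs with h'
    · have : s.reg 28 = s.reg 20 := le_antisymm h h'
      simp [Program.run, this]
    · have : s.reg 28 ≠ s.reg 20 := fun e => h' (le_of_eq e.symm)
      rw [run_setReg]
      simp [this]
  · have : s.reg 28 ≠ s.reg 20 := fun e => h (le_of_eq e)
    rw [run_setReg]
    simp [this]

/-- Put `T` in the last column of array 29. -/
def fillLast : Program :=
  .loop 10 (rg 4 * rg 5) (addCopy 29 (rg 10 * (rg 4 + 1) + rg 4) ⟨0, rg 10⟩)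

theorem fillLast_mem (O : Oracle F) {s : State F} {N M : ℕ} (hN : s.reg 4 = N)
    (hM : s.reg 4 * s.reg 5 = M) :
    (fillLast.run O s).mem 29 = s.mem 29 +
      ∑ p ∈ Finset.range M, Pi.single (p * (N + 1) + N) (s.mem 0 p) := by
  refine loop_add' O (e := rg 4 * rg 5) hM _ fun p _ s' r1 e1 m1 => ?_
  have q4 : s'.reg 4 = N := by rw [r1 4 (by decide) rfl, hN]
  rw [addCopy_mem]
  simp only [State.get, IdxExpr.eval_add, IdxExpr.eval_mul, IdxExpr.eval_rg, IdxExpr.eval_one, q4,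
    e1, m1 0 rfl]

/-- Write the decomposition. -/
def writeOutput : Program :=
  .loop 10 (rg 4) (.ifZero ⟨26, rg 10⟩ .skip
    (.seq (.op .sub ⟨42, 0⟩ ⟨43, 0⟩ ⟨31, rg 10 * (rg 4 + 1) + rg 29⟩)
    (.seq (.op .div ⟨0, rg 31⟩ ⟨42, 0⟩ ⟨31, rg 4 * (rg 4 + 1) + rg 29⟩)
    (.seq (.loop 11 (rg 0) (.op .add ⟨1, rg 31 * rg 0 + rg 11⟩ ⟨43, 0⟩ ⟨27, rg 10 * rg 0 + rg 11⟩))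
      (.setReg (.const 31) (rg 31 + 1))))))

open Classical in
-- Arrays 0 and 1 may be overwritten, since T and f are no longer read. Array 43 has stayed zero and
-- serves both for negation and for copying.
theorem writeOutput_spec (O : Oracle F) {s : State F} {n N t : ℕ} (hn : s.reg 0 = n)
    (hN : s.reg 4 = N) (ht : s.reg 29 = t) (h31 : s.reg 31 = 0) (h43 : s.mem 43 = 0) :
    (writeOutput.run O s).reg 31 = Nat.count (fun j => s.mem 26 j ≠ 0) N ∧
    ∀ a < Nat.count (fun j => s.mem 26 j ≠ 0) N,
      (writeOutput.run O s).mem 0 a =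
        -s.mem 31 (Nat.nth (fun j => s.mem 26 j ≠ 0) a * (N + 1) + t) /
          s.mem 31 (N * (N + 1) + t) ∧
      ∀ i < n, (writeOutput.run O s).mem 1 (a * n + i) =
        s.mem 27 (Nat.nth (fun j => s.mem 26 j ≠ 0) a * n + i) := by
  set p : ℕ → Prop := fun j => s.mem 26 j ≠ 0 with hp
  have key := loop_induction O (i := 10) (e := rg 4) (s := s)
    (c := .ifZero ⟨26, rg 10⟩ .skip
      (.seq (.op .sub ⟨42, 0⟩ ⟨43, 0⟩ ⟨31, rg 10 * (rg 4 + 1) + rg 29⟩)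
      (.seq (.op .div ⟨0, rg 31⟩ ⟨42, 0⟩ ⟨31, rg 4 * (rg 4 + 1) + rg 29⟩)
      (.seq (.loop 11 (rg 0)
          (.op .add ⟨1, rg 31 * rg 0 + rg 11⟩ ⟨43, 0⟩ ⟨27, rg 10 * rg 0 + rg 11⟩))
        (.setReg (.const 31) (rg 31 + 1))))))
    (fun J reg mem => reg 31 = Nat.count p J ∧ ∀ a < Nat.count p J,
      mem 0 a = -s.mem 31 (Nat.nth p a * (N + 1) + t) / s.mem 31 (N * (N + 1) + t) ∧
      ∀ i < n, mem 1 (a * n + i) = s.mem 27 (Nat.nth p a * n + i))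
    (fun _ reg mem x h => by simpa [Function.update_of_ne] using h)
    (by simp [h31]) fun j hj s1 r1 e1 m1 h => ?_
  · rw [IdxExpr.eval_rg, hN] at key
    exact key
  · have g : s1.get ⟨26, rg 10⟩ = s.mem 26 j := by
      simp only [State.get, IdxExpr.eval_rg, e1, m1 26 rfl]
    rw [run_ifZero, g]
    by_cases hz : s.mem 26 j = 0
    · rw [if_pos hz]
      have hcount : Nat.count p (j + 1) = Nat.count p j := by
        rw [Nat.count_succ, if_neg (by simpa [hp] using hz), add_zero]
      rw [hcount]
      exact h
    · rw [if_neg hz]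
      have hcount : Nat.count p (j + 1) = Nat.count p j + 1 := by
        rw [Nat.count_succ, if_pos hz]
      have hnth : Nat.nth p (Nat.count p j) = j := Nat.nth_count (p := p) hz
      simp only [run_seq]
      set s2 := Program.run O (.op .sub ⟨42, 0⟩ ⟨43, 0⟩ ⟨31, rg 10 * (rg 4 + 1) + rg 29⟩)
        (s1.tick 1) with hs2
      set s3 := Program.run O (.op .div ⟨0, rg 31⟩ ⟨42, 0⟩ ⟨31, rg 4 * (rg 4 + 1) + rg 29⟩) s2
        with hs3
      have R : s3.reg = s1.reg := rfl
      have R2 : s2.reg = s1.reg := rfl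
      have q0 : s1.reg 0 = n := by rw [r1 0 (by decide) rfl, hn]
      have q4 : s1.reg 4 = N := by rw [r1 4 (by decide) rfl, hN]
      have q29 : s1.reg 29 = t := by rw [r1 29 (by decide) rfl, ht]
      have v2 : s2.get ⟨42, 0⟩ = -s.mem 31 (j * (N + 1) + t) := by
        rw [hs2]
        simp only [Program.run, State.get_tick, mem_set_tmp _ ⟨42, 0⟩, FieldOp.eval]
        simp only [State.get, IdxExpr.eval_add, IdxExpr.eval_mul, IdxExpr.eval_rg,
          IdxExpr.eval_one, e1, q4, q29, m1 43 rfl, m1 31 rfl, h43, Pi.zero_apply, zero_sub]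
      have v2' : s2.get ⟨31, rg 4 * (rg 4 + 1) + rg 29⟩ = s.mem 31 (N * (N + 1) + t) := by
        simp only [State.get, IdxExpr.eval_add, IdxExpr.eval_mul, IdxExpr.eval_rg,
          IdxExpr.eval_one, R2, q4, q29]
        rw [hs2, run_mem O 31 _ _ rfl, State.mem_tick, m1 31 rfl]
      have m0 : s3.mem 0 = Function.update (s1.mem 0) (Nat.count p j)
          (-s.mem 31 (j * (N + 1) + t) / s.mem 31 (N * (N + 1) + t)) := by
        rw [hs3]
        simp only [Program.run, State.mem_tick]
        rw [State.mem_set_same s2 ⟨0, rg 31⟩, v2, v2']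
        simp only [FieldOp.eval, IdxExpr.eval_rg, R2, h.1]
        rw [hs2, run_mem O 0 _ _ rfl, State.mem_tick]
      have w1 : s3.mem 1 = s1.mem 1 := by
        rw [hs3, run_mem O 1 _ _ rfl, hs2, run_mem O 1 _ _ rfl, State.mem_tick]
      have w27 : s3.mem 27 = s.mem 27 := by
        rw [hs3, run_mem O 27 _ _ rfl, hs2, run_mem O 27 _ _ rfl, State.mem_tick, m1 27 rfl]
      have w43 : s3.mem 43 = 0 := by
        rw [hs3, run_mem O 43 _ _ rfl, hs2, run_mem O 43 _ _ rfl, State.mem_tick, m1 43 rfl, h43]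
      set c4 : Program := .loop 11 (rg 0)
          (.op .add ⟨1, rg 31 * rg 0 + rg 11⟩ ⟨43, 0⟩ ⟨27, rg 10 * rg 0 + rg 11⟩) with hc4
      have k := loop_induction O (i := 11) (e := rg 0) (s := s3)
        (c := .op .add ⟨1, rg 31 * rg 0 + rg 11⟩ ⟨43, 0⟩ ⟨27, rg 10 * rg 0 + rg 11⟩)
        (fun I _ mem => (∀ a < Nat.count p j, ∀ i < n, mem 1 (a * n + i) = s1.mem 1 (a * n + i)) ∧
          ∀ i < I, mem 1 (Nat.count p j * n + i) = s.mem 27 (j * n + i))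
        (fun _ reg mem x h => h) ⟨fun a _ i _ => by rw [w1], by simp⟩
        fun i hi s4 r4 e4 m4 h4 => by
          have hi' : i < n := by
            rw [IdxExpr.eval_rg, R, q0] at hi
            exact hi
          have ms : (Program.run O (.op .add ⟨1, rg 31 * rg 0 + rg 11⟩ ⟨43, 0⟩
              ⟨27, rg 10 * rg 0 + rg 11⟩) s4).mem 1 =
              Function.update (s4.mem 1) (Nat.count p j * n + i) (s.mem 27 (j * n + i)) := by
            simp only [Program.run, State.mem_tick]
            rw [State.mem_set_same s4 ⟨1, rg 31 * rg 0 + rg 11⟩]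
            simp only [FieldOp.eval, State.get, IdxExpr.eval_add, IdxExpr.eval_mul,
              IdxExpr.eval_rg, e4, r4 31 (by decide) rfl, r4 0 (by decide) rfl,
              r4 10 (by decide) rfl, R, q0, e1, h.1, m4 43 rfl, m4 27 rfl, w43, w27, Pi.zero_apply,
              zero_add]
          rw [ms]
          refine ⟨fun a ha i' hi'' => ?_, fun i' hi'' => ?_⟩
          · rw [Function.update_of_ne, h4.1 a ha i' hi'']
            -- Addresses of earlier output vectors are not hit again, by injectivity of the
            -- row-major numbering.
            intro heq
            have := (rowMajor_inj hi'' hi' heq).1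
            omega
          · rcases Nat.lt_succ_iff_lt_or_eq.1 hi'' with hlt | rfl
            · rw [Function.update_of_ne (by omega), h4.2 i' hlt]
            · rw [Function.update_self]
      rw [IdxExpr.eval_rg, R, q0] at k
      rw [run_setReg, run_setReg_mem, hcount]
      refine ⟨?_, fun a ha => ⟨?_, fun i hi => ?_⟩⟩
      · rw [Function.update_self]
        simp only [IdxExpr.eval_add, IdxExpr.eval_rg, IdxExpr.eval_one]
        rw [run_reg O 31 c4 _ rfl, R, h.1]
      · rw [run_mem O 0 c4 _ rfl, m0]
        rcases Nat.lt_succ_iff_lt_or_eq.1 ha with hlt | rfl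
        · rw [Function.update_of_ne (by omega), (h.2 a hlt).1]
        · rw [Function.update_self, hnth]
      · rcases Nat.lt_succ_iff_lt_or_eq.1 ha with hlt | rfl
        · exact (k.1 a hlt i hi).trans ((h.2 a hlt).2 i hi)
        · rw [hnth]
          exact k.2 i hi

/-- Write the length of the decomposition, and whether it is valid. -/
def finish : Program :=
  .ifLe 1 (rg 22) (.ifLe 1 (rg 30) (.ifLe (rg 23) 0
    (.seq (.setReg (.const 1) (rg 31)) (.setReg (.const 0) 1))
    (.setReg (.const 0) 0)) (.setReg (.const 0) 0)) (.setReg (.const 0) 0)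

theorem finish_spec (O : Oracle F) (s : State F) :
    ((finish.run O s).reg 0 ≠ 0 ↔ 1 ≤ s.reg 22 ∧ 1 ≤ s.reg 30 ∧ s.reg 23 = 0) ∧
    ((finish.run O s).reg 0 ≠ 0 → (finish.run O s).reg 1 = s.reg 31) ∧
    (finish.run O s).mem = s.mem := by
  simp only [finish, run_ifLe]
  split_ifs with h1 h2 h3
  · have h1' : 1 ≤ s.reg 22 := h1
    have h2' : 1 ≤ s.reg 30 := h2
    have h3' : s.reg 23 = 0 := Nat.le_zero.1 h3
    simp [Program.run, h1', h2', h3']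
  · have h3' : ¬ s.reg 23 = 0 := fun h => h3 (le_of_eq h)
    simp [Program.run, h3']
  · have h2' : ¬ 1 ≤ s.reg 30 := h2
    simp [Program.run, show s.reg 30 = 0 by omega]
  · have h1' : ¬ 1 ≤ s.reg 22 := h1
    simp [Program.run, show s.reg 22 = 0 by omega]

end Stages

end Waring

namespace Waring

/-! ### The whole program and the facts about its run -/

section Assembly

variable {F : Type*} [RCLike F]

/-- Run some programs one after the other. -/
noncomputable def runs (O : Oracle F) (l : List Program) (s : State F) : State F :=
  l.foldl (fun s c => c.run O s) s

theorem runs_mem (O : Oracle F) (a : ℕ) (l : List Program) (s : State F)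
    (h : l.all (fun c => !c.modArr a) = true) : (runs O l s).mem a = s.mem a := by
  induction l generalizing s with
  | nil => rfl
  | cons c l ih =>
    simp only [List.all_cons, Bool.and_eq_true, Bool.not_eq_true'] at h
    exact (ih (c.run O s) h.2).trans (run_mem O a c s h.1)

theorem runs_reg (O : Oracle F) (r : ℕ) (l : List Program) (s : State F)
    (h : l.all (fun c => !c.modReg r) = true) : (runs O l s).reg r = s.reg r := by
  induction l generalizing s with
  | nil => rfl
  | cons c l ih =>
    simp only [List.all_cons, Bool.and_eq_true, Bool.not_eq_true'] at h
    exact (ih (c.run O s) h.2).trans (run_reg O r c s h.1)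

theorem run_foldr_seq (O : Oracle F) (l : List Program) (s : State F) :
    (l.foldr Program.seq Program.skip).run O s = runs O l s := by
  induction l generalizing s with
  | nil => rfl
  | cons c l ih => exact ih (c.run O s)

theorem runs_take_succ (O : Oracle F) {l : List Program} {i : ℕ} {c : Program} (s : State F)
    (h : l[i]? = some c) : runs O (l.take (i + 1)) s = c.run O (runs O (l.take i) s) := by
  simp only [runs, List.take_add_one, h, Option.toList_some, List.foldl_append, List.foldl_cons,
    List.foldl_nil]

/-- The rows are longer than the filled part. This describes the matrix of powers before T is put in
its additional last column. -/
theorem sum_single_stride {U V W i j : ℕ} (hi : i < U) (hj : j < W) (hVW : V ≤ W)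
    (G : ℕ → ℕ → F) :
    (∑ a ∈ Finset.range U, ∑ b ∈ Finset.range V, Pi.single (a * W + b) (G a b) : ℕ → F)
      (i * W + j) = if j < V then G i j else 0 := by
  rw [← sum_ite_rowMajor hi hj (fun i j => if j < V then G i j else 0)]
  simp only [Finset.sum_apply, Pi.single_apply]
  refine Finset.sum_congr rfl fun a _ => ?_
  refine (Finset.sum_congr rfl fun b hb => ?_).trans
    (Finset.sum_subset (Finset.range_mono hVW) fun b _ hb => ?_)
  · rw [if_pos (Finset.mem_range.1 hb)]
  · rw [Finset.mem_range] at hb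
    rw [if_neg hb, ite_self]

/-- The computation, between the initialization and the output. -/
def stages : List Program :=
  [ker (rg 5) (rg 4) 0 10 11 12,
   fillSymRows,
   ker (2 * (rg 4 * rg 4)) (rg 4 * rg 4) 13 14 15 16,
   combine,
   gram (rg 4) (rg 4) 18 19,
   fillRatioRows,
   ker (rg 4 * rg 4) (rg 4 * rg 4 + 1) 20 21 22 23,
   pick (rg 4 * rg 4 + 1) 23 22 (rg 4 * rg 4) 21 22,
   fillRatio,
   .diagonalize (rg 4) 24 25 26,
   extractVecs,
   fillPowers (rg 2) (rg 4) 28 (rg 10 * rg 4 + rg 11),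
   fillPowers (rg 1) (rg 4 * rg 5) 29 (rg 11 * (rg 4 + 1) + rg 10),
   fillLast,
   fillDefect,
   checkEigen,
   checkCount,
   ker (rg 4 * rg 5) (rg 4 + 1) 29 30 31 32,
   pick (rg 4 + 1) 32 31 (rg 4) 29 30]

/-- The program. -/
def waringProgram : Program :=
  .seq initProg (.seq (stages.foldr Program.seq Program.skip) (.seq writeOutput finish))

open Classical in
/-- What is in the memory before the output is written. -/
structure RunFacts (n m k K N L : ℕ) (T f g : ℕ → F) (s : State F) : Prop where
  kerImage : IsKernelBasis (arrMat T L N) (arrMat (s.mem 11) N N) (fun j : Fin N => s.mem 12 j)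
  colRow : ∀ (x : ℕ → F) (c j : ℕ), c < N → j < N → rowDot (N * N) (c * N + j) x (s.mem 13) =
    if s.mem 12 c = 0 then ∑ p ∈ Finset.range N, s.mem 11 (p * N + c) * x (p + N * j) else 0
  rotRow : ∀ (x : ℕ → F) (i y : ℕ), i < n → y < K * N →
    rowDot (N * N) (N * N + (i * (K * N) + y)) x (s.mem 13) = x (i + n * y) - x (y + K * N * i)
  kerSym : IsKernelBasis (arrMat (s.mem 13) (2 * (N * N)) (N * N))
    (arrMat (s.mem 15) (N * N) (N * N)) (fun j : Fin (N * N) => s.mem 16 j)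
  combF : ∀ v < N * N, s.mem 17 v =
    ∑ l ∈ Finset.range (Nat.count (fun j => s.mem 16 j = 0) (N * N)),
      f l * s.mem 15 (v * (N * N) + Nat.nth (fun j => s.mem 16 j = 0) l)
  combG : ∀ v < N * N, s.mem 18 v =
    ∑ l ∈ Finset.range (Nat.count (fun j => s.mem 16 j = 0) (N * N)),
      g l * s.mem 15 (v * (N * N) + Nat.nth (fun j => s.mem 16 j = 0) l)
  gramG : arrMat (s.mem 19) N N = (arrMat (s.mem 18) N N).conjTranspose * arrMat (s.mem 18) N N
  ratioRow : ∀ (x : ℕ → F) (p j : ℕ), p < N → j < N →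
    rowDot (N * N + 1) (p * N + j) x (s.mem 20) =
      ∑ q ∈ Finset.range N, s.mem 19 (q * N + j) * x (p * N + q) -
        s.mem 17 (p * N + j) * x (N * N)
  kerRatio : IsKernelBasis (arrMat (s.mem 20) (N * N) (N * N + 1))
    (arrMat (s.mem 22) (N * N + 1) (N * N + 1)) (fun j : Fin (N * N + 1) => s.mem 23 j)
  pickRatio : (s.reg 22 = 0 ∧ ∀ j < N * N + 1, s.mem 23 j = 0 →
      s.mem 22 (N * N * (N * N + 1) + j) = 0) ∨
    (1 ≤ s.reg 22 ∧ s.reg 21 < N * N + 1 ∧ s.mem 23 (s.reg 21) = 0 ∧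
      s.mem 22 (N * N * (N * N + 1) + s.reg 21) ≠ 0)
  ratio : ∀ p < N, ∀ q < N, s.mem 24 (p * N + q) = ∑ e ∈ Finset.range N,
    starRingEnd F (s.mem 18 (q * N + e)) * s.mem 22 ((p * N + e) * (N * N + 1) + s.reg 21)
  eigen : (∃ (Q : Matrix (Fin N) (Fin N) F) (d : Fin N → F), IsUnit Q.det ∧
      arrMat (s.mem 24) N N * Q = Q * Matrix.diagonal d) →
    IsUnit (arrMat (s.mem 25) N N).det ∧ arrMat (s.mem 24) N N * arrMat (s.mem 25) N N =
      arrMat (s.mem 25) N N * Matrix.diagonal (fun j : Fin N => s.mem 26 j)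
  vecs : ∃ piv : ℕ → ℕ, (∀ j < N, s.mem 26 j ≠ 0 →
      (∃ p < K, ∃ i < n, s.mem 25 ((p + K * i) * N + j) ≠ 0) →
      piv j < K ∧ ∃ i < n, s.mem 25 ((piv j + K * i) * N + j) ≠ 0) ∧
    ∀ j < N, ∀ i < n, s.mem 27 (j * n + i) =
      if s.mem 26 j = 0 then 0 else s.mem 25 ((piv j + K * i) * N + j)
  powK : ∀ j < N, ∀ p < N, s.mem 28 (j * N + p) =
    ∏ l ∈ Finset.range k, s.mem 27 (j * n + p / n ^ l % n)
  powM : ∀ p < N * L, ∀ j < N, s.mem 29 (p * (N + 1) + j) =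
    ∏ l ∈ Finset.range m, s.mem 27 (j * n + p / n ^ l % n)
  powLast : ∀ p < N * L, s.mem 29 (p * (N + 1) + N) = T p
  checks : s.reg 23 = 0 ↔
    (∀ j < N, s.mem 26 j ≠ 0 → ∃ p < K, ∃ i < n, s.mem 25 ((p + K * i) * N + j) ≠ 0) ∧
    (∀ j < N, s.mem 26 j ≠ 0 → (∀ p < N, ∑ q ∈ Finset.range N,
      s.mem 24 (p * N + q) * s.mem 28 (j * N + q) = s.mem 26 j * s.mem 28 (j * N + p)) ∧
      ∀ j' < N, j < j' → s.mem 26 j ≠ s.mem 26 j') ∧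
    Nat.count (fun j => s.mem 26 j ≠ 0) N = Nat.count (fun j => s.mem 16 j = 0) (N * N)
  kerCoeff : IsKernelBasis (arrMat (s.mem 29) (N * L) (N + 1))
    (arrMat (s.mem 31) (N + 1) (N + 1)) (fun j : Fin (N + 1) => s.mem 32 j)
  pickCoeff : (s.reg 30 = 0 ∧ ∀ j < N + 1, s.mem 32 j = 0 → s.mem 31 (N * (N + 1) + j) = 0) ∨
    (1 ≤ s.reg 30 ∧ s.reg 29 < N + 1 ∧ s.mem 32 (s.reg 29) = 0 ∧
      s.mem 31 (N * (N + 1) + s.reg 29) ≠ 0)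
  unused : s.reg 31 = 0 ∧ s.mem 43 = 0

/-- The specification of each stage concerns the states before and after it. The frame rules
transport every array to the final state, since those mentioned in the facts are not changed after
their own stage. -/
theorem runFacts {O : Oracle F} (hO : O.IsValid) {n m k K N L : ℕ} (hn : 1 ≤ n) (hKN : K * n = N)
    {s0 : State F} (h0 : s0.reg 0 = n) (h1 : s0.reg 1 = m) (h2 : s0.reg 2 = k)
    (h3 : s0.reg 3 = K) (h4 : s0.reg 4 = N) (h5 : s0.reg 5 = L)
    (hr : ∀ r, 20 ≤ r → s0.reg r = 0) (hm : ∀ a, 10 ≤ a → s0.mem a = 0) :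
    RunFacts n m k K N L (s0.mem 0) (s0.mem 1) (s0.mem 2) (runs O stages s0) := by
  obtain ⟨S, hS⟩ : ∃ S : ℕ → State F, ∀ i, S i = runs O (stages.take i) s0 := ⟨_, fun _ => rfl⟩
  set sF := runs O stages s0 with hsF
  -- S i is the state after i stages. `Z` and `ZR` concern what the first i stages have not touched,
  -- `Fm` and `Fr` what the remaining stages leave unchanged; the side conditions are decided by
  -- evaluating the list of programs.
  have Z : ∀ i a, (stages.take i).all (fun c => !c.modArr a) = true → (S i).mem a = s0.mem a :=
    fun i a h => by rw [hS]; exact runs_mem O a _ s0 h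
  have ZR : ∀ i r, (stages.take i).all (fun c => !c.modReg r) = true → (S i).reg r = s0.reg r :=
    fun i r h => by rw [hS]; exact runs_reg O r _ s0 h
  have hsplit : ∀ i, sF = runs O (stages.drop i) (S i) := fun i => by
    rw [hS, hsF]
    simp only [runs]
    rw [← List.foldl_append, List.take_append_drop]
  have Fm : ∀ i a, (stages.drop i).all (fun c => !c.modArr a) = true → (S i).mem a = sF.mem a :=
    fun i a h => by rw [hsplit i]; exact (runs_mem O a _ _ h).symm
  have Fr : ∀ i r, (stages.drop i).all (fun c => !c.modReg r) = true → (S i).reg r = sF.reg r :=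
    fun i r h => by rw [hsplit i]; exact (runs_reg O r _ _ h).symm
  have low : ∀ i, ∀ r < 10, (S i).reg r = s0.reg r := by
    intro i r hr
    rw [hS]
    refine runs_reg O r _ s0 ?_
    rw [List.all_eq_true]
    intro c hc
    have hc' := List.mem_of_mem_take hc
    simp only [Bool.not_eq_true']
    have : stages.all (fun c => !c.modReg r) = true := by
      interval_cases r <;> rfl
    rw [List.all_eq_true] at this
    simpa using this c hc'
  have S0 : S 0 = s0 := hS 0
  have g0 : ∀ i, (S i).reg 0 = n := fun i => by rw [low i 0 (by decide), h0]
  have g1 : ∀ i, (S i).reg 1 = m := fun i => by rw [low i 1 (by decide), h1]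
  have g2 : ∀ i, (S i).reg 2 = k := fun i => by rw [low i 2 (by decide), h2]
  have g3 : ∀ i, (S i).reg 3 = K := fun i => by rw [low i 3 (by decide), h3]
  have g4 : ∀ i, (S i).reg 4 = N := fun i => by rw [low i 4 (by decide), h4]
  have g5 : ∀ i, (S i).reg 5 = L := fun i => by rw [low i 5 (by decide), h5]
  have st1 : S 1 = (ker (rg 5) (rg 4) 0 10 11 12).run O (S 0) := by
    rw [hS, hS]; exact runs_take_succ O s0 rfl
  have st2 : S 2 = fillSymRows.run O (S 1) := by
    rw [hS, hS]; exact runs_take_succ O s0 rfl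
  have st3 : S 3 = (ker (2 * (rg 4 * rg 4)) (rg 4 * rg 4) 13 14 15 16).run O (S 2) := by
    rw [hS, hS]; exact runs_take_succ O s0 rfl
  have st4 : S 4 = combine.run O (S 3) := by
    rw [hS, hS]; exact runs_take_succ O s0 rfl
  have st5 : S 5 = (gram (rg 4) (rg 4) 18 19).run O (S 4) := by
    rw [hS, hS]; exact runs_take_succ O s0 rfl
  have st6 : S 6 = fillRatioRows.run O (S 5) := by
    rw [hS, hS]; exact runs_take_succ O s0 rfl
  have st7 : S 7 = (ker (rg 4 * rg 4) (rg 4 * rg 4 + 1) 20 21 22 23).run O (S 6) := by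
    rw [hS, hS]; exact runs_take_succ O s0 rfl
  have st8 : S 8 = (pick (rg 4 * rg 4 + 1) 23 22 (rg 4 * rg 4) 21 22).run O (S 7) := by
    rw [hS, hS]; exact runs_take_succ O s0 rfl
  have st9 : S 9 = fillRatio.run O (S 8) := by
    rw [hS, hS]; exact runs_take_succ O s0 rfl
  have st10 : S 10 = (Program.diagonalize (rg 4) 24 25 26).run O (S 9) := by
    rw [hS, hS]; exact runs_take_succ O s0 rfl
  have st11 : S 11 = extractVecs.run O (S 10) := by
    rw [hS, hS]; exact runs_take_succ O s0 rfl
  have st12 : S 12 = (fillPowers (rg 2) (rg 4) 28 (rg 10 * rg 4 + rg 11)).run O (S 11) := by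
    rw [hS, hS]; exact runs_take_succ O s0 rfl
  have st13 : S 13 = (fillPowers (rg 1) (rg 4 * rg 5) 29 (rg 11 * (rg 4 + 1) + rg 10)).run O
      (S 12) := by
    rw [hS, hS]; exact runs_take_succ O s0 rfl
  have st14 : S 14 = fillLast.run O (S 13) := by
    rw [hS, hS]; exact runs_take_succ O s0 rfl
  have st15 : S 15 = fillDefect.run O (S 14) := by
    rw [hS, hS]; exact runs_take_succ O s0 rfl
  have st16 : S 16 = checkEigen.run O (S 15) := by
    rw [hS, hS]; exact runs_take_succ O s0 rfl
  have st17 : S 17 = checkCount.run O (S 16) := by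
    rw [hS, hS]; exact runs_take_succ O s0 rfl
  have st18 : S 18 = (ker (rg 4 * rg 5) (rg 4 + 1) 29 30 31 32).run O (S 17) := by
    rw [hS, hS]; exact runs_take_succ O s0 rfl
  have st19 : S 19 = (pick (rg 4 + 1) 32 31 (rg 4) 29 30).run O (S 18) := by
    rw [hS, hS]; exact runs_take_succ O s0 rfl
  have k1 := ker_spec hO (E := rg 5) (V := rg 4) (by rfl) (by rfl) (src := 0) (H := 10) (Q := 11)
    (D := 12) (by decide) (by decide) (by decide) (by decide) (s := S 0)
    (by rw [Z 0 10 rfl, hm 10 (by decide)]) (g5 0) (g4 0)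
  rw [← st1, Z 0 0 rfl, Fm 1 11 rfl, Fm 1 12 rfl] at k1
  have z13 : (S 1).mem 13 = 0 := by rw [Z 1 13 rfl, hm 13 (by decide)]
  have k3 := ker_spec hO (E := 2 * (rg 4 * rg 4)) (V := rg 4 * rg 4) (by rfl) (by rfl) (src := 13)
    (H := 14) (Q := 15) (D := 16) (by decide) (by decide) (by decide) (by decide) (s := S 2)
    (e := 2 * (N * N)) (v := N * N)
    (by rw [Z 2 14 rfl, hm 14 (by decide)]) (by simp [g4 2]) (by simp [g4 2])
  rw [← st3, Fm 2 13 rfl, Fm 3 15 rfl, Fm 3 16 rfl] at k3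
  have k4 := combine_spec O (s := S 3) (V := N * N) (by rw [g4 3])
    (by rw [ZR 3 20 rfl, hr 20 (by decide)])
    (by rw [Z 3 17 rfl, hm 17 (by decide)]) (by rw [Z 3 18 rfl, hm 18 (by decide)])
  rw [← st4, Fm 3 16 rfl, Fm 3 15 rfl, Fm 4 17 rfl, Fm 4 18 rfl, Fr 4 20 rfl, Z 3 1 rfl,
    Z 3 2 rfl] at k4
  have k5 := gram_mem O (E := rg 4) (V := rg 4) (by rfl) (by rfl) (src := 18) (dst := 19)
    (by decide) (by decide) (by decide) (s := S 4) (by rw [Z 4 19 rfl, hm 19 (by decide)])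
  rw [← st5, IdxExpr.eval_rg, g4 4, Fm 5 19 rfl, Fm 4 18 rfl] at k5
  have k7 := ker_spec hO (E := rg 4 * rg 4) (V := rg 4 * rg 4 + 1) (by rfl) (by rfl) (src := 20)
    (H := 21) (Q := 22) (D := 23) (by decide) (by decide) (by decide) (by decide) (s := S 6)
    (e := N * N) (v := N * N + 1)
    (by rw [Z 6 21 rfl, hm 21 (by decide)]) (by simp [g4 6]) (by simp [g4 6])
  rw [← st7, Fm 6 20 rfl, Fm 7 22 rfl, Fm 7 23 rfl] at k7
  have k8 := pick_spec O (V := rg 4 * rg 4 + 1) (row := rg 4 * rg 4) (D := 23) (Q := 22)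
    (pr := 21) (fr := 22) (v := N * N + 1) (w := N * N) (s := S 7) (by decide) (by decide)
    (by decide) (fun reg' h => by simp [h 4 (by decide), g4 7])
    (fun reg' h => by simp [h 4 (by decide), g4 7]) (by rw [ZR 7 22 rfl, hr 22 (by decide)])
  rw [← st8, Fm 7 22 rfl, Fm 7 23 rfl, Fr 8 22 rfl, Fr 8 21 rfl] at k8
  have k10 := mem_diagonalize O (S 9) N 24 25 26 (by decide)
  have e10 : (S 10).mem = ((S 9).diagonalize O N 24 25 26).mem := by
    rw [st10, Program.run, IdxExpr.eval_rg, g4 9]; rfl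
  rw [← e10, Fm 10 25 rfl, Fm 10 26 rfl, Fm 9 24 rfl] at k10
  have k11 := extractVecs_spec O (s := S 10) (g0 10) (g3 10) (g4 10)
    (by rw [ZR 10 28 rfl, hr 28 (by decide)]) (by rw [ZR 10 23 rfl, hr 23 (by decide)])
    (by rw [Z 10 27 rfl, hm 27 (by decide)])
  rw [← st11, Fm 10 26 rfl, Fm 10 25 rfl, Fm 11 27 rfl, Fr 11 28 rfl] at k11
  have k12 := fillPowers_mem O (K := rg 2) (B := rg 4) (dst := 28)
    (addr := rg 10 * rg 4 + rg 11) (s := S 11) (n := n) (N := N) (k := k) (b := N) (by decide)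
    (by decide) hn (g0 11) (g4 11) (fun reg' h => by rw [IdxExpr.eval_rg, h 2 (by decide), g2])
    (fun reg' h => by rw [IdxExpr.eval_rg, h 4 (by decide), g4]) (fun j p => j * N + p)
    (fun reg' h => by
      simp only [IdxExpr.eval_add, IdxExpr.eval_mul, IdxExpr.eval_rg, h 4 (by decide), g4])
  rw [← st12, Z 11 28 rfl, hm 28 (by decide), zero_add, Fm 12 28 rfl, Fm 11 27 rfl] at k12
  have k13 := fillPowers_mem O (K := rg 1) (B := rg 4 * rg 5) (dst := 29)
    (addr := rg 11 * (rg 4 + 1) + rg 10) (s := S 12) (n := n) (N := N) (k := m) (b := N * L)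
    (by decide) (by decide) hn (g0 12) (g4 12)
    (fun reg' h => by rw [IdxExpr.eval_rg, h 1 (by decide), g1])
    (fun reg' h => by
      simp only [IdxExpr.eval_mul, IdxExpr.eval_rg, h 4 (by decide), h 5 (by decide), g4, g5])
    (fun j p => p * (N + 1) + j)
    (fun reg' h => by
      simp only [IdxExpr.eval_add, IdxExpr.eval_mul, IdxExpr.eval_rg, IdxExpr.eval_one,
        h 4 (by decide), g4])
  rw [← st13, Z 12 29 rfl, hm 29 (by decide), zero_add, Fm 12 27 rfl] at k13
  have k14 := fillLast_mem O (s := S 13) (N := N) (M := N * L) (g4 13) (by rw [g4, g5])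
  rw [← st14, k13, Fm 14 29 rfl, Z 13 0 rfl] at k14
  have k16 := checkEigen_spec O (s := S 15) (N := N) (g4 15)
  rw [← st16, Fm 15 26 rfl, Fm 15 33 rfl] at k16
  have k17 := checkCount_spec O (S 16)
  rw [← st17, Fr 17 23 rfl, Fr 16 28 rfl, Fr 16 20 rfl] at k17
  -- The failure flag is first set while the vectors are extracted and must survive unchanged until
  -- the later tests.
  have e23 : (S 15).reg 23 = (S 11).reg 23 := by
    rw [st15, run_reg O 23 fillDefect _ rfl, st14, run_reg O 23 fillLast _ rfl, st13,
      run_reg O 23 (fillPowers _ _ _ _) _ rfl, st12, run_reg O 23 (fillPowers _ _ _ _) _ rfl]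
  have k18 := ker_spec hO (E := rg 4 * rg 5) (V := rg 4 + 1) (by rfl) (by rfl) (src := 29)
    (H := 30) (Q := 31) (D := 32) (by decide) (by decide) (by decide) (by decide) (s := S 17)
    (e := N * L) (v := N + 1)
    (by rw [Z 17 30 rfl, hm 30 (by decide)]) (by simp [g4 17, g5 17]) (by simp [g4 17])
  rw [← st18, Fm 17 29 rfl, Fm 18 31 rfl, Fm 18 32 rfl] at k18
  have k19 := pick_spec O (V := rg 4 + 1) (row := rg 4) (D := 32) (Q := 31)
    (pr := 29) (fr := 30) (v := N + 1) (w := N) (s := S 18) (by decide) (by decide)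
    (by decide) (fun reg' h => by simp [h 4 (by decide), g4 18])
    (fun reg' h => by simp [h 4 (by decide), g4 18]) (by rw [ZR 18 30 rfl, hr 30 (by decide)])
  rw [← st19, Fm 18 31 rfl, Fm 18 32 rfl, Fr 19 30 rfl, Fr 19 29 rfl] at k19
  refine ⟨k1, fun x c j hc hj => ?_, fun x i y hi hy => ?_, k3, k4.2.1, k4.2.2, k5,
    fun x p j hp hj => ?_, k7, k8, fun p hp q hq => ?_, fun hdiag => ?_, k11.2.2,
    fun j hj p hp => ?_, fun p hp j hj => ?_, fun p hp => ?_, ?_, k18, k19, ?_, ?_⟩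
  · have := fillSymRows_col O z13 (g0 1) (g3 1) (g4 1) hKN x hc hj
    rwa [← st2, Fm 2 13 rfl, Fm 1 12 rfl, Fm 1 11 rfl] at this
  · have := fillSymRows_rot O z13 (g0 1) (g3 1) (g4 1) hKN x hi hy
    rwa [← st2, Fm 2 13 rfl] at this
  · have := fillRatioRows_row O (s := S 5) (by rw [Z 5 20 rfl, hm 20 (by decide)]) (g4 5) x hp hj
    rwa [← st6, Fm 6 20 rfl, Fm 5 19 rfl, Fm 5 17 rfl] at this
  · have := fillRatio_mem O (s := S 8) (by rw [Z 8 24 rfl, hm 24 (by decide)]) (g4 8) rfl hp hq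
    rwa [← st9, Fm 9 24 rfl, Fm 8 18 rfl, Fm 8 22 rfl, Fr 8 21 rfl] at this
  · rw [k10.1, k10.2]
    exact hO N (arrMat (sF.mem 24) N N) hdiag
  · rw [k12, sum_single_rowMajor hj hp]
  -- The powers fill columns 0 to N - 1 and T fills column N, so neither contributes to the other.
  · rw [k14, Pi.add_apply, Finset.sum_comm]
    rw [sum_single_stride hp (Nat.lt_succ_of_lt hj) (Nat.le_succ N), if_pos hj, Finset.sum_apply,
      Finset.sum_eq_zero, add_zero]
    intro p' _
    rw [Pi.single_eq_of_ne]
    intro h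
    exact absurd (rowMajor_inj (Nat.lt_succ_of_lt hj) (Nat.lt_succ_self N) h).2 (by omega)
  · rw [k14, Pi.add_apply, Finset.sum_comm, sum_single_stride hp (Nat.lt_succ_self N)
      (Nat.le_succ N), if_neg (lt_irrefl N), zero_add, Finset.sum_apply, Finset.sum_eq_single p]
    · simp
    · intro p' _ hne
      rw [Pi.single_eq_of_ne]
      intro h
      exact hne (rowMajor_inj (Nat.lt_succ_self N) (Nat.lt_succ_self N) h).1.symm
    · exact fun h => absurd (Finset.mem_range.2 hp) h
  · rw [k17, ← not_ne_iff (a := (S 16).reg 23), k16, e23, not_or, not_ne_iff, k11.2.1,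
      k11.1, k4.1, and_assoc]
    have k15 : ∀ j < N, ∀ p < N, sF.mem 33 (j * N + p) = ∑ q ∈ Finset.range N,
        sF.mem 24 (p * N + q) * sF.mem 28 (j * N + q) - sF.mem 26 j * sF.mem 28 (j * N + p) := by
      intro j hj p hp
      have := fillDefect_mem O (s := S 14) (by rw [Z 14 33 rfl, hm 33 (by decide)]) (g4 14) hj hp
      rwa [← st15, Fm 15 33 rfl, Fm 14 24 rfl, Fm 14 28 rfl, Fm 14 26 rfl] at this
    refine and_congr_right fun _ => and_congr ?_ Iff.rfl
    constructor
    · intro h j hj hne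
      refine ⟨fun p hp => ?_, fun j' hj' hlt heq => h ⟨j, hj, hne, Or.inr ⟨j', hj', hlt, heq⟩⟩⟩
      by_contra hc
      refine h ⟨j, hj, hne, Or.inl ⟨p, hp, ?_⟩⟩
      rw [k15 j hj p hp]
      exact sub_ne_zero.2 hc
    · rintro h ⟨j, hj, hne, ⟨p, hp, h1⟩ | ⟨j', hj', hlt, heq⟩⟩
      · rw [k15 j hj p hp] at h1
        exact h1 (sub_eq_zero.2 ((h j hj hne).1 p hp))
      · exact (h j hj hne).2 j' hj' hlt heq
  · rw [← Fr 0 31 rfl, ZR 0 31 rfl, hr 31 (by decide)]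
  · rw [← Fm 0 43 rfl, Z 0 43 rfl, hm 43 (by decide)]

end Assembly

end Waring

namespace Waring

/-! ### Linear algebra of the ratio matrix X = W B^* -/

section MatrixCore

open Matrix

variable {F : Type*} [RCLike F] {ι : Type*} [Fintype ι] [DecidableEq ι]

open ComplexOrder in
-- B^*B and B^* have the same range, by comparison of ranks, so each column of B^* can be solved
-- for.
theorem exists_conjTranspose_factor (B : Matrix ι ι F) : ∃ C : Matrix ι ι F, Bᴴ = Bᴴ * B * C := by
  have hle : LinearMap.range (Bᴴ * B).mulVecLin ≤ LinearMap.range Bᴴ.mulVecLin := by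
    rw [Matrix.mulVecLin_mul]
    exact LinearMap.range_comp_le_range _ _
  have heq : LinearMap.range (Bᴴ * B).mulVecLin = LinearMap.range Bᴴ.mulVecLin := by
    refine Submodule.eq_of_le_of_finrank_eq hle ?_
    change (Bᴴ * B).rank = Bᴴ.rank
    rw [Matrix.rank_conjTranspose_mul_self, Matrix.rank_conjTranspose]
  have h : ∀ j, ∃ c : ι → F, (Bᴴ * B) *ᵥ c = Bᴴ.col j := by
    intro j
    have : Bᴴ.col j ∈ LinearMap.range Bᴴ.mulVecLin := ⟨Pi.single j 1, by simp⟩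
    rw [← heq] at this
    exact this
  choose c hc using h
  refine ⟨Matrix.of fun i j => c j i, ?_⟩
  ext i j
  rw [Matrix.mul_apply]
  exact (congrFun (hc j) i).symm

theorem mul_colMatrix_of_eigen {s : ℕ} {X : Matrix ι ι F} {y : Fin s → ι → F} {d : Fin s → F}
    (h : ∀ a, X *ᵥ y a = d a • y a) : X * colMatrix y = colMatrix y * diagonal d := by
  ext i a
  rw [Matrix.mul_diagonal]
  have := congrFun (h a) i
  rw [Pi.smul_apply, smul_eq_mul] at this
  rw [mul_comm]
  exact this

/-- The soundness criterion. Eigenvectors at distinct nonzero eigenvalues are independent and lie in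
the range of A; by hypothesis their squares then lie in the span of the slices. Being s independent
elements of an s-dimensional space, these squares span it, which yields the decomposition. The
relation XB = tA identifies each eigenvalue with t times the ratio. -/
theorem simDiagonalizedBy_of_eigen {s : ℕ} {Φ : Fin s → Matrix ι ι F} {f g : Fin s → F}
    {W : Matrix ι ι F} {t : F} {y : Fin s → ι → F} {d : Fin s → F} (hΦ : LinearIndependent F Φ)
    (ht : t ≠ 0) (hW : W * ((contract Φ g)ᴴ * contract Φ g) = t • contract Φ f)
    (hy : ∀ a, (W * (contract Φ g)ᴴ) *ᵥ y a = d a • y a) (hy0 : ∀ a, y a ≠ 0)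
    (hd0 : ∀ a, d a ≠ 0) (hd : Function.Injective d)
    (hmem : ∀ a, (∃ c, y a = contract Φ f *ᵥ c) →
      vecMulVec (y a) (y a) ∈ Submodule.span F (Set.range Φ)) :
    SimDiagonalizedBy Φ f g y := by
  set A := contract Φ f with hA
  set B := contract Φ g with hB
  set X := W * Bᴴ with hX
  have hXB : X * B = t • A := by rw [hX, Matrix.mul_assoc, hW]
  obtain ⟨C, hC⟩ := exists_conjTranspose_factor B
  -- B^* = B^*BC gives X = W B^*BC = tAC, and a vector with a nonzero eigenvalue lies in the range
  -- of X.
  have hrange : ∀ a, ∃ c, y a = A *ᵥ c := by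
    intro a
    refine ⟨((d a)⁻¹ * t) • (C *ᵥ y a), ?_⟩
    have h1 : X *ᵥ y a = (t • A) *ᵥ (C *ᵥ y a) := by
      rw [← hW, Matrix.mulVec_mulVec, hX, Matrix.mul_assoc W, ← hC]
    rw [hy a, Matrix.smul_mulVec] at h1
    rw [Matrix.mulVec_smul, mul_smul, ← h1, smul_smul, inv_mul_cancel₀ (hd0 a), one_smul]
  have hli : LinearIndependent F y := by
    refine Module.End.eigenvectors_linearIndependent' (Matrix.toLin' X) d hd y fun a => ?_
    refine ⟨?_, hy0 a⟩
    rw [Module.End.mem_eigenspace_iff, Matrix.toLin'_apply]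
    exact hy a
  have hspan : Submodule.span F (Set.range Φ) =
      Submodule.span F (Set.range fun a => vecMulVec (y a) (y a)) := by
    symm
    refine Submodule.eq_of_le_of_finrank_eq ?_ ?_
    · rw [Submodule.span_le]
      rintro _ ⟨a, rfl⟩
      exact hmem a (hrange a)
    · rw [finrank_span_eq_card hΦ, finrank_span_eq_card (linearIndependent_vecMulVec hli)]
  obtain ⟨z, hz, hzli⟩ := exists_coeff_of_span_eq hΦ hspan
  have hAz := contract_eq_diagonalized hz f
  have hBz := contract_eq_diagonalized hz g
  set p : Fin s → F := fun a => ∑ l, f l * z a l with hp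
  set r : Fin s → F := fun a => ∑ l, g l * z a l with hr
  set Y := colMatrix y with hY
  obtain ⟨Y', hY', -⟩ := exists_pinv_colMatrix hli
  have hYt : Yᵀ * Y'ᵀ = 1 := by rw [← Matrix.transpose_mul, hY', Matrix.transpose_one]
  have hXY : X * Y = Y * diagonal d := mul_colMatrix_of_eigen hy
  have hrel : ∀ a, d a * r a = t * p a := by
    have h1 : Y * diagonal d * diagonal r * Yᵀ = t • (Y * diagonal p * Yᵀ) := by
      rw [← hXY, ← hAz, ← hA, ← hXB, hB, hBz]
      simp only [Matrix.mul_assoc]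
    have h2 : diagonal d * diagonal r = t • diagonal p := by
      have h3 := congrArg (fun Z => Y' * Z * Y'ᵀ) h1
      simp only [Matrix.mul_smul, Matrix.smul_mul] at h3
      have e1 : Y' * (Y * diagonal d * diagonal r * Yᵀ) * Y'ᵀ =
          (Y' * Y) * (diagonal d * diagonal r) * (Yᵀ * Y'ᵀ) := by
        simp only [Matrix.mul_assoc]
      have e2 : Y' * (Y * diagonal p * Yᵀ) * Y'ᵀ = (Y' * Y) * diagonal p * (Yᵀ * Y'ᵀ) := by
        simp only [Matrix.mul_assoc]
      rwa [e1, e2, hY', hYt, Matrix.one_mul, Matrix.mul_one, Matrix.one_mul, Matrix.mul_one] at h3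
    intro a
    have := congrFun (congrFun h2 a) a
    simpa [Matrix.diagonal_mul_diagonal] using this
  -- In the coordinates of Y, the range of A has a-th coordinate zero if p_a = 0, but y_a lies in
  -- that range with a-th coordinate 1.
  have hp0 : ∀ a, p a ≠ 0 := by
    intro a h0
    obtain ⟨c, hc⟩ := hrange a
    have h1 : Y' *ᵥ y a = Pi.single a 1 := by
      have : y a = Y *ᵥ Pi.single a 1 := by
        rw [Matrix.mulVec_single_one]; rfl
      rw [this, Matrix.mulVec_mulVec, hY', Matrix.one_mulVec]
    have h2 : Y' *ᵥ y a = diagonal p *ᵥ (Yᵀ *ᵥ c) := by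
      rw [hc, hA, hAz, Matrix.mulVec_mulVec, Matrix.mulVec_mulVec, ← Matrix.mul_assoc,
        ← Matrix.mul_assoc, hY', Matrix.one_mul]
    rw [h1] at h2
    have := congrFun h2 a
    rw [Matrix.mulVec_diagonal, h0, zero_mul, Pi.single_eq_same] at this
    exact one_ne_zero this
  have hr0 : ∀ a, r a ≠ 0 := by
    intro a h0
    have := hrel a
    rw [h0, mul_zero] at this
    exact mul_ne_zero ht (hp0 a) this.symm
  refine ⟨z, hz, hzli, hli, hp0, hr0, fun a b hab => hd ?_⟩
  have key : ∀ a, d a = t * (p a / r a) := fun a => by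
    rw [mul_div_assoc', ← hrel a, mul_div_cancel_right₀ _ (hr0 a)]
  rw [key a, key b]
  exact congrArg (t * ·) hab

/-- Solves the ratio equation with t = 1. The factorization B = C^*(B^*B) reduces it to finding a
matrix that sends B to A, namely Y D_f D_g⁻¹ Y'. -/
theorem SimDiagonalizedBy.exists_ratio {s : ℕ} {Φ : Fin s → Matrix ι ι F} {f g : Fin s → F}
    {y : Fin s → ι → F} (h : SimDiagonalizedBy Φ f g y) :
    ∃ W : Matrix ι ι F, W * ((contract Φ g)ᴴ * contract Φ g) = contract Φ f := by
  obtain ⟨z, hz, -, hli, -, hr0, -⟩ := h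
  obtain ⟨C, hC⟩ := exists_conjTranspose_factor (contract Φ g)
  have hB : contract Φ g = Cᴴ * ((contract Φ g)ᴴ * contract Φ g) := by
    have := congrArg conjTranspose hC
    rwa [Matrix.conjTranspose_conjTranspose, Matrix.conjTranspose_mul, Matrix.conjTranspose_mul,
      Matrix.conjTranspose_conjTranspose] at this
  obtain ⟨Y', hY', -⟩ := exists_pinv_colMatrix hli
  refine ⟨colMatrix y * diagonal (fun a => (∑ l, f l * z a l) * (∑ l, g l * z a l)⁻¹) * Y' * Cᴴ,
    ?_⟩
  rw [Matrix.mul_assoc, ← hB, contract_eq_diagonalized hz f, contract_eq_diagonalized hz g]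
  rw [show ∀ (Y : Matrix ι (Fin s) F) (D D' : Matrix (Fin s) (Fin s) F) (Z : Matrix (Fin s) ι F),
    Y * D * Y' * (Y * D' * Z) = Y * (D * (Y' * Y) * D') * Z from fun Y D D' Z => by
      simp only [Matrix.mul_assoc]]
  rw [hY', Matrix.mul_one, Matrix.diagonal_mul_diagonal]
  congr 3
  ext a
  rw [mul_assoc, inv_mul_cancel₀ (hr0 a), mul_one]

/-- W is not determined by its equation, but WB^* is: XB = tA fixes X on the column space of Y, and
X vanishes on the orthogonal complement of the range of B. Hence X does not depend on the kernel
vector chosen, except through t. -/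
theorem SimDiagonalizedBy.ratio_eq {s : ℕ} {Φ : Fin s → Matrix ι ι F} {f g : Fin s → F}
    {y : Fin s → ι → F} (h : SimDiagonalizedBy Φ f g y) {W : Matrix ι ι F} {t : F} (ht : t ≠ 0)
    (hW : W * ((contract Φ g)ᴴ * contract Φ g) = t • contract Φ f) :
    ∃ (Y' : Matrix (Fin s) ι F) (d : Fin s → F), Y' * colMatrix y = 1 ∧ (∀ a, d a ≠ 0) ∧
      Function.Injective d ∧ W * (contract Φ g)ᴴ = colMatrix y * diagonal d * Y' := by
  obtain ⟨z, hz, -, hli, hp0, hr0, hinj⟩ := h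
  obtain ⟨Y', hY', hYh⟩ := exists_pinv_colMatrix hli
  have hAz := contract_eq_diagonalized hz f
  have hBz := contract_eq_diagonalized hz g
  set p : Fin s → F := fun a => ∑ l, f l * z a l with hp
  set r : Fin s → F := fun a => ∑ l, g l * z a l with hr
  set Y := colMatrix y with hY
  set A := contract Φ f
  set B := contract Φ g
  set X := W * Bᴴ with hX
  refine ⟨Y', fun a => t * (p a / r a), hY', fun a => mul_ne_zero ht (div_ne_zero (hp0 a) (hr0 a)),
    fun a b hab => hinj (mul_left_cancel₀ ht hab), ?_⟩
  have hYt : Yᵀ * Y'ᵀ = 1 := by rw [← Matrix.transpose_mul, hY', Matrix.transpose_one]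
  have hXB : X * B = t • A := by rw [hX, Matrix.mul_assoc, hW]
  have h1 : X * Y = Y * diagonal fun a => t * (p a / r a) := by
    have h2 : X * Y * diagonal r = t • (Y * diagonal p) := by
      have h3 := congrArg (· * Y'ᵀ) hXB
      simp only [Matrix.smul_mul] at h3
      rw [hAz, hBz] at h3
      have e1 : X * (Y * diagonal r * Yᵀ) * Y'ᵀ = X * Y * diagonal r * (Yᵀ * Y'ᵀ) := by
        simp only [Matrix.mul_assoc]
      rwa [e1, Matrix.mul_assoc _ Yᵀ, hYt, Matrix.mul_one, Matrix.mul_one] at h3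
    have h4 := congrArg (· * diagonal fun a => (r a)⁻¹) h2
    simp only [Matrix.smul_mul, Matrix.mul_assoc, Matrix.diagonal_mul_diagonal] at h4
    have e5 : (diagonal fun a => r a * (r a)⁻¹) = (1 : Matrix (Fin s) (Fin s) F) := by
      rw [← Matrix.diagonal_one]
      congr 1
      ext a
      exact mul_inv_cancel₀ (hr0 a)
    rw [e5, Matrix.mul_one] at h4
    rw [h4, ← Matrix.mul_smul, ← Matrix.diagonal_smul]
    congr 2
    ext a
    rw [Pi.smul_apply, smul_eq_mul, div_eq_mul_inv]
  -- This is the adjoint of YY'B = B; the projection YY' is Hermitian by the choice of Y'.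
  have h2 : Bᴴ * (Y * Y') = Bᴴ := by
    have h3 : Y * Y' * B = B := by
      rw [hBz, Matrix.mul_assoc, ← Matrix.mul_assoc Y' _ Yᵀ, ← Matrix.mul_assoc Y' Y, hY',
        Matrix.one_mul, ← Matrix.mul_assoc]
    have h4 := congrArg conjTranspose h3
    rwa [Matrix.conjTranspose_mul, hYh.eq] at h4
  rw [← h1, Matrix.mul_assoc X, hX, Matrix.mul_assoc W, h2]

/-- An eigenbasis is given by the columns of Y together with a basis of the kernel of Y'. So a valid
oracle has to diagonalize X. -/
theorem exists_diagonalization_of_factor {s : ℕ} {Y : Matrix ι (Fin s) F}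
    {Y' : Matrix (Fin s) ι F} (h : Y' * Y = 1) (d : Fin s → F) :
    ∃ (Q : Matrix ι ι F) (e : ι → F), IsUnit Q.det ∧
      Y * diagonal d * Y' * Q = Q * diagonal e := by
  let b := Module.finBasis F (LinearMap.ker Y'.mulVecLin)
  set r := Module.finrank F (LinearMap.ker Y'.mulVecLin) with hr
  have hsurj : LinearMap.range Y'.mulVecLin = ⊤ := by
    rw [LinearMap.range_eq_top]
    intro c
    exact ⟨Y *ᵥ c, by rw [Matrix.mulVecLin_apply, Matrix.mulVec_mulVec, h, Matrix.one_mulVec]⟩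
  have hcard : s + r = Fintype.card ι := by
    have := LinearMap.finrank_range_add_finrank_ker Y'.mulVecLin
    rw [hsurj, finrank_top, Module.finrank_fintype_fun_eq_card,
      Module.finrank_fintype_fun_eq_card, Fintype.card_fin] at this
    exact this
  have e : ι ≃ Fin s ⊕ Fin r := Fintype.equivOfCardEq (by
    rw [Fintype.card_sum, Fintype.card_fin, Fintype.card_fin, hcard])
  let col : Fin s ⊕ Fin r → ι → F := Sum.elim (fun a i => Y i a) fun a => (b a : ι → F)
  let val : Fin s ⊕ Fin r → F := Sum.elim d fun _ => 0
  have hb : ∀ a, Y' *ᵥ (b a : ι → F) = 0 := fun a => (b a).2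
  have hYcol : ∀ a, (fun i => Y i a) = Y *ᵥ Pi.single a 1 := fun a => by
    rw [Matrix.mulVec_single_one]; rfl
  have heig : ∀ x, (Y * diagonal d * Y') *ᵥ col x = val x • col x := by
    rintro (a | a)
    · change (Y * diagonal d * Y') *ᵥ (fun i => Y i a) = d a • (fun i => Y i a)
      rw [hYcol, Matrix.mulVec_mulVec, Matrix.mul_assoc, h, Matrix.mul_one, ← Matrix.mulVec_mulVec,
        ← Matrix.mulVec_smul]
      congr 1
      ext b
      rw [Matrix.mulVec_diagonal]
      by_cases hab : b = a
      · subst hab; simp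
      · simp [hab]
    · change (Y * diagonal d * Y') *ᵥ (b a : ι → F) = (0 : F) • (b a : ι → F)
      rw [← Matrix.mulVec_mulVec, hb, Matrix.mulVec_zero, zero_smul]
  have hli : LinearIndependent F col := by
    rw [Fintype.linearIndependent_iff]
    intro c hc
    rw [Fintype.sum_sum_type] at hc
    have h1 : ∀ a, c (Sum.inl a) = 0 := by
      intro a
      have h2 := congrArg (Y' *ᵥ ·) hc
      simp only [Matrix.mulVec_add, Matrix.mulVec_zero] at h2
      have h3 : Y' *ᵥ (∑ a, c (Sum.inr a) • col (Sum.inr a)) = 0 := by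
        rw [Matrix.mulVec_sum]
        refine Finset.sum_eq_zero fun a _ => ?_
        rw [Matrix.mulVec_smul]
        change _ • (Y' *ᵥ (b a : ι → F)) = 0
        rw [hb, smul_zero]
      have h4 : Y' *ᵥ (∑ a, c (Sum.inl a) • col (Sum.inl a)) = fun a => c (Sum.inl a) := by
        have h5 : (∑ a, c (Sum.inl a) • col (Sum.inl a)) = Y *ᵥ fun a => c (Sum.inl a) := by
          ext i
          simp [Matrix.mulVec, dotProduct, col, mul_comm]
        rw [h5, Matrix.mulVec_mulVec, h, Matrix.one_mulVec]
      rw [h3, h4, add_zero] at h2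
      exact congrFun h2 a
    have h2 : ∀ a, c (Sum.inr a) = 0 := by
      simp only [h1, zero_smul, Finset.sum_const_zero, zero_add] at hc
      have hb' : LinearIndependent F fun a => (b a : ι → F) :=
        b.linearIndependent.map' (LinearMap.ker Y'.mulVecLin).subtype (Submodule.ker_subtype _)
      exact Fintype.linearIndependent_iff.1 hb' _ hc
    rintro (a | a)
    · exact h1 a
    · exact h2 a
  refine ⟨Matrix.of fun i j => col (e j) i, fun j => val (e j), ?_, ?_⟩
  · rw [← Matrix.isUnit_iff_isUnit_det, ← Matrix.linearIndependent_cols_iff_isUnit]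
    exact hli.comp e e.injective
  · ext i j
    rw [Matrix.mul_diagonal, mul_comm]
    exact congrFun (heig (e j)) i

/-- The nonzero eigenvalues d_a are simple, so whatever eigenbasis the oracle returns, its columns
at nonzero eigenvalues are the y_a up to scale and order. -/
theorem exists_equiv_of_diagonalization {s : ℕ} {y : Fin s → ι → F}
    {Y' : Matrix (Fin s) ι F} (h : Y' * colMatrix y = 1) {d : Fin s → F} (hd0 : ∀ a, d a ≠ 0)
    (hd : Function.Injective d) {Q : Matrix ι ι F} {e : ι → F} (hQ : IsUnit Q.det)
    (hXQ : colMatrix y * diagonal d * Y' * Q = Q * diagonal e) :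
    ∃ σ : {j // e j ≠ 0} ≃ Fin s, ∀ j : {j // e j ≠ 0}, e j = d (σ j) ∧ ∃ c : F, c ≠ 0 ∧
      (fun i => Q i j) = c • y (σ j) := by
  set Y := colMatrix y with hY
  have hYinj : ∀ c c' : Fin s → F, Y *ᵥ c = Y *ᵥ c' → c = c' := fun c c' hc => by
    have := congrArg (Y' *ᵥ ·) hc
    simpa [Matrix.mulVec_mulVec, h] using this
  have hYcol : ∀ a, y a = Y *ᵥ Pi.single a 1 := fun a => by
    rw [Matrix.mulVec_single_one]; rfl
  have hQli : LinearIndependent F Q.col := by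
    rw [Matrix.linearIndependent_cols_iff_isUnit, Matrix.isUnit_iff_isUnit_det]
    exact hQ
  have hcol : ∀ j, (Y * diagonal d * Y') *ᵥ Q.col j = e j • Q.col j := fun j => by
    ext i
    have := congrFun (congrFun hXQ i) j
    rw [Matrix.mul_diagonal, mul_comm] at this
    exact this
  -- Such a column lies in the range of Y, and its coordinates form an eigenvector of diag(d). As d
  -- is injective, only one coordinate is nonzero.
  have main : ∀ j, e j ≠ 0 → ∃ a, e j = d a ∧ ∃ c : F, c ≠ 0 ∧ Q.col j = c • y a := by
    intro j hj
    set c : Fin s → F := (e j)⁻¹ • (diagonal d *ᵥ (Y' *ᵥ Q.col j)) with hc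
    have hqc : Q.col j = Y *ᵥ c := by
      rw [hc, Matrix.mulVec_smul, Matrix.mulVec_mulVec, Matrix.mulVec_mulVec, hcol j, smul_smul, inv_mul_cancel₀ hj, one_smul]
    have hYq : Y' *ᵥ Q.col j = c := by rw [hqc, Matrix.mulVec_mulVec, h, Matrix.one_mulVec]
    have hdc : ∀ a, d a * c a = e j * c a := by
      intro a
      have h1 : c = (e j)⁻¹ • (diagonal d *ᵥ c) := hc.trans (by rw [hYq])
      have h2 := congrFun h1 a
      rw [Pi.smul_apply, Matrix.mulVec_diagonal, smul_eq_mul] at h2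
      have h3 := congrArg (e j * ·) h2
      simp only [mul_inv_cancel_left₀ hj] at h3
      exact h3.symm
    have hc0 : c ≠ 0 := by
      intro h0
      rw [h0, Matrix.mulVec_zero] at hqc
      exact hQli.ne_zero j hqc
    obtain ⟨a, ha⟩ := Function.ne_iff.1 hc0
    rw [Pi.zero_apply] at ha
    have hea : e j = d a := (mul_right_cancel₀ ha (hdc a)).symm
    refine ⟨a, hea, c a, ha, ?_⟩
    rw [hqc, hYcol, ← Matrix.mulVec_smul]
    congr 1
    ext b
    by_cases hb : b = a
    · subst hb; simp
    · have : c b = 0 := by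
        by_contra hne
        exact hb (hd ((mul_right_cancel₀ hne (hdc b)).trans hea))
      simp [hb, this]
  choose σ hσ using main
  have hinj : Function.Injective fun j : {j // e j ≠ 0} => σ j.1 j.2 := by
    rintro ⟨j, hj⟩ ⟨j', hj'⟩ hjj
    obtain ⟨-, c, hc, h1⟩ := hσ j hj
    obtain ⟨-, c', hc', h2⟩ := hσ j' hj'
    simp only at hjj
    rw [← hjj] at h2
    by_contra hne
    have hne' : j ≠ j' := fun h => hne (Subtype.ext h)
    have h3 : c' • Q.col j = c • Q.col j' := by rw [h1, h2, smul_comm]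
    have hpair := hQli.comp ![j, j'] (by
      intro x x' hx
      fin_cases x <;> fin_cases x' <;> simp_all)
    have h5 := Fintype.linearIndependent_iff.1 hpair ![c', -c] (by simp [h3]) 0
    exact hc' h5
  -- Expand y_a in the basis Q: every column that occurs has eigenvalue d_a ≠ 0, and at least one
  -- occurs.
  have hsurj : Function.Surjective fun j : {j // e j ≠ 0} => σ j.1 j.2 := by
    intro a
    have hy : (Y * diagonal d * Y') *ᵥ y a = d a • y a := by
      rw [hYcol, Matrix.mulVec_mulVec, Matrix.mul_assoc, h, Matrix.mul_one,
        ← Matrix.mulVec_mulVec, ← Matrix.mulVec_smul]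
      congr 1
      ext b
      rw [Matrix.mulVec_diagonal]
      by_cases hab : b = a
      · subst hab; simp
      · simp [hab]
    set w := Q⁻¹ *ᵥ y a with hw
    have hQw : Q *ᵥ w = y a := by
      rw [hw, Matrix.mulVec_mulVec, Matrix.mul_nonsing_inv _ hQ, Matrix.one_mulVec]
    have h1 : ∀ j, e j * w j = d a * w j := by
      have h2 : Q *ᵥ (diagonal e *ᵥ w) = Q *ᵥ (d a • w) := by
        rw [Matrix.mulVec_mulVec, ← hXQ, ← Matrix.mulVec_mulVec, hQw, hy, Matrix.mulVec_smul, hQw]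
      have h3 := congrArg (Q⁻¹ *ᵥ ·) h2
      simp only [Matrix.mulVec_mulVec, ← Matrix.mul_assoc, Matrix.nonsing_inv_mul _ hQ,
        Matrix.one_mul, Matrix.one_mulVec] at h3
      intro j
      have := congrFun h3 j
      rwa [Matrix.mulVec_diagonal] at this
    have hw0 : w ≠ 0 := by
      intro h0
      rw [h0, Matrix.mulVec_zero] at hQw
      have := congrArg (Y' *ᵥ ·) hQw
      simp only [Matrix.mulVec_zero] at this
      rw [hYcol, Matrix.mulVec_mulVec, h, Matrix.one_mulVec] at this
      have := congrFun this a
      simp at this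
    obtain ⟨j, hj⟩ := Function.ne_iff.1 hw0
    rw [Pi.zero_apply] at hj
    have hej : e j = d a := mul_right_cancel₀ hj (h1 j)
    have hne : e j ≠ 0 := by rw [hej]; exact hd0 a
    exact ⟨⟨j, hne⟩, hd ((hσ j hne).1.symm.trans hej)⟩
  exact ⟨Equiv.ofBijective _ ⟨hinj, hsurj⟩, fun j => hσ j.1 j.2⟩

end MatrixCore

end Waring

namespace Waring

/-! ### Addresses of multi-indices and symmetry from generators -/

section Codes

/-- The address of a multi-index. -/
def code {n d : ℕ} (i : Fin d → Fin n) : ℕ := (finFunctionFinEquiv i : ℕ)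

theorem code_eq_sum {n d : ℕ} (i : Fin d → Fin n) : code i = ∑ j, (i j : ℕ) * n ^ (j : ℕ) :=
  finFunctionFinEquiv_apply i

theorem code_lt {n d : ℕ} (i : Fin d → Fin n) : code i < n ^ d := (finFunctionFinEquiv i).2

theorem code_symm {n d : ℕ} (x : Fin (n ^ d)) : code (finFunctionFinEquiv.symm x) = x := by
  rw [code, Equiv.apply_symm_apply]

theorem exists_code {n d x : ℕ} (hx : x < n ^ d) : ∃ i : Fin d → Fin n, code i = x :=
  ⟨finFunctionFinEquiv.symm ⟨x, hx⟩, code_symm _⟩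

theorem code_digit {n d : ℕ} (i : Fin d → Fin n) (l : Fin d) : code i / n ^ (l : ℕ) % n = i l := by
  have h : finFunctionFinEquiv.symm (finFunctionFinEquiv i) l = i l := by
    rw [Equiv.symm_apply_apply]
  exact congrArg Fin.val h

theorem code_append {n k l : ℕ} (i : Fin k → Fin n) (j : Fin l → Fin n) :
    code (Fin.append i j) = code i + n ^ k * code j := by
  simp only [code_eq_sum, Fin.sum_univ_add, Fin.append_left, Fin.append_right, Fin.val_castAdd,
    Fin.val_natAdd, pow_add, Finset.mul_sum]
  congr 1
  exact Finset.sum_congr rfl fun x _ => by ring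

theorem code_cons {n d : ℕ} (a : Fin n) (y : Fin d → Fin n) :
    code (Fin.cons a y : Fin (d + 1) → Fin n) = a + n * code y := by
  simp only [code_eq_sum, Fin.sum_univ_succ, Fin.cons_zero, Fin.cons_succ, Fin.val_zero,
    pow_zero, mul_one, Fin.val_succ, pow_succ, Finset.mul_sum]
  congr 1
  exact Finset.sum_congr rfl fun x _ => by ring

theorem code_snoc {n d : ℕ} (a : Fin n) (y : Fin d → Fin n) :
    code (Fin.snoc y a : Fin (d + 1) → Fin n) = code y + n ^ d * a := by
  simp only [code_eq_sum, Fin.sum_univ_castSucc, Fin.snoc_castSucc, Fin.snoc_last,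
    Fin.val_castSucc, Fin.val_last]
  ring

theorem code_comp_cast {n d d' : ℕ} (h : d' = d) (i : Fin d → Fin n) :
    code (i ∘ Fin.cast h) = code i := by
  subst h; rfl

variable {F : Type*} [RCLike F]

theorem prod_digits {n d : ℕ} (i : Fin d → Fin n) (x : ℕ → F) :
    ∏ l ∈ Finset.range d, x (code i / n ^ l % n) = tensorPow (fun a : Fin n => x a) d i := by
  rw [Finset.prod_range]
  exact Finset.prod_congr rfl fun l _ => by rw [code_digit]

/-- The permutations that preserve S form a subgroup; the full cycle and one adjacent transposition
generate the symmetric group. -/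
theorem isSymmetric_of_rotate {n d : ℕ} (hd : 2 ≤ d) {S : Tensor F n d}
    (h1 : ∀ i, S (i ∘ finRotate d) = S i)
    (h2 : ∀ i, S (i ∘ Equiv.swap ⟨0, by omega⟩ (finRotate d ⟨0, by omega⟩)) = S i) :
    IsSymmetric S := by
  let H : Subgroup (Equiv.Perm (Fin d)) :=
    { carrier := {σ | ∀ i, S (i ∘ σ) = S i}
      one_mem' := fun i => rfl
      mul_mem' := by
        intro σ τ hσ hτ i
        rw [Equiv.Perm.coe_mul, ← Function.comp_assoc, hτ, hσ]
      inv_mem' := by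
        intro σ hσ i
        rw [← hσ (i ∘ ⇑σ⁻¹)]
        congr 1
        ext x
        simp }
  have htop : H = ⊤ := by
    rw [eq_top_iff, ← Equiv.Perm.closure_cycle_adjacent_swap (isCycle_finRotate_of_le hd)
      (support_finRotate_of_le hd) ⟨0, by omega⟩, Subgroup.closure_le]
    rintro σ (rfl | rfl)
    · exact h1
    · exact h2
  intro σ i
  have : σ ∈ H := by rw [htop]; trivial
  exact this i

theorem append_comp_perm {α : Type*} {k l : ℕ} (i : Fin k → α) (j : Fin l → α)
    (σ : Equiv.Perm (Fin k)) : ∃ τ : Equiv.Perm (Fin (k + l)),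
      Fin.append (i ∘ σ) j = Fin.append i j ∘ τ := by
  refine ⟨finSumFinEquiv.symm.trans ((Equiv.sumCongr σ (Equiv.refl _)).trans finSumFinEquiv), ?_⟩
  ext x
  refine Fin.addCases (fun x => ?_) (fun x => ?_) x
  · simp
  · simp

theorem IsSymmetric.append_left {n k l : ℕ} {S : Tensor F n (k + l)} (hS : IsSymmetric S)
    (j : Fin l → Fin n) : IsSymmetric fun i : Fin k → Fin n => S (Fin.append i j) := by
  intro σ i
  obtain ⟨τ, hτ⟩ := append_comp_perm i j σ
  change S (Fin.append (i ∘ σ) j) = S (Fin.append i j)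
  rw [hτ, hS τ]

theorem IsSymmetric.append_comm {n k : ℕ} {S : Tensor F n (k + k)} (hS : IsSymmetric S)
    (i j : Fin k → Fin n) : S (Fin.append i j) = S (Fin.append j i) := by
  rw [← hS (finSumFinEquiv.symm.trans ((Equiv.sumComm _ _).trans finSumFinEquiv))]
  congr 1
  funext x
  refine Fin.addCases (fun x => ?_) (fun x => ?_) x
  · change Fin.append i j (finSumFinEquiv (Sum.swap (finSumFinEquiv.symm (Fin.castAdd k x)))) = _
    rw [finSumFinEquiv_symm_apply_castAdd, Sum.swap_inl, finSumFinEquiv_apply_right,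
      Fin.append_right, Fin.append_left]
  · change Fin.append i j (finSumFinEquiv (Sum.swap (finSumFinEquiv.symm (Fin.natAdd k x)))) = _
    rw [finSumFinEquiv_symm_apply_natAdd, Sum.swap_inr, finSumFinEquiv_apply_left,
      Fin.append_right, Fin.append_left]

theorem IsSymmetric.cast {n m m' : ℕ} (h : m = m') {T : Tensor F n m} (hT : IsSymmetric T) :
    IsSymmetric fun i : Fin m' → Fin n => T (i ∘ Fin.cast h) := by
  subst h; exact hT

theorem finRotate_zero' {d : ℕ} (hd : 2 ≤ d) : finRotate d ⟨0, by omega⟩ = ⟨1, by omega⟩ := by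
  obtain ⟨e, rfl⟩ : ∃ e, d = e + 1 := ⟨d - 1, by omega⟩
  exact finRotate_of_lt (by omega)

/-- Symmetry in the first half of the indices and invariance under rotation imply symmetry. -/
theorem isSymmetric_of_columns {n k : ℕ} (hk : 2 ≤ k) {S : Tensor F n (k + k)}
    (h1 : ∀ i, S (i ∘ finRotate (k + k)) = S i)
    (h2 : ∀ j, IsSymmetric fun i : Fin k → Fin n => S (Fin.append i j)) : IsSymmetric S := by
  refine isSymmetric_of_rotate (by omega) h1 fun i => ?_
  rw [finRotate_zero' (by omega)]
  set p : Fin k → Fin n := i ∘ Fin.castAdd k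
  set q : Fin k → Fin n := i ∘ Fin.natAdd k
  have hi : i = Fin.append p q := (append_comp_sum i).symm
  have := h2 q (Equiv.swap ⟨0, by omega⟩ ⟨1, by omega⟩) p
  simp only at this
  rw [hi, ← this]
  congr 1
  ext x
  refine Fin.addCases (fun x => ?_) (fun x => ?_) x
  · rw [Fin.append_left, Function.comp_apply, Function.comp_apply]
    have : Equiv.swap (⟨0, by omega⟩ : Fin (k + k)) ⟨1, by omega⟩ (Fin.castAdd k x) =
        Fin.castAdd k (Equiv.swap (⟨0, by omega⟩ : Fin k) ⟨1, by omega⟩ x) := by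
      simp only [Equiv.swap_apply_def, Fin.ext_iff, Fin.val_castAdd]
      split_ifs <;> rfl
    rw [this, Fin.append_left]
  · rw [Fin.append_right, Function.comp_apply, Equiv.swap_apply_of_ne_of_ne, Fin.append_right]
    · simp only [ne_eq, Fin.ext_iff, Fin.val_natAdd]; omega
    · simp only [ne_eq, Fin.ext_iff, Fin.val_natAdd]; omega

end Codes

/-! ### The image of the flattening and the tensors with columns in it -/

section Flattenings

variable {F : Type*} [RCLike F] {n m : ℕ}

/-- The image of the flattening, inside of the space of all tensors. -/
def fullImage (T : Tensor F n m) : Submodule F (Tensor F n ((m + 1) / 2)) :=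
  Submodule.span F (Set.range fun j : Fin (m / 2) → Fin n => fun i : Fin ((m + 1) / 2) → Fin n =>
    T (Fin.append i j ∘ Fin.cast (by omega : m = (m + 1) / 2 + m / 2)))

theorem map_fullImage (T : Tensor F n m) :
    (fullImage T).map (symCoordsₗ F n ((m + 1) / 2)) = image T := by
  rw [fullImage, Submodule.map_span, ← Set.range_comp]
  rfl

theorem fullImage_le {T : Tensor F n m} (hT : IsSymmetric T) :
    fullImage T ≤ symTensors F n ((m + 1) / 2) := by
  rw [fullImage, Submodule.span_le]
  rintro _ ⟨j, rfl⟩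
  exact (hT.cast (half_add_half m).symm).append_left j

/-- The symmetric tensors with columns in the image of the flattening. -/
def symColumns (T : Tensor F n m) :
    Submodule F (Tensor F n ((m + 1) / 2 + (m + 1) / 2)) where
  carrier := {Φ | IsSymmetric Φ ∧
    ∀ j, (fun i : Fin ((m + 1) / 2) → Fin n => Φ (Fin.append i j)) ∈ fullImage T}
  zero_mem' := ⟨fun _ _ => rfl, fun _ => (fullImage T).zero_mem⟩
  add_mem' := fun h h' => ⟨h.1.add h'.1, fun j => (fullImage T).add_mem (h.2 j) (h'.2 j)⟩
  smul_mem' := fun c _ h => ⟨h.1.smul c, fun j => (fullImage T).smul_mem c (h.2 j)⟩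

/-- The lifted intersection lives in sorted coordinates, while the program uses all entries. For
symmetric tensors the two descriptions agree. -/
theorem mem_symColumns_iff {T : Tensor F n m} (hT : IsSymmetric T) {p : ℕ}
    {q : Fin p → Matrix (MonoIdx n ((m + 1) / 2)) (MonoIdx n ((m + 1) / 2)) F}
    (hq : Submodule.span F (Set.range q) = quadricsOn (veroneseCone F n ((m + 1) / 2)))
    {Φ : Tensor F n ((m + 1) / 2 + (m + 1) / 2)} (hΦ : IsSymmetric Φ) :
    Φ ∈ symColumns T ↔ matOf Φ ∈ liftedIntersection (image T) q := by
  rw [mem_liftedIntersection_iff hq, ← map_matOf_symTensors]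
  have hcol : ∀ j : MonoIdx n ((m + 1) / 2), (fun i => matOf Φ i j) =
      symCoords fun i : Fin ((m + 1) / 2) → Fin n => Φ (Fin.append i j.1) := fun _ => rfl
  constructor
  · rintro ⟨-, h⟩
    refine ⟨fun j => ?_, Submodule.mem_map_of_mem (mem_symTensors.2 hΦ)⟩
    rw [hcol, ← map_fullImage]
    exact Submodule.mem_map_of_mem (h j.1)
  · rintro ⟨h, -⟩
    refine ⟨hΦ, fun j => ?_⟩
    -- Only columns with sorted index are constrained; the column at j equals the one at its sorted
    -- rearrangement.
    have h1 := h (sortIdx j)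
    rw [hcol, ← map_fullImage] at h1
    obtain ⟨w, hw, hwe⟩ := h1
    have h2 := symCoords_injOn (mem_symTensors.1 (fullImage_le hT hw)) (hΦ.append_left _) hwe
    have h3 : (fun i : Fin ((m + 1) / 2) → Fin n => Φ (Fin.append i j)) =
        fun i => Φ (Fin.append i (sortIdx j).1) := by
      ext i
      rw [hΦ.append_comm, hΦ.append_comm i (sortIdx j).1]
      exact (symCoords_apply_sortIdx (hΦ.append_left i) j).symm
    rw [h3, ← h2]
    exact hw

/-- The row space is the annihilator of the kernel, for the bilinear pairing without conjugation.
The kernel basis therefore provides equations for the image. -/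
theorem mem_span_rows_iff {ι κ : Type*} [Fintype ι] [Fintype κ] [DecidableEq κ]
    {K : Matrix ι κ F} {Q : Matrix κ κ F} {d : κ → F} (h : IsKernelBasis K Q d) (z : κ → F) :
    z ∈ Submodule.span F (Set.range fun i => K i) ↔ ∀ c, d c = 0 → ∑ p, Q p c * z p = 0 := by
  constructor
  · intro hz c hc
    refine Submodule.span_induction (p := fun z _ => ∑ p, Q p c * z p = 0) ?_ ?_ ?_ ?_ hz
    · rintro _ ⟨i, rfl⟩
      have := congrFun (h.2.1 c hc) i
      exact (Finset.sum_congr rfl fun p _ => mul_comm _ _).trans this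
    · simp
    · intro x y _ _ hx hy
      simp [mul_add, Finset.sum_add_distrib, hx, hy]
    · intro a x _ hx
      have : ∑ p, Q p c * (a • x) p = a * ∑ p, Q p c * x p := by
        rw [Finset.mul_sum]
        exact Finset.sum_congr rfl fun p _ => by rw [Pi.smul_apply, smul_eq_mul]; ring
      rw [this, hx, mul_zero]
  · intro hz
    by_contra hn
    obtain ⟨c, hc, hcz⟩ := exists_dot_of_notMem hn
    have hK : K.mulVec c = 0 := by
      ext i
      have := hc (K i) (Submodule.subset_span ⟨i, rfl⟩)
      rw [Pi.zero_apply, ← this]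
      exact Finset.sum_congr rfl fun p _ => mul_comm _ _
    obtain ⟨e, he, rfl⟩ := h.2.2 c hK
    apply hcz
    simp only [Matrix.mulVec, dotProduct, Finset.sum_mul]
    rw [Finset.sum_comm]
    refine Finset.sum_eq_zero fun j _ => ?_
    by_cases hj : d j = 0
    · have : ∑ i, Q i j * e j * z i = e j * ∑ i, Q i j * z i := by
        rw [Finset.mul_sum]
        exact Finset.sum_congr rfl fun p _ => by ring
      rw [this, hz j hj, mul_zero]
    · simp [he j hj]

/-- The array with the entries of `T`. -/
noncomputable def tensorArray (T : Tensor F n m) : ℕ → F :=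
  fun x => if h : x < n ^ m then T (finFunctionFinEquiv.symm ⟨x, h⟩) else 0

theorem tensorArray_code (T : Tensor F n m) (i : Fin m → Fin n) : tensorArray T (code i) = T i := by
  rw [tensorArray, dif_pos (code_lt i)]
  congr 1
  rw [Equiv.symm_apply_eq]
  exact Fin.ext rfl

theorem tensorArray_flatten (T : Tensor F n m) (i : Fin ((m + 1) / 2) → Fin n)
    (j : Fin (m / 2) → Fin n) :
    tensorArray T (code j * n ^ ((m + 1) / 2) + code i) =
      T (Fin.append i j ∘ Fin.cast (by omega : m = (m + 1) / 2 + m / 2)) := by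
  rw [← tensorArray_code T, code_comp_cast, code_append]
  congr 1
  ring

theorem mem_fullImage_iff (T : Tensor F n m) {Q D : ℕ → F} {N : ℕ} (hN : n ^ ((m + 1) / 2) = N)
    (h : IsKernelBasis (arrMat (tensorArray T) (n ^ (m / 2)) N) (arrMat Q N N)
      (fun j : Fin N => D j)) (t : ℕ → F) :
    (fun i : Fin ((m + 1) / 2) → Fin n => t (code i)) ∈ fullImage T ↔
      ∀ c < N, D c = 0 → ∑ p ∈ Finset.range N, Q (p * N + c) * t p = 0 := by
  subst hN
  set e : (Fin ((m + 1) / 2) → Fin n) ≃ Fin (n ^ ((m + 1) / 2)) := finFunctionFinEquiv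
  let φ : Tensor F n ((m + 1) / 2) ≃ₗ[F] (Fin (n ^ ((m + 1) / 2)) → F) :=
    LinearEquiv.funCongrLeft F F e.symm
  have hφ : ∀ (t : Tensor F n ((m + 1) / 2)) (p), φ t p = t (e.symm p) := fun _ _ => rfl
  have h1 : (fullImage T).map φ.toLinearMap =
      Submodule.span F (Set.range fun i => arrMat (tensorArray T) (n ^ (m / 2))
        (n ^ ((m + 1) / 2)) i) := by
    rw [fullImage, Submodule.map_span, ← Set.range_comp]
    congr 1
    ext z
    constructor
    · rintro ⟨j, rfl⟩
      refine ⟨finFunctionFinEquiv j, ?_⟩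
      ext p
      have := tensorArray_flatten T (e.symm p) j
      rw [code_symm] at this
      exact this
    · rintro ⟨q, rfl⟩
      refine ⟨finFunctionFinEquiv.symm q, ?_⟩
      ext p
      have := tensorArray_flatten T (e.symm p) (finFunctionFinEquiv.symm q)
      rw [code_symm, code_symm] at this
      exact this.symm
  have h2 : (fun i : Fin ((m + 1) / 2) → Fin n => t (code i)) ∈ fullImage T ↔
      (fun p : Fin (n ^ ((m + 1) / 2)) => t p) ∈ (fullImage T).map φ.toLinearMap := by
    have h3 : (fun p : Fin (n ^ ((m + 1) / 2)) => t p) =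
        φ.toLinearMap fun i : Fin ((m + 1) / 2) → Fin n => t (code i) := by
      ext p
      change t p = t (code (e.symm p))
      rw [code_symm]
    rw [h3]
    constructor
    · exact Submodule.mem_map_of_mem
    · rintro ⟨w, hw, hwe⟩
      have hww := φ.injective hwe
      rw [← hww]
      exact hw
  rw [h2, h1, mem_span_rows_iff h]
  constructor
  · intro h c hc hD
    rw [Finset.sum_range]
    exact h ⟨c, hc⟩ hD
  · intro h c hD
    have := h c c.2 hD
    rw [Finset.sum_range] at this
    exact this

end Flattenings

end Waring

namespace Waring

/-! ### Enumeration of the selected columns -/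

section Selected

/-- The elements of `Fin V` with a given property, in increasing order. -/
noncomputable def nthEquiv (p : ℕ → Prop) [DecidablePred p] (V : ℕ) :
    Fin (Nat.count p V) ≃ {j : Fin V // p j} :=
  Equiv.ofBijective
    (fun l => ⟨⟨Nat.nth p l, Nat.nth_lt_of_lt_count l.2⟩,
      Nat.nth_mem l fun hf => lt_of_lt_of_le l.2 (Nat.count_le_card hf V)⟩) (by
    constructor
    · intro a b h
      have h1 : Nat.nth p a = Nat.nth p b := congrArg (fun z => (z.1 : ℕ)) h
      have h2 := congrArg (Nat.count p) h1
      have hp : ∀ c : Fin (Nat.count p V), Nat.count p (Nat.nth p c) = c := fun c =>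
        Nat.count_nth fun hf => lt_of_lt_of_le c.2 (Nat.count_le_card hf V)
      rw [hp, hp] at h2
      exact Fin.ext h2
    · rintro ⟨⟨j, hj⟩, hpj⟩
      refine ⟨⟨Nat.count p j, Nat.count_strict_mono hpj hj⟩, ?_⟩
      ext
      exact Nat.nth_count hpj)

@[simp] theorem nthEquiv_apply (p : ℕ → Prop) [DecidablePred p] (V : ℕ)
    (l : Fin (Nat.count p V)) : ((nthEquiv p V l).1 : ℕ) = Nat.nth p l := rfl

variable {F : Type*} [RCLike F]

theorem linearIndependent_columns_of_isUnit_det {v : Type*} [Fintype v] [DecidableEq v]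
    {Q : Matrix v v F} (hQ : IsUnit Q.det) : LinearIndependent F fun j i => Q i j := by
  exact Matrix.linearIndependent_cols_of_isUnit ((Matrix.isUnit_iff_isUnit_det Q).2 hQ)

theorem IsKernelBasis.mem_span_iff {m v : Type*} [Fintype m] [Fintype v] [DecidableEq v]
    {K : Matrix m v F} {Q : Matrix v v F} {d : v → F} (h : IsKernelBasis K Q d) (x : v → F) :
    x ∈ Submodule.span F (Set.range fun j : {j // d j = 0} => fun i => Q i j) ↔
      K.mulVec x = 0 := by
  constructor
  · intro hx
    have : Submodule.span F (Set.range fun j : {j // d j = 0} => fun i => Q i j) ≤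
        LinearMap.ker K.mulVecLin := by
      rw [Submodule.span_le]
      rintro _ ⟨j, rfl⟩
      exact h.2.1 j j.2
    exact this hx
  · intro hx
    obtain ⟨c, hc, rfl⟩ := h.2.2 x hx
    have : Q.mulVec c = ∑ j, c j • fun i => Q i j := by
      ext i
      simp [Matrix.mulVec, dotProduct, Finset.sum_apply, mul_comm]
    rw [this]
    refine Submodule.sum_mem _ fun j _ => ?_
    by_cases hj : d j = 0
    · exact Submodule.smul_mem _ _ (Submodule.subset_span ⟨⟨j, hj⟩, rfl⟩)
    · rw [hc j hj, zero_smul]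
      exact Submodule.zero_mem _

end Selected

/-! ### The computed kernel is a basis of L -/

section SymmetricKernel

variable {F : Type*} [RCLike F] {n m : ℕ}

/-- Splitting off the first index, rotation moves it to the last place; in addresses, i + n y
becomes y + n^e i. -/
theorem rotate_code_iff {d e : ℕ} (h : d = e + 1) (x : ℕ → F) :
    (∀ i : Fin d → Fin n, x (code (i ∘ finRotate d)) = x (code i)) ↔
      ∀ i < n, ∀ y < n ^ e, x (i + n * y) = x (y + n ^ e * i) := by
  subst h
  have key : ∀ (a : Fin n) (y : Fin e → Fin n),
      code ((Fin.cons a y : Fin (e + 1) → Fin n) ∘ finRotate (e + 1)) = code y + n ^ e * a := by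
    intro a y
    rw [← code_snoc]
    congr 1
    rw [Fin.snoc_eq_cons_rotate]
    rfl
  constructor
  · intro hx i hi y hy
    obtain ⟨y, rfl⟩ := exists_code hy
    have := hx (Fin.cons ⟨i, hi⟩ y)
    rw [key, code_cons] at this
    exact this.symm
  · intro hx i
    have h1 : i = Fin.cons (i 0) (Fin.tail i) := (Fin.cons_self_tail i).symm
    rw [h1, key, code_cons]
    exact (hx _ (i 0).2 _ (code_lt _)).symm

/-- `RunFacts` for the sizes that belong to a tensor. -/
abbrev TensorRunFacts (T : Tensor F n m) (f g : ℕ → F) (s : State F) : Prop :=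
  RunFacts n m ((m + 1) / 2) (n ^ ((m + 1) / 2 - 1)) (n ^ ((m + 1) / 2)) (n ^ (m / 2))
    (tensorArray T) f g s

variable {T : Tensor F n m} {f g : ℕ → F} {s : State F}

theorem pow_pred_mul (n : ℕ) {k : ℕ} (hk : 1 ≤ k) : n ^ (k - 1) * n = n ^ k := by
  rw [← pow_succ, Nat.sub_add_cancel hk]

/-- Symmetry is not imposed in full. Columns in the image of the flattening are symmetric because T
is, which includes one adjacent transposition as k ≥ 2, and invariance under rotation supplies the
rest. -/
theorem TensorRunFacts.mulVec_eq_zero_iff (hs : TensorRunFacts T f g s) (hm : 3 ≤ m)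
    (hT : IsSymmetric T) (x : ℕ → F) :
    (arrMat (s.mem 13) (2 * (n ^ ((m + 1) / 2) * n ^ ((m + 1) / 2)))
      (n ^ ((m + 1) / 2) * n ^ ((m + 1) / 2))).mulVec (fun v => x v) = 0 ↔
      (fun i => x (code i)) ∈ symColumns T := by
  have hk : 2 ≤ (m + 1) / 2 := by omega
  have hKN := pow_pred_mul n (show 1 ≤ (m + 1) / 2 by omega)
  have hpow : n ^ ((m + 1) / 2 - 1) * n ^ ((m + 1) / 2) =
      n ^ ((m + 1) / 2 - 1 + (m + 1) / 2) := (pow_add _ _ _).symm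
  have hcol := hs.colRow x
  have hrot := hs.rotRow x
  have himg := mem_fullImage_iff T rfl hs.kerImage
  rw [hpow] at hrot
  have hrotS := rotate_code_iff (n := n) (show (m + 1) / 2 + (m + 1) / 2 =
    ((m + 1) / 2 - 1 + (m + 1) / 2) + 1 by omega) x
  have hNe : n ^ ((m + 1) / 2) * n ^ ((m + 1) / 2) =
      n * n ^ ((m + 1) / 2 - 1 + (m + 1) / 2) := by
    rw [← hpow, ← mul_assoc, mul_comm n, hKN]
  generalize hN : n ^ ((m + 1) / 2) = N at *
  generalize n ^ ((m + 1) / 2 - 1 + (m + 1) / 2) = M at *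
  have himg' : ∀ j : Fin ((m + 1) / 2) → Fin n,
      (fun i : Fin ((m + 1) / 2) → Fin n => x (code (Fin.append i j))) ∈ fullImage T ↔
      ∀ c < N, s.mem 12 c = 0 →
        ∑ p ∈ Finset.range N, s.mem 11 (p * N + c) * x (p + N * code j) = 0 := by
    intro j
    rw [← himg fun p => x (p + N * code j)]
    simp only [code_append, hN]
  constructor
  · intro h
    have hrow : ∀ r < 2 * (N * N), rowDot (N * N) r x (s.mem 13) = 0 := fun r hr => by
      rw [← arrMat_mulVec (s.mem 13) (2 * (N * N)) (N * N) x ⟨r, hr⟩, h]; rfl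
    have hcols : ∀ j : Fin ((m + 1) / 2) → Fin n,
        (fun i : Fin ((m + 1) / 2) → Fin n => x (code (Fin.append i j))) ∈ fullImage T := by
      intro j
      rw [himg']
      intro c hc h12
      have hj : code j < N := hN ▸ code_lt j
      have h1 := hcol c (code j) hc hj
      rw [if_pos h12, hrow _ (by nlinarith)] at h1
      exact h1.symm
    refine ⟨isSymmetric_of_columns hk (hrotS.2 fun i hi y hy => ?_)
      fun j => mem_symTensors.1 (fullImage_le hT (hcols j)), hcols⟩
    have h1 := hrot i y hi hy
    rw [hrow _ (by rw [hNe]; nlinarith)] at h1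
    exact (sub_eq_zero.1 h1.symm)
  · rintro ⟨h1, h2⟩
    ext ⟨r, hr⟩
    rw [arrMat_mulVec, Pi.zero_apply]
    change rowDot (N * N) r x (s.mem 13) = 0
    rcases lt_or_ge r (N * N) with h | h
    · have hN0 : 0 < N := by
        rcases Nat.eq_zero_or_pos N with h0 | h0
        · simp [h0] at h
        · exact h0
      have e1 := hcol (r / N) (r % N) (Nat.div_lt_of_lt_mul h) (Nat.mod_lt _ hN0)
      rw [Nat.div_add_mod'] at e1
      rw [e1]
      split_ifs with h12
      · obtain ⟨j, hj⟩ := exists_code (n := n) (d := (m + 1) / 2) (x := r % N) (by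
          rw [hN]; exact Nat.mod_lt r hN0)
        rw [← hj]
        exact (himg' j).1 (h2 j) _ (Nat.div_lt_of_lt_mul h) h12
      · rfl
    · have hr2 : r - N * N < n * M := by rw [← hNe]; omega
      have hM0 : 0 < M := by
        rcases Nat.eq_zero_or_pos M with h0 | h0
        · simp [h0] at hr2
        · exact h0
      have hi : (r - N * N) / M < n := Nat.div_lt_of_lt_mul (by rw [mul_comm M n]; exact hr2)
      have e1 := hrot ((r - N * N) / M) ((r - N * N) % M) hi (Nat.mod_lt _ hM0)
      rw [Nat.div_add_mod', Nat.add_sub_cancel' h] at e1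
      rw [e1, sub_eq_zero]
      refine hrotS.1 (fun i => ?_) _ hi _ (Nat.mod_lt _ hM0)
      exact h1 (finRotate _) i

open Classical in
/-- The tensors whose entries stand in those columns of the matrix `E` with `V` columns for
which `D` vanishes. -/
noncomputable def columnTensors (n d V : ℕ) (E D : ℕ → F)
    (l : Fin (Nat.count (fun j => D j = 0) V)) : Tensor F n d :=
  fun i => E (code i * V + Nat.nth (fun j => D j = 0) l)

theorem TensorRunFacts.columnTensors_basis (hs : TensorRunFacts T f g s) (hm : 3 ≤ m)
    (hT : IsSymmetric T) :
    LinearIndependent F (columnTensors n ((m + 1) / 2 + (m + 1) / 2)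
      (n ^ ((m + 1) / 2) * n ^ ((m + 1) / 2)) (s.mem 15) (s.mem 16)) ∧
    Submodule.span F (Set.range (columnTensors n ((m + 1) / 2 + (m + 1) / 2)
      (n ^ ((m + 1) / 2) * n ^ ((m + 1) / 2)) (s.mem 15) (s.mem 16))) = symColumns T := by
  have hker := hs.mulVec_eq_zero_iff hm hT
  have hK := hs.kerSym
  have hV : n ^ ((m + 1) / 2) * n ^ ((m + 1) / 2) = n ^ ((m + 1) / 2 + (m + 1) / 2) :=
    (pow_add _ _ _).symm
  rw [hV] at hker hK ⊢
  set V := n ^ ((m + 1) / 2 + (m + 1) / 2) with hVdef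
  let e : (Fin ((m + 1) / 2 + (m + 1) / 2) → Fin n) ≃ Fin V := finFunctionFinEquiv
  let φ : (Fin V → F) ≃ₗ[F] Tensor F n ((m + 1) / 2 + (m + 1) / 2) := LinearEquiv.funCongrLeft F F e
  have hcomp : columnTensors n ((m + 1) / 2 + (m + 1) / 2) V (s.mem 15) (s.mem 16) =
      φ ∘ (fun j : {j : Fin V // s.mem 16 j = 0} => fun i => arrMat (s.mem 15) V V i j) ∘
        nthEquiv (fun j => s.mem 16 j = 0) V := rfl
  constructor
  · rw [hcomp]
    refine LinearIndependent.map' ?_ φ.toLinearMap φ.ker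
    exact ((linearIndependent_columns_of_isUnit_det hK.1).comp _ Subtype.val_injective).comp _
      (nthEquiv _ _).injective
  · rw [hcomp, Set.range_comp, EquivLike.range_comp]
    have hsp : ∀ x, x ∈ Submodule.span F (Set.range fun j : {j : Fin V // s.mem 16 j = 0} =>
        fun i => arrMat (s.mem 15) V V i j) ↔ _ := hK.mem_span_iff
    ext Φ
    rw [← LinearEquiv.coe_toLinearMap, ← Submodule.map_span, Submodule.mem_map_equiv, hsp]
    -- The kernel criterion is stated for functions on all addresses, so the vector is extended by
    -- zero.
    have h1 : φ.symm Φ = fun v : Fin V => (fun y : ℕ => if h : y < V then Φ (e.symm ⟨y, h⟩) else 0) v := by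
      ext v
      simp [φ]
    rw [h1]
    refine (hker fun y => if h : y < V then Φ (e.symm ⟨y, h⟩) else 0).trans ?_
    have h2 : (fun i : Fin ((m + 1) / 2 + (m + 1) / 2) → Fin n =>
        if h : code i < V then Φ (e.symm ⟨code i, h⟩) else 0) = Φ := by
      ext i
      rw [dif_pos (code_lt i)]
      congr 1
      rw [Equiv.symm_apply_eq]
      rfl
    rw [h2]

theorem symColumns_map_matOf (hT : IsSymmetric T) {p : ℕ}
    {q : Fin p → Matrix (MonoIdx n ((m + 1) / 2)) (MonoIdx n ((m + 1) / 2)) F}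
    (hq : Submodule.span F (Set.range q) = quadricsOn (veroneseCone F n ((m + 1) / 2))) :
    (symColumns T).map (matOfₗ F n ((m + 1) / 2)) = liftedIntersection (image T) q := by
  ext P
  constructor
  · rintro ⟨Φ, hΦ, rfl⟩
    exact (mem_symColumns_iff hT hq hΦ.1).1 hΦ
  · intro hP
    have h1 := ((mem_liftedIntersection_iff hq).1 hP).2
    rw [← map_matOf_symTensors] at h1
    obtain ⟨Φ, hΦ, rfl⟩ := h1
    exact ⟨Φ, (mem_symColumns_iff hT hq (mem_symTensors.1 hΦ)).2 hP, rfl⟩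

/-- The program's tensors become an admissible basis for the algorithm, whatever basis of the
quadrics was chosen. -/
theorem matOf_basis {r : ℕ} {Φ : Fin r → Tensor F n ((m + 1) / 2 + (m + 1) / 2)}
    (hT : IsSymmetric T) (hΦ : LinearIndependent F Φ)
    (hspan : Submodule.span F (Set.range Φ) = symColumns T) {p : ℕ}
    {q : Fin p → Matrix (MonoIdx n ((m + 1) / 2)) (MonoIdx n ((m + 1) / 2)) F}
    (hq : Submodule.span F (Set.range q) = quadricsOn (veroneseCone F n ((m + 1) / 2))) :
    LinearIndependent F (fun l => matOf (Φ l)) ∧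
    Submodule.span F (Set.range fun l => matOf (Φ l)) = liftedIntersection (image T) q := by
  constructor
  · refine LinearIndependent.map_injOn hΦ (matOfₗ F n ((m + 1) / 2)) ?_
    rw [hspan]
    intro S hS S' hS' h
    exact matOf_injOn hS.1 hS'.1 h
  · rw [← symColumns_map_matOf hT hq, ← hspan, Submodule.map_span, ← Set.range_comp]
    rfl

end SymmetricKernel

end Waring

namespace Waring

open Matrix

/-! ### Matrices indexed by addresses -/

section Flat

variable {F : Type*} [RCLike F] {n k : ℕ}

/-- A tensor of even order as a matrix with rows and columns numbered by addresses. -/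
def flatMat (F : Type*) [RCLike F] (n k : ℕ) :
    Tensor F n (k + k) →ₗ[F] Matrix (Fin (n ^ k)) (Fin (n ^ k)) F where
  toFun S := Matrix.of fun p j =>
    S (Fin.append (finFunctionFinEquiv.symm j) (finFunctionFinEquiv.symm p))
  map_add' _ _ := rfl
  map_smul' _ _ := rfl

theorem flatMat_apply (S : Tensor F n (k + k)) (p j : Fin (n ^ k)) :
    flatMat F n k S p j =
      S (Fin.append (finFunctionFinEquiv.symm j) (finFunctionFinEquiv.symm p)) := rfl

theorem flatMat_injective : Function.Injective (flatMat F n k) := by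
  intro S S' h
  ext i
  have := congrFun (congrFun h (finFunctionFinEquiv (i ∘ Fin.natAdd k)))
    (finFunctionFinEquiv (i ∘ Fin.castAdd k))
  rw [flatMat_apply, flatMat_apply, Equiv.symm_apply_apply, Equiv.symm_apply_apply,
    append_comp_sum] at this
  exact this

/-- The entries of `x^{⊗ k}`, numbered by addresses. -/
def flatPow (k : ℕ) (x : Fin n → F) : Fin (n ^ k) → F :=
  fun p => tensorPow x k (finFunctionFinEquiv.symm p)

theorem flatMat_tensorPow (x : Fin n → F) :
    flatMat F n k (tensorPow x (k + k)) = vecMulVec (flatPow k x) (flatPow k x) := by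
  ext p j
  rw [flatMat_apply, tensorPow_append, vecMulVec_apply, mul_comm]
  rfl

theorem flatPow_smul (c : F) (x : Fin n → F) : flatPow k (c • x) = c ^ k • flatPow k x := by
  ext p
  simp only [flatPow, tensorPow_smul, Pi.smul_apply]

theorem flatPow_ne_zero {x : Fin n → F} (hx : x ≠ 0) : flatPow k x ≠ 0 := by
  obtain ⟨i, hi⟩ := tensorPow_ne_zero hx k
  intro h
  apply hi
  have := congrFun h (finFunctionFinEquiv i)
  simpa [flatPow] using this

theorem linearIndependent_flatPow_iff {r : ℕ} {x : Fin r → Fin n → F} :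
    LinearIndependent F (fun a => flatPow k (x a)) ↔
      LinearIndependent F (fun a => tensorPow (x a) k) := by
  let φ : Tensor F n k ≃ₗ[F] (Fin (n ^ k) → F) :=
    LinearEquiv.funCongrLeft F F finFunctionFinEquiv.symm
  exact LinearMap.linearIndependent_iff φ.toLinearMap φ.ker (v := fun a => tensorPow (x a) k)

/-- Both presentations are injective on symmetric tensors, so an expansion into squares is in each
case an expansion of Φ_l into powers x_a^{⊗2k}. This transfers the program's n^k × n^k matrices to
the sorted coordinates of the algorithm. -/
theorem simDiagonalizedBy_matOf_iff {r : ℕ} {Φ : Fin r → Tensor F n (k + k)}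
    (hΦ : ∀ l, IsSymmetric (Φ l)) {f g : Fin r → F} {x : Fin r → Fin n → F} :
    SimDiagonalizedBy (fun l => matOf (Φ l)) f g (fun a => ver k (x a)) ↔
      SimDiagonalizedBy (fun l => flatMat F n k (Φ l)) f g (fun a => flatPow k (x a)) := by
  have key : ∀ z : Fin r → Fin r → F, ∀ l,
      (∀ i j, matOf (Φ l) i j = ∑ a, z a l * (ver k (x a) i * ver k (x a) j)) ↔
      (∀ i j, flatMat F n k (Φ l) i j =
        ∑ a, z a l * (flatPow k (x a) i * flatPow k (x a) j)) := by
    intro z l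
    have hsum : IsSymmetric (∑ a, z a l • tensorPow (x a) (k + k)) :=
      mem_symTensors.1 (Submodule.sum_mem _ fun a _ => Submodule.smul_mem _ _
        (mem_symTensors.2 (tensorPow_isSymmetric _ _)))
    have h1 : matOf (∑ a, z a l • tensorPow (x a) (k + k)) =
        ∑ a, z a l • vecMulVec (ver k (x a)) (ver k (x a)) := by
      have := map_sum (matOfₗ F n k) (fun a => z a l • tensorPow (x a) (k + k)) Finset.univ
      refine this.trans (Finset.sum_congr rfl fun a _ => ?_)
      rw [map_smul, ← matOf_tensorPow]
      rfl
    have h2 : flatMat F n k (∑ a, z a l • tensorPow (x a) (k + k)) =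
        ∑ a, z a l • vecMulVec (flatPow k (x a)) (flatPow k (x a)) := by
      rw [map_sum]
      exact Finset.sum_congr rfl fun a _ => by rw [map_smul, flatMat_tensorPow]
    have e1 : (∀ i j, matOf (Φ l) i j = ∑ a, z a l * (ver k (x a) i * ver k (x a) j)) ↔
        matOf (Φ l) = matOf (∑ a, z a l • tensorPow (x a) (k + k)) := by
      rw [h1, ← Matrix.ext_iff]
      simp only [Matrix.sum_apply, Matrix.smul_apply, vecMulVec_apply, smul_eq_mul]
    have e2 : (∀ i j, flatMat F n k (Φ l) i j =
        ∑ a, z a l * (flatPow k (x a) i * flatPow k (x a) j)) ↔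
        flatMat F n k (Φ l) = flatMat F n k (∑ a, z a l • tensorPow (x a) (k + k)) := by
      rw [h2, ← Matrix.ext_iff]
      simp only [Matrix.sum_apply, Matrix.smul_apply, vecMulVec_apply, smul_eq_mul]
    rw [e1, e2]
    exact ⟨fun h => congrArg _ (matOf_injOn (hΦ l) hsum h),
      fun h => congrArg _ (flatMat_injective h)⟩
  simp only [SimDiagonalizedBy, key, linearIndependent_flatPow_iff, linearIndependent_ver_iff]

end Flat

/-! ### What the pivot flag says about a kernel -/

section KernelFlag

variable {F : Type*} [RCLike F]

theorem IsKernelBasis.row_eq_zero {ι : Type*} [Fintype ι] {v w : ℕ} {K : Matrix ι (Fin v) F}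
    {Q D : ℕ → F} (h : IsKernelBasis K (arrMat Q v v) (fun j : Fin v => D j)) (hw : w < v)
    (h0 : ∀ j < v, D j = 0 → Q (w * v + j) = 0) {x : ℕ → F}
    (hx : K.mulVec (fun i => x i) = 0) : x w = 0 := by
  obtain ⟨c, hc, he⟩ := h.2.2 _ hx
  have := congrFun he ⟨w, hw⟩
  change x w = _ at this
  rw [this]
  change ∑ j, arrMat Q v v ⟨w, hw⟩ j * c j = 0
  refine Finset.sum_eq_zero fun j _ => ?_
  by_cases hj : D j = 0
  · rw [arrMat_apply, h0 j j.2 hj, zero_mul]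
  · rw [hc j hj, mul_zero]

theorem IsKernelBasis.column_mulVec {ι : Type*} [Fintype ι] {v j : ℕ} {K : Matrix ι (Fin v) F}
    {Q D : ℕ → F} (h : IsKernelBasis K (arrMat Q v v) (fun j : Fin v => D j)) (hj : j < v)
    (hD : D j = 0) : K.mulVec (fun i => (fun y => Q (y * v + j)) i) = 0 :=
  h.2.1 ⟨j, hj⟩ hD

end KernelFlag

/-! ### Meaning of the arrays: ratio and vectors -/

section Ratio

variable {F : Type*} [RCLike F] {n m k K N L : ℕ} {T f g : ℕ → F} {s : State F}

theorem RunFacts.ratio_kernel_iff (hs : RunFacts n m k K N L T f g s) (x : ℕ → F) :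
    (arrMat (s.mem 20) (N * N) (N * N + 1)).mulVec (fun i => x i) = 0 ↔
      arrMat x N N * ((arrMat (s.mem 18) N N)ᴴ * arrMat (s.mem 18) N N) =
        x (N * N) • arrMat (s.mem 17) N N := by
  rw [← hs.gramG]
  have key : ∀ p j : Fin N, rowDot (N * N + 1) (p * N + j) x (s.mem 20) =
      (arrMat x N N * arrMat (s.mem 19) N N) p j - (x (N * N) • arrMat (s.mem 17) N N) p j := by
    intro p j
    rw [hs.ratioRow x p j p.2 j.2, Finset.sum_range, mul_apply, Matrix.smul_apply, smul_eq_mul,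
      arrMat_apply, mul_comm (x _)]
    congr 1
    exact Finset.sum_congr rfl fun q _ => mul_comm _ _
  constructor
  · intro h
    ext p j
    rw [← sub_eq_zero, ← key]
    have hlt : (p : ℕ) * N + j < N * N := by
      have := p.2; have := j.2; nlinarith
    rw [← arrMat_mulVec (s.mem 20) (N * N) (N * N + 1) x ⟨_, hlt⟩, h]
    rfl
  · intro h
    ext ⟨r, hr⟩
    rw [arrMat_mulVec, Pi.zero_apply]
    have hN : 0 < N := by
      rcases Nat.eq_zero_or_pos N with h0 | h0
      · simp [h0] at hr
      · exact h0
    have := key ⟨r / N, Nat.div_lt_of_lt_mul hr⟩ ⟨r % N, Nat.mod_lt _ hN⟩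
    rw [h, sub_self] at this
    simp only [Nat.div_add_mod'] at this
    exact this

/-- The column of the kernel basis that is chosen for the ratio. -/
def ratioColumn (N : ℕ) (s : State F) : ℕ → F :=
  fun y => s.mem 22 (y * (N * N + 1) + s.reg 21)

theorem RunFacts.ratio_eq (hs : RunFacts n m k K N L T f g s) :
    arrMat (s.mem 24) N N = arrMat (ratioColumn N s) N N * (arrMat (s.mem 18) N N)ᴴ := by
  ext p q
  rw [arrMat_apply, hs.ratio p p.2 q q.2, Finset.sum_range, mul_apply]
  exact Finset.sum_congr rfl fun e _ => mul_comm _ _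

theorem RunFacts.ratioColumn_spec (hs : RunFacts n m k K N L T f g s) (h22 : 1 ≤ s.reg 22) :
    ratioColumn N s (N * N) ≠ 0 ∧
    arrMat (ratioColumn N s) N N * ((arrMat (s.mem 18) N N)ᴴ * arrMat (s.mem 18) N N) =
      ratioColumn N s (N * N) • arrMat (s.mem 17) N N := by
  rcases hs.pickRatio with h | ⟨-, h1, h2, h3⟩
  · omega
  · exact ⟨h3, (hs.ratio_kernel_iff _).1 (hs.kerRatio.column_mulVec h1 h2)⟩

/-- If no kernel vector had t ≠ 0, then neither would the one made from a solution W with t = 1. -/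
theorem RunFacts.ratio_flag (hs : RunFacts n m k K N L T f g s) {W : Matrix (Fin N) (Fin N) F}
    (hW : W * ((arrMat (s.mem 18) N N)ᴴ * arrMat (s.mem 18) N N) = arrMat (s.mem 17) N N) :
    1 ≤ s.reg 22 := by
  rcases hs.pickRatio with ⟨-, h⟩ | h
  · exfalso
    -- W is written row by row; the default value 1 beyond its entries is the required t at position
    -- N².
    let x : ℕ → F := fun y => if h : y < N * N then
      W (finProdFinEquiv.symm ⟨y, h⟩).1 (finProdFinEquiv.symm ⟨y, h⟩).2 else 1
    have hxW : arrMat x N N = W := by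
      ext p q
      have hlt : (p : ℕ) * N + q < N * N := by
        have := p.2; have := q.2; nlinarith
      have he : (⟨(p : ℕ) * N + q, hlt⟩ : Fin (N * N)) = finProdFinEquiv (p, q) := by
        ext; simp [finProdFinEquiv]; ring
      simp only [arrMat_apply, x, dif_pos hlt, he, Equiv.symm_apply_apply]
    have hx1 : x (N * N) = 1 := dif_neg (lt_irrefl _)
    have := hs.kerRatio.row_eq_zero (Nat.lt_succ_self _) h (x := x)
      ((hs.ratio_kernel_iff x).2 (by rw [hxW, hx1, one_smul, hW]))
    rw [hx1] at this
    exact one_ne_zero this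
  · exact h.1

/-- The vector number `j` that is read off from the eigenvectors. -/
def vecAt (n : ℕ) (s : State F) (j : ℕ) : Fin n → F := fun i => s.mem 27 (j * n + i)

theorem RunFacts.powK_eq (hs : RunFacts n m k (n ^ (k - 1)) (n ^ k) L T f g s) {j : ℕ}
    (hj : j < n ^ k) (p : Fin (n ^ k)) :
    s.mem 28 (j * n ^ k + p) = flatPow k (vecAt n s j) p := by
  rw [hs.powK j hj p p.2]
  have := prod_digits (finFunctionFinEquiv.symm p) (fun i => s.mem 27 (j * n + i))
  rw [code_symm] at this
  exact this

theorem RunFacts.vecAt_ne_zero (hs : RunFacts n m k K N L T f g s) (h23 : s.reg 23 = 0) {j : ℕ}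
    (hj : j < N) (h26 : s.mem 26 j ≠ 0) : vecAt n s j ≠ 0 := by
  obtain ⟨piv, h1, h2⟩ := hs.vecs
  obtain ⟨-, i, hi, h3⟩ := h1 j hj h26 ((hs.checks.1 h23).1 j hj h26)
  intro h
  have h4 := h2 j hj i hi
  rw [if_neg h26] at h4
  rw [← h4] at h3
  exact h3 (congrFun h ⟨i, hi⟩)

theorem RunFacts.vecAt_eq_zero (hs : RunFacts n m k K N L T f g s) {j : ℕ}
    (hj : j < N) (h26 : s.mem 26 j = 0) : vecAt n s j = 0 := by
  obtain ⟨piv, -, h2⟩ := hs.vecs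
  ext i
  exact (h2 j hj i i.2).trans (if_pos h26)

end Ratio

end Waring

namespace Waring

open Matrix

/-! ### Passing the tests certifies the decomposition -/

section Soundness

variable {F : Type*} [RCLike F] {n m k L : ℕ} {f g : ℕ → F} {s : State F}

/-- The tensors found by the program. -/
noncomputable abbrev foundTensors (n k : ℕ) (s : State F)
    (l : Fin (Nat.count (fun j => s.mem 16 j = 0) (n ^ k * n ^ k))) : Tensor F n (k + k) :=
  columnTensors n (k + k) (n ^ k * n ^ k) (s.mem 15) (s.mem 16) l

theorem contract_flatMat_apply (n k : ℕ) (s : State F) (f : ℕ → F) (p j : Fin (n ^ k)) :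
    contract (fun l => flatMat F n k (foundTensors n k s l)) (fun l => f l) p j =
      ∑ l ∈ Finset.range (Nat.count (fun j => s.mem 16 j = 0) (n ^ k * n ^ k)),
        f l * s.mem 15 (((p : ℕ) * n ^ k + j) * (n ^ k * n ^ k) +
          Nat.nth (fun j => s.mem 16 j = 0) l) := by
  rw [contract, Matrix.sum_apply, Finset.sum_range]
  refine Finset.sum_congr rfl fun l _ => ?_
  rw [Matrix.smul_apply, smul_eq_mul, flatMat_apply, foundTensors, columnTensors, code_append,
    code_symm, code_symm]
  congr 4
  ring

theorem RunFacts.combF_eq {T : ℕ → F} (hs : RunFacts n m k (n ^ (k - 1)) (n ^ k) L T f g s) :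
    arrMat (s.mem 17) (n ^ k) (n ^ k) =
      contract (fun l => flatMat F n k (foundTensors n k s l)) (fun l => f l) := by
  ext p j
  rw [contract_flatMat_apply, arrMat_apply, hs.combF]
  have := p.2; have := j.2; nlinarith

theorem RunFacts.combG_eq {T : ℕ → F} (hs : RunFacts n m k (n ^ (k - 1)) (n ^ k) L T f g s) :
    arrMat (s.mem 18) (n ^ k) (n ^ k) =
      contract (fun l => flatMat F n k (foundTensors n k s l)) (fun l => g l) := by
  ext p j
  rw [contract_flatMat_apply, arrMat_apply, hs.combG]
  have := p.2; have := j.2; nlinarith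

theorem tensorPow_zero_vec {n m : ℕ} (hm : 1 ≤ m) : tensorPow (0 : Fin n → F) m = 0 := by
  ext i
  exact Finset.prod_eq_zero (Finset.mem_univ ⟨0, hm⟩) rfl

variable {T : Tensor F n m}

/-- Every column of a combination of elements of `symColumns T` lies in the image, so a power in the
range of that combination does too. -/
theorem flatPow_mem_fullImage {r : ℕ} {Φ : Fin r → Tensor F n ((m + 1) / 2 + (m + 1) / 2)}
    (hΦ : ∀ l, Φ l ∈ symColumns T) (f : Fin r → F) {x : Fin n → F}
    {c : Fin (n ^ ((m + 1) / 2)) → F}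
    (h : flatPow ((m + 1) / 2) x =
      contract (fun l => flatMat F n ((m + 1) / 2) (Φ l)) f *ᵥ c) :
    tensorPow x ((m + 1) / 2) ∈ fullImage T := by
  have h1 : tensorPow x ((m + 1) / 2) = ∑ j, c j • ∑ l, f l •
      fun i => Φ l (Fin.append i (finFunctionFinEquiv.symm j)) := by
    ext i
    have := congrFun h (finFunctionFinEquiv i)
    simp only [flatPow, Equiv.symm_apply_apply] at this
    rw [this]
    simp only [mulVec, dotProduct, Finset.sum_apply, Pi.smul_apply, smul_eq_mul]
    refine Finset.sum_congr rfl fun j _ => ?_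
    rw [mul_comm]
    congr 1
    simp only [contract, Matrix.sum_apply, Matrix.smul_apply, smul_eq_mul, flatMat_apply,
      Equiv.symm_apply_apply]
    exact Finset.sum_congr rfl fun l _ => by rw [(hΦ l).1.append_comm]
  rw [h1]
  exact Submodule.sum_mem _ fun j _ => Submodule.smul_mem _ _ <|
    Submodule.sum_mem _ fun l _ => Submodule.smul_mem _ _ ((hΦ l).2 _)

theorem tensorPow_mem_symColumns {x : Fin n → F}
    (h : tensorPow x ((m + 1) / 2) ∈ fullImage T) :
    tensorPow x ((m + 1) / 2 + (m + 1) / 2) ∈ symColumns T := by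
  refine ⟨tensorPow_isSymmetric _ _, fun j => ?_⟩
  have : (fun i : Fin ((m + 1) / 2) → Fin n =>
      tensorPow x ((m + 1) / 2 + (m + 1) / 2) (Fin.append i j)) =
      tensorPow x ((m + 1) / 2) j • tensorPow x ((m + 1) / 2) := by
    ext i
    rw [tensorPow_append, Pi.smul_apply, smul_eq_mul, mul_comm]
  rw [this]
  exact Submodule.smul_mem _ _ h

theorem pow_half_mul (n m : ℕ) : n ^ ((m + 1) / 2) * n ^ (m / 2) = n ^ m := by
  rw [← pow_add, half_add_half]

/-- The coefficients are found by treating T as one more column; only kernel vectors with nonzero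
last coordinate express T through the powers. -/
theorem TensorRunFacts.coeff_kernel_iff (hs : TensorRunFacts T f g s) (x : ℕ → F) :
    (arrMat (s.mem 29) (n ^ ((m + 1) / 2) * n ^ (m / 2)) (n ^ ((m + 1) / 2) + 1)).mulVec
        (fun i => x i) = 0 ↔
      ∑ j ∈ Finset.range (n ^ ((m + 1) / 2)), x j • tensorPow (vecAt n s j) m +
        x (n ^ ((m + 1) / 2)) • T = 0 := by
  have key : ∀ i : Fin m → Fin n, rowDot (n ^ ((m + 1) / 2) + 1) (code i) x (s.mem 29) =
      (∑ j ∈ Finset.range (n ^ ((m + 1) / 2)), x j • tensorPow (vecAt n s j) m +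
        x (n ^ ((m + 1) / 2)) • T) i := by
    intro i
    have hi : code i < n ^ ((m + 1) / 2) * n ^ (m / 2) := by
      rw [pow_half_mul]; exact code_lt i
    change ∑ v ∈ Finset.range (n ^ ((m + 1) / 2) + 1), _ = _
    rw [Finset.sum_range_succ, hs.powLast _ hi, tensorArray_code, Pi.add_apply,
      Finset.sum_apply, Pi.smul_apply, smul_eq_mul, mul_comm (T i)]
    congr 1
    refine Finset.sum_congr rfl fun j hj => ?_
    rw [hs.powM _ hi j (Finset.mem_range.1 hj), Pi.smul_apply, smul_eq_mul, mul_comm]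
    congr 1
    exact prod_digits i (fun i => s.mem 27 (j * n + i))
  constructor
  · intro h
    ext i
    rw [← key]
    have hi : code i < n ^ ((m + 1) / 2) * n ^ (m / 2) := by
      rw [pow_half_mul]; exact code_lt i
    rw [← arrMat_mulVec (s.mem 29) _ (n ^ ((m + 1) / 2) + 1) x ⟨_, hi⟩, h]
    rfl
  · intro h
    ext ⟨r, hr⟩
    rw [arrMat_mulVec, Pi.zero_apply]
    obtain ⟨i, rfl⟩ := exists_code (n := n) (d := m) (x := r) (by rw [← pow_half_mul]; exact hr)
    exact (key i).trans (congrFun h i)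

theorem sum_range_eq_sum_nth {M : Type*} [AddCommMonoid M] (p : ℕ → Prop) [DecidablePred p]
    (V : ℕ) {G : ℕ → M} (hG : ∀ j < V, ¬ p j → G j = 0) :
    ∑ j ∈ Finset.range V, G j = ∑ l : Fin (Nat.count p V), G (Nat.nth p l) := by
  rw [Finset.sum_range, ← (nthEquiv p V).symm.sum_comp]
  have h1 : ∀ j : {j : Fin V // p j}, Nat.nth p ((nthEquiv p V).symm j) = j.1 := fun j => by
    rw [← nthEquiv_apply, Equiv.apply_symm_apply]
  simp only [h1]
  rw [← Finset.sum_subtype (Finset.univ.filter fun j : Fin V => p j) (fun x => by simp)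
    fun j : Fin V => G j]
  refine (Finset.sum_filter_of_ne fun j _ hj => ?_).symm
  by_contra h
  exact hj (hG j j.2 h)

/-- The eigenvector equations were tested for the exact powers of the vectors read off, so no
property of the oracle's answer for X is needed. A power in the range of A lies in the image of the
flattening, and then its 2k-th power lies in `symColumns T`; this is the hypothesis of
`simDiagonalizedBy_of_eigen`. -/
theorem TensorRunFacts.sound (hs : TensorRunFacts T f g s) (hm : 3 ≤ m) (hT : IsSymmetric T)
    (h22 : 1 ≤ s.reg 22) (h30 : 1 ≤ s.reg 30) (h23 : s.reg 23 = 0) :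
    Nat.count (fun j => s.mem 26 j ≠ 0) (n ^ ((m + 1) / 2)) =
      Nat.count (fun j => s.mem 16 j = 0) (n ^ ((m + 1) / 2) * n ^ ((m + 1) / 2)) ∧
    SimDiagonalizedBy (fun l => matOf (foundTensors n ((m + 1) / 2) s l)) (fun l => f l)
      (fun l => g l) (fun a => ver ((m + 1) / 2)
        (vecAt n s (Nat.nth (fun j => s.mem 26 j ≠ 0) a))) ∧
    ∑ a : Fin (Nat.count (fun j => s.mem 26 j ≠ 0) (n ^ ((m + 1) / 2))),
      (-s.mem 31 (Nat.nth (fun j => s.mem 26 j ≠ 0) a * (n ^ ((m + 1) / 2) + 1) + s.reg 29) /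
        s.mem 31 (n ^ ((m + 1) / 2) * (n ^ ((m + 1) / 2) + 1) + s.reg 29)) •
      tensorPow (vecAt n s (Nat.nth (fun j => s.mem 26 j ≠ 0) a)) m = T := by
  obtain ⟨hpiv, heig, hcount⟩ := hs.checks.1 h23
  obtain ⟨hli, hspan⟩ := hs.columnTensors_basis hm hT
  have hmem : ∀ l, foundTensors n ((m + 1) / 2) s l ∈ symColumns T := fun l => by
    rw [← hspan]; exact Submodule.subset_span ⟨l, rfl⟩
  refine ⟨hcount, ?_, ?_⟩
  · rw [simDiagonalizedBy_matOf_iff fun l => (hmem l).1]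
    obtain ⟨ht, hW⟩ := hs.ratioColumn_spec h22
    rw [hs.combF_eq, hs.combG_eq] at hW
    have hX := hs.ratio_eq
    rw [hs.combG_eq] at hX
    let e := nthEquiv (fun j => s.mem 26 j ≠ 0) (n ^ ((m + 1) / 2))
    have hlt : ∀ a : Fin (Nat.count (fun j => s.mem 16 j = 0)
        (n ^ ((m + 1) / 2) * n ^ ((m + 1) / 2))),
        Nat.nth (fun j => s.mem 26 j ≠ 0) a < n ^ ((m + 1) / 2) ∧
        s.mem 26 (Nat.nth (fun j => s.mem 26 j ≠ 0) a) ≠ 0 := fun a =>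
      ⟨(e (a.cast hcount.symm)).1.2, (e (a.cast hcount.symm)).2⟩
    refine simDiagonalizedBy_of_eigen
      (d := fun a => s.mem 26 (Nat.nth (fun j => s.mem 26 j ≠ 0) a))
      (LinearIndependent.map' hli (flatMat F n ((m + 1) / 2))
        (LinearMap.ker_eq_bot.2 flatMat_injective)) ht hW (fun a => ?_)
      (fun a => flatPow_ne_zero (hs.vecAt_ne_zero h23 (hlt a).1 (hlt a).2))
      (fun a => (hlt a).2) ?_ ?_
    · rw [← hX]
      ext p
      have h1 := (heig _ (hlt a).1 (hlt a).2).1 p p.2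
      rw [hs.powK_eq (hlt a).1 p, Finset.sum_range] at h1
      rw [Pi.smul_apply, smul_eq_mul, ← h1]
      change ∑ q, arrMat (s.mem 24) _ _ p q * _ = _
      exact Finset.sum_congr rfl fun q _ => by rw [hs.powK_eq (hlt a).1 q, arrMat_apply]
    · intro a b hab
      by_contra hne
      have h1 : Nat.nth (fun j => s.mem 26 j ≠ 0) a ≠ Nat.nth (fun j => s.mem 26 j ≠ 0) b := by
        intro h
        apply hne
        have : e (a.cast hcount.symm) = e (b.cast hcount.symm) := Subtype.ext (Fin.ext h)
        exact Fin.cast_injective _ (e.injective this)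
      rcases lt_or_gt_of_ne h1 with h | h
      · exact (heig _ (hlt a).1 (hlt a).2).2 _ (hlt b).1 h hab
      · exact (heig _ (hlt b).1 (hlt b).2).2 _ (hlt a).1 h hab.symm
    · rintro a ⟨c, hc⟩
      rw [← flatMat_tensorPow]
      have h1 := tensorPow_mem_symColumns (flatPow_mem_fullImage hmem _ hc)
      rw [← hspan] at h1
      have h2 := Submodule.mem_map_of_mem (f := flatMat F n ((m + 1) / 2)) h1
      rw [Submodule.map_span, ← Set.range_comp] at h2
      exact h2
  · rcases hs.pickCoeff with h | ⟨-, h1, h2, h3⟩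
    · omega
    · have h4 := (hs.coeff_kernel_iff fun y =>
        s.mem 31 (y * (n ^ ((m + 1) / 2) + 1) + s.reg 29)).1 (hs.kerCoeff.column_mulVec h1 h2)
      rw [sum_range_eq_sum_nth (fun j => s.mem 26 j ≠ 0)] at h4
      · have h5 := eq_neg_of_add_eq_zero_left h4
        -- Normalize the kernel vector by its coefficient at T; this accounts for the sign and the
        -- denominator of the output coefficients.
        have h6 : ∀ w : F, w ≠ 0 → ∀ S : Tensor F n m, S = -(w • T) → (-w⁻¹) • S = T := by
          rintro w hw S rfl
          rw [smul_neg, neg_smul, neg_neg, smul_smul, inv_mul_cancel₀ hw, one_smul]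
        have h7 := h6 _ h3 _ h5
        rw [← h7, Finset.smul_sum]
        refine Finset.sum_congr rfl fun a _ => ?_
        rw [smul_smul]
        congr 1
        rw [div_eq_mul_inv]
        ring
      · intro j hj hj0
        rw [hs.vecAt_eq_zero hj (not_not.1 hj0), tensorPow_zero_vec (by omega), smul_zero]

end Soundness

end Waring

namespace Waring

open Matrix

/-! ### The program does not fail when a decomposition can be read off -/

section Completeness

variable {F : Type*} [RCLike F] {n m k L : ℕ} {f g : ℕ → F} {s : State F} {T : Tensor F n m}

theorem flatPow_snoc {k : ℕ} (x : Fin n → F) {p : ℕ} (hp : p < n ^ k) (i : Fin n)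
    (h : p + n ^ k * i < n ^ (k + 1)) :
    flatPow (k + 1) x ⟨p + n ^ k * i, h⟩ = flatPow k x ⟨p, hp⟩ * x i := by
  obtain ⟨w, rfl⟩ := exists_code hp
  have h1 : (⟨code w + n ^ k * i, h⟩ : Fin (n ^ (k + 1))) =
      finFunctionFinEquiv (Fin.snoc w i : Fin (k + 1) → Fin n) := Fin.ext (code_snoc i w).symm
  have h2 : (⟨code w, hp⟩ : Fin (n ^ k)) = finFunctionFinEquiv w := rfl
  rw [h1, h2, flatPow, flatPow, Equiv.symm_apply_apply, Equiv.symm_apply_apply, tensorPow,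
    tensorPow, Fin.prod_univ_castSucc]
  simp only [Fin.snoc_castSucc, Fin.snoc_last]

/-- A vector can be read off from the entries of a multiple of its power. -/
theorem flatPow_fiber {k : ℕ} (hk : 1 ≤ k) (x : Fin n → F) {p : ℕ} (hp : p < n ^ (k - 1))
    (i : Fin n) (h : p + n ^ (k - 1) * i < n ^ k) :
    flatPow k x ⟨p + n ^ (k - 1) * i, h⟩ = flatPow (k - 1) x ⟨p, hp⟩ * x i := by
  obtain ⟨k, rfl⟩ := Nat.exists_eq_add_of_le' hk
  exact flatPow_snoc x hp i h

theorem fiber_lt {k p i : ℕ} (hk : 1 ≤ k) (hp : p < n ^ (k - 1)) (hi : i < n) :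
    p + n ^ (k - 1) * i < n ^ k := by
  have h1 := pow_pred_mul n hk
  have h2 : n ^ (k - 1) * (i + 1) ≤ n ^ (k - 1) * n := Nat.mul_le_mul_left _ hi
  rw [mul_add, mul_one] at h2
  omega

theorem exists_fiber {k v : ℕ} (hk : 1 ≤ k) (hv : v < n ^ k) :
    ∃ p < n ^ (k - 1), ∃ i < n, v = p + n ^ (k - 1) * i := by
  rw [← pow_pred_mul n hk] at hv
  have h0 : 0 < n ^ (k - 1) := Nat.pos_of_ne_zero fun h => by simp [h] at hv
  exact ⟨v % n ^ (k - 1), Nat.mod_lt _ h0, v / n ^ (k - 1), Nat.div_lt_of_lt_mul hv,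
    (Nat.mod_add_div _ _).symm⟩

/-- A fibre of c x^{⊗k} is c times an entry of x^{⊗(k-1)} times x, and the pivot was chosen so that
it is nonzero. -/
theorem RunFacts.vecAt_eq_smul {T : ℕ → F} (hs : RunFacts n m k (n ^ (k - 1)) (n ^ k) L T f g s)
    (hk : 1 ≤ k) {j : ℕ} (hj : j < n ^ k) (h26 : s.mem 26 j ≠ 0) {x : Fin n → F} {c : F}
    (h : ∀ v : Fin (n ^ k), s.mem 25 (v * n ^ k + j) = c * flatPow k x v)
    (h0 : ∃ v : Fin (n ^ k), s.mem 25 (v * n ^ k + j) ≠ 0) :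
    (∃ p < n ^ (k - 1), ∃ i < n, s.mem 25 ((p + n ^ (k - 1) * i) * n ^ k + j) ≠ 0) ∧
      ∃ c' : F, c' ≠ 0 ∧ vecAt n s j = c' • x := by
  have hpiv : ∃ p < n ^ (k - 1), ∃ i < n, s.mem 25 ((p + n ^ (k - 1) * i) * n ^ k + j) ≠ 0 := by
    obtain ⟨v, hv⟩ := h0
    obtain ⟨p, hp, i, hi, hvp⟩ := exists_fiber hk v.2
    exact ⟨p, hp, i, hi, hvp ▸ hv⟩
  refine ⟨hpiv, ?_⟩
  obtain ⟨piv, h1, h2⟩ := hs.vecs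
  obtain ⟨hp, i, hi, hne⟩ := h1 j hj h26 hpiv
  have h3 : ∀ (i : ℕ) (hi : i < n), s.mem 25 ((piv j + n ^ (k - 1) * i) * n ^ k + j) =
      c * flatPow (k - 1) x ⟨piv j, hp⟩ * x ⟨i, hi⟩ := by
    intro i hi
    have := h ⟨_, fiber_lt hk hp hi⟩
    rw [flatPow_fiber hk x hp ⟨i, hi⟩, ← mul_assoc] at this
    exact this
  refine ⟨c * flatPow (k - 1) x ⟨piv j, hp⟩, ?_, ?_⟩
  · intro h4
    rw [h3 i hi, h4, zero_mul] at hne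
    exact hne rfl
  · ext i
    refine (h2 j hj i i.2).trans ?_
    rw [if_neg h26, h3 i i.2]
    rfl

/-- X equals Y diag(d) Y', so the oracle must diagonalize it and its relevant columns are multiples
of the x_a^{⊗k}. The vectors read off are multiples of the x_a, and each test follows. -/
theorem TensorRunFacts.complete (hs : TensorRunFacts T f g s) (hm : 3 ≤ m) (hT : IsSymmetric T)
    {x : Fin (Nat.count (fun j => s.mem 16 j = 0) (n ^ ((m + 1) / 2) * n ^ ((m + 1) / 2))) →
      Fin n → F}
    {α : Fin (Nat.count (fun j => s.mem 16 j = 0) (n ^ ((m + 1) / 2) * n ^ ((m + 1) / 2))) → F}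
    (hx : SimDiagonalizedBy (fun l => matOf (foundTensors n ((m + 1) / 2) s l)) (fun l => f l)
      (fun l => g l) (fun a => ver ((m + 1) / 2) (x a)))
    (hα : ∑ a, α a • tensorPow (x a) m = T) :
    1 ≤ s.reg 22 ∧ 1 ≤ s.reg 30 ∧ s.reg 23 = 0 := by
  have hk : 1 ≤ (m + 1) / 2 := by omega
  obtain ⟨hli, hspan⟩ := hs.columnTensors_basis hm hT
  have hmem : ∀ l, foundTensors n ((m + 1) / 2) s l ∈ symColumns T := fun l => by
    rw [← hspan]; exact Submodule.subset_span ⟨l, rfl⟩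
  rw [simDiagonalizedBy_matOf_iff fun l => (hmem l).1] at hx
  obtain ⟨W, hW⟩ := hx.exists_ratio
  rw [← hs.combF_eq, ← hs.combG_eq] at hW
  have h22 := hs.ratio_flag hW
  obtain ⟨ht, hW'⟩ := hs.ratioColumn_spec h22
  have hX := hs.ratio_eq
  rw [hs.combF_eq, hs.combG_eq] at hW'
  rw [hs.combG_eq] at hX
  obtain ⟨Y', d, hY', hd0, hd, hfac⟩ := hx.ratio_eq ht hW'
  rw [← hX] at hfac
  obtain ⟨hQ, hXQ⟩ := hs.eigen (by rw [hfac]; exact exists_diagonalization_of_factor hY' d)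
  rw [hfac] at hXQ
  obtain ⟨σ, hσ⟩ := exists_equiv_of_diagonalization hY' hd0 hd hQ hXQ
  have hy0 : ∀ a, flatPow ((m + 1) / 2) (x a) ≠ 0 := by
    obtain ⟨z, -, -, hv, -⟩ := hx
    exact hv.ne_zero
  have hvec : ∀ j : {j : Fin (n ^ ((m + 1) / 2)) // s.mem 26 j ≠ 0},
      (∃ p < n ^ ((m + 1) / 2 - 1), ∃ i < n,
        s.mem 25 ((p + n ^ ((m + 1) / 2 - 1) * i) * n ^ ((m + 1) / 2) + j.1) ≠ 0) ∧
      ∃ c' : F, c' ≠ 0 ∧ vecAt n s j.1 = c' • x (σ j) := by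
    intro j
    obtain ⟨-, c, hc, hcol⟩ := hσ j
    have h1 : ∀ v : Fin (n ^ ((m + 1) / 2)), s.mem 25 (v * n ^ ((m + 1) / 2) + j.1) =
        c * flatPow ((m + 1) / 2) (x (σ j)) v := fun v => congrFun hcol v
    refine hs.vecAt_eq_smul hk j.1.2 j.2 h1 ?_
    by_contra! h0
    apply hy0 (σ j)
    ext v
    have h2 := h1 v
    rw [h0 v] at h2
    simpa [hc] using h2.symm
  have hXy : ∀ a, arrMat (s.mem 24) (n ^ ((m + 1) / 2)) (n ^ ((m + 1) / 2)) *ᵥ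
      flatPow ((m + 1) / 2) (x a) = d a • flatPow ((m + 1) / 2) (x a) := by
    intro a
    have h1 : arrMat (s.mem 24) (n ^ ((m + 1) / 2)) (n ^ ((m + 1) / 2)) *
        colMatrix (fun a => flatPow ((m + 1) / 2) (x a)) =
        colMatrix (fun a => flatPow ((m + 1) / 2) (x a)) * diagonal d := by
      rw [hfac, Matrix.mul_assoc, hY', Matrix.mul_one]
    ext p
    have h2 := congrFun (congrFun h1 p) a
    rw [mul_diagonal] at h2
    rw [Pi.smul_apply, smul_eq_mul, mul_comm]
    exact h2
  refine ⟨h22, ?_, hs.checks.2 ⟨fun j hj hj0 => (hvec ⟨⟨j, hj⟩, hj0⟩).1, fun j hj hj0 =>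
    ⟨fun p hp => ?_, fun j' hj' hlt heq => ?_⟩, ?_⟩⟩
  · rcases hs.pickCoeff with ⟨-, h⟩ | h
    · exfalso
      classical
      choose c hc hcx using fun j => (hvec j).2
      -- The vector read off is c_j x_{σ j}, so the given decomposition becomes a kernel vector with
      -- entries -α_{σ j} c_j^{-m} and 1 at T.
      let w : ℕ → F := fun y => if h : y < n ^ ((m + 1) / 2) then
        (if h0 : s.mem 26 y ≠ 0 then
          -(α (σ ⟨⟨y, h⟩, h0⟩) * ((c ⟨⟨y, h⟩, h0⟩)⁻¹) ^ m) else 0) else 1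
      have hw1 : w (n ^ ((m + 1) / 2)) = 1 := dif_neg (lt_irrefl _)
      have hsum : ∑ j ∈ Finset.range (n ^ ((m + 1) / 2)), w j • tensorPow (vecAt n s j) m +
          w (n ^ ((m + 1) / 2)) • T = 0 := by
        rw [hw1, one_smul, Finset.sum_range, ← hα, add_eq_zero_iff_eq_neg,
          ← Finset.sum_neg_distrib, ← σ.sum_comp]
        have h1 : ∑ j : Fin (n ^ ((m + 1) / 2)), w j • tensorPow (vecAt n s j) m =
            ∑ j ∈ Finset.univ.filter (fun j : Fin (n ^ ((m + 1) / 2)) => s.mem 26 j ≠ 0),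
              w j • tensorPow (vecAt n s j) m := by
          refine (Finset.sum_filter_of_ne fun j _ hj => ?_).symm
          intro h0
          apply hj
          rw [hs.vecAt_eq_zero j.2 h0, tensorPow_zero_vec (by omega), smul_zero]
        rw [h1, Finset.sum_subtype _ (p := fun j : Fin (n ^ ((m + 1) / 2)) => s.mem 26 j ≠ 0)
          (fun j => by simp)]
        refine Finset.sum_congr rfl fun j _ => ?_
        have h2 : w j.1 = -(α (σ j) * ((c j)⁻¹) ^ m) := by
          simp only [w, dif_pos j.1.2, dif_pos j.2]
        have h3 : (c j)⁻¹ ^ m * c j ^ m = 1 := by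
          rw [← mul_pow, inv_mul_cancel₀ (hc j), one_pow]
        rw [h2, hcx j, tensorPow_smul, smul_smul, neg_mul, mul_assoc, h3, mul_one, neg_smul]
      have := hs.kerCoeff.row_eq_zero (Nat.lt_succ_self _) h (x := w)
        ((hs.coeff_kernel_iff w).2 hsum)
      rw [hw1] at this
      exact one_ne_zero this
    · exact h.1
  · obtain ⟨-, c', -, hc'⟩ := hvec ⟨⟨j, hj⟩, hj0⟩
    have h1 := congrFun (hXy (σ ⟨⟨j, hj⟩, hj0⟩)) ⟨p, hp⟩
    rw [← (hσ ⟨⟨j, hj⟩, hj0⟩).1] at h1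
    have h2 : ∀ q : Fin (n ^ ((m + 1) / 2)), s.mem 28 (j * n ^ ((m + 1) / 2) + q) =
        c' ^ ((m + 1) / 2) * flatPow ((m + 1) / 2) (x (σ ⟨⟨j, hj⟩, hj0⟩)) q := fun q => by
      rw [hs.powK_eq hj q, hc', flatPow_smul, Pi.smul_apply, smul_eq_mul]
    rw [Finset.sum_range, h2 ⟨p, hp⟩]
    rw [Pi.smul_apply, smul_eq_mul] at h1
    rw [mul_left_comm, ← h1]
    change _ = _ * ∑ q, arrMat (s.mem 24) _ _ ⟨p, hp⟩ q * _
    rw [Finset.mul_sum]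
    exact Finset.sum_congr rfl fun q _ => by rw [h2 q, arrMat_apply]; ring
  · have h0' : s.mem 26 j' ≠ 0 := heq ▸ hj0
    have e1 := (hσ ⟨⟨j, hj⟩, hj0⟩).1
    have e2 := (hσ ⟨⟨j', hj'⟩, h0'⟩).1
    have e3 : σ ⟨⟨j, hj⟩, hj0⟩ = σ ⟨⟨j', hj'⟩, h0'⟩ := hd (e1.symm.trans (heq.trans e2))
    have e4 := congrArg (fun z => (z.1 : ℕ)) (σ.injective e3)
    exact absurd e4 hlt.ne
  · have e1 := Fintype.card_congr ((nthEquiv (fun j => s.mem 26 j ≠ 0) (n ^ ((m + 1) / 2))).trans σ)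
    rwa [Fintype.card_fin, Fintype.card_fin] at e1

end Completeness

end Waring

namespace Waring

/-! ### Running time and number of oracle calls -/

section Cost

variable {F : Type*} [RCLike F] {n m : ℕ}

/-- The computation between the initialization and the output. -/
abbrev bodyProg : Program := stages.foldr Program.seq Program.skip

theorem bodyProg_boundsLe {b : ℕ} {ρ : ℕ → ℕ} (h0 : ρ 0 ≤ b) (h1 : ρ 1 ≤ b) (h2 : ρ 2 ≤ b)
    (h3 : ρ 3 ≤ b) (h4 : ρ 4 < b) (h5 : ρ 5 ≤ b) (h34 : ρ 3 * ρ 4 ≤ b) (h44 : ρ 4 * ρ 4 < b)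
    (h244 : 2 * (ρ 4 * ρ 4) ≤ b) (h45 : ρ 4 * ρ 5 ≤ b) : bodyProg.boundsLe b ρ := by
  have h4' := h4.le
  have h44' := h44.le
  simp only [bodyProg, stages, List.foldr, Program.boundsLe]
  simp [ker, gram, pick, fillSymRows, combine, fillRatioRows, fillRatio, extractVecs, findFiber,
    powEntry, fillPowers, fillLast, fillDefect, checkEigen, checkCount, addConjMul, addMul, subMul,
    addCopy, subCopy, addOne, subOne, Program.boundsLe, *]

/-- The largest quantity is 2N². It is at most (n+1)^{1+2k}, and 1 + 2k ≤ m + 2 ≤ 2m; the factor 2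
is absorbed by n + 1 ≥ 2. -/
theorem size_bounds (hm : 3 ≤ m) (hn : 1 ≤ n) :
    n ≤ (n + 1) ^ (2 * m) ∧ m ≤ (n + 1) ^ (2 * m) ∧ (m + 1) / 2 ≤ (n + 1) ^ (2 * m) ∧
    n ^ ((m + 1) / 2 - 1) ≤ (n + 1) ^ (2 * m) ∧ n ^ ((m + 1) / 2) < (n + 1) ^ (2 * m) ∧
    n ^ (m / 2) ≤ (n + 1) ^ (2 * m) ∧
    n ^ ((m + 1) / 2 - 1) * n ^ ((m + 1) / 2) ≤ (n + 1) ^ (2 * m) ∧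
    n ^ ((m + 1) / 2) * n ^ ((m + 1) / 2) < (n + 1) ^ (2 * m) ∧
    2 * (n ^ ((m + 1) / 2) * n ^ ((m + 1) / 2)) ≤ (n + 1) ^ (2 * m) ∧
    n ^ ((m + 1) / 2) * n ^ (m / 2) ≤ (n + 1) ^ (2 * m) := by
  have hNpos : 1 ≤ n ^ ((m + 1) / 2) := Nat.one_le_pow _ _ hn
  have key : 2 * (n ^ ((m + 1) / 2) * n ^ ((m + 1) / 2)) ≤ (n + 1) ^ (2 * m) := by
    calc 2 * (n ^ ((m + 1) / 2) * n ^ ((m + 1) / 2))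
        ≤ (n + 1) * ((n + 1) ^ ((m + 1) / 2) * (n + 1) ^ ((m + 1) / 2)) := by
          gcongr <;> omega
      _ = (n + 1) ^ (1 + ((m + 1) / 2 + (m + 1) / 2)) := by rw [pow_add, pow_add, pow_one]
      _ ≤ (n + 1) ^ (2 * m) := Nat.pow_le_pow_right (by omega) (by omega)
  have hm' : m ≤ (n + 1) ^ (2 * m) := by
    calc m ≤ 2 ^ m := Nat.lt_two_pow_self.le
      _ ≤ (n + 1) ^ m := Nat.pow_le_pow_left (by omega) _
      _ ≤ (n + 1) ^ (2 * m) := Nat.pow_le_pow_right (by omega) (by omega)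
  have hK : n ^ ((m + 1) / 2 - 1) ≤ n ^ ((m + 1) / 2) := Nat.pow_le_pow_right hn (by omega)
  have hL : n ^ (m / 2) ≤ n ^ ((m + 1) / 2) := Nat.pow_le_pow_right hn (by omega)
  have hn' : n ≤ n ^ ((m + 1) / 2) := Nat.le_self_pow (by omega) n
  have hNN : n ^ ((m + 1) / 2) ≤ n ^ ((m + 1) / 2) * n ^ ((m + 1) / 2) :=
    Nat.le_mul_of_pos_left _ hNpos
  have hKN := Nat.mul_le_mul_right (n ^ ((m + 1) / 2)) hK
  have hNL := Nat.mul_le_mul_left (n ^ ((m + 1) / 2)) hL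
  refine ⟨?_, hm', ?_, ?_, ?_, ?_, ?_, ?_, key, ?_⟩ <;> omega

theorem add_add_pow_le {b x y z : ℕ} (hb : 2 ≤ b) : b ^ x + b ^ y + b ^ z ≤ b ^ (x + y + z + 2) := by
  have h1 : b ^ x ≤ b ^ (x + y + z) := Nat.pow_le_pow_right (by omega) (by omega)
  have h2 : b ^ y ≤ b ^ (x + y + z) := Nat.pow_le_pow_right (by omega) (by omega)
  have h3 : b ^ z ≤ b ^ (x + y + z) := Nat.pow_le_pow_right (by omega) (by omega)
  have h4 : 4 * b ^ (x + y + z) ≤ b ^ 2 * b ^ (x + y + z) :=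
    Nat.mul_le_mul_right _ (by nlinarith)
  rw [pow_add b _ 2, mul_comm _ (b ^ 2)]
  omega

/-- The state after the initialization. -/
noncomputable def startState (O : Oracle F) (T : Tensor F n m) (f g : ℕ → F) : State F :=
  initProg.run O (initialState T f g)

/-- The state before the output is written. -/
noncomputable def midState (O : Oracle F) (T : Tensor F n m) (f g : ℕ → F) : State F :=
  runs O stages (startState O T f g)

theorem waringProgram_run (O : Oracle F) (T : Tensor F n m) (f g : ℕ → F) :
    waringProgram.run O (initialState T f g) =
      finish.run O (writeOutput.run O (midState O T f g)) := by
  rw [waringProgram, run_seq, run_seq, run_seq, run_foldr_seq]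
  rfl

theorem startState_reg (O : Oracle F) (T : Tensor F n m) (f g : ℕ → F) (hm : 3 ≤ m) :
    (startState O T f g).reg 0 = n ∧ (startState O T f g).reg 1 = m ∧
    (startState O T f g).reg 2 = (m + 1) / 2 ∧
    (startState O T f g).reg 3 = n ^ ((m + 1) / 2 - 1) ∧
    (startState O T f g).reg 4 = n ^ ((m + 1) / 2) ∧
    (startState O T f g).reg 5 = n ^ (m / 2) ∧
    ∀ r, 20 ≤ r → (startState O T f g).reg r = 0 := by
  obtain ⟨h0, h1, h2, h3, h4, h5, h6⟩ := initProg_reg O (initialState T f g) (n := n) (m := m)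
    (by omega) rfl rfl rfl
  refine ⟨h0, h1, h2, h3, h4, h5, fun r hr => ?_⟩
  rw [startState, h6 r (by omega) (by omega)]
  simp only [initialState]
  rw [if_neg (by omega), if_neg (by omega)]

theorem startState_mem (O : Oracle F) (T : Tensor F n m) (f g : ℕ → F) :
    (startState O T f g).mem = (initialState T f g).mem := by
  ext1 a
  exact run_mem O a initProg _ rfl

theorem midState_reg (O : Oracle F) (T : Tensor F n m) (f g : ℕ → F) {r : ℕ}
    (h : stages.all (fun c => !c.modReg r) = true) :
    (midState O T f g).reg r = (startState O T f g).reg r := by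
  rw [midState, runs_reg O r stages _ h]

theorem waringProgram_steps_le (O : Oracle F) (T : Tensor F n m) (f g : ℕ → F) (hn : 1 ≤ n)
    (hm : 3 ≤ m) : (waringProgram.run O (initialState T f g)).steps ≤
      (n + 1) ^ (2 * (initProg.weight + bodyProg.weight + (Program.seq writeOutput finish).weight + 2)
        * m) := by
  obtain ⟨r0, r1, r2, r3, r4, r5, -⟩ := startState_reg O T f g hm
  have m0 := midState_reg O T f g (r := 0) (by decide)
  have m4 := midState_reg O T f g (r := 4) (by decide)
  obtain ⟨b0, b1, b2, b3, b4, b5, b34, b44, b244, b45⟩ := size_bounds hm hn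
  set b := (n + 1) ^ (2 * m) with hb
  have hb2 : 2 ≤ b := by
    have : 1 ≤ n ^ ((m + 1) / 2) := Nat.one_le_pow _ _ hn
    omega
  have e1 := run_steps O hb2 (bad := initProg.modReg) (ρ := (initialState T f g).reg) initProg
    (initialState T f g) (fun _ h => h) (by decide) (fun _ _ => rfl) (by
      simp [initProg, Program.boundsLe, initialState, b1])
  -- Registers below 6 contain the sizes and are not changed by the stages, so they may occur in
  -- loop bounds.
  have e2 := run_steps O hb2 (bad := fun r => decide (6 ≤ r)) (ρ := (startState O T f g).reg)
    bodyProg (startState O T f g) (fun r h => by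
      rw [decide_eq_true_iff]
      by_contra hr
      have : ∀ r < 6, bodyProg.modReg r = false := by decide
      rw [this r (by omega)] at h
      exact absurd h (by simp)) (by decide) (fun _ _ => rfl) (by
      apply bodyProg_boundsLe <;> simp only [r0, r1, r2, r3, r4, r5] <;> assumption)
  have e3 := run_steps O hb2 (bad := fun r => decide (r ≠ 0 ∧ r ≠ 4))
    (ρ := (startState O T f g).reg)
    writeOutput (midState O T f g) (fun r h => by
      rw [decide_eq_true_iff]
      constructor <;> rintro rfl <;> exact absurd h (by decide)) (by decide) (fun r hr => by
        have hr' : r = 0 ∨ r = 4 := by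
          by_contra! h
          simp [h] at hr
        rcases hr' with rfl | rfl
        · exact m0
        · exact m4) (by
      simp [writeOutput, Program.boundsLe, r0, r4, b0, b4.le])
  have e4 := run_steps O hb2 (bad := finish.modReg)
    (ρ := (writeOutput.run O (midState O T f g)).reg) finish (writeOutput.run O (midState O T f g))
    (fun _ h => h) (by decide) (fun _ _ => rfl) (by simp [finish, Program.boundsLe])
  have e0 : (initialState T f g).steps = 0 := rfl
  have e5 := add_add_pow_le (x := initProg.weight) (y := bodyProg.weight)
    (z := (Program.seq writeOutput finish).weight) hb2
  have e6 : b ^ writeOutput.weight + b ^ finish.weight ≤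
      b ^ (Program.seq writeOutput finish).weight := by
    change _ ≤ b ^ (writeOutput.weight + finish.weight + 1)
    have h1 : b ^ writeOutput.weight ≤ b ^ (writeOutput.weight + finish.weight) :=
      Nat.pow_le_pow_right (by omega) (by omega)
    have h2 : b ^ finish.weight ≤ b ^ (writeOutput.weight + finish.weight) :=
      Nat.pow_le_pow_right (by omega) (by omega)
    have h3 := Nat.mul_le_mul_left (b ^ (writeOutput.weight + finish.weight)) hb2
    rw [pow_succ]
    linarith
  have e7 : bodyProg.run O (startState O T f g) = midState O T f g := run_foldr_seq O _ _
  have e8 : initProg.run O (initialState T f g) = startState O T f g := rfl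
  rw [e0, e8] at e1
  rw [e7] at e2
  rw [waringProgram_run, mul_right_comm, pow_mul, ← hb]
  omega

theorem waringProgram_calls_le (O : Oracle F) (T : Tensor F n m) (f g : ℕ → F) :
    (waringProgram.run O (initialState T f g)).calls ≤ waringProgram.callCount :=
  (run_calls O waringProgram _ (by decide)).trans (Nat.zero_add _).le

end Cost

/-! ### The output in terms of the final memory -/

section Output

variable {F : Type*} [RCLike F] {n m : ℕ}

theorem midState_facts {O : Oracle F} (hO : O.IsValid) (T : Tensor F n m) (f g : ℕ → F)
    (hn : 1 ≤ n) (hm : 3 ≤ m) : TensorRunFacts T f g (midState O T f g) := by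
  obtain ⟨r0, r1, r2, r3, r4, r5, r6⟩ := startState_reg O T f g hm
  have h := runFacts hO hn (pow_pred_mul n (show 1 ≤ (m + 1) / 2 by omega)) r0 r1 r2 r3 r4 r5 r6
    (fun a ha => by
      rw [startState_mem]
      ext x
      simp only [initialState]
      rw [if_neg (by omega), if_neg (by omega), if_neg (by omega)]
      rfl)
  rw [startState_mem] at h
  exact h

/-- The kernel found in the second step depends only on the tensor. -/
theorem midState_mem_eq (O : Oracle F) (T : Tensor F n m) (f g : ℕ → F) {a : ℕ}
    (ha : a = 15 ∨ a = 16) : (midState O T f g).mem a = (midState O T 0 0).mem a := by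
  have h1 : ∀ f g : ℕ → F, (midState O T f g).mem a =
      (runs O (stages.take 3) (startState O T f g)).mem a := by
    intro f g
    have : midState O T f g = runs O (stages.drop 3) (runs O (stages.take 3) (startState O T f g)) := by
      simp only [midState, runs, ← List.foldl_append, List.take_append_drop]
    rw [this]
    rcases ha with rfl | rfl <;> exact runs_mem O _ _ _ (by decide)
  let B : ℕ → Bool := fun a => a == 1 || a == 2
  let h : ℕ → ℕ → F := fun a => if a = 1 then f else g
  have h2 : initialState T f g = (initialState T 0 0).withArrays B h := by
    simp only [initialState, State.withArrays, State.mk.injEq, true_and, and_true]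
    ext a x
    by_cases h0 : a = 0
    · simp [h0, B]
    · by_cases h1 : a = 1
      · simp [h1, B, h]
      · by_cases h2 : a = 2
        · simp [h2, B, h]
        · simp [h0, h1, h2, B]
  have h3 : runs O (stages.take 3) (startState O T f g) =
      (runs O (stages.take 3) (startState O T 0 0)).withArrays B h := by
    rw [startState, startState, h2, run_withArrays O B h _ _ (by decide)]
    simp only [stages, List.take, runs, List.foldl_cons, List.foldl_nil]
    rw [run_withArrays O B h _ _ (by decide), run_withArrays O B h _ _ (by decide),
      run_withArrays O B h _ _ (by decide)]
  rw [h1, h1, h3]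
  generalize runs O (stages.take 3) (startState O T 0 0) = s
  rcases ha with rfl | rfl <;> rfl

theorem waringProgram_output (O : Oracle F) (hO : O.IsValid) (T : Tensor F n m) (f g : ℕ → F)
    (hn : 1 ≤ n) (hm : 3 ≤ m) (s : State F) (hs : s = midState O T f g) :
    (waringProgram.run O (initialState T f g)).output n =
      if 1 ≤ s.reg 22 ∧ 1 ≤ s.reg 30 ∧ s.reg 23 = 0 then
        some { length := Nat.count (fun j => s.mem 26 j ≠ 0) (n ^ ((m + 1) / 2))
               coeff := fun a =>
                -s.mem 31 (Nat.nth (fun j => s.mem 26 j ≠ 0) a * (n ^ ((m + 1) / 2) + 1) +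
                  s.reg 29) / s.mem 31 (n ^ ((m + 1) / 2) * (n ^ ((m + 1) / 2) + 1) + s.reg 29)
               vec := fun a => vecAt n s (Nat.nth (fun j => s.mem 26 j ≠ 0) a) }
      else none := by
  have hf := midState_facts hO T f g hn hm
  obtain ⟨r0, -, -, -, r4, -, -⟩ := startState_reg O T f g hm
  rw [waringProgram_run, ← hs]
  rw [← hs] at hf
  have h0 : s.reg 0 = n := by rw [hs, midState_reg O T f g (by decide), r0]
  have h4 : s.reg 4 = n ^ ((m + 1) / 2) := by rw [hs, midState_reg O T f g (by decide), r4]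
  obtain ⟨w1, w2⟩ := writeOutput_spec O h0 h4 rfl hf.unused.1 hf.unused.2
  obtain ⟨f1, f2, f3⟩ := finish_spec O (writeOutput.run O s)
  rw [run_reg O 22 writeOutput s rfl, run_reg O 30 writeOutput s rfl,
    run_reg O 23 writeOutput s rfl] at f1
  split_ifs with hc
  · have hne := f1.2 hc
    rw [State.output, if_neg hne, f3]
    have hl := (f2 hne).trans w1
    congr 1
    generalize (finish.run O (writeOutput.run O s)).reg 1 = r at hl
    subst hl
    congr 1
    · ext a
      exact (w2 a a.2).1
    · ext a j
      exact (w2 a a.2).2 j j.2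
  · rw [State.output, if_pos]
    by_contra h
    exact hc (f1.1 h)

end Output

end Waring

namespace Waring

open Matrix

/-! ### From the run of the program to the intersection algorithm -/

section Specification

variable {F : Type*} [RCLike F] {n m : ℕ}

/-- The number of basis tensors, hence the index types, depends on the contents of arrays 15 and 16.
Naming these contents allows them to be replaced by those of another run. -/
theorem TensorRunFacts.sound_of_eq {f g : ℕ → F} {s : State F} {T : Tensor F n m}
    (hs : TensorRunFacts T f g s) (hm : 3 ≤ m) (hT : IsSymmetric T)
    (hc : 1 ≤ s.reg 22 ∧ 1 ≤ s.reg 30 ∧ s.reg 23 = 0) {E D : ℕ → F} (hE : s.mem 15 = E)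
    (hD : s.mem 16 = D) :
    Nat.count (fun j => s.mem 26 j ≠ 0) (n ^ ((m + 1) / 2)) =
      Nat.count (fun j => D j = 0) (n ^ ((m + 1) / 2) * n ^ ((m + 1) / 2)) ∧
    SimDiagonalizedBy (fun l => matOf (columnTensors n ((m + 1) / 2 + (m + 1) / 2)
      (n ^ ((m + 1) / 2) * n ^ ((m + 1) / 2)) E D l)) (fun l => f l)
      (fun l => g l) (fun a => ver ((m + 1) / 2)
        (vecAt n s (Nat.nth (fun j => s.mem 26 j ≠ 0) a))) := by
  subst hE hD
  obtain ⟨h1, h2, -⟩ := hs.sound hm hT hc.1 hc.2.1 hc.2.2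
  exact ⟨h1, h2⟩

theorem TensorRunFacts.complete_of_eq {f g : ℕ → F} {s : State F} {T : Tensor F n m}
    (hs : TensorRunFacts T f g s) (hm : 3 ≤ m) (hT : IsSymmetric T) {E D : ℕ → F}
    (hE : s.mem 15 = E) (hD : s.mem 16 = D)
    {x : Fin (Nat.count (fun j => D j = 0) (n ^ ((m + 1) / 2) * n ^ ((m + 1) / 2))) →
      Fin n → F}
    {α : Fin (Nat.count (fun j => D j = 0) (n ^ ((m + 1) / 2) * n ^ ((m + 1) / 2))) → F}
    (hx : SimDiagonalizedBy (fun l => matOf (columnTensors n ((m + 1) / 2 + (m + 1) / 2)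
      (n ^ ((m + 1) / 2) * n ^ ((m + 1) / 2)) E D l)) (fun l => f l)
      (fun l => g l) (fun a => ver ((m + 1) / 2) (x a)))
    (hα : ∑ a, α a • tensorPow (x a) m = T) :
    1 ≤ s.reg 22 ∧ 1 ≤ s.reg 30 ∧ s.reg 23 = 0 := by
  subst hE hD
  exact hs.complete hm hT hx hα

/-- The order of quantifiers is essential: the basis is fixed before f and g, so that exceptional
random inputs can be measured with respect to one basis. -/
theorem waringProgram_spec {O : Oracle F} (hO : O.IsValid) {T : Tensor F n m} (hT : IsSymmetric T)
    (hn : 1 ≤ n) (hm : 3 ≤ m) :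
    ∃ (r : ℕ) (Φ : Fin r → Tensor F n ((m + 1) / 2 + (m + 1) / 2)), LinearIndependent F Φ ∧
      Submodule.span F (Set.range Φ) = symColumns T ∧ ∀ f g : ℕ → F,
      (∀ D, (waringProgram.run O (initialState T f g)).output n = some D →
        ∃ h : r = D.length, SimDiagonalizedBy (fun l => matOf (Φ l)) (fun l => f l) (fun l => g l)
          (fun a => ver ((m + 1) / 2) (D.vec (a.cast h))) ∧ ∑ a, D.term m a = T) ∧
      ∀ (x : Fin r → Fin n → F) (α : Fin r → F),
        SimDiagonalizedBy (fun l => matOf (Φ l)) (fun l => f l) (fun l => g l)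
          (fun a => ver ((m + 1) / 2) (x a)) → ∑ a, α a • tensorPow (x a) m = T →
        ∃ D, (waringProgram.run O (initialState T f g)).output n = some D := by
  obtain ⟨h1, h2⟩ := (midState_facts hO T 0 0 hn hm).columnTensors_basis hm hT
  -- The basis is taken from the run with zero random inputs; every other run finds the same one.
  refine ⟨_, _, h1, h2, fun f g => ?_⟩
  obtain ⟨s, hs⟩ : ∃ s, s = midState O T f g := ⟨_, rfl⟩
  have hf := midState_facts hO T f g hn hm
  have hE := midState_mem_eq O T f g (Or.inl rfl : 15 = 15 ∨ 15 = 16)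
  have hD := midState_mem_eq O T f g (Or.inr rfl : 16 = 15 ∨ 16 = 16)
  have hout := waringProgram_output O hO T f g hn hm s hs
  rw [← hs] at hf hE hD
  rw [hout]
  constructor
  · intro Dx hDx
    split_ifs at hDx with hc
    obtain rfl := Option.some.inj hDx
    obtain ⟨e1, e2⟩ := hf.sound_of_eq hm hT hc hE hD
    obtain ⟨-, -, e3⟩ := hf.sound hm hT hc.1 hc.2.1 hc.2.2
    exact ⟨e1.symm, e2, e3⟩
  · intro x α hx hα
    have hc := hf.complete_of_eq hm hT hE hD hx hα
    rw [if_pos hc]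
    exact ⟨_, rfl⟩

theorem exists_basis_of_submodule {V : Type*} [AddCommGroup V] [Module F V]
    [FiniteDimensional F V] (W : Submodule F V) :
    ∃ (r : ℕ) (u : Fin r → V), LinearIndependent F u ∧ Submodule.span F (Set.range u) = W := by
  refine ⟨_, fun i => (Module.finBasis F W i : V),
    (Module.finBasis F W).linearIndependent.map' W.subtype W.ker_subtype, ?_⟩
  have := congrArg (Submodule.map W.subtype) (Module.finBasis F W).span_eq
  rw [Submodule.map_span, ← Set.range_comp, Submodule.map_subtype_top] at this
  exact this

/-- The s independent vectors belong to U, so s ≤ dim U holds automatically on success. This is why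
the program does not test it. -/
theorem SimDiagonalizedBy.le_of_span_eq {ι : Type*} [Fintype ι] {R p s : ℕ}
    {U : Submodule F (ι → F)} {u : Fin R → ι → F} (hU : Submodule.span F (Set.range u) = U)
    {q : Fin p → Matrix ι ι F} {P : Fin s → Matrix ι ι F} {f g : Fin s → F} {v : Fin s → ι → F}
    (h : SimDiagonalizedBy P f g v) (hP : LinearIndependent F P)
    (hspan : Submodule.span F (Set.range P) = liftedIntersection U q) : s ≤ R := by
  obtain ⟨z, -, -, hv, -⟩ := id h
  have hmem : ∀ a, v a ∈ Submodule.span F (Set.range u) := fun a => by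
    rw [hU]
    refine mem_of_vecMulVec_mem_liftedIntersection (q := q) (hv.ne_zero a) ?_
    rw [← hspan, h.span_eq hP]
    exact Submodule.subset_span ⟨a, rfl⟩
  have h1 := finrank_span_eq_card hv
  have h2 := Submodule.finrank_mono (Submodule.span_le.2 (Set.range_subset_iff.2 hmem))
  have h3 := finrank_range_le_card (R := F) u
  rw [Fintype.card_fin] at h1 h3
  exact h1 ▸ h2.trans h3

theorem simDiagonalizedBy_of_isEmpty {ι : Type*} [Fintype ι] (P : Fin 0 → Matrix ι ι F)
    (f g : Fin 0 → F) (v : Fin 0 → ι → F) : SimDiagonalizedBy P f g v :=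
  ⟨fun a => a.elim0, fun a => a.elim0, linearIndependent_empty_type, linearIndependent_empty_type,
    fun a => a.elim0, fun a => a.elim0, fun a => a.elim0⟩

/-- Matches the output with an answer. Some outputs `none` belong to a successful algorithm whose
vectors are not the powers in a decomposition of T; then nothing can be read off, since a readable
decomposition would have made the program succeed. -/
theorem exists_answer {T : Tensor F n m} {r p : ℕ}
    {q : Fin p → Matrix (MonoIdx n ((m + 1) / 2)) (MonoIdx n ((m + 1) / 2)) F}
    {P : Fin r → Matrix (MonoIdx n ((m + 1) / 2)) (MonoIdx n ((m + 1) / 2)) F}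
    (hP : LinearIndependent F P)
    (hspan : Submodule.span F (Set.range P) = liftedIntersection (image T) q) {f g : Fin r → F}
    {out : Option (Expression F n)}
    (hsome : ∀ D, out = some D → ∃ h : r = D.length, SimDiagonalizedBy P f g
      (fun a => ver ((m + 1) / 2) (D.vec (a.cast h))) ∧ ∑ a, D.term m a = T)
    (hnone : ∀ (x : Fin r → Fin n → F) (α : Fin r → F),
      SimDiagonalizedBy P f g (fun a => ver ((m + 1) / 2) (x a)) →
        ∑ a, α a • tensorPow (x a) m = T → ∃ D, out = some D)
    {R : ℕ} {u : Fin R → MonoIdx n ((m + 1) / 2) → F}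
    (hu : Submodule.span F (Set.range u) = image T) :
    ∃ ans, IntersectionAlgorithm u q P f g ans ∧
      ((∃ D, out = some D ∧ ReadsOff T ans D) ∨ (out = none ∧ ¬ ∃ D, ReadsOff T ans D)) := by
  have hspan' : Submodule.span F (Set.range P) =
      liftedIntersection (Submodule.span F (Set.range u)) q := by rw [hu, hspan]
  cases out with
  | some D =>
    obtain ⟨h, hsim, hsum⟩ := hsome D rfl
    rcases Nat.eq_zero_or_pos r with hr | hr
    · exact ⟨.trivial, ⟨hP, hspan', hr⟩, Or.inl ⟨D, rfl, h.symm.trans hr, hsum⟩⟩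
    · refine ⟨.only r fun a => ver ((m + 1) / 2) (D.vec (a.cast h)),
        ⟨hP, hspan', hr, hsim.le_of_span_eq hu hP hspan, rfl, hsim.stepTwoSucceeds⟩,
        Or.inl ⟨D, rfl, ⟨finCongr h, fun a => ⟨1, one_ne_zero, ?_⟩⟩, hsum⟩⟩
      rw [one_smul]
      rfl
  | none =>
    rcases Nat.eq_zero_or_pos r with hr | hr
    · subst hr
      refine ⟨.trivial, ⟨hP, hspan', rfl⟩, Or.inr ⟨rfl, ?_⟩⟩
      rintro ⟨D, hD, hsum⟩
      have hD' : D.length = 0 := hD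
      have : IsEmpty (Fin D.length) := by rw [hD']; infer_instance
      -- With s = 0 a readable decomposition is empty, so T = 0; the empty family then satisfies the
      -- hypotheses for success.
      obtain ⟨D', h⟩ := hnone (fun a => a.elim0) (fun a => a.elim0)
        (simDiagonalizedBy_of_isEmpty _ _ _ _) (by
          rw [← hsum]
          simp)
      exact absurd h (by simp)
    · by_cases hv : ∃ v, StepTwoSucceeds P f g v
      · obtain ⟨v, hv⟩ := hv
        have hsim := hv.simDiagonalizedBy
        refine ⟨.only r v, ⟨hP, hspan', hr, hsim.le_of_span_eq hu hP hspan, rfl, hv⟩,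
          Or.inr ⟨rfl, ?_⟩⟩
        rintro ⟨D, ⟨e, he⟩, hsum⟩
        choose c hc hvc using he
        obtain ⟨D', h⟩ := hnone (fun a => D.vec (e a)) (fun a => D.coeff (e a))
          (hsim.of_smul hc hvc) (by
            rw [← hsum]
            exact e.sum_comp fun a => D.term m a)
        exact absurd h (by simp)
      · refine ⟨.fail, ⟨hP, hspan', hr, fun _ => hv⟩, Or.inr ⟨rfl, ?_⟩⟩
        rintro ⟨D, hD, -⟩
        exact hD

end Specification

/-! ### The certificate and the generic case -/

section Main

open MeasureTheory

variable {F : Type*} [RCLike F] {n m : ℕ}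

theorem waringProgram_certifies {O : Oracle F} (hO : O.IsValid) {T : Tensor F n m}
    (hT : IsSymmetric T) (hn : 1 ≤ n) (hm : 3 ≤ m) (f g : ℕ → F) :
    (∀ (p : ℕ) (q : Fin p → Matrix (MonoIdx n ((m + 1) / 2)) (MonoIdx n ((m + 1) / 2)) F),
      LinearIndependent F q →
      Submodule.span F (Set.range q) = quadricsOn (veroneseCone F n ((m + 1) / 2)) →
      ∃ (R s : ℕ) (u : Fin R → MonoIdx n ((m + 1) / 2) → F)
        (P : Fin s → Matrix (MonoIdx n ((m + 1) / 2)) (MonoIdx n ((m + 1) / 2)) F)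
        (ans : Answer F (MonoIdx n ((m + 1) / 2))),
        IsAlgorithmInput T u q ∧
        IntersectionAlgorithm u q P (fun i => f i) (fun i => g i) ans ∧
        ((∃ D, (waringProgram.run O (initialState T f g)).output n = some D ∧ ReadsOff T ans D) ∨
          ((waringProgram.run O (initialState T f g)).output n = none ∧
            ¬ ∃ D, ReadsOff T ans D))) ∧
    (∀ D, (waringProgram.run O (initialState T f g)).output n = some D →
      IsUniqueWaringRankDecomposition T (fun a => D.term m a)) := by
  obtain ⟨r, Φ, hli, hspan, hfg⟩ := waringProgram_spec hO hT hn hm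
  obtain ⟨hsome, hnone⟩ := hfg f g
  constructor
  · intro p q hq hqspan
    obtain ⟨R, u, hu, huspan⟩ := exists_basis_of_submodule (image T)
    obtain ⟨hP, hPspan⟩ := matOf_basis hT hli hspan hqspan
    obtain ⟨ans, h1, h2⟩ := exists_answer hP hPspan hsome hnone huspan
    exact ⟨R, r, u, _, ans, ⟨⟨hu, huspan⟩, hq, hqspan⟩, h1, h2⟩
  · intro D hD
    obtain ⟨p, q, -, hq⟩ := exists_basis_of_submodule (quadricsOn (veroneseCone F n ((m + 1) / 2)))
    obtain ⟨hP, hPspan⟩ := matOf_basis hT hli hspan hq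
    obtain ⟨rfl, hsim, hsum⟩ := hsome D hD
    exact SimDiagonalizedBy.isUniqueWaringRankDecomposition (by omega) hsum hq hP hPspan hsim

/-- The conditions make L the span of the squares of the x_a^{⊗k}. Uniqueness follows from isolation
of these points, and for any basis of L almost all f, g separate them; this applies to all
admissible bases and, in particular, to the program's own. -/
theorem generic_decomposition [MeasurableSpace F] [BorelSpace F] {R : ℕ} (hn : 1 ≤ n) (hm : 3 ≤ m)
    {α : Fin R → F} {x : Fin R → Fin n → F} (hα : ∀ a, α a ≠ 0) (hx : ∀ a, x a ≠ 0)
    (hl : LinearIndependent F (fun a => tensorPow (x a) (m / 2)))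
    (hE : LinearIndepOn F (pairClass fun a => ver ((m + 1) / 2) (x a)) {s | ¬ s.IsDiag}) :
    IsUniqueWaringRankDecomposition (∑ a, α a • tensorPow (x a) m)
      (fun a => α a • tensorPow (x a) m) ∧
    (∀ (R' p s : ℕ) (u : Fin R' → MonoIdx n ((m + 1) / 2) → F)
      (q : Fin p → Matrix (MonoIdx n ((m + 1) / 2)) (MonoIdx n ((m + 1) / 2)) F)
      (P : Fin s → Matrix (MonoIdx n ((m + 1) / 2)) (MonoIdx n ((m + 1) / 2)) F),
      IsAlgorithmInput (∑ a, α a • tensorPow (x a) m) u q →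
      ∀ᵐ fg : (Fin s → F) × (Fin s → F) ∂Measure.addHaar,
        ∀ ans, IntersectionAlgorithm u q P fg.1 fg.2 ans →
          ans.Lists (fun a => symCoords (tensorPow (x a) ((m + 1) / 2)))) ∧
    (∀ O : Oracle F, O.IsValid →
      ∀ᵐ fg : (Fin R → F) × (Fin R → F) ∂Measure.addHaar,
        ∃ D, (waringProgram.run O (initialState (∑ a, α a • tensorPow (x a) m)
            (tape fg.1) (tape fg.2))).output n = some D ∧
          ∃ e : Fin D.length ≃ Fin R,
            ∀ a, D.term m a = α (e a) • tensorPow (x (e a)) m) := by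
  have himg := image_eq_span_ver (m := m) hα hl
  have hy : LinearIndependent F fun a => ver ((m + 1) / 2) (x a) :=
    linearIndependent_ver_iff.2 (linearIndependent_tensorPow_of_le hl hx (by omega))
  obtain ⟨p, q, -, hq⟩ := exists_basis_of_submodule (quadricsOn (veroneseCone F n ((m + 1) / 2)))
  have hlift := liftedIntersection_eq_span hy hE hq
  have hT : IsSymmetric (∑ a, α a • tensorPow (x a) m) :=
    mem_symTensors.1 (Submodule.sum_mem _ fun a _ => Submodule.smul_mem _ _
      (mem_symTensors.2 (tensorPow_isSymmetric _ _)))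
  have huniq : IsUniqueWaringRankDecomposition (∑ a, α a • tensorPow (x a) m)
      (fun a => α a • tensorPow (x a) m) := by
    refine isUniqueWaringRankDecomposition_of_isolated (by omega) rfl hy
      (fun a => himg ▸ Submodule.subset_span ⟨a, rfl⟩) fun y hyU hy0 => ?_
    obtain ⟨a, c, -, h⟩ := isolated_of_liftedIntersection hq hy himg (by rw [himg, hlift]) hyU hy0
    exact ⟨a, c, h⟩
  refine ⟨huniq, fun R' p' s u q' P hin => ?_, fun O hO => ?_⟩
  · refine ae_intersectionAlgorithm_lists hy hin.1.1 (hin.1.2.trans himg) ?_ P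
    rw [hin.1.2, himg]
    exact liftedIntersection_eq_span hy hE hin.2.2
  · obtain ⟨r, Φ, hli, hspan, hfg⟩ := waringProgram_spec hO hT hn hm
    obtain ⟨hP, hPspan⟩ := matOf_basis hT hli hspan hq
    rw [himg, hlift] at hPspan
    -- Both numbers are the dimension of L, so the R random coordinates on each tape are exactly
    -- those that the program uses.
    have hr : r = R := by
      have h1 := finrank_span_eq_card hP
      have h2 := finrank_span_eq_card (linearIndependent_vecMulVec hy)
      rw [hPspan, h2, Fintype.card_fin, Fintype.card_fin] at h1
      exact h1.symm
    subst hr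
    filter_upwards [ae_simDiagonalizedBy hP hy hPspan] with fg hsim
    obtain ⟨hsome, hnone⟩ := hfg (tape fg.1) (tape fg.2)
    have ht : ∀ h : Fin r → F, (fun l : Fin r => tape h l) = h := fun h => by
      ext l
      simp [tape]
    rw [ht, ht] at hsome hnone
    obtain ⟨D, hD⟩ := hnone x α hsim rfl
    refine ⟨D, hD, ?_⟩
    obtain ⟨h, -, hsum⟩ := hsome D hD
    -- The output is a decomposition of length R, so uniqueness identifies its summands with the
    -- given ones.
    obtain ⟨σ, hσ⟩ := huniq.2.2 (fun a => D.term m (a.cast h))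
      ⟨fun a => ⟨_, _, rfl⟩, by rw [← hsum]; exact (finCongr h).sum_comp fun a => D.term m a⟩
    exact ⟨(finCongr h.symm).trans σ, fun a => congrFun hσ (a.cast h.symm)⟩

end Main

end Waring

open Waring MeasureTheory in
theorem corollary6p6 {F : Type} [RCLike F] [MeasurableSpace F] [BorelSpace F] :
    ∃ (prog : Program) (C : ℕ),
      -- On every symmetric tensor, whatever the random functionals and the oracle: the program
      -- makes `n ^ O(m)` steps (base `n + 1`, so that `n = 1` is covered) and `O(1)` oracle calls,
      -- its output is what the intersection algorithm yields, and an output other than "Fail" is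
      -- certified to be the unique Waring rank decomposition.
      (∀ (n m : ℕ), 1 ≤ n → 3 ≤ m → ∀ T : Tensor F n m, IsSymmetric T →
        ∀ (f g : ℕ → F) (O : Oracle F), O.IsValid →
          (prog.run O (initialState T f g)).steps ≤ (n + 1) ^ (C * m) ∧
          (prog.run O (initialState T f g)).calls ≤ C ∧
          (∀ (p : ℕ) (q : Fin p → Matrix (MonoIdx n ((m + 1) / 2)) (MonoIdx n ((m + 1) / 2)) F),
            LinearIndependent F q →
            Submodule.span F (Set.range q) = quadricsOn (veroneseCone F n ((m + 1) / 2)) →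
            ∃ (R s : ℕ) (u : Fin R → MonoIdx n ((m + 1) / 2) → F)
              (P : Fin s → Matrix (MonoIdx n ((m + 1) / 2)) (MonoIdx n ((m + 1) / 2)) F)
              (ans : Answer F (MonoIdx n ((m + 1) / 2))),
              IsAlgorithmInput T u q ∧
              IntersectionAlgorithm u q P (fun i => f i) (fun i => g i) ans ∧
              ((∃ D, (prog.run O (initialState T f g)).output n = some D ∧ ReadsOff T ans D) ∨
                ((prog.run O (initialState T f g)).output n = none ∧
                  ¬ ∃ D, ReadsOff T ans D))) ∧
          (∀ D, (prog.run O (initialState T f g)).output n = some D →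
            IsUniqueWaringRankDecomposition T (fun a => D.term m a))) ∧
      -- Generic tensors of rank `R` within the bound.
      (∀ (n m R : ℕ), 1 ≤ n → 3 ≤ m → (R : ℝ) ≤ rankBound n m →
        ∃ A : Set (Fin R × (Fin m → Fin n) → F),
          IsZariskiOpenDense (symProductTuples F n m R) A ∧
          ∀ (α : Fin R → F) (x : Fin R → Fin n → F),
            (fun y : Fin R × (Fin m → Fin n) => (α y.1 • tensorPow (x y.1) m) y.2) ∈ A →
            -- the decomposition is the unique Waring rank decomposition;
            IsUniqueWaringRankDecomposition (∑ a, α a • tensorPow (x a) m)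
              (fun a => α a • tensorPow (x a) m) ∧
            -- for all choices of bases, the intersection algorithm almost surely finds the
            -- points (almost surely: up to a null set of pairs of functionals);
            (∀ (R' p s : ℕ) (u : Fin R' → MonoIdx n ((m + 1) / 2) → F)
              (q : Fin p → Matrix (MonoIdx n ((m + 1) / 2)) (MonoIdx n ((m + 1) / 2)) F)
              (P : Fin s → Matrix (MonoIdx n ((m + 1) / 2)) (MonoIdx n ((m + 1) / 2)) F),
              IsAlgorithmInput (∑ a, α a • tensorPow (x a) m) u q →
              ∀ᵐ fg : (Fin s → F) × (Fin s → F) ∂Measure.addHaar,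
                ∀ ans, IntersectionAlgorithm u q P fg.1 fg.2 ans →
                  ans.Lists (fun a => symCoords (tensorPow (x a) ((m + 1) / 2)))) ∧
            -- the program almost surely outputs it.
            (∀ O : Oracle F, O.IsValid →
              ∀ᵐ fg : (Fin R → F) × (Fin R → F) ∂Measure.addHaar,
                ∃ D, (prog.run O (initialState (∑ a, α a • tensorPow (x a) m)
                    (tape fg.1) (tape fg.2))).output n = some D ∧
                  ∃ e : Fin D.length ≃ Fin R,
                    ∀ a, D.term m a = α (e a) • tensorPow (x (e a)) m)) ∧
      -- The bound for `m = 4`.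
      (∀ n : ℕ, 1 ≤ n → rankBound n 4 = (n : ℝ) * (n - 1) / 6) := by
  -- One constant serves both purposes. The first summand is the exponent of the time bound, with
  -- the factor 2 from the base (n+1)^{2m}; the second is the number of oracle calls in the text.
  refine ⟨waringProgram, 2 * (initProg.weight + bodyProg.weight +
    (Program.seq writeOutput finish).weight + 2) + waringProgram.callCount, ?_, ?_,
    fun n hn => rankBound_four hn⟩
  · intro n m hn hm T hT f g O hO
    refine ⟨(waringProgram_steps_le O T f g hn hm).trans ?_,
      (waringProgram_calls_le O T f g).trans (Nat.le_add_left _ _),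
      waringProgram_certifies hO hT hn hm f g⟩
    exact Nat.pow_le_pow_right (by omega) (Nat.mul_le_mul_right _ (Nat.le_add_right _ _))
  · intro n m R hn hm hR
    obtain ⟨A, hA, h⟩ := exists_generic_set (F := F) hn (by omega) hR
    refine ⟨A, hA, fun α x hx => ?_⟩
    obtain ⟨hα, hx0, hl, hE⟩ := h α x hx
    exact generic_decomposition hn hm hα hx0 hl hE
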